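/- **Theorem 1.3.** Let $n>1$ and let $M$ be a quaternionic contact (qc) manifold of dimension $4n+3$: a smooth (Hausdorff, $\sigma$-compact) manifold with a codimension three distribution $H$, a metric $g$ on $H$ and a bundle $\mathbb Q\subset \mathrm{End}(H)$ such that locally $H=\ker\eta$ for smooth 1-forms $\eta=(\eta_1,\eta_2,\eta_3)$ and $\mathbb Q$ is spanned by $g$-Hermitian almost complex structures $I_1,I_2,I_3$ of $H$ with $I_1I_2=-I_2I_1=I_3$ and $2g(I_sX,Y)=d\eta_s(X,Y)$ for $X,Y\in H$. Let $V$ and $\nabla$ be the supplementary subbundle and the Biquard connection, i.e. $TM=H\oplus V$ and the connection $\nabla$ with torsion $T$ are characterized by: $\nabla$ preserves $H$, $V$, $g$ and $\mathbb Q$; $T(X,Y)=-[X,Y]_V$ for $X,Y\in H$; for $\xi\in V$, $T_\xi=T(\xi,\cdot)$ is an endomorphism of $H$ orthogonal to $sp(n)\oplus sp(1)$ for $\langle A,B\rangle=\sum_a g(Ae_a,Be_a)$; and the identification $V\to\mathbb Q$, $\xi\mapsto\sum_s\eta_s(\xi)I_s$, is parallel. Let $\{e_a\}$ be an orthonormal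 basis of $H$, and let $\xi_s\in V$ be the Reeb vectors, $\eta_t(\xi_s)=\delta_{st}$. With $R=[\nabla,\nabla]-\nabla_{[\cdot,\cdot]}$ put $Ric(A,B)=\sum_b g(R(e_b,A)B,e_b)$ and $8n(n+2)S=\sum_a Ric(e_a,e_a)$. Let $T^0_{\xi_s}$ and $b_{\xi_s}$ be the symmetric and skew-symmetric parts of $T_{\xi_s}$, put $T^0(X,Y)=\sum_s g(T^0_{\xi_s}I_sX,Y)$, and put $U(X,Y)=g(uX,Y)$, where $b_{\xi_s}=I_su$. For a smooth function $f$ let $\nabla^2f(X,Y)=X(Yf)-(\nabla_XY)f$, $|\nabla^2f|^2=\sum_{a,b}\nabla^2f(e_a,e_b)^2$, $\triangle f=-\sum_a\nabla^2f(e_a,e_a)$, and let $\nabla f\in H$ be the horizontal gradient, $g(\nabla f,X)=df(X)$ for $X\in H$. Let $Vol_\eta=\eta_1\wedge\eta_2\wedge\eta_3\wedge\omega_s^{2n}$, where $\omega_s(X,Y)=g(I_sX,Y)$ on $H$ and $\xi\lrcorner\omega_s=0$ for $\xi\in V$ (this does not depend on $s$ or on the local form $\eta$ used). Then for every $f\in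 C_o^\infty(M)$ all the functions integrated below are integrable and $$ \begin{aligned} \int_M|\triangle f|^2\,Vol_\eta\ \ge\ &\frac{n}{n+1}\int_M|\nabla^2f|^2\,Vol_\eta+\frac{n^2}{n^2-1}\int_M Ric(\nabla f,\nabla f)\,Vol_\eta\\ &+\frac{n^2}{n^2-1}\int_M\Big[-\frac4nT^0(\nabla f,\nabla f)-6U(\nabla f,\nabla f)-6S|\nabla f|^2\Big]Vol_\eta\\ =\ &\frac{n}{n+1}\int_M|\nabla^2f|^2\,Vol_\eta\\ &+\int_M\Big[\frac{2n(n+2)}{n+1}T^0(\nabla f,\nabla f)+\frac{4n^2}{n-1}U(\nabla f,\nabla f)+\frac{2n^2}{n+1}S|\nabla f|^2\Big]Vol_\eta . \end{aligned} $$ -/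

import Mathlib

open scoped Manifold ContDiff Bundle
open MeasureTheory

noncomputable section

namespace QC

variable {n : ℕ} {M : Type*} [TopologicalSpace M]
  [ChartedSpace (EuclideanSpace ℝ (Fin (4 * n + 3))) M]

/-- The tangent space `T_x M` of a manifold of dimension `4n+3`. -/
abbrev Tan (n : ℕ) {M : Type*} [TopologicalSpace M]
    [ChartedSpace (EuclideanSpace ℝ (Fin (4 * n + 3))) M] (x : M) : Type :=
  TangentSpace (𝓡 (4 * n + 3)) x

/-- An extension of a tangent vector to a vector field which is smooth near its base point.
The tensors below do not depend on the extension. -/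
def ext {x : M} [IsManifold (𝓡 (4 * n + 3)) ∞ M] (v : Tan n x) : ∀ y : M, Tan n y :=
  FiberBundle.extend (EuclideanSpace ℝ (Fin (4 * n + 3))) v

/-- The differential `df` of a real function. -/
def d (n : ℕ) {M : Type*} [TopologicalSpace M]
    [ChartedSpace (EuclideanSpace ℝ (Fin (4 * n + 3))) M] (f : M → ℝ) (x : M) :
    Tan n x →L[ℝ] ℝ :=
  mvfderiv (𝓡 (4 * n + 3)) f x

/-- The Lie bracket of vector fields. -/
def bracket (X Y : ∀ x : M, Tan n x) : ∀ x : M, Tan n x :=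
  VectorField.mlieBracket (𝓡 (4 * n + 3)) X Y

variable [IsManifold (𝓡 (4 * n + 3)) ∞ M]

/-- Smoothness on `U` of a vector field. -/
def SmoothField (U : Set M) (X : ∀ x : M, Tan n x) : Prop :=
  ContMDiffOn (𝓡 (4 * n + 3)) (𝓡 (4 * n + 3)).tangent ∞
    (fun x => (⟨x, X x⟩ : TangentBundle (𝓡 (4 * n + 3)) M)) U

/-- Smoothness on `U` of a 1-form, as a section of the cotangent bundle. -/
def SmoothForm (U : Set M) (η : ∀ x : M, Tan n x →L[ℝ] ℝ) : Prop :=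
  ContMDiffOn (𝓡 (4 * n + 3))
    ((𝓡 (4 * n + 3)).prod 𝓘(ℝ, EuclideanSpace ℝ (Fin (4 * n + 3)) →L[ℝ] ℝ)) ∞
    (fun x => Bundle.TotalSpace.mk' (EuclideanSpace ℝ (Fin (4 * n + 3)) →L[ℝ] ℝ)
      (E := fun x : M => Tan n x →L[ℝ] Bundle.Trivial M ℝ x) x (η x)) U

/-- The exterior derivative of a 1-form, `dη(X,Y) = X(η(Y)) - Y(η(X)) - η([X,Y])`. -/
def dForm (η : ∀ x : M, Tan n x →L[ℝ] ℝ) (x : M) (u v : Tan n x) : ℝ :=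
  d n (fun y => η y (ext v y)) x u - d n (fun y => η y (ext u y)) x v
    - η x (bracket (ext u) (ext v) x)

/-- On the open set `U`, the triple `η` of smooth 1-forms and the triple `J` of endomorphisms
of `H` define the quaternionic contact structure `(H, g, Q)`: `H` is the kernel of `η`, the `J s`
satisfy the identities of the imaginary unit quaternions, are Hermitian for `g` and span `Q`, and
`2 g(J_s X, Y) = dη_s(X, Y)` on `H`. (The last identity makes `J` and `g` smooth on `U`.) -/
structure IsLocalFrame (H : ∀ x : M, Submodule ℝ (Tan n x))
    (g : ∀ x : M, LinearMap.BilinForm ℝ (H x)) (Q : ∀ x : M, Submodule ℝ (Module.End ℝ (H x)))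
    (U : Set M) (η : Fin 3 → ∀ x : M, Tan n x →L[ℝ] ℝ)
    (J : Fin 3 → ∀ x : M, Module.End ℝ (H x)) : Prop where
  isOpen : IsOpen U
  smooth : ∀ s, SmoothForm U (η s)
  mem_iff : ∀ x ∈ U, ∀ v : Tan n x, v ∈ H x ↔ ∀ s, η s x v = 0
  sq : ∀ x ∈ U, ∀ s, J s x * J s x = -1
  mul : ∀ x ∈ U, J 0 x * J 1 x = J 2 x
  mul' : ∀ x ∈ U, J 1 x * J 0 x = -J 2 x
  hermitian : ∀ x ∈ U, ∀ s, ∀ u v : H x, g x (J s x u) (J s x v) = g x u v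
  span_eq : ∀ x ∈ U, Q x = Submodule.span ℝ (Set.range fun s => J s x)
  compat : ∀ x ∈ U, ∀ s, ∀ u v : H x, 2 * g x (J s x u) v = dForm (η s) x u v

variable (n M) in
/-- A quaternionic contact structure `(g, Q)` on a `(4n+3)`-dimensional manifold `M`: a
codimension three distribution `H`, a metric `g` on `H` and a bundle `Q` of endomorphisms of `H`
which are locally given by an `ℝ³`-valued contact form and three almost complex structures.
The forms need not exist globally. -/
structure QCStructure where
  /-- the horizontal distribution -/
  H : ∀ x : M, Submodule ℝ (Tan n x)
  /-- the metric on the horizontal distribution -/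
  g : ∀ x : M, LinearMap.BilinForm ℝ (H x)
  /-- the quaternionic bundle -/
  Q : ∀ x : M, Submodule ℝ (Module.End ℝ (H x))
  finrank_H : ∀ x, Module.finrank ℝ (H x) = 4 * n
  g_symm : ∀ x, ∀ u v : H x, g x u v = g x v u
  g_pos : ∀ x, ∀ u : H x, u ≠ 0 → 0 < g x u u
  exists_frame : ∀ x, ∃ (U : Set M) (η : Fin 3 → ∀ x : M, Tan n x →L[ℝ] ℝ)
    (J : Fin 3 → ∀ x : M, Module.End ℝ (H x)), x ∈ U ∧ IsLocalFrame H g Q U η J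

namespace QCStructure

variable (D : QCStructure n M)

/-- `(U, η, J)` is a local frame of the qc structure. -/
abbrev LocalFrame (U : Set M) (η : Fin 3 → ∀ x : M, Tan n x →L[ℝ] ℝ)
    (J : Fin 3 → ∀ x : M, Module.End ℝ (D.H x)) : Prop :=
  IsLocalFrame D.H D.g D.Q U η J

/-- Smoothness on `U` of a section of a distribution `W`. -/
def SmoothSec (W : ∀ x : M, Submodule ℝ (Tan n x)) (U : Set M) (X : ∀ x : M, W x) : Prop :=
  SmoothField U fun x => (X x : Tan n x)

/-- `e` is an orthonormal basis of `H_x`. -/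
def Orthonormal (x : M) (e : Fin (4 * n) → D.H x) : Prop :=
  ∀ a b, D.g x (e a) (e b) = if a = b then 1 else 0

/-- `sp(n) ⊂ End(H_x)`: the endomorphisms which are skew for `g` and commute with `Q`. -/
def IsSp (x : M) (A : Module.End ℝ (D.H x)) : Prop :=
  (∀ u v, D.g x (A u) v = -D.g x u (A v)) ∧ ∀ σ ∈ D.Q x, A * σ = σ * A

/-- The endomorphism `φ(ξ) = ∑ η_s(ξ) J_s` of `H` attached to a tangent vector `ξ`; on a
complement `V` of `H` this is the natural identification of `V` with `Q`, `ξ_s ↦ J_s`. -/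
def φ {H : ∀ x : M, Submodule ℝ (Tan n x)} (η : Fin 3 → ∀ x : M, Tan n x →L[ℝ] ℝ)
    (J : Fin 3 → ∀ x : M, Module.End ℝ (H x)) (x : M) (ξ : Tan n x) : Module.End ℝ (H x) :=
  ∑ s, η s x ξ • J s x

end QCStructure

/-- The Biquard connection of a qc structure (in dimension greater than 7): the supplementary
subbundle `V` and the connection `∇`, with torsion `T`, which are characterized as follows.
`conn Y x v` is `∇_v Y` at `x`. -/
structure BiquardConnection (D : QCStructure n M) where
  /-- the vertical distribution -/
  V : ∀ x : M, Submodule ℝ (Tan n x)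
  isCompl : ∀ x, IsCompl (D.H x) (V x)
  /-- the connection -/
  conn : CovariantDerivative (𝓡 (4 * n + 3)) (EuclideanSpace ℝ (Fin (4 * n + 3)))
    (TangentSpace (𝓡 (4 * n + 3)) : M → Type _)
  smooth : CovariantDerivative.ContMDiffCovariantDerivative conn ∞
  /-- `∇` preserves `H` -/
  preserves_H : ∀ U : Set M, IsOpen U → ∀ X : ∀ y : M, D.H y, QCStructure.SmoothSec D.H U X →
    ∀ x ∈ U, ∀ v : Tan n x, conn (fun y => (X y : Tan n y)) x v ∈ D.H x
  /-- `∇` preserves `V` -/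
  preserves_V : ∀ U : Set M, IsOpen U → ∀ Z : ∀ y : M, V y, QCStructure.SmoothSec V U Z →
    ∀ x ∈ U, ∀ v : Tan n x, conn (fun y => (Z y : Tan n y)) x v ∈ V x
  /-- `∇g = 0` -/
  metric : ∀ U : Set M, IsOpen U → ∀ X Y : ∀ y : M, D.H y,
    QCStructure.SmoothSec D.H U X → QCStructure.SmoothSec D.H U Y → ∀ x ∈ U, ∀ v : Tan n x,
    d n (fun y => D.g y (X y) (Y y)) x v =
      D.g x ((D.H x).projectionOnto (V x) (isCompl x) (conn (fun y => (X y : Tan n y)) x v)) (Y x)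
      + D.g x (X x) ((D.H x).projectionOnto (V x) (isCompl x) (conn (fun y => (Y y : Tan n y)) x v))
  /-- `∇σ ∈ Γ(Q)` for `σ ∈ Γ(Q)`, where `(∇_v σ) X = ∇_v (σ X) - σ (∇_v X)` -/
  preserves_Q : ∀ U : Set M, IsOpen U → ∀ σ : ∀ y : M, Module.End ℝ (D.H y),
    (∀ y ∈ U, σ y ∈ D.Q y) →
    (∀ X : ∀ y : M, D.H y, QCStructure.SmoothSec D.H U X →
      QCStructure.SmoothSec D.H U fun y => σ y (X y)) →
    ∀ x ∈ U, ∀ v : Tan n x, ∃ τ ∈ D.Q x,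
      ∀ X : ∀ y : M, D.H y, QCStructure.SmoothSec D.H U X →
        conn (fun y => (σ y (X y) : Tan n y)) x v
          - (σ x ((D.H x).projectionOnto (V x) (isCompl x)
              (conn (fun y => (X y : Tan n y)) x v)) : Tan n x) = (τ (X x) : Tan n x)
  /-- `T(X,Y) = -[X,Y]_V` for horizontal `X`, `Y` -/
  torsion_H : ∀ U : Set M, IsOpen U → ∀ X Y : ∀ y : M, D.H y,
    QCStructure.SmoothSec D.H U X → QCStructure.SmoothSec D.H U Y → ∀ x ∈ U,
    conn.torsion x (X x) (Y x) =
      -(V x).projection (D.H x) (isCompl x).symm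
        (bracket (fun y => (X y : Tan n y)) (fun y => (Y y : Tan n y)) x)
  /-- `T(ξ,·)` is an endomorphism of `H` for `ξ ∈ V` -/
  torsion_V : ∀ x, ∀ ξ ∈ V x, ∀ u ∈ D.H x, conn.torsion x ξ u ∈ D.H x
  /-- `T(ξ,·)` is orthogonal to `sp(n) ⊕ sp(1)`, `sp(1) = Q`, for `⟨A,B⟩ = ∑ g(A e_a, B e_a)` -/
  torsion_perp : ∀ x, ∀ ξ : V x, ∀ A : Module.End ℝ (D.H x), D.IsSp x A ∨ A ∈ D.Q x →
    ∀ e, D.Orthonormal x e →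
      ∑ a, D.g x ⟨conn.torsion x ξ (e a), torsion_V x ξ ξ.2 (e a) (e a).2⟩ (A (e a)) = 0
  /-- `∇φ = 0` for the natural identification `φ : V → Q` -/
  parallel : ∀ (U : Set M) (η : Fin 3 → ∀ x : M, Tan n x →L[ℝ] ℝ)
    (J : Fin 3 → ∀ x : M, Module.End ℝ (D.H x)), D.LocalFrame U η J →
    ∀ Z : ∀ y : M, V y, QCStructure.SmoothSec V U Z →
    ∀ X : ∀ y : M, D.H y, QCStructure.SmoothSec D.H U X → ∀ x ∈ U, ∀ v : Tan n x,
      (QCStructure.φ η J x (conn (fun y => (Z y : Tan n y)) x v) (X x) : Tan n x) =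
        conn (fun y => (QCStructure.φ η J y (Z y) (X y) : Tan n y)) x v
        - (QCStructure.φ η J x (Z x) ((D.H x).projectionOnto (V x) (isCompl x)
            (conn (fun y => (X y : Tan n y)) x v)) : Tan n x)

namespace QCStructure

variable (D : QCStructure n M)

theorem exists_orthonormal (x : M) : ∃ e, D.Orthonormal x e := by
  have hs : LinearMap.IsSymm (D.g x) := ⟨fun u v => by simpa using D.g_symm x u v⟩
  have : FiniteDimensional ℝ (Tan n x) :=
    inferInstanceAs (FiniteDimensional ℝ (EuclideanSpace ℝ (Fin (4 * n + 3))))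
  obtain ⟨v, hv⟩ := LinearMap.BilinForm.exists_orthogonal_basis (K := ℝ) (B := D.g x) hs
  have hpos : ∀ a, 0 < D.g x (v a) (v a) := fun a => D.g_pos x _ (v.ne_zero a)
  refine ⟨fun a => (√(D.g x (v (Fin.cast (D.finrank_H x).symm a))
    (v (Fin.cast (D.finrank_H x).symm a))))⁻¹ • v (Fin.cast (D.finrank_H x).symm a), ?_⟩
  intro a b
  by_cases hab : a = b
  · subst hab
    have h := hpos (Fin.cast (D.finrank_H x).symm a)
    have h2 := Real.mul_self_sqrt h.le
    have h3 : √(D.g x (v (Fin.cast (D.finrank_H x).symm a))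
      (v (Fin.cast (D.finrank_H x).symm a))) ≠ 0 := (Real.sqrt_pos.2 h).ne'
    simp only [map_smul, LinearMap.smul_apply, smul_eq_mul, if_true]
    field_simp
    nlinarith [h2]
  · have h : D.g x (v (Fin.cast (D.finrank_H x).symm a))
        (v (Fin.cast (D.finrank_H x).symm b)) = 0 :=
      hv (by simpa using hab)
    simp [h, hab]

/-- An orthonormal basis `e_1, …, e_{4n}` of `H_x`. The invariants below do not depend on it. -/
def e (x : M) : Fin (4 * n) → D.H x := (D.exists_orthonormal x).choose

/-- The values at `x` of the 1-forms `η_1, η_2, η_3` of a local frame of the qc structure. The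
invariants below do not depend on the frame. -/
def η (x : M) (s : Fin 3) : Tan n x →L[ℝ] ℝ := (D.exists_frame x).choose_spec.choose s x

/-- The values at `x` of the complex structures `I_1, I_2, I_3` of the same local frame. -/
def J (x : M) (s : Fin 3) : Module.End ℝ (D.H x) :=
  (D.exists_frame x).choose_spec.choose_spec.choose s x

theorem mem_H_iff (x : M) (v : Tan n x) : v ∈ D.H x ↔ ∀ s, D.η x s v = 0 :=
  (D.exists_frame x).choose_spec.choose_spec.choose_spec.2.mem_iff x
    (D.exists_frame x).choose_spec.choose_spec.choose_spec.1 v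

end QCStructure

namespace BiquardConnection

variable {D : QCStructure n M} (B : BiquardConnection D)

/-- The projection of `T_x M = H_x ⊕ V_x` onto `H_x`. -/
def hor (x : M) : Tan n x →ₗ[ℝ] D.H x := (D.H x).projectionOnto (B.V x) (B.isCompl x)

theorem exists_reeb (x : M) (s : Fin 3) :
    ∃ ξ : B.V x, ∀ t, D.η x t ξ = if s = t then 1 else 0 := by
  let L : B.V x →ₗ[ℝ] (Fin 3 → ℝ) :=
    LinearMap.pi fun t => (D.η x t : Tan n x →ₗ[ℝ] ℝ) ∘ₗ (B.V x).subtype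
  have hinj : Function.Injective L := by
    rw [injective_iff_map_eq_zero]
    intro ξ hξ
    have h1 : (ξ : Tan n x) ∈ D.H x := (D.mem_H_iff x _).2 fun t => congrFun hξ t
    have h2 := (Submodule.disjoint_def.1 (B.isCompl x).disjoint) _ h1 ξ.2
    exact Subtype.ext h2
  have : FiniteDimensional ℝ (Tan n x) :=
    inferInstanceAs (FiniteDimensional ℝ (EuclideanSpace ℝ (Fin (4 * n + 3))))
  have hdim : Module.finrank ℝ (B.V x) = Module.finrank ℝ (Fin 3 → ℝ) := by
    have h1 := Submodule.finrank_add_eq_of_isCompl (B.isCompl x)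
    have h2 : Module.finrank ℝ (Tan n x) = 4 * n + 3 :=
      finrank_euclideanSpace_fin (𝕜 := ℝ) (n := 4 * n + 3)
    have h3 := D.finrank_H x
    simp only [Module.finrank_fin_fun]
    omega
  have hsurj : Function.Surjective L :=
    (LinearMap.injective_iff_surjective_of_finrank_eq_finrank hdim).1 hinj
  obtain ⟨ξ, hξ⟩ := hsurj fun t => if s = t then 1 else 0
  exact ⟨ξ, fun t => congrFun hξ t⟩

/-- The Reeb vectors `ξ_1, ξ_2, ξ_3 ∈ V_x`, dual to `η_1, η_2, η_3`. -/
def ξ (x : M) (s : Fin 3) : B.V x := (B.exists_reeb x s).choose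

/-- The covariant Hessian `∇²f(X,Y) = X(Yf) - (∇_X Y)f`. -/
def hess (f : M → ℝ) (x : M) (u v : Tan n x) : ℝ :=
  d n (fun y => d n f y (ext v y)) x u - d n f x (B.conn (ext v) x u)

/-- The square norm of the horizontal Hessian. -/
def hessNormSq (f : M → ℝ) (x : M) : ℝ := ∑ a, ∑ b, B.hess f x (D.e x a) (D.e x b) ^ 2

/-- The sub-Laplacian `△f = -∑ ∇²f(e_a, e_a)`. -/
def subLaplacian (f : M → ℝ) (x : M) : ℝ := -∑ a, B.hess f x (D.e x a) (D.e x a)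

/-- The curvature `R(A,B)C = ∇_A ∇_B C - ∇_B ∇_A C - ∇_{[A,B]} C`. -/
def curv (x : M) (u v w : Tan n x) : Tan n x :=
  B.conn (fun y => B.conn (ext w) y (ext v y)) x u
    - B.conn (fun y => B.conn (ext w) y (ext u y)) x v
    - B.conn (ext w) x (bracket (ext u) (ext v) x)

/-- The qc-Ricci tensor `Ric(A,B) = ∑ g(R(e_b,A)B, e_b)`. -/
def Ric (x : M) (u v : Tan n x) : ℝ :=
  ∑ b, D.g x (B.hor x (B.curv x (D.e x b) u v)) (D.e x b)

/-- The normalized qc-scalar curvature, `8n(n+2) S = ∑ Ric(e_a, e_a)`. -/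
def S (x : M) : ℝ := (∑ a, B.Ric x (D.e x a) (D.e x a)) / (8 * n * (n + 2))

/-- `g(T(ξ_s, X), Y)`. -/
def tor (x : M) (s : Fin 3) (u v : D.H x) : ℝ :=
  D.g x (B.hor x (B.conn.torsion x (B.ξ x s) u)) v

/-- `g(T⁰_{ξ_s} X, Y)`, where `T⁰_{ξ_s}` is the symmetric part of `T(ξ_s,·)`. -/
def torSymm (x : M) (s : Fin 3) (u v : D.H x) : ℝ := (B.tor x s u v + B.tor x s v u) / 2

/-- `g(b_{ξ_s} X, Y)`, where `b_{ξ_s}` is the skew-symmetric part of `T(ξ_s,·)`. -/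
def torSkew (x : M) (s : Fin 3) (u v : D.H x) : ℝ := (B.tor x s u v - B.tor x s v u) / 2

/-- The torsion component `T⁰(X,Y) = ∑ g(T⁰_{ξ_s} I_s X, Y)`. -/
def T0 (x : M) (u v : D.H x) : ℝ := ∑ s, B.torSymm x s (D.J x s u) v

/-- The torsion component `U(X,Y) = g(uX,Y)`, where `b_{ξ_s} = I_s u`. Since
`g(uX,Y) = g(b_{ξ_s} X, I_s Y)` for each `s`, it is the mean of the right hand sides. -/
def U (x : M) (u v : D.H x) : ℝ := (∑ s, B.torSkew x s u (D.J x s v)) / 3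

end BiquardConnection

namespace QCStructure

variable (D : QCStructure n M)

/-- The horizontal gradient: `∇f ∈ H` and `g(∇f, X) = df(X)` for `X ∈ H`. -/
def grad (f : M → ℝ) (x : M) : D.H x := ∑ a, d n f x (D.e x a) • D.e x a

end QCStructure

namespace BiquardConnection

variable {D : QCStructure n M} (B : BiquardConnection D)

/-- The fundamental 2-form `ω_s`: it is `g(I_s X, Y)` on `H` and `V` lies in its kernel. -/
def fundForm (x : M) (s : Fin 3) (u v : Tan n x) : ℝ := D.g x (D.J x s (B.hor x u)) (B.hor x v)

/-- The volume form `η_1 ∧ η_2 ∧ η_3 ∧ ω_s^{2n}` (it does not depend on `s`; here `s` is the first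
index), with the wedge product normalized as in `(α ∧ β)(X,Y) = α(X)β(Y) - α(Y)β(X)`. -/
def vol (x : M) (v : Fin (4 * n + 3) → Tan n x) : ℝ :=
  (∑ σ : Equiv.Perm (Fin (4 * n + 3)), ((Equiv.Perm.sign σ : ℤ) : ℝ) *
    (D.η x 0 (v (σ ⟨0, by omega⟩)) * D.η x 1 (v (σ ⟨1, by omega⟩)) *
      D.η x 2 (v (σ ⟨2, by omega⟩)) *
      ∏ k : Fin (2 * n), B.fundForm x 0 (v (σ ⟨2 * k + 3, by omega⟩)) (v (σ ⟨2 * k + 4, by omega⟩))))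
    / 2 ^ (2 * n)

/-- The density of `Vol_η` in the chart at `c`: `|Vol_η(∂_1, …, ∂_{4n+3})|`. -/
def chartDensity (c : M) (y : EuclideanSpace ℝ (Fin (4 * n + 3))) : ℝ :=
  |B.vol ((chartAt (EuclideanSpace ℝ (Fin (4 * n + 3))) c).symm y) fun i =>
    mfderiv (𝓡 (4 * n + 3)) (𝓡 (4 * n + 3))
      (chartAt (EuclideanSpace ℝ (Fin (4 * n + 3))) c).symm y (EuclideanSpace.single i (1 : ℝ))|

/-- A smooth partition of unity subordinate to the charts. -/
def partition (n : ℕ) (M : Type*) [TopologicalSpace M]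
    [ChartedSpace (EuclideanSpace ℝ (Fin (4 * n + 3))) M] [IsManifold (𝓡 (4 * n + 3)) ∞ M]
    [T2Space M] [SigmaCompactSpace M] : SmoothPartitionOfUnity M (𝓡 (4 * n + 3)) M Set.univ :=
  (SmoothPartitionOfUnity.exists_isSubordinate_chartAt_source (𝓡 (4 * n + 3)) M).choose

/-- Integration against `Vol_η`, for the orientation given by `Vol_η`, as a measure: with a
partition of unity `ρ` subordinate to the charts, `∫ F Vol_η = ∑_c ∫ ρ_c F |Vol_η(∂_1, …)| dy`,
each term being a Lebesgue integral over the target of the chart at `c`. -/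
def volMeasure [T2Space M] [SigmaCompactSpace M] [MeasurableSpace M] : Measure M :=
  Measure.sum fun c : M =>
    Measure.map (chartAt (EuclideanSpace ℝ (Fin (4 * n + 3))) c).symm
      ((volume.restrict (chartAt (EuclideanSpace ℝ (Fin (4 * n + 3))) c).target).withDensity
        fun y => ENNReal.ofReal
          (partition n M c ((chartAt (EuclideanSpace ℝ (Fin (4 * n + 3))) c).symm y) *
            B.chartDensity c y))

end BiquardConnection

end QC

end

/-! The inequality is an integrated Bochner formula in which every vertical derivative of the
gradient cancels. Put G = ∇f, let h be the horizontal Hessian, N the endomorphism with h(X,Y) = g(N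
X, Y), and let σ be the horizontal field dual to n h(·,G) + Σ_s h(I_s·, I_s G), plus n(△f)G
(`bochnerField`). In div σ the rough Laplacian of G is exchanged, by the Ricci identities, for the
derivative of tr h, the Ricci form, torsion, and 4 Σ_s g(∇_{ξ_s}G, I_s G) (`sum_nab2_grad`). The
rotated second derivatives Σ_a ∇²G(e_a, I_s e_a) only see curvature and torsion and produce −4n
g(∇_{ξ_s}G, I_s G) (`sum_nab2_J`). The weight n on the first summand makes the vertical derivatives
cancel, and the third summand removes the derivative of tr h. What remains is div σ = n|h|² + Σ_s
Σ_a g(N I_s e_a, I_s N e_a) − n(△f)² + n Ric(G,G) + contractions of torsion and curvature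
(`two_mul_div_bochnerField`).

These contractions are reduced to T⁰, U and S by the first Bianchi identity. Its vertical part
expresses the curvature κ of V through the torsion. Since ∇ preserves the quaternion relations, κ is
so(3)-valued, and this together with orthogonality to sp(n) ⊕ sp(1) determines the torsion: T⁰_{ξ_s}
anticommutes with I_s, b_{ξ_s} = I_s u with a single u, and the vertical part of T(ξ_r,ξ_s) is
governed by one scalar, which turns out to be −S. The horizontal part, contracted in two ways, then
gives `Ric_eq_τ` and `ricForm_eq_τ`. The former is also the pointwise identity that turns the first
right-hand side of the theorem into the second.

The inequality enters through linear algebra alone. N − Σ_s I_s N I_s is four times the component of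
N commuting with all I_s; comparing the norm of this component with its trace gives |N|² + Σ_s Σ_a
g(N I_s e_a, I_s N e_a) ≥ (△f)²/n (`trace_sq_le`). Hence div σ ≥ (n−1)|h|² − (n−1/n)(△f)² + n Ric −
4T⁰ − 6nU − 6nS|∇f|² (`le_bochnerDiv`); integrating and multiplying by n/(n²−1) gives the theorem.

That ∫ div σ = 0 needs care, because ∇ has torsion and Vol_η is defined by a wedge product. In an
adapted frame the connection matrix is traceless and the trace of T(σ,·) vanishes for horizontal σ,
so the determinant of the adapted coframe in coordinates is the right density for div
(`sum_D_det_mul`). Up to sign and a constant depending only on n it is also the density of Vol_η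
(`abs_vol`, `density_eq`). A partition of unity reduces the claim to ∫ ∂_i w = 0 in Euclidean space.

The computations take place in a module of vector fields over a ring of functions (`FieldAlgebra`,
`FrameAlgebra`) and, after evaluation at a point, in quaternionic linear algebra
(`TorsionCurvature`). The manifold enters only through the construction of local smooth adapted
frames and through tensoriality. -/

noncomputable section

namespace QC

/-! ### Orthonormal bases of bilinear forms -/

/-- `e` is an orthonormal basis for the symmetric bilinear form `g`. -/
structure IsONB {ι W : Type*} [Fintype ι] [DecidableEq ι] [AddCommGroup W] [Module ℝ W]
    (g : W →ₗ[ℝ] W →ₗ[ℝ] ℝ) (e : ι → W) : Prop where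
  symm : ∀ u v, g u v = g v u
  orth : ∀ a b, g (e a) (e b) = if a = b then 1 else 0
  expand : ∀ v, v = ∑ a, g v (e a) • e a

namespace IsONB

variable {ι κ W N : Type*} [Fintype ι] [DecidableEq ι] [Fintype κ] [DecidableEq κ]
  [AddCommGroup W] [Module ℝ W] [AddCommGroup N] [Module ℝ N]
  {g : W →ₗ[ℝ] W →ₗ[ℝ] ℝ} {e : ι → W} {e' : κ → W}

theorem map_eq_sum (h : IsONB g e) (φ : W →ₗ[ℝ] N) (v : W) :
    φ v = ∑ a, g v (e a) • φ (e a) := by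
  conv_lhs => rw [h.expand v]
  simp

theorem inner_eq_sum (h : IsONB g e) (u v : W) : g u v = ∑ a, g u (e a) * g v (e a) := by
  rw [h.symm u v, h.map_eq_sum (g v) u]
  simp

/-- Both sides expand to the same double sum, because the matrix of A' is the transpose of that of
A. This is the mechanism by which the I_s are moved between slots in the contractions below. -/
theorem sum_map_adjoint (h : IsONB g e) (B : W →ₗ[ℝ] W →ₗ[ℝ] N) {A A' : W →ₗ[ℝ] W}
    (hA : ∀ u v, g (A u) v = g u (A' v)) :
    ∑ a, B (A (e a)) (e a) = ∑ a, B (e a) (A' (e a)) := by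
  have h1 : ∀ a, B (A (e a)) (e a) = ∑ b, g (A (e a)) (e b) • B (e b) (e a) := fun a => by
    have := h.map_eq_sum (B.flip (e a)) (A (e a))
    simpa using this
  have h2 : ∀ b, B (e b) (A' (e b)) = ∑ a, g (A' (e b)) (e a) • B (e b) (e a) := fun b =>
    h.map_eq_sum (B (e b)) (A' (e b))
  simp_rw [h1, h2]
  rw [Finset.sum_comm]
  refine Finset.sum_congr rfl fun b _ => Finset.sum_congr rfl fun a _ => ?_
  rw [hA, h.symm]

theorem sum_map_skew (h : IsONB g e) (B : W →ₗ[ℝ] W →ₗ[ℝ] N) {J : W →ₗ[ℝ] W}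
    (hJ : ∀ u v, g (J u) v = -g u (J v)) :
    ∑ a, B (J (e a)) (e a) = -∑ a, B (e a) (J (e a)) := by
  rw [h.sum_map_adjoint B (A := J) (A' := -J) (by simpa using hJ)]
  simp

theorem sum_map_isometry (h : IsONB g e) (B : W →ₗ[ℝ] W →ₗ[ℝ] N) {J : W →ₗ[ℝ] W}
    (hJ : ∀ u v, g (J u) v = -g u (J v)) (hJ2 : ∀ u, J (J u) = -u) :
    ∑ a, B (J (e a)) (J (e a)) = ∑ a, B (e a) (e a) := by
  have := h.sum_map_skew (B.compl₁₂ LinearMap.id J) hJ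
  simp only [LinearMap.compl₁₂_apply, LinearMap.id_apply, hJ2] at this
  rw [this]
  simp

/-- Needed because the invariants of the statement use an arbitrary orthonormal basis at each point,
whereas calculus requires a smooth frame. -/
theorem trace_eq (h : IsONB g e) (h' : IsONB g e') (B : W →ₗ[ℝ] W →ₗ[ℝ] N) :
    ∑ a, B (e a) (e a) = ∑ a, B (e' a) (e' a) := by
  have h1 : ∀ a, B (e a) (e a) = ∑ b, g (e a) (e' b) • B (e' b) (e a) := fun a => by
    have := h'.map_eq_sum (B.flip (e a)) (e a)
    simpa using this
  have h2 : ∀ b, B (e' b) (e' b) = ∑ a, g (e' b) (e a) • B (e' b) (e a) := fun b =>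
    h.map_eq_sum (B (e' b)) (e' b)
  simp_rw [h1, h2]
  rw [Finset.sum_comm]
  refine Finset.sum_congr rfl fun b _ => Finset.sum_congr rfl fun a _ => ?_
  rw [h.symm]

theorem eq_of_inner (h : IsONB g e) {u v : W} (huv : ∀ w, g u w = g v w) : u = v := by
  rw [h.expand u, h.expand v]
  simp [huv]

theorem self_nonneg (h : IsONB g e) (u : W) : 0 ≤ g u u := by
  rw [h.inner_eq_sum]
  exact Finset.sum_nonneg fun a _ => mul_self_nonneg _

end IsONB

/-! ### Linear algebra at a point: what the Bianchi identity forces on the torsion -/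

/-- `(i, j, k)` is a cyclic permutation of the three indices. -/
def Cyc (i j k : Fin 3) : Prop := j = i + 1 ∧ k = i + 2

theorem Cyc.rot {i j k : Fin 3} (h : Cyc i j k) : Cyc j k i := by
  revert i j k; unfold Cyc; decide

theorem Cyc.sum {i j k : Fin 3} (h : Cyc i j k) {N : Type*} [AddCommGroup N] (F : Fin 3 → N) :
    ∑ s, F s = F i + F j + F k := by
  obtain ⟨rfl, rfl⟩ := h
  fin_cases i <;> simp [Fin.sum_univ_three] <;> abel

theorem Cyc.ne {i j k : Fin 3} (h : Cyc i j k) : j ≠ i := by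
  revert i j k; unfold Cyc; decide

theorem Cyc.eq_or_eq {i j k t : Fin 3} (h : Cyc i j k) (ht : t ≠ i) : t = j ∨ t = k := by
  revert i j k t; unfold Cyc; decide

theorem cyc_zero : Cyc 0 1 2 := by unfold Cyc; decide

/-- The values at a point of the torsion `T(ξ_s, ·)` and of the curvature of a connection on a
quaternionic Hermitian space: `κ s t` are the components of the curvature on the vertical space,
`τ r s t` those of `T(ξ_r, ξ_s)`. -/
structure TorsionCurvature (ι W : Type*) [Fintype ι] [DecidableEq ι] [AddCommGroup W]
    [Module ℝ W] where
  /-- metric -/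
  g : W →ₗ[ℝ] W →ₗ[ℝ] ℝ
  /-- orthonormal basis -/
  e : ι → W
  /-- complex structures -/
  I : Fin 3 → W →ₗ[ℝ] W
  /-- torsion endomorphisms -/
  T : Fin 3 → W →ₗ[ℝ] W
  /-- curvature -/
  R : W →ₗ[ℝ] W →ₗ[ℝ] W →ₗ[ℝ] W
  /-- vertical curvature -/
  κ : Fin 3 → Fin 3 → W →ₗ[ℝ] W →ₗ[ℝ] ℝ
  /-- vertical torsion -/
  τ : Fin 3 → Fin 3 → Fin 3 → ℝ
  onb : IsONB g e
  I_sq : ∀ s X, I s (I s X) = -X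
  I_mul : ∀ i j k, Cyc i j k → ∀ X, I i (I j X) = I k X
  I_mul' : ∀ i j k, Cyc i j k → ∀ X, I j (I i X) = -I k X
  I_skew : ∀ s X Y, g (I s X) Y = -g X (I s Y)
  τ_antisymm : ∀ r s t, τ r s t = -τ s r t
  perp_Q : ∀ s t, ∑ a, g (T s (e a)) (I t (e a)) = 0
  perp_sp : ∀ s (A : W →ₗ[ℝ] W), (∀ X Y, g (A X) Y = -g X (A Y)) →
    (∀ t X, A (I t X) = I t (A X)) → ∑ a, g (T s (e a)) (A (e a)) = 0
  R_antisymm : ∀ X Y Z, R X Y Z = -R Y X Z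
  R_skew : ∀ X Y Z Z', g (R X Y Z) Z' = -g Z (R X Y Z')
  R_I : ∀ X Y s Z, R X Y (I s Z) = I s (R X Y Z) + ∑ t, κ s t X Y • I t Z
  κ_eq : ∀ X Y s t, κ s t X Y = 2 * ∑ r, g (I r X) Y * τ r s t
    + 2 * (g (T s Y) (I t X) - g (T s X) (I t Y))
  bianchi : ∀ X Y Z, R X Y Z + R Y Z X + R Z X Y =
    ∑ s, (2 : ℝ) • (g (I s X) Y • T s Z + g (I s Y) Z • T s X + g (I s Z) X • T s Y)

namespace TorsionCurvature

variable {ι W : Type*} [Fintype ι] [DecidableEq ι] [AddCommGroup W] [Module ℝ W]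
  (P : TorsionCurvature ι W) {i j k : Fin 3}

/-- symmetric part of the torsion -/
def sym (s : Fin 3) : W →ₗ[ℝ] W →ₗ[ℝ] ℝ :=
  (1 / 2 : ℝ) • (P.g ∘ₗ P.T s + (P.g ∘ₗ P.T s).flip)

/-- skew-symmetric part of the torsion -/
def skw (s : Fin 3) : W →ₗ[ℝ] W →ₗ[ℝ] ℝ :=
  (1 / 2 : ℝ) • (P.g ∘ₗ P.T s - (P.g ∘ₗ P.T s).flip)

theorem sym_apply (s X Y) : P.sym s X Y = (P.g (P.T s X) Y + P.g (P.T s Y) X) / 2 := by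
  simp [sym]; ring

theorem skw_apply (s X Y) : P.skw s X Y = (P.g (P.T s X) Y - P.g (P.T s Y) X) / 2 := by
  simp [skw]; ring

theorem sym_comm (s X Y) : P.sym s X Y = P.sym s Y X := by simp only [sym_apply]; ring

theorem skw_comm (s X Y) : P.skw s X Y = -P.skw s Y X := by simp only [skw_apply]; ring

theorem torsion_eq (s X Y) : P.g (P.T s X) Y = P.sym s X Y + P.skw s X Y := by
  simp only [sym_apply, skw_apply]; ring

theorem I_rules (h : Cyc i j k) :
    (∀ X, P.I i (P.I j X) = P.I k X) ∧ (∀ X, P.I j (P.I k X) = P.I i X) ∧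
    (∀ X, P.I k (P.I i X) = P.I j X) ∧ (∀ X, P.I j (P.I i X) = -P.I k X) ∧
    (∀ X, P.I k (P.I j X) = -P.I i X) ∧ (∀ X, P.I i (P.I k X) = -P.I j X) :=
  ⟨P.I_mul _ _ _ h, P.I_mul _ _ _ h.rot, P.I_mul _ _ _ h.rot.rot,
    P.I_mul' _ _ _ h, P.I_mul' _ _ _ h.rot, P.I_mul' _ _ _ h.rot.rot⟩

theorem I_isom (s X Y) : P.g (P.I s X) (P.I s Y) = P.g X Y := by
  rw [P.I_skew, P.I_sq]; simp

theorem I_self (s X) : P.g (P.I s X) X = 0 := by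
  have := P.I_skew s X X
  rw [P.onb.symm X] at this; linarith

theorem trace_one : ∑ a, P.g (P.e a) (P.e a) = Fintype.card ι := by
  simp [P.onb.orth]

/-- The vertical curvature is skew. -/
theorem κ_skew [Nonempty ι] (X Y : W) (s t : Fin 3) : P.κ s t X Y = -P.κ t s X Y := by
  obtain ⟨a⟩ := ‹Nonempty ι›
  set E := P.e a with hE
  have hEE : P.g E E = 1 := by simp [hE, P.onb.orth]
  have h0 : ∀ s, P.g (P.I s E) E = 0 := fun s => P.I_self s E
  -- The curvature acts as a derivation on the quaternion relations. Differentiating I_i² = −1 and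
  -- taking the component along E gives κ_ii = 0; differentiating I_i I_j + I_j I_i = 0 in the same
  -- way gives κ_ij + κ_ji = 0.
  have hkey : ∀ s, P.κ s s X Y = 0 := fun s => by
    obtain ⟨i, j, k, h, rfl⟩ : ∃ i j k, Cyc i j k ∧ i = s := ⟨s, s + 1, s + 2, ⟨rfl, rfl⟩, rfl⟩
    obtain ⟨r1, r2, r3, r4, r5, r6⟩ := P.I_rules h
    have h1 := P.R_I X Y i (P.I i E)
    rw [P.I_sq, P.R_I, h.sum, h.sum] at h1
    have h2 := congrArg (fun v => P.g v E) h1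
    simp only [map_neg, map_add, map_smul, P.I_sq, r4, r3, LinearMap.add_apply,
      LinearMap.smul_apply, LinearMap.neg_apply, hEE, h0, smul_eq_mul, r1, r6] at h2
    linarith
  have hcyc : ∀ i j k, Cyc i j k → P.κ i j X Y = -P.κ j i X Y := fun i j k h => by
    obtain ⟨r1, r2, r3, r4, r5, r6⟩ := P.I_rules h
    have h1 := P.R_I X Y i (P.I j E)
    have h3 := P.R_I X Y j (P.I i E)
    rw [r1] at h1
    rw [r4, map_neg] at h3
    simp only [P.R_I, h.sum] at h1 h3
    have h2 := congrArg (fun v => P.g v E) h1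
    have h4 := congrArg (fun v => P.g v E) h3
    simp only [map_neg, map_add, map_smul, P.I_sq, r1, r3, r4, r5, r6, LinearMap.add_apply,
      LinearMap.smul_apply, LinearMap.neg_apply, hEE, h0, smul_eq_mul] at h2 h4
    linarith
  by_cases hst : s = t
  · subst hst; rw [hkey]; simp
  · have : Cyc s t (s + 2) ∨ Cyc t s (t + 2) := by
      revert s t; unfold Cyc; decide
    rcases this with h | h
    · exact hcyc _ _ _ h
    · rw [hcyc _ _ _ h]; simp

/-- I_t is skew, so pairing the torsion with it sees only the skew part, and orthogonality to Q
applies. -/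
theorem trace_skw (s t : Fin 3) : ∑ a, P.skw s (P.e a) (P.I t (P.e a)) = 0 := by
  have e1 := P.perp_Q s t
  have e2 := P.onb.sum_map_skew (P.g ∘ₗ P.T s) (P.I_skew t)
  simp only [LinearMap.comp_apply] at e2
  simp only [skw_apply, ← Finset.sum_div, Finset.sum_sub_distrib]
  linarith

/-- Since κ_ii = 0, `κ_eq` becomes an identity between T(ξ_i,·), ω_j and ω_k. Under (X,Y) ↦ (I_i X,
I_i Y) the forms ω_j, ω_k change sign; this isolates the symmetric part, so T⁰_{ξ_i} anticommutes
with I_i. Contracting the rest with I_j and I_k kills the skew torsion by `trace_skw`, hence the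
vertical components vanish, and then b_{ξ_i} commutes with I_i. -/
theorem torsion_I_self [Nonempty ι] (h : Cyc i j k) :
    (∀ X Y, P.sym i (P.I i X) Y = P.sym i X (P.I i Y)) ∧
    (∀ X Y, P.skw i (P.I i X) Y = -P.skw i X (P.I i Y)) ∧ P.τ j i i = 0 ∧ P.τ k i i = 0 := by
  obtain ⟨r1, r2, r3, r4, r5, r6⟩ := P.I_rules h
  have hτ : P.τ i i i = 0 := by have := P.τ_antisymm i i i; linarith
  have hκ : ∀ X Y, P.g (P.I j X) Y * P.τ j i i + P.g (P.I k X) Y * P.τ k i i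
      + (P.g (P.T i Y) (P.I i X) - P.g (P.T i X) (P.I i Y)) = 0 := fun X Y => by
    have h1 := P.κ_eq X Y i i
    have h2 := P.κ_skew X Y i i
    rw [h.sum, hτ] at h1
    linarith
  have hA : ∀ X Y, P.g (P.I j (P.I i X)) (P.I i Y) = -P.g (P.I j X) Y := fun X Y => by
    rw [r4, ← r1, map_neg, LinearMap.neg_apply, P.I_isom]
  have hB : ∀ X Y, P.g (P.I k (P.I i X)) (P.I i Y) = -P.g (P.I k X) Y := fun X Y => by
    rw [r3, ← P.I_isom i (P.I k X), r6]; simp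
  have h1 : ∀ X Y, P.sym i (P.I i X) Y = P.sym i X (P.I i Y) := fun X Y => by
    have e1 := hκ X Y
    have e2 := hκ (P.I i X) (P.I i Y)
    rw [hA, hB, P.I_sq, P.I_sq] at e2
    simp only [map_neg] at e2
    simp only [sym_apply]
    linarith
  have h2 : ∀ X Y, P.g (P.I j X) Y * P.τ j i i + P.g (P.I k X) Y * P.τ k i i
      = P.skw i X (P.I i Y) + P.skw i (P.I i X) Y := fun X Y => by
    have e1 := hκ X Y
    have e2 := h1 X Y
    simp only [sym_apply] at e2
    simp only [skw_apply]
    linarith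
  have htr := P.trace_skw i
  have hN : (Fintype.card ι : ℝ) ≠ 0 := by
    exact_mod_cast Fintype.card_ne_zero
  have hskI : ∀ s t, ∑ a, P.skw i (P.I s (P.e a)) (P.I t (P.e a)) =
      -∑ a, P.skw i (P.e a) (P.I t (P.I s (P.e a))) := fun s t => by
    have := P.onb.sum_map_skew ((P.skw i).compl₁₂ LinearMap.id (P.I t)) (P.I_skew s)
    simpa using this
  have hj : P.τ j i i = 0 := by
    have e : ∑ a, (P.g (P.I j (P.e a)) (P.I j (P.e a)) * P.τ j i i
        + P.g (P.I k (P.e a)) (P.I j (P.e a)) * P.τ k i i)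
      = ∑ a, (P.skw i (P.e a) (P.I i (P.I j (P.e a))) + P.skw i (P.I i (P.e a)) (P.I j (P.e a))) :=
      Finset.sum_congr rfl fun a _ => h2 _ _
    have e3 : ∀ a, P.g (P.I k (P.e a)) (P.I j (P.e a)) = 0 := fun a => by
      rw [← r1, P.I_self]
    simp only [Finset.sum_add_distrib, ← Finset.sum_mul, hskI, e3, P.I_isom,
      P.trace_one, r1, r4, map_neg, Finset.sum_neg_distrib, htr] at e
    simp [hN] at e
    exact e
  have hk : P.τ k i i = 0 := by
    have e : ∑ a, (P.g (P.I k (P.e a)) (P.I k (P.e a)) * P.τ k i i)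
      = ∑ a, (P.skw i (P.e a) (P.I i (P.I k (P.e a))) + P.skw i (P.I i (P.e a)) (P.I k (P.e a))) :=
      Finset.sum_congr rfl fun a _ => by rw [← h2, hj]; ring
    simp only [Finset.sum_add_distrib, ← Finset.sum_mul, hskI, P.I_isom,
      P.trace_one, r3, r6, map_neg, Finset.sum_neg_distrib, htr] at e
    simp [hN] at e
    exact e
  refine ⟨h1, fun X Y => ?_, hj, hk⟩
  have := h2 X Y
  rw [hj, hk] at this
  linarith

theorem exists_cyc (s : Fin 3) : ∃ j k, Cyc s j k := ⟨s + 1, s + 2, rfl, rfl⟩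


theorem sym_I [Nonempty ι] (s X Y) : P.sym s (P.I s X) Y = P.sym s X (P.I s Y) := by
  obtain ⟨j, k, h⟩ := exists_cyc s
  exact (P.torsion_I_self h).1 X Y

theorem skw_I [Nonempty ι] (s X Y) : P.skw s (P.I s X) Y = -P.skw s X (P.I s Y) := by
  obtain ⟨j, k, h⟩ := exists_cyc s
  exact (P.torsion_I_self h).2.1 X Y

/-- The `sp(n)`-component of the skew torsion vanishes. -/
theorem skw_average (s : Fin 3) (X Y : W) :
    P.skw s X Y + ∑ t, P.skw s (P.I t X) (P.I t Y) = 0 := by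
  -- Four times the projection of the skew torsion to the forms invariant under all I_t; its
  -- endomorphism A below lies in sp(n), so it is orthogonal to the torsion.
  set Q : W →ₗ[ℝ] W →ₗ[ℝ] ℝ :=
    P.skw s + ∑ t, (P.skw s).compl₁₂ (P.I t) (P.I t) with hQ
  have hQa : ∀ X Y, Q X Y = P.skw s X Y + ∑ t, P.skw s (P.I t X) (P.I t Y) := fun X Y => by
    simp [hQ]
  rw [← hQa]
  have hQskew : ∀ X Y, Q X Y = -Q Y X := fun X Y => by
    rw [hQa, hQa, P.skw_comm s X Y]
    simp_rw [fun t => P.skw_comm s (P.I t X) (P.I t Y)]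
    simp only [Finset.sum_neg_distrib]; ring
  have hQI : ∀ t X Y, Q (P.I t X) (P.I t Y) = Q X Y := fun t X Y => by
    obtain ⟨j, k, h⟩ := exists_cyc t
    obtain ⟨r1, r2, r3, r4, r5, r6⟩ := P.I_rules h
    simp only [hQa, h.sum, P.I_sq, r3, r4, map_neg, LinearMap.neg_apply]
    ring
  let A : W →ₗ[ℝ] W := ∑ a, (Q.flip (P.e a)).smulRight (P.e a)
  have hA : ∀ X Y, P.g (A X) Y = Q X Y := fun X Y => by
    have := P.onb.map_eq_sum (Q X) Y
    rw [this]
    simp only [A, LinearMap.coe_sum, Finset.sum_apply, LinearMap.smulRight_apply, map_sum, map_smul,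
      LinearMap.smul_apply, smul_eq_mul, LinearMap.flip_apply]
    exact Finset.sum_congr rfl fun a _ => by rw [P.onb.symm]; ring
  have hperp := P.perp_sp s A (fun X Y => by rw [hA, P.onb.symm, hA, hQskew])
    (fun t X => P.onb.eq_of_inner fun w => by
      rw [hA, P.I_skew, hA]
      have := hQI t X (P.I t w)
      rw [P.I_sq] at this
      simp only [map_neg] at this
      linarith)
  have hdbl : ∀ B C : W →ₗ[ℝ] W →ₗ[ℝ] ℝ, ∀ t,
      ∑ a, ∑ b, B (P.I t (P.e a)) (P.I t (P.e b)) * C (P.I t (P.e a)) (P.I t (P.e b)) =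
      ∑ a, ∑ b, B (P.e a) (P.e b) * C (P.e a) (P.e b) := fun B C t => by
    have h1 : ∀ u, ∑ b, B u (P.I t (P.e b)) * C u (P.I t (P.e b)) =
        ∑ b, B u (P.e b) * C u (P.e b) := fun u => by
      have := P.onb.sum_map_isometry ((LinearMap.mul ℝ ℝ).compl₁₂ (B u) (C u))
        (P.I_skew t) (P.I_sq t)
      simpa using this
    simp_rw [h1]
    rw [Finset.sum_comm]
    conv_rhs => rw [Finset.sum_comm]
    refine Finset.sum_congr rfl fun b _ => ?_
    have := P.onb.sum_map_isometry ((LinearMap.mul ℝ ℝ).compl₁₂ (B.flip (P.e b)) (C.flip (P.e b)))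
        (P.I_skew t) (P.I_sq t)
    simpa using this
  have hTQ : ∑ a, ∑ b, P.g (P.T s (P.e a)) (P.e b) * Q (P.e a) (P.e b) = 0 := by
    rw [← hperp]
    refine Finset.sum_congr rfl fun a _ => ?_
    rw [P.onb.inner_eq_sum]
    exact Finset.sum_congr rfl fun b _ => by rw [hA]
  have hskQ : ∑ a, ∑ b, P.skw s (P.e a) (P.e b) * Q (P.e a) (P.e b) = 0 := by
    have h2 : ∑ a, ∑ b, P.g (P.T s (P.e b)) (P.e a) * Q (P.e a) (P.e b) = 0 := by
      rw [Finset.sum_comm, ← neg_eq_zero, ← hTQ, ← Finset.sum_neg_distrib]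
      refine Finset.sum_congr rfl fun a _ => ?_
      rw [← Finset.sum_neg_distrib]
      exact Finset.sum_congr rfl fun b _ => by rw [hQskew]; ring
    have h3 : ∑ a, ∑ b, P.skw s (P.e a) (P.e b) * Q (P.e a) (P.e b) =
        (∑ a, ∑ b, P.g (P.T s (P.e a)) (P.e b) * Q (P.e a) (P.e b)
        - ∑ a, ∑ b, P.g (P.T s (P.e b)) (P.e a) * Q (P.e a) (P.e b)) / 2 := by
      rw [← Finset.sum_sub_distrib, Finset.sum_div]
      refine Finset.sum_congr rfl fun a _ => ?_
      rw [← Finset.sum_sub_distrib, Finset.sum_div]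
      exact Finset.sum_congr rfl fun b _ => by rw [skw_apply]; ring
    rw [h3, hTQ, h2]; simp
  -- Invariance of Q makes |Q|² a sum of four copies of ⟨skw, Q⟩, one for each of 1, I_0, I_1, I_2,
  -- and each of them is zero.
  have hQQ : ∑ a, ∑ b, Q (P.e a) (P.e b) * Q (P.e a) (P.e b) = 0 := by
    have h1 : ∀ a b, Q (P.e a) (P.e b) * Q (P.e a) (P.e b) =
        P.skw s (P.e a) (P.e b) * Q (P.e a) (P.e b) +
        ∑ t, P.skw s (P.I t (P.e a)) (P.I t (P.e b)) * Q (P.I t (P.e a)) (P.I t (P.e b)) :=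
      fun a b => by
        simp_rw [hQI]
        rw [← Finset.sum_mul, ← add_mul, ← hQa]
    simp_rw [h1, Finset.sum_add_distrib]
    rw [hskQ, zero_add]
    simp_rw [fun a => Finset.sum_comm (s := (Finset.univ : Finset ι)) (t := Finset.univ (α := Fin 3))
      (f := fun b t => P.skw s (P.I t (P.e a)) (P.I t (P.e b)) * Q (P.I t (P.e a)) (P.I t (P.e b)))]
    rw [Finset.sum_comm]
    simp_rw [hdbl, hskQ]
    simp
  have hz : ∀ a b, Q (P.e a) (P.e b) = 0 := fun a b => by
    have h1 := (Finset.sum_eq_zero_iff_of_nonneg (fun a _ => Finset.sum_nonneg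
      fun b _ => mul_self_nonneg _)).1 hQQ a (Finset.mem_univ _)
    have h2 := (Finset.sum_eq_zero_iff_of_nonneg (fun b _ => mul_self_nonneg _)).1 h1 b
      (Finset.mem_univ _)
    simpa using h2
  rw [P.onb.map_eq_sum (Q X) Y]
  refine Finset.sum_eq_zero fun b _ => ?_
  have := P.onb.map_eq_sum (Q.flip (P.e b)) X
  simp only [LinearMap.flip_apply, hz, smul_zero, Finset.sum_const_zero] at this
  rw [this, smul_zero]

theorem skw_I_I_self [Nonempty ι] (s X Y) : P.skw s (P.I s X) (P.I s Y) = P.skw s X Y := by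
  rw [P.skw_I, P.I_sq]; simp

/-- The identity and I_s contribute equal terms to `skw_average`, and since I_k = I_i I_j so do the
two other structures; hence each of these equals minus the common value. -/
theorem skw_I_I_of_ne [Nonempty ι] {s t : Fin 3} (hst : t ≠ s) (X Y : W) :
    P.skw s (P.I t X) (P.I t Y) = -P.skw s X Y := by
  obtain ⟨j, k, h⟩ := exists_cyc s
  obtain ⟨r1, r2, r3, r4, r5, r6⟩ := P.I_rules h
  have h1 := P.skw_average s X Y
  rw [h.sum, P.skw_I_I_self] at h1
  have h2 : P.skw s (P.I k X) (P.I k Y) = P.skw s (P.I j X) (P.I j Y) := by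
    rw [← r1, ← r1, P.skw_I_I_self]
  have : t = j ∨ t = k := h.eq_or_eq hst
  rcases this with rfl | rfl <;> linarith

/-- the tensor `U`, computed from `ξ_s` -/
theorem skw_I_I_I [Nonempty ι] (s t : Fin 3) (X Y : W) :
    P.skw s (P.I t X) (P.I s (P.I t Y)) = P.skw s X (P.I s Y) := by
  by_cases hst : t = s
  · subst hst; rw [P.skw_I_I_self]
  · rw [← neg_inj, ← P.skw_I_I_of_ne hst X]
    obtain ⟨j, k, h⟩ := exists_cyc s
    obtain ⟨r1, r2, r3, r4, r5, r6⟩ := P.I_rules h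
    have : t = j ∨ t = k := h.eq_or_eq hst
    rcases this with rfl | rfl
    · rw [r1, r4]; simp
    · rw [r6, r3]; simp

/-- κ_ij + κ_ji = 0 is written through the torsion and split by (X,Y) ↦ (I_i X, I_i Y). The
symmetric torsion terms are invariant, while ω_k and the skew terms change sign, so the two groups
vanish separately. The trace of the second group determines the vertical component, and what is left
says that I_s u = b_{ξ_s} has the same u for ξ_i and ξ_j. -/
theorem torsion_I_cyc [Nonempty ι] (h : Cyc i j k) :
    (∀ X Y, P.sym i Y (P.I j X) - P.sym i X (P.I j Y) + P.sym j Y (P.I i X)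
      - P.sym j X (P.I i Y) = 0) ∧
    (∀ X Y, P.skw i X (P.I i Y) = P.skw j X (P.I j Y)) ∧ P.τ k i j = P.τ j k i := by
  obtain ⟨r1, r2, r3, r4, r5, r6⟩ := P.I_rules h
  have hij : j ≠ i := h.ne
  have t1 := (P.torsion_I_self h).2.2.1
  have t2 := (P.torsion_I_self h.rot).2.2.2
  have a1 := P.τ_antisymm i i j
  have a2 := P.τ_antisymm i j i
  have a3 := P.τ_antisymm j j i
  have a4 := P.τ_antisymm j i j
  have hF : ∀ X Y, P.g (P.I k X) Y * (P.τ k i j + P.τ k j i) +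
      (P.sym i Y (P.I j X) - P.sym i X (P.I j Y) + P.sym j Y (P.I i X) - P.sym j X (P.I i Y))
      - 2 * P.skw i X (P.I j Y) - 2 * P.skw j X (P.I i Y) = 0 := fun X Y => by
    have h1 := P.κ_eq X Y i j
    have h2 := P.κ_eq X Y j i
    have h3 := P.κ_skew X Y i j
    rw [h.sum] at h1 h2
    have e1 : P.skw i Y (P.I j X) = -P.skw i X (P.I j Y) := by
      rw [P.skw_comm, neg_inj, ← neg_neg (P.skw i X _), ← P.skw_I_I_of_ne hij, P.I_sq]; simp
    have e2 : P.skw j Y (P.I i X) = -P.skw j X (P.I i Y) := by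
      rw [P.skw_comm, neg_inj, ← neg_neg (P.skw j X _), ← P.skw_I_I_of_ne hij.symm, P.I_sq]; simp
    simp only [torsion_eq] at h1 h2
    have z1 : P.τ i i j = 0 := by linarith
    have z2 : P.τ i j i = 0 := by linarith
    have z3 : P.τ j j i = 0 := by linarith
    have z4 : P.τ j i j = 0 := by linarith
    rw [z1, z4] at h1
    rw [z2, z3] at h2
    linarith
  have hG : ∀ X Y, P.g (P.I k X) Y * (P.τ k i j + P.τ k j i) +
      2 * P.skw i X (P.I i (P.I k Y)) - 2 * P.skw j X (P.I j (P.I k Y)) = 0 ∧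
      P.sym i Y (P.I j X) - P.sym i X (P.I j Y) + P.sym j Y (P.I i X)
      - P.sym j X (P.I i Y) = 0 := fun X Y => by
    have h1 := hF X Y
    have h2 := hF (P.I i X) (P.I i Y)
    have w1 : P.g (P.I k (P.I i X)) (P.I i Y) = -P.g (P.I k X) Y := by
      rw [r3, ← P.I_isom i (P.I k X), r6]; simp
    have w2 : ∀ X Y, P.sym i (P.I i Y) (P.I j (P.I i X)) = P.sym i Y (P.I j X) := fun X Y => by
      rw [P.sym_I, r4, map_neg, r6, neg_neg]
    have w3 : P.skw i (P.I i X) (P.I j (P.I i Y)) = -P.skw i X (P.I j Y) := by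
      rw [P.skw_I, r4, map_neg, r6, neg_neg]
    have w4 : P.skw j (P.I i X) (P.I i (P.I i Y)) = -P.skw j X (P.I i Y) := by
      rw [P.skw_I_I_of_ne hij.symm]
    rw [w1, w2, w2, w3, w4] at h2
    simp only [P.I_sq, map_neg] at h2
    have w5 := P.sym_comm j (P.I i Y) X
    have w6 := P.sym_comm j (P.I i X) Y
    rw [r6, r2]
    simp only [map_neg]
    constructor <;> linarith
  have htr : (P.τ k i j + P.τ k j i) * Fintype.card ι = 0 := by
    have e : ∀ a, (P.τ k i j + P.τ k j i) * P.g (P.e a) (P.e a) =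
        2 * P.skw i (P.e a) (P.I i (P.e a)) - 2 * P.skw j (P.e a) (P.I j (P.e a)) := fun a => by
      have := (hG (P.e a) (P.I k (P.e a))).1
      rw [P.I_isom, P.I_sq] at this
      simp only [map_neg] at this
      linarith
    rw [← P.trace_one, Finset.mul_sum]
    simp_rw [e]
    rw [Finset.sum_sub_distrib, ← Finset.mul_sum, ← Finset.mul_sum, P.trace_skw, P.trace_skw]
    simp
  have hN : (Fintype.card ι : ℝ) ≠ 0 := by
    exact_mod_cast Fintype.card_ne_zero
  have hμ : P.τ k i j + P.τ k j i = 0 := by simpa [hN] using htr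
  refine ⟨fun X Y => (hG X Y).2, fun X Y => ?_, ?_⟩
  · have := (hG X (P.I k Y)).1
    rw [hμ, P.I_sq] at this
    simp only [map_neg] at this
    linarith
  · have := P.τ_antisymm k j i
    linarith

end TorsionCurvature
end QC
end

/-! ### Linear algebra at a point: Ricci contractions in terms of T⁰, U and one scalar -/

noncomputable section

namespace QC

namespace TorsionCurvature

variable {ι W : Type*} [Fintype ι] [DecidableEq ι] [AddCommGroup W] [Module ℝ W]
  (P : TorsionCurvature ι W) {i j k : Fin 3} [Nonempty ι]

/-- the qc-Ricci form -/
def Ric (X Y : W) : ℝ := ∑ b, P.g (P.R (P.e b) X Y) (P.e b)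

/-- the torsion component `T⁰` -/
def T0 (X Y : W) : ℝ := ∑ s, P.sym s (P.I s X) Y

/-- the torsion component `U` -/
def U (X Y : W) : ℝ := (∑ s, P.skw s X (P.I s Y)) / 3

/-- the contraction `∑ R(e_a, I_s e_a, I_s X, X) / 2` of the curvature -/
def ricForm (X : W) : ℝ := (∑ s, ∑ a, P.g (P.R (P.e a) (P.I s (P.e a)) (P.I s X)) X) / 2

theorem skw_eq_U (s X Y) : P.skw s X (P.I s Y) = P.U X Y := by
  have h1 := (P.torsion_I_cyc cyc_zero).2.1 X Y
  have h2 := (P.torsion_I_cyc cyc_zero.rot).2.1 X Y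
  have h3 : P.U X Y = P.skw 0 X (P.I 0 Y) := by
    rw [U, cyc_zero.sum, ← h2, ← h1]; ring
  rw [h3]
  fin_cases s
  · rfl
  · exact h1.symm
  · exact (h1.trans h2).symm

theorem U_I (s X) : P.U (P.I s X) (P.I s X) = P.U X X := by
  rw [← P.skw_eq_U 0, ← P.skw_eq_U 0, P.skw_I_I_I]

/-- The vertical torsion reduces to one scalar; `trace_Ric` identifies it, for dim H = 4n, with −S.
-/
theorem τ_eq (h : Cyc i j k) : P.τ k i j = P.τ 2 0 1 := by
  have h1 := (P.torsion_I_cyc cyc_zero).2.2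
  have h2 := (P.torsion_I_cyc cyc_zero.rot).2.2
  obtain ⟨rfl, rfl⟩ := h
  fin_cases i
  · rfl
  · exact h2
  · exact h1.symm

omit [Nonempty ι] in
theorem sym_I_self_I_self (s X) : P.sym s (P.I s (P.I s X)) (P.I s X) = -P.sym s (P.I s X) X := by
  rw [P.I_sq, P.sym_comm]; simp

/-- With q_i(X) = `sym i (I i X) X`, anticommutation and the symmetric relation of `torsion_I_cyc`
form a linear system for the values of the q_i at the rotated vectors. Its solution makes all later
identities linear in q_0(X), q_1(X), q_2(X). -/
theorem sym_I_self (h : Cyc i j k) (X : W) :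
    P.sym i (P.I i (P.I j X)) (P.I j X) = P.sym k (P.I k X) X - P.sym j (P.I j X) X ∧
    P.sym i (P.I i (P.I k X)) (P.I k X) = P.sym j (P.I j X) X - P.sym k (P.I k X) X := by
  have hq : ∀ i j k, Cyc i j k → P.sym i (P.I i (P.I j X)) (P.I j X) - P.sym i (P.I i X) X =
      P.sym j (P.I j (P.I i X)) (P.I i X) - P.sym j (P.I j X) X := fun i j k h => by
    obtain ⟨r1, r2, r3, r4, r5, r6⟩ := P.I_rules h
    have h1 := (P.torsion_I_cyc h).1 X (P.I k X)
    rw [r2, r6] at h1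
    rw [r1, r4]
    rw [P.sym_comm i X, P.sym_comm j X] at h1
    simp only [map_neg, LinearMap.neg_apply] at h1 ⊢
    linarith
  have hn : ∀ i j k, Cyc i j k → P.sym i (P.I i (P.I k X)) (P.I k X) =
      -P.sym i (P.I i (P.I j X)) (P.I j X) := fun i j k h => by
    obtain ⟨r1, r2, r3, r4, r5, r6⟩ := P.I_rules h
    have := P.sym_I_self_I_self i (P.I j X)
    rw [r1] at this ⊢
    rw [r6, map_neg, LinearMap.neg_apply, P.sym_comm]
  have a1 := hq _ _ _ h
  have a2 := hq _ _ _ h.rot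
  have a3 := hq _ _ _ h.rot.rot
  have b1 := hn _ _ _ h
  have b2 := hn _ _ _ h.rot
  have b3 := hn _ _ _ h.rot.rot
  constructor <;> linarith

omit [Nonempty ι] in
theorem κ_antisymm (s t X Y) : P.κ s t X Y = -P.κ s t Y X := by
  have h1 := P.κ_eq X Y s t
  have h2 := P.κ_eq Y X s t
  have h3 : ∀ r, P.g (P.I r X) Y = -P.g (P.I r Y) X := fun r => by
    rw [P.I_skew, P.onb.symm X]
  simp_rw [h3 _] at h1
  simp only [neg_mul, Finset.sum_neg_distrib] at h1
  linarith

/-- Of the vertical terms in `κ_eq` only r = k survives, because T(ξ_i,ξ_j) has no component along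
ξ_i or ξ_j. -/
theorem κ_diag (h : Cyc i j k) (X : W) : P.κ i j X (P.I k X) = 2 * P.τ 2 0 1 * P.g X X
    + 2 * (P.sym k (P.I k X) X - P.sym i (P.I i X) X - P.sym j (P.I j X) X) - 4 * P.U X X := by
  obtain ⟨r1, r2, r3, r4, r5, r6⟩ := P.I_rules h
  have t1 := (P.torsion_I_self h).2.2.1
  have t2 := (P.torsion_I_self h.rot).2.2.2
  have z1 : P.τ i i j = 0 := by have := P.τ_antisymm i i j; linarith
  have z4 : P.τ j i j = 0 := by have := P.τ_antisymm j i j; linarith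
  have h1 := P.κ_eq X (P.I k X) i j
  rw [h.sum, z1, z4, P.τ_eq h, P.I_isom, P.torsion_eq, P.torsion_eq, r2, P.skw_eq_U] at h1
  have e1 := (P.sym_I_self h X).1
  have e2 : P.skw i (P.I k X) (P.I j X) = -P.U X X := by
    rw [← P.U_I j, ← P.skw_eq_U i, r1, P.skw_comm]
  rw [r1] at e1
  rw [e1, e2, P.sym_comm i X] at h1
  linarith

/-- Writing I_k = I_i I_j and commuting R(X,Y) past I_i costs κ_ij; rotating the basis by I_i then
turns the remaining trace into minus the original one. -/
theorem sum_R_I (h : Cyc i j k) (X Y : W) :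
    ∑ a, P.g (P.R X Y (P.e a)) (P.I k (P.e a)) = P.κ i j X Y * Fintype.card ι / 2 := by
  obtain ⟨r1, r2, r3, r4, r5, r6⟩ := P.I_rules h
  have h1 : ∀ a, P.g (P.R X Y (P.e a)) (P.I k (P.e a)) =
      -P.g (P.R X Y (P.I i (P.e a))) (P.I j (P.e a)) + P.κ i j X Y * P.g (P.e a) (P.e a) :=
    fun a => by
      have e1 := P.I_skew i (P.R X Y (P.e a)) (P.I j (P.e a))
      have e0 := P.κ_skew X Y i i
      have e4 : P.κ i i X Y = 0 := by linarith
      rw [P.R_I, h.sum, e4, ← r1]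
      simp only [map_add, LinearMap.add_apply, map_smul, LinearMap.smul_apply, smul_eq_mul,
        P.I_isom]
      have e2 : P.g (P.I k (P.e a)) (P.I j (P.e a)) = 0 := by rw [← r1, P.I_self]
      rw [r1, e2, ← r1, e1]; ring
  have h2 := P.onb.sum_map_skew (P.g.compl₁₂ (P.R X Y) (P.I j)) (P.I_skew i)
  simp only [LinearMap.compl₁₂_apply, r4, map_neg, Finset.sum_neg_distrib, neg_neg] at h2
  have h3 := Finset.sum_congr (rfl : (Finset.univ : Finset ι) = _) fun a _ => h1 a
  rw [Finset.sum_add_distrib, Finset.sum_neg_distrib, h2, ← Finset.mul_sum, P.trace_one] at h3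
  linarith

/-- I_k is moved across R onto Y, which yields the Ricci form; the commutator of R with I_k
contributes the κ terms. -/
theorem sum_R_I_left (h : Cyc i j k) (X Y : W) :
    ∑ a, P.g (P.R (P.e a) X Y) (P.I k (P.e a)) =
      -P.Ric X (P.I k Y) + P.κ k i (P.I i Y) X + P.κ k j (P.I j Y) X := by
  have h0 : P.κ k k = 0 := by
    ext u v
    have := P.κ_skew u v k k
    simp only [LinearMap.zero_apply]; linarith
  have h1 : ∀ a, P.g (P.R (P.e a) X Y) (P.I k (P.e a)) = -P.g (P.R (P.e a) X (P.I k Y)) (P.e a)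
      + (P.g (P.I i Y) (P.e a) * P.κ k i (P.e a) X + P.g (P.I j Y) (P.e a) * P.κ k j (P.e a) X) :=
    fun a => by
      have e1 := P.I_skew k (P.R (P.e a) X Y) (P.e a)
      rw [P.R_I, h.sum, h0]
      simp only [map_add, LinearMap.add_apply, map_smul, LinearMap.smul_apply, smul_eq_mul,
        LinearMap.zero_apply, zero_smul, add_zero]
      rw [e1]; ring
  have h2 := P.onb.map_eq_sum ((P.κ k i).flip X) (P.I i Y)
  have h3 := P.onb.map_eq_sum ((P.κ k j).flip X) (P.I j Y)
  simp only [LinearMap.flip_apply, smul_eq_mul] at h2 h3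
  simp_rw [h1, Finset.sum_add_distrib, Finset.sum_neg_distrib]
  rw [← h2, ← h3, Ric, add_assoc]

/-- The Bianchi identity for X, I_k X, e_a is paired with I_k e_a and summed over a. The three
curvature traces are given by `sum_R_I` and `sum_R_I_left`, and every κ that appears is known from
`κ_diag`. -/
theorem Ric_add_Ric_I (h : Cyc i j k) (X : W) :
    P.Ric X X + P.Ric (P.I k X) (P.I k X) =
      4 * P.U X X + 4 * (P.sym i (P.I i X) X + P.sym j (P.I j X) X - P.sym k (P.I k X) X)
      - Fintype.card ι * (P.τ 2 0 1 * P.g X X +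
        (P.sym k (P.I k X) X - P.sym i (P.I i X) X - P.sym j (P.I j X) X) - 2 * P.U X X)
      - 8 * P.τ 2 0 1 * P.g X X + 16 * P.U X X := by
  obtain ⟨r1, r2, r3, r4, r5, r6⟩ := P.I_rules h
  have hb : ∀ a, P.g (P.R X (P.I k X) (P.e a)) (P.I k (P.e a))
      - P.g (P.R (P.e a) (P.I k X) X) (P.I k (P.e a))
      + P.g (P.R (P.e a) X (P.I k X)) (P.I k (P.e a)) =
      ∑ s, 2 * (P.g (P.I s X) (P.I k X) * P.g (P.T s (P.e a)) (P.I k (P.e a))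
        + P.g (P.I s (P.I k X)) (P.e a) * P.g (P.T s X) (P.I k (P.e a))
        - P.g (P.I s X) (P.e a) * P.g (P.T s (P.I k X)) (P.I k (P.e a))) := fun a => by
    have e1 := congrArg (fun v => P.g v (P.I k (P.e a))) (P.bianchi X (P.I k X) (P.e a))
    have e2 := P.R_antisymm (P.I k X) (P.e a) X
    rw [e2] at e1
    simp only [map_add, map_neg, LinearMap.add_apply, LinearMap.neg_apply, map_sum, map_smul,
      LinearMap.coe_sum, Finset.sum_apply, LinearMap.smul_apply, smul_eq_mul] at e1
    rw [← sub_eq_add_neg] at e1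
    rw [e1]
    refine Finset.sum_congr rfl fun s _ => ?_
    rw [P.I_skew s (P.e a), P.onb.symm (P.e a)]; ring
  have hs : ∀ s u v, ∑ a, P.g u (P.e a) * P.g (P.T s v) (P.I k (P.e a)) =
      P.g (P.T s v) (P.I k u) := fun s u v => by
    have := P.onb.map_eq_sum (P.g (P.T s v) ∘ₗ P.I k) u
    simpa using this.symm
  have hc := Finset.sum_congr (rfl : (Finset.univ : Finset ι) = _) fun a _ => hb a
  rw [Finset.sum_comm] at hc
  simp only [← Finset.mul_sum, Finset.sum_add_distrib, Finset.sum_sub_distrib, hs, P.perp_Q,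
    P.sum_R_I h, P.sum_R_I_left h, mul_zero, zero_add] at hc
  rw [h.sum] at hc
  have c1 := P.κ_diag h X
  have c2 := P.κ_diag h.rot X
  have c3 := P.κ_diag h.rot.rot X
  have c4 := P.κ_diag h.rot (P.I j X)
  have c5 := P.κ_diag h.rot.rot (P.I k X)
  rw [P.U_I, P.I_isom] at c4 c5
  obtain ⟨p1, p2⟩ := P.sym_I_self h X
  obtain ⟨p3, p4⟩ := P.sym_I_self h.rot X
  obtain ⟨p5, p6⟩ := P.sym_I_self h.rot.rot X
  rw [p1, p6, P.sym_I_self_I_self] at c4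
  rw [p2, p3, P.sym_I_self_I_self] at c5
  have d1 : P.g (P.T i (P.I k X)) (P.I j X) =
      -(P.sym j (P.I j X) X - P.sym k (P.I k X) X) - P.U X X := by
    have e := P.torsion_eq i (P.I k X) (P.I i (P.I k X))
    rw [P.skw_eq_U, P.U_I, P.sym_comm, p2, r6, map_neg] at e
    linarith
  have d2 : P.g (P.T j (P.I k X)) (P.I i X) =
      P.sym i (P.I i X) X - P.sym k (P.I k X) X + P.U X X := by
    have e := P.torsion_eq j (P.I k X) (P.I j (P.I k X))
    rw [P.skw_eq_U, P.U_I, P.sym_comm, p3, r2] at e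
    linarith
  have d3 : ∀ s, P.g (P.T s X) (P.I s X) = P.sym s (P.I s X) X + P.U X X := fun s => by
    rw [P.torsion_eq, P.skw_eq_U, P.sym_comm]
  have d4 : P.g (P.T k (P.I k X)) X = P.sym k (P.I k X) X - P.U X X := by
    rw [P.torsion_eq, P.skw_comm, P.skw_eq_U]; ring
  simp only [P.I_sq, r1, r2, r3, r5, r6, map_neg, LinearMap.neg_apply, h.sum, d1, d2, d3,
    d4, neg_neg] at hc c4 c5
  rw [P.κ_antisymm k i (P.I i X), P.κ_skew (P.I j X) (P.I k X) k j, P.κ_antisymm k i (P.I j X),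
    P.κ_skew (P.I i X) X k j, P.κ_antisymm j k (P.I i X), c1, c2, c3, c4, c5] at hc
  have hR : ∀ Y, P.Ric (-Y) (-Y) = P.Ric Y Y := fun Y => by simp [Ric]
  have hR' : ∀ Y, P.Ric X (-Y) = -P.Ric X Y := fun Y => by simp [Ric]
  rw [hR'] at hc
  linarith

omit [Nonempty ι] in
theorem trace_T0 : ∑ a, P.T0 (P.e a) (P.e a) = 0 := by
  simp only [T0]
  rw [Finset.sum_comm]
  refine Finset.sum_eq_zero fun s _ => ?_
  have h := P.onb.sum_map_skew (P.sym s) (P.I_skew s)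
  simp_rw [fun a => P.sym_comm s (P.e a) (P.I s (P.e a))] at h
  linarith

theorem trace_U : ∑ a, P.U (P.e a) (P.e a) = 0 := by
  simp_rw [← P.skw_eq_U 0]
  exact P.trace_skw 0 0

/-- `Ric_add_Ric_I` gives the sum of Ric at two vectors; three such sums isolate a single value. -/
theorem Ric_eq_τ (X : W) : P.Ric X X = (Fintype.card ι / 2 + 2) * P.T0 X X
    + (Fintype.card ι + 10) * P.U X X
    - (Fintype.card ι / 2 + 4) * (P.τ 2 0 1 * P.g X X) := by
  have h := cyc_zero
  have e1 := P.Ric_add_Ric_I h X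
  have e2 := P.Ric_add_Ric_I h.rot X
  -- The pairs are (X, I_2 X), (X, I_0 X) and (I_0 X, I_1 I_0 X). As I_1 I_0 X = −I_2 X, the first
  -- two sums minus the third equal 2 Ric(X,X).
  have e3 := P.Ric_add_Ric_I h.rot.rot (P.I 0 X)
  have r4 : P.I 1 (P.I 0 X) = -P.I 2 X := P.I_mul' _ _ _ h X
  have hR : ∀ Y, P.Ric (-Y) (-Y) = P.Ric Y Y := fun Y => by simp [Ric]
  rw [P.sym_I_self_I_self, (P.sym_I_self h.rot.rot X).1, (P.sym_I_self h.rot X).2, P.U_I,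
    P.I_isom, r4, hR] at e3
  have hT : P.T0 X X = P.sym 0 (P.I 0 X) X + P.sym 1 (P.I 1 X) X + P.sym 2 (P.I 2 X) X :=
    h.sum _
  rw [hT]
  linarith

/-- The qc-scalar curvature is the vertical torsion. -/
theorem trace_Ric : ∑ a, P.Ric (P.e a) (P.e a) =
    -(Fintype.card ι / 2 + 4) * Fintype.card ι * P.τ 2 0 1 := by
  simp_rw [P.Ric_eq_τ]
  rw [Finset.sum_sub_distrib, Finset.sum_add_distrib, ← Finset.mul_sum, ← Finset.mul_sum,
    ← Finset.mul_sum, ← Finset.mul_sum, P.trace_T0, P.trace_U, P.trace_one]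
  ring

theorem T0_I_sum (X : W) : ∑ s, P.T0 (P.I s X) (P.I s X) = -P.T0 X X := by
  have h := cyc_zero
  obtain ⟨p1, p2⟩ := P.sym_I_self h X
  obtain ⟨p3, p4⟩ := P.sym_I_self h.rot X
  obtain ⟨p5, p6⟩ := P.sym_I_self h.rot.rot X
  simp only [T0, h.sum, P.sym_I_self_I_self, p1, p2, p3, p4, p5, p6]
  ring

theorem κ_I_sum (h : Cyc i j k) (X : W) :
    P.κ k i (P.I i X) (P.I k X) + P.κ k j (P.I j X) (P.I k X) =
      -(4 * P.τ 2 0 1 * P.g X X + 4 * P.sym k (P.I k X) X - 8 * P.U X X) := by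
  obtain ⟨r1, r2, r3, r4, r5, r6⟩ := P.I_rules h
  have c4 := P.κ_diag h.rot (P.I j X)
  have c5 := P.κ_diag h.rot.rot (P.I k X)
  rw [P.U_I, P.I_isom] at c4 c5
  obtain ⟨p1, p2⟩ := P.sym_I_self h X
  obtain ⟨p3, p4⟩ := P.sym_I_self h.rot X
  obtain ⟨p5, p6⟩ := P.sym_I_self h.rot.rot X
  rw [p1, p6, P.sym_I_self_I_self, r1] at c4
  rw [p2, p3, P.sym_I_self_I_self, r2] at c5
  rw [P.κ_antisymm k i, P.κ_skew _ _ k j, c4, c5]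
  ring

/-- The Bianchi identity is contracted over e_a, I_k e_a, I_k X and paired with X. Its last two
curvature terms coincide after rotating the basis and equal Ric(I_k X, I_k X) up to κ; summing over
k and inserting `Ric_eq_τ` makes U cancel. -/
theorem ricForm_eq_τ (X : W) : P.ricForm X = (Fintype.card ι / 2 + 4) * P.T0 X X
    - 3 / 2 * Fintype.card ι * (P.τ 2 0 1 * P.g X X) := by
  have hB : ∀ i j k, Cyc i j k → ∑ a, P.g (P.R (P.e a) (P.I k (P.e a)) (P.I k X)) X =
      2 * (P.Ric (P.I k X) (P.I k X) - P.κ k i (P.I i X) (P.I k X) - P.κ k j (P.I j X) (P.I k X))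
      + 2 * Fintype.card ι * P.g (P.T k (P.I k X)) X
      + 4 * (P.g (P.T i (P.I i X)) X + P.g (P.T j (P.I j X)) X - P.g (P.T k (P.I k X)) X) :=
    fun i j k h => by
      obtain ⟨r1, r2, r3, r4, r5, r6⟩ := P.I_rules h
      have h1 : ∀ a, P.g (P.R (P.e a) (P.I k (P.e a)) (P.I k X)) X
          + P.g (P.R (P.I k (P.e a)) (P.I k X) (P.e a)) X
          - P.g (P.R (P.e a) (P.I k X) (P.I k (P.e a))) X =
          ∑ s, 2 * (P.g (P.I s (P.e a)) (P.I k (P.e a)) * P.g (P.T s (P.I k X)) X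
            - P.g (P.I k (P.I s (P.I k X))) (P.e a) * -P.g (P.T s (P.e a)) X
            + P.g (P.I s (P.I k X)) (P.e a) * P.g (P.T s (P.I k (P.e a))) X) := fun a => by
        have e1 := congrArg (fun v => P.g v X) (P.bianchi (P.e a) (P.I k (P.e a)) (P.I k X))
        rw [P.R_antisymm (P.I k X) (P.e a)] at e1
        simp only [map_add, map_neg, LinearMap.add_apply, LinearMap.neg_apply, map_sum, map_smul,
          LinearMap.coe_sum, Finset.sum_apply, LinearMap.smul_apply, smul_eq_mul] at e1
        rw [← sub_eq_add_neg] at e1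
        rw [e1]
        refine Finset.sum_congr rfl fun s _ => ?_
        have e2 : P.g (P.I s (P.I k (P.e a))) (P.I k X) = P.g (P.I k (P.I s (P.I k X))) (P.e a) := by
          rw [P.I_skew s, P.I_skew k (P.e a), P.onb.symm]; ring
        rw [e2]; ring
      have h2 := P.onb.sum_map_skew
        ((P.R.flip (P.I k X)).compr₂ (P.g.flip X)) (P.I_skew k)
      simp only [LinearMap.compr₂_apply, LinearMap.flip_apply] at h2
      have h3 : ∑ a, P.g (P.R (P.e a) (P.I k X) (P.I k (P.e a))) X =
          P.Ric (P.I k X) (P.I k X) - P.κ k i (P.I i X) (P.I k X)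
          - P.κ k j (P.I j X) (P.I k X) := by
        have := P.sum_R_I_left h (P.I k X) X
        have e : ∀ a, P.g (P.R (P.e a) (P.I k X) (P.I k (P.e a))) X =
            -P.g (P.R (P.e a) (P.I k X) X) (P.I k (P.e a)) := fun a => by
          rw [P.R_skew, P.onb.symm]
        simp_rw [e, Finset.sum_neg_distrib]
        rw [this]; ring
      have hs1 : ∀ s u, ∑ a, P.g u (P.e a) * P.g (P.T s (P.e a)) X = P.g (P.T s u) X :=
        fun s u => by
          have := P.onb.map_eq_sum ((P.g.flip X) ∘ₗ P.T s) u
          simpa using this.symm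
      have hs2 : ∀ s u, ∑ a, P.g u (P.e a) * P.g (P.T s (P.I k (P.e a))) X =
          P.g (P.T s (P.I k u)) X := fun s u => by
          have := P.onb.map_eq_sum ((P.g.flip X) ∘ₗ P.T s ∘ₗ P.I k) u
          simpa using this.symm
      have h4 := Finset.sum_congr (rfl : (Finset.univ : Finset ι) = _) fun a _ => h1 a
      rw [Finset.sum_comm] at h4
      have z1 : ∀ a, P.g (P.I i (P.e a)) (P.I k (P.e a)) = 0 := fun a => by
        rw [← r2, P.I_self]
      have z2 : ∀ a, P.g (P.I j (P.e a)) (P.I k (P.e a)) = 0 := fun a => by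
        rw [← r1, P.onb.symm, P.I_self]
      simp only [← Finset.mul_sum, Finset.sum_add_distrib, Finset.sum_sub_distrib, mul_neg,
        Finset.sum_neg_distrib, hs1, hs2, h2, h3, ← Finset.sum_mul] at h4
      simp only [h.sum, z1, z2, P.I_isom, P.trace_one, P.I_sq, r2, r3, r5, r6, map_neg,
        LinearMap.neg_apply, Finset.sum_const_zero, neg_neg] at h4
      linarith
  have h := cyc_zero
  have hR : ∑ s, P.Ric (P.I s X) (P.I s X) = -(Fintype.card ι / 2 + 2) * P.T0 X X
      + 3 * (Fintype.card ι + 10) * P.U X X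
      - 3 * (Fintype.card ι / 2 + 4) * (P.τ 2 0 1 * P.g X X) := by
    simp_rw [P.Ric_eq_τ, P.U_I, P.I_isom]
    rw [Finset.sum_sub_distrib, Finset.sum_add_distrib, ← Finset.mul_sum, P.T0_I_sum]
    simp only [Finset.sum_const, Finset.card_univ, Fintype.card_fin, nsmul_eq_mul]
    push_cast; ring
  have hT : P.T0 X X = P.sym 0 (P.I 0 X) X + P.sym 1 (P.I 1 X) X + P.sym 2 (P.I 2 X) X :=
    h.sum _
  have hw : ∀ s, P.g (P.T s (P.I s X)) X = P.sym s (P.I s X) X - P.U X X := fun s => by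
    rw [P.torsion_eq, P.skw_comm, P.skw_eq_U]; ring
  rw [h.sum] at hR
  rw [ricForm, h.sum, hB _ _ _ h, hB _ _ _ h.rot, hB _ _ _ h.rot.rot]
  have k1 := P.κ_I_sum h X
  have k2 := P.κ_I_sum h.rot X
  have k3 := P.κ_I_sum h.rot.rot X
  rw [hT] at hR ⊢
  simp only [hw]
  linarith

end TorsionCurvature
end QC
end

/-! ### Formal vector field calculus: torsion, curvature, Bianchi and Ricci identities -/

noncomputable section

namespace QC

/-- The algebra of vector fields: a module `𝔛` over a ring `A` of functions, with the action `D` of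
fields on functions, the Lie bracket and a connection. -/
structure FieldAlgebra (A 𝔛 : Type*) [CommRing A] [AddCommGroup 𝔛] [Module A 𝔛] where
  /-- derivative of functions -/
  D : 𝔛 → A → A
  /-- Lie bracket -/
  br : 𝔛 → 𝔛 → 𝔛
  /-- connection -/
  nab : 𝔛 → 𝔛 → 𝔛
  D_add : ∀ X a b, D X (a + b) = D X a + D X b
  D_mul : ∀ X a b, D X (a * b) = a * D X b + b * D X a
  D_add_left : ∀ X Y a, D (X + Y) a = D X a + D Y a
  D_smul_left : ∀ (c : A) X a, D (c • X) a = c * D X a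
  br_antisymm : ∀ X Y, br X Y = -br Y X
  br_add : ∀ X Y Z, br X (Y + Z) = br X Y + br X Z
  br_smul : ∀ X (c : A) Y, br X (c • Y) = D X c • Y + c • br X Y
  jacobi : ∀ X Y Z, br X (br Y Z) = br (br X Y) Z + br Y (br X Z)
  D_br : ∀ X Y a, D (br X Y) a = D X (D Y a) - D Y (D X a)
  nab_add_left : ∀ X Y Z, nab (X + Y) Z = nab X Z + nab Y Z
  nab_smul_left : ∀ (c : A) X Z, nab (c • X) Z = c • nab X Z
  nab_add : ∀ X Y Z, nab X (Y + Z) = nab X Y + nab X Z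
  nab_smul : ∀ X (c : A) Y, nab X (c • Y) = D X c • Y + c • nab X Y

namespace FieldAlgebra

variable {A 𝔛 : Type*} [CommRing A] [AddCommGroup 𝔛] [Module A 𝔛] (P : FieldAlgebra A 𝔛)

/-- `D X` as an additive map -/
def DHom (X : 𝔛) : A →+ A := AddMonoidHom.mk' (P.D X) (P.D_add X)

theorem D_zero (X) : P.D X 0 = 0 := (P.DHom X).map_zero
theorem D_neg (X a) : P.D X (-a) = -P.D X a := (P.DHom X).map_neg a
theorem D_sub (X a b) : P.D X (a - b) = P.D X a - P.D X b := (P.DHom X).map_sub a b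
theorem D_sum (X) {ι : Type*} (s : Finset ι) (f : ι → A) :
    P.D X (∑ i ∈ s, f i) = ∑ i ∈ s, P.D X (f i) := map_sum (P.DHom X) f s
theorem D_one (X) : P.D X 1 = 0 := by have := P.D_mul X 1 1; simpa using this
theorem D_natCast (X) (n : ℕ) : P.D X n = 0 := by
  induction n with
  | zero => simpa using P.D_zero X
  | succ k ih => rw [Nat.cast_succ, P.D_add, ih, P.D_one, add_zero]

/-- the derivative of a function as a linear form -/
def dL (a : A) : 𝔛 →ₗ[A] A where
  toFun X := P.D X a
  map_add' X Y := P.D_add_left X Y a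
  map_smul' c X := by simp [P.D_smul_left]

theorem D_sum_left {ι : Type*} (s : Finset ι) (f : ι → 𝔛) (a : A) :
    P.D (∑ i ∈ s, f i) a = ∑ i ∈ s, P.D (f i) a := map_sum (P.dL a) f s

/-- the covariant derivative of a field as a linear map -/
def nabL (Z : 𝔛) : 𝔛 →ₗ[A] 𝔛 where
  toFun X := P.nab X Z
  map_add' X Y := P.nab_add_left X Y Z
  map_smul' c X := by simp [P.nab_smul_left]

@[simp] theorem dL_apply (a X) : P.dL a X = P.D X a := rfl
@[simp] theorem nabL_apply (Z X) : P.nabL Z X = P.nab X Z := rfl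

/-- `nab X` as an additive map -/
def nabHom (X : 𝔛) : 𝔛 →+ 𝔛 := AddMonoidHom.mk' (P.nab X) (P.nab_add X)

theorem nab_neg (X Y) : P.nab X (-Y) = -P.nab X Y := (P.nabHom X).map_neg Y
theorem nab_sub (X Y Z) : P.nab X (Y - Z) = P.nab X Y - P.nab X Z := (P.nabHom X).map_sub Y Z
theorem nab_sum (X) {ι : Type*} (s : Finset ι) (f : ι → 𝔛) :
    P.nab X (∑ i ∈ s, f i) = ∑ i ∈ s, P.nab X (f i) := map_sum (P.nabHom X) f s
theorem nab_sum_left {ι : Type*} (s : Finset ι) (f : ι → 𝔛) (Z) :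
    P.nab (∑ i ∈ s, f i) Z = ∑ i ∈ s, P.nab (f i) Z := map_sum (P.nabL Z) f s
theorem nab_sub_left (X Y Z) : P.nab (X - Y) Z = P.nab X Z - P.nab Y Z := (P.nabL Z).map_sub X Y
theorem nab_neg_left (X Z) : P.nab (-X) Z = -P.nab X Z := (P.nabL Z).map_neg X

theorem br_add_left (X Y Z) : P.br (X + Y) Z = P.br X Z + P.br Y Z := by
  rw [P.br_antisymm, P.br_add, P.br_antisymm Z X, P.br_antisymm Z Y]; abel
theorem br_smul_left (c : A) (X Y) : P.br (c • X) Y = c • P.br X Y - P.D Y c • X := by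
  rw [P.br_antisymm, P.br_smul, P.br_antisymm Y X]; module

/-- the torsion -/
def T : 𝔛 →ₗ[A] 𝔛 →ₗ[A] 𝔛 :=
  LinearMap.mk₂ A (fun X Y => P.nab X Y - P.nab Y X - P.br X Y)
    (fun X X' Y => by rw [P.nab_add_left, P.nab_add, P.br_add_left]; abel)
    (fun c X Y => by rw [P.nab_smul_left, P.nab_smul, P.br_smul_left]; module)
    (fun X Y Y' => by rw [P.nab_add_left, P.nab_add, P.br_add]; abel)
    (fun c X Y => by rw [P.nab_smul_left, P.nab_smul, P.br_smul]; module)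

theorem T_apply (X Y) : P.T X Y = P.nab X Y - P.nab Y X - P.br X Y := rfl

theorem T_antisymm (X Y) : P.T X Y = -P.T Y X := by
  rw [T_apply, T_apply, P.br_antisymm X Y]; abel

theorem br_eq (X Y) : P.br X Y = P.nab X Y - P.nab Y X - P.T X Y := by
  rw [T_apply]; abel

/-- the curvature -/
def R (X Y : 𝔛) : 𝔛 →ₗ[A] 𝔛 where
  toFun Z := P.nab X (P.nab Y Z) - P.nab Y (P.nab X Z) - P.nab (P.br X Y) Z
  map_add' Z Z' := by simp only [P.nab_add]; abel
  map_smul' c Z := by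
    simp only [P.nab_smul, P.nab_add, P.D_br, RingHom.id_apply]
    module

theorem R_apply (X Y Z) :
    P.R X Y Z = P.nab X (P.nab Y Z) - P.nab Y (P.nab X Z) - P.nab (P.br X Y) Z := rfl

theorem R_antisymm (X Y Z) : P.R X Y Z = -P.R Y X Z := by
  rw [R_apply, R_apply, P.br_antisymm X Y, P.nab_neg_left]; abel

theorem R_add_left (X X' Y Z) : P.R (X + X') Y Z = P.R X Y Z + P.R X' Y Z := by
  simp only [R_apply, P.nab_add_left, P.nab_add, P.br_add_left]; abel

theorem R_smul_left (c : A) (X Y Z) : P.R (c • X) Y Z = c • P.R X Y Z := by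
  simp only [R_apply, P.nab_smul_left, P.nab_smul, P.br_smul_left, P.nab_sub_left]; module

/-- the curvature as a trilinear map -/
def RL : 𝔛 →ₗ[A] 𝔛 →ₗ[A] 𝔛 →ₗ[A] 𝔛 :=
  LinearMap.mk₂ A P.R (fun X X' Y => LinearMap.ext fun Z => P.R_add_left X X' Y Z)
    (fun c X Y => LinearMap.ext fun Z => P.R_smul_left c X Y Z)
    (fun X Y Y' => LinearMap.ext fun Z => by
      rw [LinearMap.add_apply, R_antisymm, R_add_left, R_antisymm P X Y, R_antisymm P X Y']; abel)
    (fun c X Y => LinearMap.ext fun Z => by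
      rw [LinearMap.smul_apply, R_antisymm, R_smul_left, R_antisymm P X Y, smul_neg])

@[simp] theorem RL_apply (X Y) : P.RL X Y = P.R X Y := rfl

/-- The first Bianchi identity. -/
theorem bianchi (X Y Z) : P.R X Y Z + P.R Y Z X + P.R Z X Y =
    (P.nab X (P.T Y Z) - P.T (P.br Y Z) X) + (P.nab Y (P.T Z X) - P.T (P.br Z X) Y)
      + (P.nab Z (P.T X Y) - P.T (P.br X Y) Z) := by
  -- Jacobi in cyclic form. Replacing every bracket by ∇ − ∇ − T turns it into the Bianchi identity;
  -- the right-hand side keeps derivatives of the fields T(Y,Z), so no covariant derivative of the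
  -- tensor T is needed.
  have h : P.br (P.br X Y) Z + P.br (P.br Y Z) X + P.br (P.br Z X) Y = 0 := by
    have := P.jacobi X Y Z
    rw [P.br_antisymm X (P.br Y Z), P.br_antisymm Y (P.br X Z), P.br_antisymm X Z] at this
    have h2 : P.br (-P.br Z X) Y = -P.br (P.br Z X) Y := by
      have := P.br_smul_left (-1) (P.br Z X) Y
      rw [P.D_neg, P.D_one] at this
      simpa using this
    rw [h2] at this
    have h3 := eq_add_of_sub_eq' (sub_eq_zero.2 this)
    rw [neg_neg, add_zero] at h3
    rw [add_assoc, add_comm (P.br (P.br Y Z) X)]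
    have := sub_eq_zero.2 this
    rw [← neg_eq_zero, ← this]; abel
  have h1 : ∀ X Y Z, P.br (P.br X Y) Z =
      P.nab (P.br X Y) Z - P.nab Z (P.br X Y) - P.T (P.br X Y) Z := fun X Y Z => P.br_eq _ _
  have h2 : ∀ X Y Z, P.nab Z (P.br X Y) = P.nab Z (P.nab X Y) - P.nab Z (P.nab Y X)
      - P.nab Z (P.T X Y) := fun X Y Z => by rw [P.br_eq X Y, P.nab_sub, P.nab_sub]
  simp only [h1, h2] at h
  simp only [R_apply]
  rw [← sub_eq_zero, ← neg_eq_zero, ← h]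
  abel

/-- the second covariant derivative of `G` -/
def nab2 (G : 𝔛) : 𝔛 →ₗ[A] 𝔛 →ₗ[A] 𝔛 :=
  LinearMap.mk₂ A (fun X Y => P.nab X (P.nab Y G) - P.nab (P.nab X Y) G)
    (fun X X' Y => by simp only [P.nab_add_left]; abel)
    (fun c X Y => by simp only [P.nab_smul_left]; module)
    (fun X Y Y' => by simp only [P.nab_add_left, P.nab_add]; abel)
    (fun c X Y => by simp only [P.nab_smul_left, P.nab_smul, P.nab_add_left]; module)

theorem nab2_apply (G X Y) : P.nab2 G X Y = P.nab X (P.nab Y G) - P.nab (P.nab X Y) G := rfl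

/-- The Ricci identity. -/
theorem nab2_sub (G X Y) : P.nab2 G X Y - P.nab2 G Y X = P.R X Y G - P.nab (P.T X Y) G := by
  simp only [nab2_apply, R_apply, T_apply, P.nab_sub_left]; abel

end FieldAlgebra
end QC
end

/-! ### Adapted frames: structure equations and the two parts of the Bianchi identity -/

noncomputable section

namespace QC

/-- A frame adapted to a quaternionic contact structure with its Biquard connection; `g` and `J s`
are extended by zero to the vertical fields. -/
structure FrameAlgebra (A 𝔛 ι : Type*) [CommRing A] [Algebra ℝ A] [AddCommGroup 𝔛] [Module A 𝔛]
    [Fintype ι] [DecidableEq ι] extends FieldAlgebra A 𝔛 where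
  /-- horizontal metric -/
  g : 𝔛 →ₗ[A] 𝔛 →ₗ[A] A
  /-- contact forms -/
  η : Fin 3 → 𝔛 →ₗ[A] A
  /-- complex structures -/
  J : Fin 3 → 𝔛 →ₗ[A] 𝔛
  /-- orthonormal horizontal frame -/
  e : ι → 𝔛
  /-- Reeb fields -/
  ξ : Fin 3 → 𝔛
  g_symm : ∀ X Y, g X Y = g Y X
  g_e : ∀ a b, g (e a) (e b) = if a = b then 1 else 0
  g_ξ : ∀ s X, g (ξ s) X = 0
  η_e : ∀ s a, η s (e a) = 0
  η_ξ : ∀ s t, η s (ξ t) = if s = t then 1 else 0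
  expand : ∀ X, X = ∑ a, g X (e a) • e a + ∑ s, η s X • ξ s
  η_J : ∀ s t X, η s (J t X) = 0
  J_skew : ∀ s X Y, g (J s X) Y = -g X (J s Y)
  J_sq : ∀ s a, J s (J s (e a)) = -e a
  J_mul : ∀ i j k, Cyc i j k → ∀ X, J i (J j X) = J k X
  J_mul' : ∀ i j k, Cyc i j k → ∀ X, J j (J i X) = -J k X
  η_nab_e : ∀ s X a, η s (nab X (e a)) = 0
  g_nab_ξ : ∀ s X Y, g (nab X (ξ s)) Y = 0
  nab_g : ∀ X a b, g (nab X (e a)) (e b) + g (e a) (nab X (e b)) = 0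
  nab_J : ∀ s X a, nab X (J s (e a)) = J s (nab X (e a)) + ∑ t, η t (nab X (ξ s)) • J t (e a)
  torsion_e : ∀ a b, toFieldAlgebra.T (e a) (e b) = ∑ s, (2 * g (J s (e a)) (e b)) • ξ s
  η_torsion : ∀ r s a, η r (toFieldAlgebra.T (ξ s) (e a)) = 0

namespace FrameAlgebra

variable {A 𝔛 ι : Type*} [CommRing A] [Algebra ℝ A] [AddCommGroup 𝔛] [Module A 𝔛]
    [Fintype ι] [DecidableEq ι] (P : FrameAlgebra A 𝔛 ι)

/-- horizontal fields -/
def IsHor (X : 𝔛) : Prop := ∀ s, P.η s X = 0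

/-- connection forms of the quaternionic bundle -/
def α (s t : Fin 3) (X : 𝔛) : A := P.η t (P.nab X (P.ξ s))

theorem isHor_e (a) : P.IsHor (P.e a) := fun s => P.η_e s a
theorem isHor_J (s X) : P.IsHor (P.J s X) := fun t => P.η_J t s X
theorem IsHor.neg {P : FrameAlgebra A 𝔛 ι} {X : 𝔛} (h : P.IsHor X) : P.IsHor (-X) :=
  fun s => by rw [map_neg, h s, neg_zero]
theorem IsHor.add {P : FrameAlgebra A 𝔛 ι} {X Y : 𝔛} (h : P.IsHor X) (h' : P.IsHor Y) :
    P.IsHor (X + Y) := fun s => by rw [map_add, h s, h' s, zero_add]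
theorem IsHor.smul {P : FrameAlgebra A 𝔛 ι} {X : 𝔛} (h : P.IsHor X) (c : A) :
    P.IsHor (c • X) := fun s => by rw [map_smul, h s, smul_zero]
theorem IsHor.sum {P : FrameAlgebra A 𝔛 ι} {κ : Type*} {S : Finset κ} {F : κ → 𝔛}
    (h : ∀ i ∈ S, P.IsHor (F i)) : P.IsHor (∑ i ∈ S, F i) := fun s => by
  rw [map_sum]; exact Finset.sum_eq_zero fun i hi => h i hi s

variable {P}

theorem IsHor.expand {X : 𝔛} (h : P.IsHor X) : X = ∑ a, P.g X (P.e a) • P.e a := by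
  conv_lhs => rw [P.expand X]
  simp [h _]

theorem IsHor.map_eq_sum {N : Type*} [AddCommGroup N] [Module A N] {X : 𝔛} (h : P.IsHor X)
    (φ : 𝔛 →ₗ[A] N) : φ X = ∑ a, P.g X (P.e a) • φ (P.e a) := by
  conv_lhs => rw [h.expand]
  simp

theorem IsHor.eq_of_inner {X Y : 𝔛} (h : P.IsHor X) (h' : P.IsHor Y)
    (hg : ∀ Z, P.IsHor Z → P.g X Z = P.g Y Z) : X = Y := by
  rw [h.expand, h'.expand]
  exact Finset.sum_congr rfl fun a _ => by rw [hg _ (P.isHor_e a)]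

theorem IsHor.inner_eq_sum {X : 𝔛} (h : P.IsHor X) (Y : 𝔛) :
    P.g X Y = ∑ a, P.g X (P.e a) * P.g Y (P.e a) := by
  have := h.map_eq_sum (P.g.flip Y)
  simp only [LinearMap.flip_apply, smul_eq_mul] at this
  rw [this]
  exact Finset.sum_congr rfl fun a _ => by rw [P.g_symm Y]

theorem IsHor.J_sq {X : 𝔛} (h : P.IsHor X) (s) : P.J s (P.J s X) = -X := by
  have := h.map_eq_sum (P.J s ∘ₗ P.J s)
  simp only [LinearMap.comp_apply, P.J_sq, smul_neg, Finset.sum_neg_distrib] at this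
  rw [this, ← h.expand]

variable (P)

theorem J_isom (s) {X : 𝔛} (h : P.IsHor X) (Y) : P.g (P.J s Y) (P.J s X) = P.g Y X := by
  rw [P.J_skew, h.J_sq]; simp

/-- The ring of functions is not a domain; 2 is cancelled as a scalar of ℝ. -/
theorem two_cancel {a : A} (h : 2 * a = 0) : a = 0 := by
  have h2 : (2 : ℝ) • a = 0 := by rw [Algebra.smul_def, map_ofNat, h]
  have h3 := congrArg (fun b => (2⁻¹ : ℝ) • b) h2
  simpa [smul_smul] using h3

theorem J_rules {i j k : Fin 3} (h : Cyc i j k) :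
    (∀ X, P.J i (P.J j X) = P.J k X) ∧ (∀ X, P.J j (P.J k X) = P.J i X) ∧
    (∀ X, P.J k (P.J i X) = P.J j X) ∧ (∀ X, P.J j (P.J i X) = -P.J k X) ∧
    (∀ X, P.J k (P.J j X) = -P.J i X) ∧ (∀ X, P.J i (P.J k X) = -P.J j X) :=
  ⟨P.J_mul _ _ _ h, P.J_mul _ _ _ h.rot, P.J_mul _ _ _ h.rot.rot,
    P.J_mul' _ _ _ h, P.J_mul' _ _ _ h.rot, P.J_mul' _ _ _ h.rot.rot⟩

theorem g_J_self (s X) : P.g (P.J s X) X = 0 := by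
  have := P.J_skew s X X
  rw [P.g_symm X] at this
  refine two_cancel ?_
  rw [two_mul]
  nth_rw 1 [this]
  simp

/-! Extension of the axioms from the frame to all fields -/

theorem isHor_nab {X : 𝔛} (h : P.IsHor X) (Y) : P.IsHor (P.nab Y X) := fun s => by
  rw [h.expand, P.nab_sum]
  simp [P.nab_smul, P.η_nab_e, P.η_e]

theorem nab_ξ (s X) : P.nab X (P.ξ s) = ∑ t, P.α s t X • P.ξ t := by
  conv_lhs => rw [P.expand (P.nab X (P.ξ s))]
  simp [P.g_nab_ξ, α]

theorem D_g {Y Z : 𝔛} (hY : P.IsHor Y) (hZ : P.IsHor Z) (X) :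
    P.D X (P.g Y Z) = P.g (P.nab X Y) Z + P.g Y (P.nab X Z) := by
  have key : ∀ a Z, P.IsHor Z → P.D X (P.g (P.e a) Z) =
      P.g (P.nab X (P.e a)) Z + P.g (P.e a) (P.nab X Z) := fun a Z hZ => by
    have h1 : P.g (P.nab X (P.e a)) Z =
        ∑ b, P.g Z (P.e b) * P.g (P.nab X (P.e a)) (P.e b) := hZ.map_eq_sum (P.g (P.nab X (P.e a)))
    have h2 : P.g (P.e a) (P.nab X Z) = ∑ b, (P.D X (P.g Z (P.e b)) * P.g (P.e a) (P.e b) +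
        P.g Z (P.e b) * P.g (P.e a) (P.nab X (P.e b))) := by
      conv_lhs => rw [hZ.expand]
      simp [P.nab_sum, P.nab_smul]
    rw [h1, h2, ← Finset.sum_add_distrib]
    have h3 : ∀ b, P.g Z (P.e b) * P.g (P.nab X (P.e a)) (P.e b) +
        (P.D X (P.g Z (P.e b)) * P.g (P.e a) (P.e b) +
        P.g Z (P.e b) * P.g (P.e a) (P.nab X (P.e b))) =
        P.D X (P.g Z (P.e b)) * P.g (P.e a) (P.e b) := fun b => by
      linear_combination P.g Z (P.e b) * P.nab_g X a b
    simp_rw [h3, P.g_e]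
    simp [P.g_symm Z]
  rw [hY.inner_eq_sum, P.D_sum]
  have h1 : P.g (P.nab X Y) Z = ∑ a, (P.D X (P.g Y (P.e a)) * P.g (P.e a) Z +
      P.g Y (P.e a) * P.g (P.nab X (P.e a)) Z) := by
    conv_lhs => rw [hY.expand]
    simp [P.nab_sum, P.nab_smul]
  have h2 : P.g Y (P.nab X Z) = ∑ a, P.g Y (P.e a) * P.g (P.e a) (P.nab X Z) := by
    have := hY.map_eq_sum (P.g.flip (P.nab X Z))
    simpa using this
  rw [h1, h2, ← Finset.sum_add_distrib]
  refine Finset.sum_congr rfl fun a _ => ?_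
  rw [P.D_mul, P.g_symm Z, key a Z hZ]
  ring

theorem nab_J_hor {Y : 𝔛} (hY : P.IsHor Y) (s X) :
    P.nab X (P.J s Y) = P.J s (P.nab X Y) + ∑ t, P.α s t X • P.J t Y := by
  have h1 : P.nab X (P.J s Y) = ∑ a, (P.D X (P.g Y (P.e a)) • P.J s (P.e a) +
      P.g Y (P.e a) • P.nab X (P.J s (P.e a))) := by
    rw [hY.map_eq_sum (P.J s), P.nab_sum]
    simp only [P.nab_smul]
  have h2 : P.J s (P.nab X Y) = ∑ a, (P.D X (P.g Y (P.e a)) • P.J s (P.e a) +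
      P.g Y (P.e a) • P.J s (P.nab X (P.e a))) := by
    conv_lhs => rw [hY.expand]
    simp [P.nab_sum, P.nab_smul]
  have h3 : ∀ t, P.J t Y = ∑ a, P.g Y (P.e a) • P.J t (P.e a) := fun t => hY.map_eq_sum (P.J t)
  rw [h1, h2]
  simp_rw [h3, Finset.smul_sum]
  rw [Finset.sum_comm, ← Finset.sum_add_distrib]
  refine Finset.sum_congr rfl fun a _ => ?_
  rw [P.nab_J, smul_add, ← add_assoc, Finset.smul_sum]
  congr 1
  exact Finset.sum_congr rfl fun t _ => by rw [smul_comm, α]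

/-- As for the vertical curvature, with ∇ in place of R: the quaternion relations are differentiated
and the component along a unit horizontal field is compared. -/
theorem α_skew [Nonempty ι] (s t X) : P.α s t X = -P.α t s X := by
  obtain ⟨a⟩ := ‹Nonempty ι›
  set E := P.e a with hE
  have hEh : P.IsHor E := P.isHor_e a
  have hEE : P.g E E = 1 := by simp [hE, P.g_e]
  have h0 : ∀ s, P.g (P.J s E) E = 0 := fun s => P.g_J_self s E
  have hkey : ∀ s, P.α s s X = 0 := fun s => by
    obtain ⟨i, j, k, h, rfl⟩ : ∃ i j k, Cyc i j k ∧ i = s := ⟨s, s + 1, s + 2, ⟨rfl, rfl⟩, rfl⟩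
    obtain ⟨r1, r2, r3, r4, r5, r6⟩ := P.J_rules h
    have h1 := P.nab_J_hor (P.isHor_J i E) i X
    rw [hEh.J_sq, P.nab_neg, P.nab_J_hor hEh, h.sum, h.sum] at h1
    have h2 := congrArg (fun v => P.g v E) h1
    simp only [map_neg, map_add, map_smul, hEh.J_sq, (P.isHor_nab hEh _).J_sq, r4, r3,
      LinearMap.add_apply, LinearMap.smul_apply, LinearMap.neg_apply, hEE, h0, smul_eq_mul, r1,
      r6] at h2
    refine two_cancel ?_
    linear_combination h2
  have hcyc : ∀ i j k, Cyc i j k → P.α i j X = -P.α j i X := fun i j k h => by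
    obtain ⟨r1, r2, r3, r4, r5, r6⟩ := P.J_rules h
    have h1 := P.nab_J_hor (P.isHor_J j E) i X
    have h3 := P.nab_J_hor (P.isHor_J i E) j X
    rw [r1] at h1
    rw [r4, P.nab_neg] at h3
    simp only [P.nab_J_hor hEh, h.sum] at h1 h3
    have h2 := congrArg (fun v => P.g v E) h1
    have h4 := congrArg (fun v => P.g v E) h3
    simp only [map_neg, map_add, map_smul, hEh.J_sq, r1, r2, r3, r4, r5, r6,
      LinearMap.add_apply, LinearMap.smul_apply, LinearMap.neg_apply, hEE, h0, smul_eq_mul]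
      at h2 h4
    have := two_cancel (a := P.α i j X + P.α j i X) (by linear_combination h2 + h4)
    linear_combination this
  by_cases hst : s = t
  · subst hst; rw [hkey]; simp
  · have : Cyc s t (s + 2) ∨ Cyc t s (t + 2) := by
      revert s t; unfold Cyc; decide
    rcases this with h | h
    · exact hcyc _ _ _ h
    · rw [hcyc _ _ _ h]; simp

theorem torsion_hor {X Y : 𝔛} (hX : P.IsHor X) (hY : P.IsHor Y) :
    P.T X Y = ∑ s, (2 * P.g (P.J s X) Y) • P.ξ s := by
  have h1 := hX.map_eq_sum P.T
  have h2 : ∀ a, P.T (P.e a) Y = ∑ b, P.g Y (P.e b) • P.T (P.e a) (P.e b) := fun a =>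
    hY.map_eq_sum (P.T (P.e a))
  rw [h1]
  simp only [LinearMap.coe_sum, Finset.sum_apply, LinearMap.smul_apply, h2, P.torsion_e,
    Finset.smul_sum]
  have h3 : ∀ s, (2 * P.g (P.J s X) Y) • P.ξ s = ∑ a, ∑ b,
      P.g X (P.e a) • P.g Y (P.e b) • (2 * P.g (P.J s (P.e a)) (P.e b)) • P.ξ s := fun s => by
    have e1 : P.g (P.J s X) Y = ∑ a, P.g X (P.e a) * P.g (P.J s (P.e a)) Y := by
      simpa using hX.map_eq_sum (P.g.flip Y ∘ₗ P.J s)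
    have e2 : ∀ a, P.g (P.J s (P.e a)) Y =
        ∑ b, P.g Y (P.e b) * P.g (P.J s (P.e a)) (P.e b) := fun a =>
      hY.map_eq_sum (P.g (P.J s (P.e a)))
    simp_rw [e1, e2, Finset.mul_sum, Finset.sum_smul, smul_smul]
    refine Finset.sum_congr rfl fun a _ => Finset.sum_congr rfl fun b _ => ?_
    congr 1; ring
  simp_rw [h3]
  rw [Finset.sum_comm (s := (Finset.univ : Finset (Fin 3)))]
  exact Finset.sum_congr rfl fun a _ => Finset.sum_comm

theorem isHor_torsion {X : 𝔛} (hX : P.IsHor X) (s) : P.IsHor (P.T (P.ξ s) X) := fun r => by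
  rw [hX.map_eq_sum (P.T (P.ξ s))]
  simp [P.η_torsion]

theorem g_nab_vert {Z : 𝔛} (hZ : ∀ Y, P.g Z Y = 0) (X Y : 𝔛) : P.g (P.nab X Z) Y = 0 := by
  have : Z = ∑ s, P.η s Z • P.ξ s := by
    conv_lhs => rw [P.expand Z]
    simp [hZ]
  rw [this, P.nab_sum]
  simp [P.nab_smul, P.g_nab_ξ, P.g_ξ]

theorem isHor_R {Z : 𝔛} (hZ : P.IsHor Z) (X Y) : P.IsHor (P.R X Y Z) := fun s => by
  simp only [FieldAlgebra.R_apply, map_sub]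
  rw [P.isHor_nab (P.isHor_nab hZ _), P.isHor_nab (P.isHor_nab hZ _), P.isHor_nab hZ]
  simp

theorem R_skew {Z W : 𝔛} (hZ : P.IsHor Z) (hW : P.IsHor W) (X Y) :
    P.g (P.R X Y Z) W = -P.g Z (P.R X Y W) := by
  have h := P.D_br X Y (P.g Z W)
  simp only [P.D_g hZ hW, P.D_add, P.D_g (P.isHor_nab hZ _) hW, P.D_g hZ (P.isHor_nab hW _)] at h
  simp only [FieldAlgebra.R_apply, map_sub, LinearMap.sub_apply]
  linear_combination -h

/-- curvature of the vertical bundle -/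
def κ (s t : Fin 3) (X Y : 𝔛) : A := P.η t (P.R X Y (P.ξ s))

/-- Cartan's structure equation κ = dα + α∧α for V. -/
theorem κ_eq_α (s t X Y) : P.κ s t X Y = P.D X (P.α s t Y) - P.D Y (P.α s t X)
    - P.α s t (P.br X Y) + ∑ r, (P.α s r Y * P.α r t X - P.α s r X * P.α r t Y) := by
  have h : ∀ X Y, P.η t (P.nab X (P.nab Y (P.ξ s))) =
      P.D X (P.α s t Y) + ∑ r, P.α s r Y * P.α r t X := fun X Y => by
    rw [P.nab_ξ s Y, P.nab_sum]
    simp only [P.nab_smul, map_sum, map_add, map_smul, P.η_ξ, Finset.sum_add_distrib, smul_eq_mul]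
    simp [α]
  rw [κ, FieldAlgebra.R_apply, map_sub, map_sub, h, h, Finset.sum_sub_distrib, α]
  simp only [α]
  ring

/-- V and Q share the connection forms α. Differentiating ∇J_s = Σ α_st J_t again therefore produces
the combination of `κ_eq_α`; the mixed first order terms are symmetric in X, Y and drop out. -/
theorem R_J {Z : 𝔛} (hZ : P.IsHor Z) (X Y s) :
    P.R X Y (P.J s Z) = P.J s (P.R X Y Z) + ∑ t, P.κ s t X Y • P.J t Z := by
  have h : ∀ X Y, P.nab X (P.nab Y (P.J s Z)) = P.J s (P.nab X (P.nab Y Z))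
      + ∑ t, P.α s t X • P.J t (P.nab Y Z) + ∑ t, P.α s t Y • P.J t (P.nab X Z)
      + ∑ t, (P.D X (P.α s t Y) + ∑ r, P.α s r Y * P.α r t X) • P.J t Z := fun X Y => by
    rw [P.nab_J_hor hZ, P.nab_add, P.nab_J_hor (P.isHor_nab hZ _), P.nab_sum]
    simp only [P.nab_smul, P.nab_J_hor hZ, smul_add, Finset.sum_add_distrib, add_smul,
      Finset.smul_sum, Finset.sum_smul, smul_smul]
    rw [Finset.sum_comm (f := fun r t => (P.α s r Y * P.α r t X) • P.J t Z)]
    abel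
  simp only [FieldAlgebra.R_apply]
  rw [h, h, P.nab_J_hor hZ]
  simp only [map_sub, κ_eq_α, sub_smul, add_smul,
    Finset.sum_sub_distrib, Finset.sum_add_distrib]
  abel

/-- The horizontal part of the first Bianchi identity. -/
theorem bianchi_hor {X Y Z : 𝔛} (hX : P.IsHor X) (hY : P.IsHor Y) (hZ : P.IsHor Z) :
    P.R X Y Z + P.R Y Z X + P.R Z X Y = ∑ s, (2 * P.g (P.J s X) Y) • P.T (P.ξ s) Z
      + ∑ s, (2 * P.g (P.J s Y) Z) • P.T (P.ξ s) X
      + ∑ s, (2 * P.g (P.J s Z) X) • P.T (P.ξ s) Y := by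
  -- Only horizontal components matter here. The torsion of horizontal fields is vertical and ∇
  -- preserves V, so of T([Y,Z],X) only the part coming from the vertical −T(Y,Z) is visible.
  have key : ∀ X Y Z W, P.IsHor X → P.IsHor Y → P.IsHor Z →
      P.g (P.nab X (P.T Y Z) - P.T (P.br Y Z) X) W =
      P.g (∑ s, (2 * P.g (P.J s Y) Z) • P.T (P.ξ s) X) W := fun X Y Z W hX hY hZ => by
    have v1 : ∀ X Y, P.IsHor X → P.IsHor Y → ∀ W, P.g (P.T X Y) W = 0 := fun X Y hX hY W => by
      rw [P.torsion_hor hX hY]; simp [P.g_ξ]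
    have : P.T (P.T Y Z) X = ∑ s, (2 * P.g (P.J s Y) Z) • P.T (P.ξ s) X := by
      rw [P.torsion_hor hY hZ]; simp
    rw [← this, P.br_eq]
    simp only [map_sub, LinearMap.sub_apply]
    rw [P.g_nab_vert (v1 Y Z hY hZ), v1 _ _ (P.isHor_nab hZ _) hX, v1 _ _ (P.isHor_nab hY _) hX]
    ring
  have hh : ∀ {X Y Z}, P.IsHor Z → P.IsHor (∑ s, (2 * P.g (P.J s X) Y) • P.T (P.ξ s) Z) :=
    fun hZ => .sum fun s _ => (P.isHor_torsion hZ s).smul _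
  refine IsHor.eq_of_inner (((P.isHor_R hZ _ _).add (P.isHor_R hX _ _)).add (P.isHor_R hY _ _))
    (((hh hZ).add (hh hX)).add (hh hY)) fun W _ => ?_
  rw [P.bianchi]
  have k1 := key X Y Z W hX hY hZ
  have k2 := key Y Z X W hY hZ hX
  have k3 := key Z X Y W hZ hX hY
  rw [map_add, map_add, LinearMap.add_apply, LinearMap.add_apply, k1, k2, k3, map_add, map_add,
    LinearMap.add_apply, LinearMap.add_apply]
  ring

/-- The vertical part of the first Bianchi identity. -/
theorem κ_eq_torsion [Nonempty ι] {X Y : 𝔛} (hX : P.IsHor X) (hY : P.IsHor Y) (s t) :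
    P.κ s t X Y = 2 * ∑ r, P.g (P.J r X) Y * P.η t (P.T (P.ξ r) (P.ξ s))
      + 2 * (P.g (P.T (P.ξ s) Y) (P.J t X) - P.g (P.T (P.ξ s) X) (P.J t Y)) := by
  have h := congrArg (P.η t) (P.bianchi X Y (P.ξ s))
  have hv : ∀ X, P.IsHor X → ∀ Z, P.η t (P.T (P.nab Z (P.ξ s)) X) = 0 := fun X hX Z => by
    rw [P.nab_ξ]; simp [P.isHor_torsion hX _ t]
  have ht : ∀ X Y, P.IsHor X → P.IsHor Y → P.η t (P.T X Y) = 2 * P.g (P.J t X) Y :=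
    fun X Y hX hY => by rw [P.torsion_hor hX hY]; simp [P.η_ξ]
  have ha : ∀ X, P.T X (P.ξ s) = -P.T (P.ξ s) X := fun X => P.T_antisymm _ _
  have hω : ∀ r, P.D (P.ξ s) (2 * P.g (P.J r X) Y) = 2 * (P.g (P.J r (P.nab (P.ξ s) X)) Y
      + P.g (P.J r X) (P.nab (P.ξ s) Y) + ∑ t, P.α r t (P.ξ s) * P.g (P.J t X) Y) := fun r => by
    have h2 : P.D (P.ξ s) 2 = 0 := by simpa using P.D_natCast (P.ξ s) 2
    rw [P.D_mul, h2, P.D_g (P.isHor_J r X) hY, P.nab_J_hor hX]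
    simp only [map_add, map_sum, map_smul, LinearMap.add_apply, LinearMap.coe_sum,
      Finset.sum_apply, LinearMap.smul_apply, smul_eq_mul]
    ring
  -- The derivatives of J_r and of ξ_r in Σ 2ω_r(X,Y) ξ_r cancel by skewness of α: the horizontal
  -- torsion is a parallel tensor.
  have hn : P.η t (P.nab (P.ξ s) (P.T X Y)) = 2 * (P.g (P.J t (P.nab (P.ξ s) X)) Y
      + P.g (P.J t X) (P.nab (P.ξ s) Y)) := by
    rw [P.torsion_hor hX hY, P.nab_sum, map_sum]
    simp only [P.nab_smul, map_add, map_smul, P.η_ξ, smul_eq_mul, Finset.sum_add_distrib,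
      mul_ite, mul_one, mul_zero, Finset.sum_ite_eq, Finset.mem_univ, if_true, hω]
    have : ∀ r, P.η t (P.nab (P.ξ s) (P.ξ r)) = -P.α t r (P.ξ s) := fun r => P.α_skew r t _
    simp only [this, mul_add, Finset.mul_sum, mul_neg, Finset.sum_neg_distrib]
    have e : ∀ r, 2 * P.g (P.J r X) Y * P.α t r (P.ξ s) =
        2 * (P.α t r (P.ξ s) * P.g (P.J r X) Y) := fun r => by ring
    simp only [e]; ring
  simp only [map_add, map_sub, P.br_eq, LinearMap.sub_apply] at h
  rw [P.isHor_R hX, P.isHor_R hY, hn, P.isHor_nab (P.isHor_torsion hX s), ha,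
    P.isHor_nab (P.isHor_torsion hY s).neg] at h
  simp only [ha, map_neg, LinearMap.neg_apply] at h
  rw [hv _ hX, hv _ hY, ht _ _ (P.isHor_nab hX _) hY, ht _ _ (P.isHor_nab hY _) hX,
    ht _ _ (P.isHor_torsion hX s) hY, ht _ _ (P.isHor_torsion hY s) hX,
    P.isHor_torsion (P.isHor_nab hX _), P.isHor_torsion (P.isHor_nab hY _),
    P.torsion_hor hX hY] at h
  simp only [map_sum, map_smul, smul_eq_mul] at h
  rw [κ, Finset.mul_sum]
  have e1 := P.J_skew t (P.T (P.ξ s) Y) X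
  have e2 := P.J_skew t (P.T (P.ξ s) X) Y
  have e3 := P.J_skew t (P.nab (P.ξ s) Y) X
  have e4 := P.g_symm (P.nab (P.ξ s) Y) (P.J t X)
  have e5 : ∀ r, P.η t (P.T (P.ξ s) (P.ξ r)) = -P.η t (P.T (P.ξ r) (P.ξ s)) := fun r => by
    rw [P.T_antisymm, map_neg]
  simp only [e5, mul_neg, Finset.sum_neg_distrib] at h
  simp only [← mul_assoc]
  linear_combination h - 2 * e1 + 2 * e2 + 2 * e3 - 2 * e4

end FrameAlgebra
end QC
end

/-! ### The Bochner formula -/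

noncomputable section

namespace QC

namespace FrameAlgebra

variable {A 𝔛 ι : Type*} [CommRing A] [Algebra ℝ A] [AddCommGroup 𝔛] [Module A 𝔛]
    [Fintype ι] [DecidableEq ι] (P : FrameAlgebra A 𝔛 ι)

theorem sum_map_J {N : Type*} [AddCommGroup N] [Module A N] (B : 𝔛 →ₗ[A] 𝔛 →ₗ[A] N) (s) :
    ∑ a, B (P.J s (P.e a)) (P.e a) = -∑ a, B (P.e a) (P.J s (P.e a)) := by
  have h1 : ∀ a, B (P.J s (P.e a)) (P.e a) =
      ∑ b, P.g (P.J s (P.e a)) (P.e b) • B (P.e b) (P.e a) := fun a => by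
    have := (P.isHor_J s (P.e a)).map_eq_sum (B.flip (P.e a))
    simpa using this
  have h2 : ∀ b, B (P.e b) (P.J s (P.e b)) =
      ∑ a, P.g (P.J s (P.e b)) (P.e a) • B (P.e b) (P.e a) := fun b =>
    (P.isHor_J s (P.e b)).map_eq_sum (B (P.e b))
  simp_rw [h1, h2, ← Finset.sum_neg_distrib]
  rw [Finset.sum_comm]
  refine Finset.sum_congr rfl fun b _ => Finset.sum_congr rfl fun a _ => ?_
  rw [P.J_skew, P.g_symm, neg_smul]

/-- contraction of a linear form with a horizontal field -/
theorem IsHor.sum_g {P : FrameAlgebra A 𝔛 ι} {N : Type*} [AddCommGroup N] [Module A N] {X : 𝔛}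
    (h : P.IsHor X) (φ : 𝔛 →ₗ[A] N) : ∑ a, P.g (P.e a) X • φ (P.e a) = φ X := by
  rw [h.map_eq_sum φ]
  exact Finset.sum_congr rfl fun a _ => by rw [P.g_symm]

theorem sum_g_J_J (s t : Fin 3) : ∑ a, P.g (P.J t (P.e a)) (P.J s (P.e a)) =
    if s = t then (Fintype.card ι : A) else 0 := by
  split_ifs with h
  · subst h
    simp [P.J_isom _ (P.isHor_e _), P.g_e]
  · refine Finset.sum_eq_zero fun a _ => ?_
    obtain ⟨j, k, hc⟩ : ∃ j k, Cyc s j k := ⟨s + 1, s + 2, rfl, rfl⟩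
    obtain ⟨r1, r2, r3, r4, r5, r6⟩ := P.J_rules hc
    have hr : ∀ r, P.g (P.J r (P.e a)) (P.e a) = 0 := fun r => P.g_J_self r _
    rw [P.g_symm, P.J_skew]
    rcases hc.eq_or_eq (Ne.symm h) with rfl | rfl
    · rw [r1, P.g_symm, hr, neg_zero]
    · rw [r6, P.g_symm, map_neg, LinearMap.neg_apply, hr]; simp

/-- the divergence of a horizontal field -/
def div (X : 𝔛) : A := ∑ a, P.g (P.nab (P.e a) X) (P.e a)

theorem div_add (X Y) : P.div (X + Y) = P.div X + P.div Y := by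
  simp [div, P.nab_add, Finset.sum_add_distrib]

theorem div_smul (c : A) {X} (hX : P.IsHor X) : P.div (c • X) = P.D X c + c * P.div X := by
  have := hX.sum_g (P.dL c)
  simp only [FieldAlgebra.dL_apply, smul_eq_mul] at this
  rw [← this, div, div, Finset.mul_sum, ← Finset.sum_add_distrib]
  refine Finset.sum_congr rfl fun a _ => ?_
  rw [P.nab_smul, P.g_symm (P.e a)]
  simp only [map_add, map_smul, LinearMap.add_apply, LinearMap.smul_apply, smul_eq_mul]
  ring

theorem div_dual (θ : 𝔛 →ₗ[A] A) : P.div (∑ b, θ (P.e b) • P.e b) =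
    ∑ a, (P.D (P.e a) (θ (P.e a)) - θ (P.nab (P.e a) (P.e a))) := by
  set X := ∑ b, θ (P.e b) • P.e b with hX
  have hX' : P.IsHor X := .sum fun b _ => (P.isHor_e b).smul _
  have hg : ∀ Y, P.IsHor Y → P.g X Y = θ Y := fun Y hY => by
    rw [hY.map_eq_sum θ, hX]
    simp only [map_sum, map_smul, LinearMap.coe_sum, Finset.sum_apply, LinearMap.smul_apply,
      smul_eq_mul]
    exact Finset.sum_congr rfl fun a _ => by rw [P.g_symm]; ring
  refine Finset.sum_congr rfl fun a _ => ?_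
  have h1 := P.D_g hX' (P.isHor_e a) (P.e a)
  rw [hg _ (P.isHor_e a), hg _ (P.isHor_nab (P.isHor_e a) _)] at h1
  linear_combination -h1

/-- the horizontal trace of the covariant derivative -/
def tr (G : 𝔛) : A := ∑ a, P.g (P.nab (P.e a) G) (P.e a)

/-- the square norm of the covariant derivative -/
def normSq (G : 𝔛) : A := ∑ a, P.g (P.nab (P.e a) G) (P.nab (P.e a) G)

/-- the product of the covariant derivative with its quaternionic rotations -/
def rotSq (G : 𝔛) : A :=
  ∑ s, ∑ a, P.g (P.nab (P.J s (P.e a)) G) (P.J s (P.nab (P.e a) G))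

/-- the Ricci form -/
def Ric (X Y : 𝔛) : A := ∑ b, P.g (P.R (P.e b) X Y) (P.e b)

/-- twice the curvature contraction `ricForm` -/
def ricForm₂ (X : 𝔛) : A := ∑ s, ∑ a, P.g (P.R (P.e a) (P.J s (P.e a)) (P.J s X)) X

/-- the torsion contraction -/
def tors (X : 𝔛) : A := ∑ s, P.g (P.T (P.ξ s) (P.J s X)) X

/-- the field whose divergence gives the integral formula -/
def bochnerField (n : ℕ) (G : 𝔛) : 𝔛 :=
  (n : A) • ∑ b, P.g (P.nab (P.e b) G) G • P.e b
    + ∑ b, (∑ s, P.g (P.nab (P.J s (P.e b)) G) (P.J s G)) • P.e b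
    - ((n : A) * P.tr G) • G

theorem isHor_bochnerField (n : ℕ) {G : 𝔛} (hG : P.IsHor G) : P.IsHor (P.bochnerField n G) := by
  rw [bochnerField, sub_eq_add_neg]
  exact (((IsHor.sum fun b _ => (P.isHor_e b).smul _).smul _).add
    (IsHor.sum fun b _ => (P.isHor_e b).smul _)).add (hG.smul _).neg

section

variable {P} {G : 𝔛} (hG : P.IsHor G)
include hG

theorem div_first : P.div (∑ b, P.g (P.nab (P.e b) G) G • P.e b) =
    ∑ a, P.g (P.nab2 G (P.e a) (P.e a)) G + P.normSq G := by
  have := P.div_dual (P.g.flip G ∘ₗ P.nabL G)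
  simp only [LinearMap.comp_apply, LinearMap.flip_apply, FieldAlgebra.nabL_apply] at this
  rw [this, normSq, ← Finset.sum_add_distrib]
  refine Finset.sum_congr rfl fun a _ => ?_
  rw [P.D_g (P.isHor_nab hG _) hG, FieldAlgebra.nab2_apply, map_sub, LinearMap.sub_apply]
  ring

/-- Differentiating J_s in its two occurrences produces α_st terms which cancel in the sum over s
and t by skewness. For this reason all three rotations enter the field together. -/
theorem div_second [Nonempty ι] :
    P.div (∑ b, (∑ s, P.g (P.nab (P.J s (P.e b)) G) (P.J s G)) • P.e b) =
    ∑ s, ∑ a, P.g (P.nab2 G (P.e a) (P.J s (P.e a))) (P.J s G) + P.rotSq G := by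
  have := P.div_dual (∑ s, P.g.flip (P.J s G) ∘ₗ P.nabL G ∘ₗ P.J s)
  simp only [LinearMap.coe_sum, Finset.sum_apply, LinearMap.comp_apply, LinearMap.flip_apply,
    FieldAlgebra.nabL_apply] at this
  rw [this, rotSq, ← Finset.sum_add_distrib]
  simp_rw [← Finset.sum_add_distrib]
  rw [Finset.sum_comm]
  refine Finset.sum_congr rfl fun a _ => ?_
  have h1 : ∀ s, P.D (P.e a) (P.g (P.nab (P.J s (P.e a)) G) (P.J s G)) =
      P.g (P.nab (P.J s (P.nab (P.e a) (P.e a))) G) (P.J s G)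
      + P.g (P.nab2 G (P.e a) (P.J s (P.e a))) (P.J s G)
      + P.g (P.nab (P.J s (P.e a)) G) (P.J s (P.nab (P.e a) G))
      + (∑ t, P.α s t (P.e a) * P.g (P.nab (P.J t (P.e a)) G) (P.J s G)
      + ∑ t, P.α s t (P.e a) * P.g (P.nab (P.J s (P.e a)) G) (P.J t G)) := fun s => by
    rw [P.D_g (P.isHor_nab hG _) (P.isHor_J s G), FieldAlgebra.nab2_apply, P.nab_J_hor hG,
      P.nab_J_hor (P.isHor_e a), ← FieldAlgebra.nabL_apply (X := P.J s _ + _)]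
    simp only [map_add, map_sub, map_sum, map_smul, LinearMap.add_apply, LinearMap.sub_apply,
      LinearMap.coe_sum, Finset.sum_apply, LinearMap.smul_apply, smul_eq_mul,
      FieldAlgebra.nabL_apply]
    ring
  have h2 : ∑ s, (∑ t, P.α s t (P.e a) * P.g (P.nab (P.J t (P.e a)) G) (P.J s G)
      + ∑ t, P.α s t (P.e a) * P.g (P.nab (P.J s (P.e a)) G) (P.J t G)) = 0 := by
    rw [Finset.sum_add_distrib, Finset.sum_comm, ← Finset.sum_add_distrib]
    refine Finset.sum_eq_zero fun s _ => ?_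
    rw [← Finset.sum_add_distrib]
    refine Finset.sum_eq_zero fun t _ => ?_
    rw [P.α_skew s t]; ring
  rw [P.D_sum]
  simp_rw [h1]
  rw [Finset.sum_add_distrib, h2, Finset.sum_add_distrib, Finset.sum_add_distrib,
    Finset.sum_add_distrib]
  ring

/-- The derivatives of the frame in the two slots cancel because its connection matrix is skew. -/
theorem D_tr (Z : 𝔛) : P.D Z (P.tr G) = ∑ a, P.g (P.nab2 G Z (P.e a)) (P.e a) := by
  have h1 : ∑ a, (P.g (P.nab (P.nab Z (P.e a)) G) (P.e a) +
      P.g (P.nab (P.e a) G) (P.nab Z (P.e a))) = 0 := by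
    have e1 : ∀ a, P.g (P.nab (P.nab Z (P.e a)) G) (P.e a) =
        ∑ b, P.g (P.nab Z (P.e a)) (P.e b) * P.g (P.nab (P.e b) G) (P.e a) := fun a => by
      have := (P.isHor_nab (P.isHor_e a) Z).map_eq_sum (P.g.flip (P.e a) ∘ₗ P.nabL G)
      simpa using this
    have e2 : ∀ a, P.g (P.nab (P.e a) G) (P.nab Z (P.e a)) =
        ∑ b, P.g (P.nab Z (P.e a)) (P.e b) * P.g (P.nab (P.e a) G) (P.e b) := fun a => by
      have := (P.isHor_nab (P.isHor_e a) Z).map_eq_sum (P.g (P.nab (P.e a) G))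
      simpa using this
    simp_rw [e1, e2]
    rw [Finset.sum_add_distrib, Finset.sum_comm, ← Finset.sum_add_distrib]
    refine Finset.sum_eq_zero fun a _ => ?_
    rw [← Finset.sum_add_distrib]
    refine Finset.sum_eq_zero fun b _ => ?_
    have := P.nab_g Z a b
    rw [P.g_symm (P.e a)] at this
    linear_combination P.g (P.nab (P.e a) G) (P.e b) * this
  rw [tr, P.D_sum, ← sub_eq_zero, ← Finset.sum_sub_distrib, ← h1]
  refine Finset.sum_congr rfl fun a _ => ?_
  rw [P.D_g (P.isHor_nab hG _) (P.isHor_e a), FieldAlgebra.nab2_apply, map_sub,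
    LinearMap.sub_apply]
  ring

/-- Contracting with the skew J_s sees only the antisymmetric part of ∇²G, which the Ricci identity
converts to curvature and T(e_a, J_s e_a). The latter sums to 2 dim H times ξ_s, since the J_t e_a
are orthogonal for different t. -/
theorem sum_nab2_J (s : Fin 3) :
    2 * ∑ a, P.g (P.nab2 G (P.e a) (P.J s (P.e a))) (P.J s G) =
      -∑ a, P.g (P.R (P.e a) (P.J s (P.e a)) (P.J s G)) G
      - 2 * Fintype.card ι * P.g (P.nab (P.ξ s) G) (P.J s G) := by
  have h1 := P.sum_map_J (P.nab2 G) s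
  have h2 : ∀ a, P.g (P.nab2 G (P.e a) (P.J s (P.e a))) (P.J s G)
      - P.g (P.nab2 G (P.J s (P.e a)) (P.e a)) (P.J s G) =
      -P.g (P.R (P.e a) (P.J s (P.e a)) (P.J s G)) G
      - ∑ t, 2 * P.g (P.J t (P.e a)) (P.J s (P.e a)) * P.g (P.nab (P.ξ t) G) (P.J s G) :=
    fun a => by
      rw [← LinearMap.sub_apply, ← map_sub, P.nab2_sub, P.R_skew (P.isHor_J s G) hG,
        P.torsion_hor (P.isHor_e a) (P.isHor_J s _), P.nab_sum_left,
        P.g_symm (P.J s G)]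
      simp [P.nab_smul_left]
  have h3 := congrArg (fun X => P.g X (P.J s G)) h1
  simp only [map_sum, map_neg, LinearMap.coe_sum, Finset.sum_apply, LinearMap.neg_apply] at h3
  have h4 := Finset.sum_congr (rfl : (Finset.univ : Finset ι) = _) fun a _ => h2 a
  rw [Finset.sum_sub_distrib, h3, Finset.sum_sub_distrib, Finset.sum_comm] at h4
  simp only [← Finset.sum_mul, ← Finset.mul_sum, P.sum_g_J_J] at h4
  simp only [mul_ite, ite_mul, mul_zero, zero_mul, Finset.sum_ite_eq, Finset.mem_univ,
    if_true, Finset.sum_neg_distrib] at h4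
  linear_combination h4

variable {f : A} (hf : ∀ X, P.IsHor X → P.g G X = P.D X f)
include hf

/-- The Hessian of a connection with torsion fails to be symmetric by −df(T). -/
theorem nab_grad_antisymm {Y Z : 𝔛} (hY : P.IsHor Y) (hZ : P.IsHor Z) :
    P.g (P.nab Y G) Z - P.g (P.nab Z G) Y = -P.D (P.T Y Z) f := by
  have h1 := P.D_g hG hZ Y
  have h2 := P.D_g hG hY Z
  rw [hf _ hZ, hf _ (P.isHor_nab hZ _)] at h1
  rw [hf _ hY, hf _ (P.isHor_nab hY _)] at h2
  have h3 : P.D (P.T Y Z) f = P.D (P.nab Y Z) f - P.D (P.nab Z Y) f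
      - (P.D Y (P.D Z f) - P.D Z (P.D Y f)) := by
    rw [← P.D_br, FieldAlgebra.T_apply]
    exact (P.dL f).map_sub _ _ |>.trans (by rw [map_sub]; rfl)
  linear_combination h2 - h1 + h3

/-- Differentiates `nab_grad_antisymm` with T(Y,Z) = 2 Σ ω_s(Y,Z) ξ_s. The α terms complete X(ξ_s f)
to the mixed Hessian ∇²f(X,ξ_s), and exchanging its two arguments costs T(ξ_s,X). -/
theorem nab2_grad_antisymm [Nonempty ι] {X Y Z : 𝔛} (hX : P.IsHor X) (hY : P.IsHor Y)
    (hZ : P.IsHor Z) :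
    P.g (P.nab2 G X Y) Z - P.g (P.nab2 G X Z) Y =
      -2 * ∑ s, P.g (P.J s Y) Z * (P.g (P.nab (P.ξ s) G) X + P.g (P.T (P.ξ s) X) G) := by
  have hT : ∀ Y Z, P.IsHor Y → P.IsHor Z →
      P.D (P.T Y Z) f = ∑ s, 2 * P.g (P.J s Y) Z * P.D (P.ξ s) f := fun Y Z hY hZ => by
    rw [P.torsion_hor hY hZ, ← FieldAlgebra.dL_apply]
    simp
  have h0 := congrArg (P.D X) (nab_grad_antisymm hG hf hY hZ)
  rw [hT Y Z hY hZ] at h0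
  have h1 := nab_grad_antisymm hG hf (P.isHor_nab hY X) hZ
  have h2 := nab_grad_antisymm hG hf hY (P.isHor_nab hZ X)
  rw [hT _ _ (P.isHor_nab hY X) hZ] at h1
  rw [hT _ _ hY (P.isHor_nab hZ X)] at h2
  rw [P.D_sub, P.D_g (P.isHor_nab hG _) hZ, P.D_g (P.isHor_nab hG _) hY, P.D_neg, P.D_sum] at h0
  have hω : ∀ s, P.D X (2 * P.g (P.J s Y) Z * P.D (P.ξ s) f) =
      2 * P.g (P.J s (P.nab X Y)) Z * P.D (P.ξ s) f
      + 2 * P.g (P.J s Y) (P.nab X Z) * P.D (P.ξ s) f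
      + (∑ t, 2 * (P.α s t X * P.g (P.J t Y) Z * P.D (P.ξ s) f)
      + 2 * P.g (P.J s Y) Z * P.D X (P.D (P.ξ s) f)) := fun s => by
    have e : P.D X 2 = 0 := by simpa using P.D_natCast X 2
    rw [P.D_mul, P.D_mul, e, P.D_g (P.isHor_J s Y) hZ, P.nab_J_hor hY, ← Finset.mul_sum,
      ← Finset.sum_mul]
    simp only [map_add, map_sum, map_smul, LinearMap.add_apply, LinearMap.coe_sum,
      Finset.sum_apply, LinearMap.smul_apply, smul_eq_mul]
    ring
  have hα : ∑ s, ∑ t, 2 * (P.α s t X * P.g (P.J t Y) Z * P.D (P.ξ s) f) =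
      -∑ s, 2 * P.g (P.J s Y) Z * P.D (P.nab X (P.ξ s)) f := by
    rw [Finset.sum_comm, ← Finset.sum_neg_distrib]
    refine Finset.sum_congr rfl fun s _ => ?_
    rw [P.nab_ξ, ← FieldAlgebra.dL_apply, map_sum, Finset.mul_sum, ← Finset.sum_neg_distrib]
    refine Finset.sum_congr rfl fun t _ => ?_
    rw [P.α_skew s t, map_smul, FieldAlgebra.dL_apply, smul_eq_mul]
    ring
  have hξ : ∀ s, P.D X (P.D (P.ξ s) f) - P.D (P.nab X (P.ξ s)) f =
      P.g (P.nab (P.ξ s) G) X + P.g (P.T (P.ξ s) X) G := fun s => by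
    have e1 := P.D_g hG hX (P.ξ s)
    rw [hf _ hX, hf _ (P.isHor_nab hX _)] at e1
    have e2 : P.D (P.T (P.ξ s) X) f = P.D (P.nab (P.ξ s) X) f - P.D (P.nab X (P.ξ s)) f
        - (P.D (P.ξ s) (P.D X f) - P.D X (P.D (P.ξ s) f)) := by
      rw [← P.D_br, FieldAlgebra.T_apply]
      exact (P.dL f).map_sub _ _ |>.trans (by rw [map_sub]; rfl)
    rw [P.g_symm _ G, hf _ (P.isHor_torsion hX s)]
    linear_combination e1 - e2
  simp_rw [hω, Finset.sum_add_distrib] at h0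
  rw [hα, ← sub_eq_neg_add, ← Finset.sum_sub_distrib] at h0
  have h5 : ∀ s, 2 * P.g (P.J s Y) Z * P.D X (P.D (P.ξ s) f)
      - 2 * P.g (P.J s Y) Z * P.D (P.nab X (P.ξ s)) f =
      2 * (P.g (P.J s Y) Z * (P.g (P.nab (P.ξ s) G) X + P.g (P.T (P.ξ s) X) G)) := fun s => by
    rw [← hξ]; ring
  simp_rw [h5, ← Finset.mul_sum] at h0
  simp only [FieldAlgebra.nab2_apply, map_sub, LinearMap.sub_apply]
  linear_combination h0 - h1 - h2

/-- The contracted Ricci identity for the horizontal gradient. -/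
theorem sum_nab2_grad [Nonempty ι] {Z : 𝔛} (hZ : P.IsHor Z) :
    ∑ a, P.g (P.nab2 G (P.e a) (P.e a)) Z = P.D Z (P.tr G) + P.Ric Z G
      + 4 * ∑ s, P.g (P.nab (P.ξ s) G) (P.J s Z) + 2 * ∑ s, P.g (P.T (P.ξ s) (P.J s Z)) G := by
  have hc : ∀ s (φ : 𝔛 →ₗ[A] A), ∑ a, P.g (P.J s (P.e a)) Z * φ (P.e a) = -φ (P.J s Z) :=
    fun s φ => by
      rw [← (P.isHor_J s Z).sum_g φ, ← Finset.sum_neg_distrib]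
      exact Finset.sum_congr rfl fun a _ => by rw [P.J_skew, smul_eq_mul, neg_mul]
  -- Two exchanges bring Z to the front: first of the last two arguments, then of the two
  -- derivatives. Each yields 2 Σ ω_s(e_a,Z) ∇_{ξ_s}G, whence the coefficient 4; only the first
  -- brings in torsion explicitly.
  have h1 : ∀ a, P.g (P.nab2 G (P.e a) (P.e a)) Z = P.g (P.nab2 G Z (P.e a)) (P.e a)
      + P.g (P.R (P.e a) Z G) (P.e a)
      - 2 * ∑ s, P.g (P.J s (P.e a)) Z * P.g (P.nab (P.ξ s) G) (P.e a)
      - 2 * ∑ s, P.g (P.J s (P.e a)) Z *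
        (P.g (P.nab (P.ξ s) G) (P.e a) + P.g (P.T (P.ξ s) (P.e a)) G) := fun a => by
    have e1 := nab2_grad_antisymm hG hf (P.isHor_e a) (P.isHor_e a) hZ
    have e2 := congrArg (fun X => P.g X (P.e a)) (P.nab2_sub G (P.e a) Z)
    rw [P.torsion_hor (P.isHor_e a) hZ, P.nab_sum_left] at e2
    simp only [map_sub, LinearMap.sub_apply, map_sum, map_smul, LinearMap.coe_sum,
      Finset.sum_apply, LinearMap.smul_apply, smul_eq_mul, mul_assoc, ← Finset.mul_sum,
      P.nab_smul_left] at e2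
    linear_combination e1 + e2
  simp_rw [h1, Finset.sum_sub_distrib, Finset.sum_add_distrib, ← Finset.mul_sum]
  rw [← D_tr hG, Ric]
  have c1 : ∑ a, ∑ s, P.g (P.J s (P.e a)) Z * P.g (P.nab (P.ξ s) G) (P.e a) =
      -∑ s, P.g (P.nab (P.ξ s) G) (P.J s Z) := by
    rw [Finset.sum_comm, ← Finset.sum_neg_distrib]
    exact Finset.sum_congr rfl fun s _ => hc s _
  have c2 : ∑ a, ∑ s, P.g (P.J s (P.e a)) Z *
      (P.g (P.nab (P.ξ s) G) (P.e a) + P.g (P.T (P.ξ s) (P.e a)) G) =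
      -∑ s, (P.g (P.nab (P.ξ s) G) (P.J s Z) + P.g (P.T (P.ξ s) (P.J s Z)) G) := by
    rw [Finset.sum_comm, ← Finset.sum_neg_distrib]
    exact Finset.sum_congr rfl fun s _ =>
      hc s (P.g (P.nab (P.ξ s) G) + P.g.flip G ∘ₗ P.T (P.ξ s))
  rw [c1, c2, Finset.sum_add_distrib]
  ring

/-- The pointwise Bochner type formula. -/
theorem two_mul_div_bochnerField [Nonempty ι] {n : ℕ} (hn : Fintype.card ι = 4 * n) :
    2 * P.div (P.bochnerField n G) = 2 * (n * P.normSq G + P.rotSq G - n * P.tr G ^ 2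
      + n * P.Ric G G + 2 * n * P.tors G) - P.ricForm₂ G := by
  have h0 : P.D G (n : A) = 0 := P.D_natCast G n
  have hsum : P.IsHor (∑ b, P.g (P.nab (P.e b) G) G • P.e b) :=
    .sum fun b _ => (P.isHor_e b).smul _
  have h1 := sum_nab2_grad hG hf hG
  have h2 := Finset.sum_congr (rfl : (Finset.univ : Finset (Fin 3)) = _)
    fun s _ => sum_nab2_J hG s
  -- Here dim H = 4n enters: the rotated term carries −4n g(∇_{ξ_s}G, J_s G), which is cancelled by
  -- n times the 4 of `sum_nab2_grad`.
  rw [Finset.sum_sub_distrib, Finset.sum_neg_distrib, ← Finset.mul_sum, ← Finset.mul_sum, hn]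
    at h2
  push_cast at h2
  have h3 : P.div G = P.tr G := rfl
  rw [bochnerField, sub_eq_add_neg, ← neg_smul, P.div_add, P.div_add, P.div_smul _ hsum,
    P.div_smul _ hG, div_first hG, div_second hG, P.D_neg, P.D_mul, h0, P.D_natCast, h3, h1,
    tors, ricForm₂]
  linear_combination h2

end

end FrameAlgebra
end QC
end

/-! ### Jacobi's formula and the divergence in coordinates -/

noncomputable section

namespace QC

namespace FieldAlgebra
variable {A 𝔛 : Type*} [CommRing A] [AddCommGroup 𝔛] [Module A 𝔛] (P : FieldAlgebra A 𝔛)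

/-- A derivation as a ring homomorphism into the dual numbers. -/
def dualHom (X : 𝔛) : A →+* DualNumber A where
  toFun a := TrivSqZeroExt.inl a + TrivSqZeroExt.inr (P.D X a)
  map_one' := by simp [P.D_one]
  map_zero' := by simp [P.D_zero]
  map_mul' a b := by
    ext
    · simp
    · simp [P.D_mul]; ring
  map_add' a b := by
    ext <;> simp [P.D_add]

/-- Jacobi's formula for a matrix which satisfies a linear equation. -/
theorem D_det {κ : Type*} [Fintype κ] [DecidableEq κ] (X : 𝔛) (M C Γ : Matrix κ κ A)
    (h : M.map (P.D X) = C * M + M * Γ) :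
    P.D X M.det = (C.trace + Γ.trace) * M.det := by
  set ι₀ : A →+* DualNumber A := TrivSqZeroExt.inlHom A A with hι
  set ε : DualNumber A := DualNumber.eps with hε
  have hεε : ε * ε = 0 := DualNumber.eps_mul_eps
  -- To first order in ε, M + ε D_X M = (1 + εC) M (1 + εΓ). Taking determinants and using det(1 +
  -- εC) = 1 + ε tr C gives the formula over any commutative ring.
  have h1 : M.map (P.dualHom X) = (1 + ε • C.map ι₀) * M.map ι₀ * (1 + ε • Γ.map ι₀) := by
    have e1 : M.map (P.dualHom X) = M.map ι₀ + ε • (M.map (P.D X)).map ι₀ := by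
      ext i j
      · simp [dualHom, hι, hε]
      · simp [dualHom, hι, hε]
    rw [e1, h, Matrix.map_add ι₀ (map_add ι₀), Matrix.map_mul, Matrix.map_mul]
    simp only [add_mul, mul_add, one_mul, mul_one, Matrix.smul_mul, Matrix.mul_smul, smul_add,
      smul_smul, hεε, zero_smul, add_zero]
    abel
  have hdet : ∀ C : Matrix κ κ A, (1 + ε • C.map ι₀).det = 1 + ι₀ C.trace * ε := fun C => by
    rw [Matrix.det_one_add_smul, pow_two, hεε, mul_zero, add_zero]
    congr 2
    simp [Matrix.trace]
  have h2 : P.dualHom X M.det = ι₀ M.det + ι₀ ((C.trace + Γ.trace) * M.det) * ε := by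
    rw [RingHom.map_det, RingHom.mapMatrix_apply, h1, Matrix.det_mul, Matrix.det_mul, hdet, hdet,
      ← RingHom.mapMatrix_apply, ← RingHom.map_det, map_mul, map_add]
    linear_combination (ι₀ C.trace * ι₀ M.det * ι₀ Γ.trace) * hεε
  have h3 := congrArg TrivSqZeroExt.snd h2
  simpa [dualHom, hι, hε] using h3

end FieldAlgebra

namespace FrameAlgebra

variable {A 𝔛 ι : Type*} [CommRing A] [Algebra ℝ A] [AddCommGroup 𝔛] [Module A 𝔛]
    [Fintype ι] [DecidableEq ι] (P : FrameAlgebra A 𝔛 ι)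

/-- the full frame -/
def frame : ι ⊕ Fin 3 → 𝔛 := Sum.elim P.e P.ξ

/-- the full coframe -/
def coframe : ι ⊕ Fin 3 → 𝔛 →ₗ[A] A := Sum.elim (fun a => P.g (P.e a)) P.η

theorem expand_frame (X : 𝔛) : X = ∑ i, P.coframe i X • P.frame i := by
  conv_lhs => rw [P.expand X]
  simp [frame, coframe, Fintype.sum_sum_type, P.g_symm X]

/-- connection matrix of the frame -/
def connMatrix (X : 𝔛) : Matrix (ι ⊕ Fin 3) (ι ⊕ Fin 3) A :=
  .of fun i j => -P.coframe i (P.nab X (P.frame j))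

theorem coframe_frame (i j) : P.coframe i (P.frame j) = if i = j then 1 else 0 := by
  obtain (a | s) := i <;> obtain (b | t) := j <;>
    simp [coframe, frame, P.g_e, P.η_e, P.η_ξ, P.g_symm (P.e _) (P.ξ _), P.g_ξ, eq_comm]

theorem D_coframe (i) (X Y : 𝔛) : P.D X (P.coframe i Y) =
    P.coframe i (P.nab X Y) + ∑ j, P.connMatrix X i j * P.coframe j Y := by
  have h1 : P.coframe i (P.nab X Y) =
      P.D X (P.coframe i Y) + ∑ j, P.coframe j Y * P.coframe i (P.nab X (P.frame j)) := by
    conv_lhs => rw [P.expand_frame Y, P.nab_sum]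
    simp only [P.nab_smul, map_sum, map_add, map_smul, P.coframe_frame, Finset.sum_add_distrib, smul_eq_mul]
    simp
  rw [h1]
  simp only [connMatrix, Matrix.of_apply, neg_mul, Finset.sum_neg_distrib]
  simp_rw [mul_comm (P.coframe i _)]
  ring

/-- The horizontal block is skew by metricity, the vertical block by `α_skew`. Thus the volume
element of the coframe is parallel. -/
theorem trace_connMatrix [Nonempty ι] (X : 𝔛) : (P.connMatrix X).trace = 0 := by
  have h1 : ∀ a, P.g (P.e a) (P.nab X (P.e a)) = 0 := fun a => by
    have := P.nab_g X a a
    rw [P.g_symm, ← two_mul] at this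
    exact two_cancel this
  have h2 : ∀ s, P.η s (P.nab X (P.ξ s)) = 0 := fun s => by
    have := P.α_skew s s X
    exact two_cancel (by rw [two_mul]; exact add_eq_zero_iff_eq_neg.2 this)
  simp [connMatrix, Matrix.trace, coframe, frame, h1, h2]

variable {P} in
/-- The divergence in coordinates. -/
theorem sum_D_det_mul [Nonempty ι] {σ : 𝔛} (hσ : P.IsHor σ) (x : ι ⊕ Fin 3 → A)
    (Δ : ι ⊕ Fin 3 → 𝔛) (hx : ∀ i j, P.D (Δ i) (x j) = if i = j then 1 else 0)
    (hΔ : ∀ X, X = ∑ i, P.D X (x i) • Δ i) :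
    ∑ i, P.D (Δ i) ((Matrix.of fun j k => P.coframe j (Δ k)).det * P.D σ (x i)) =
      (Matrix.of fun j k => P.coframe j (Δ k)).det * P.div σ := by
  set M : Matrix (ι ⊕ Fin 3) (ι ⊕ Fin 3) A := Matrix.of fun j k => P.coframe j (Δ k) with hM
  have hdet : ∀ X, P.D X M.det = (∑ k, P.D (P.nab X (Δ k)) (x k)) * M.det := fun X => by
    have h1 : M.map (P.D X) = P.connMatrix X * M
        + M * Matrix.of fun j k => P.D (P.nab X (Δ k)) (x j) := by
      ext i k
      simp only [hM, Matrix.map_apply, Matrix.of_apply, Matrix.add_apply, Matrix.mul_apply]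
      rw [P.D_coframe, add_comm]
      congr 1
      conv_lhs => rw [hΔ (P.nab X (Δ k))]
      simp [mul_comm]
    rw [P.D_det X M _ _ h1, P.trace_connMatrix, zero_add]
    rfl
  -- The trace of an endomorphism is the same in the coordinate basis and in the adapted frame.
  have htr : ∀ L : 𝔛 →ₗ[A] 𝔛, ∑ i, P.D (L (Δ i)) (x i) = ∑ j, P.coframe j (L (P.frame j)) :=
    fun L => by
      have e1 : ∀ i, P.D (L (Δ i)) (x i) =
          ∑ j, P.coframe j (Δ i) * P.D (L (P.frame j)) (x i) := fun i => by
        conv_lhs => rw [P.expand_frame (Δ i), map_sum, P.D_sum_left]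
        simp only [map_smul, P.D_smul_left]
      have e2 : ∀ j, P.coframe j (L (P.frame j)) =
          ∑ i, P.coframe j (Δ i) * P.D (L (P.frame j)) (x i) := fun j => by
        conv_lhs => rw [hΔ (L (P.frame j))]
        simp [mul_comm]
      simp_rw [e1, e2]
      rw [Finset.sum_comm]
  -- Since Δ_i x_i = 1 is constant, Δ_i(σ x_i) is the derivative of x_i along [Δ_i, σ], which is
  -- expanded by ∇ and T.
  have h1 : ∀ i, P.D (Δ i) (M.det * P.D σ (x i)) = P.D σ (x i) * P.D (Δ i) M.det
      + M.det * (P.D (P.nab (Δ i) σ) (x i) - P.D (P.nab σ (Δ i)) (x i)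
        + P.D (P.T σ (Δ i)) (x i)) := fun i => by
    have e1 := P.D_br (Δ i) σ (x i)
    have e2 : P.D (P.br (Δ i) σ) (x i) = P.D (P.nab (Δ i) σ) (x i) - P.D (P.nab σ (Δ i)) (x i)
        + P.D (P.T σ (Δ i)) (x i) := by
      rw [P.br_eq, P.T_antisymm, sub_neg_eq_add, P.D_add_left]
      congr 1
      exact (P.dL (x i)).map_sub _ _
    rw [hx, if_pos rfl, P.D_one] at e1
    rw [P.D_mul]
    linear_combination M.det * (e2 - e1)
  have h2 : ∑ i, P.D σ (x i) * P.D (Δ i) M.det = P.D σ M.det := by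
    conv_rhs => rw [hΔ σ, P.D_sum_left]
    simp only [P.D_smul_left]
  have h3 := htr (P.nabL σ)
  have h4 := htr (P.T σ)
  have h5 : ∑ j, P.coframe j (P.nab (P.frame j) σ) = P.div σ := by
    simp [Fintype.sum_sum_type, coframe, frame, div, P.isHor_nab hσ _ _, P.g_symm (P.e _)]
  -- The torsion does not disturb the divergence theorem: T(σ,ξ_s) is horizontal and T(σ,e_a) is
  -- vertical, so T(σ,·) has no diagonal entries.
  have h6 : ∑ j, P.coframe j (P.T σ (P.frame j)) = 0 := by
    have e1 : ∀ s, P.η s (P.T σ (P.ξ s)) = 0 := fun s => by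
      rw [P.T_antisymm, map_neg, P.isHor_torsion hσ, neg_zero]
    have e2 : ∀ a, P.g (P.e a) (P.T σ (P.e a)) = 0 := fun a => by
      rw [P.torsion_hor hσ (P.isHor_e a), P.g_symm]
      simp [P.g_ξ]
    simp [Fintype.sum_sum_type, coframe, frame, e1, e2]
  simp only [FieldAlgebra.nabL_apply, h5] at h3
  rw [h6] at h4
  simp_rw [h1]
  rw [Finset.sum_add_distrib, h2, hdet, ← Finset.mul_sum, Finset.sum_add_distrib,
    Finset.sum_sub_distrib, h3, h4]
  ring

end FrameAlgebra
end QC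
end

/-! ### The algebraic inequality, and evaluation of the formal calculus at a point -/

noncomputable section

namespace QC

namespace TorsionCurvature

variable {ι W : Type*} [Fintype ι] [DecidableEq ι] [AddCommGroup W] [Module ℝ W]
  (P : TorsionCurvature ι W)

/-- The square norm of the `sp(n) sp(1)`-component of an endomorphism orthogonal to the identity
is nonnegative. -/
theorem trace_sq_le (N : W →ₗ[ℝ] W) :
    4 * (∑ a, P.g (N (P.e a)) (P.e a)) ^ 2 ≤ Fintype.card ι * (∑ a, P.g (N (P.e a)) (N (P.e a))
      + ∑ s, ∑ a, P.g (N (P.I s (P.e a))) (P.I s (N (P.e a)))) := by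
  set tr := ∑ a, P.g (N (P.e a)) (P.e a) with htr
  set nn := ∑ a, P.g (N (P.e a)) (N (P.e a)) with hnn
  set L : Fin 3 → ℝ := fun s => ∑ a, P.g (N (P.I s (P.e a))) (P.I s (N (P.e a))) with hL
  have h1 : ∀ s, ∑ a, P.g (N (P.e a)) (P.I s (N (P.I s (P.e a)))) = -L s := fun s => by
    rw [hL, ← Finset.sum_neg_distrib]
    refine Finset.sum_congr rfl fun a _ => ?_
    rw [P.onb.symm, P.I_skew]
  have h2 : ∀ s, ∑ a, P.g (P.I s (N (P.I s (P.e a)))) (P.I s (N (P.I s (P.e a)))) = nn := fun s => by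
    simp only [P.I_isom]
    have := P.onb.sum_map_isometry (P.g.compl₁₂ N N) (P.I_skew s) (P.I_sq s)
    simpa using this
  have h3 : ∀ i j k, Cyc i j k →
      ∑ a, P.g (P.I i (N (P.I i (P.e a)))) (P.I j (N (P.I j (P.e a)))) = L k := fun i j k h => by
    obtain ⟨r1, r2, r3, r4, r5, r6⟩ := P.I_rules h
    have := P.onb.sum_map_isometry (P.g.compl₁₂ (P.I i ∘ₗ N ∘ₗ P.I i) (P.I j ∘ₗ N ∘ₗ P.I j))
      (P.I_skew i) (P.I_sq i)
    simp only [LinearMap.compl₁₂_apply, LinearMap.comp_apply, P.I_sq, r4] at this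
    rw [← this]
    refine Finset.sum_congr rfl fun a _ => ?_
    simp only [map_neg, LinearMap.neg_apply, neg_neg]
    rw [P.onb.symm, P.I_skew, r4, map_neg, neg_neg]
  have h4 : ∀ s, ∑ a, P.g (P.I s (N (P.I s (P.e a)))) (P.e a) = -tr := fun s => by
    have := P.onb.sum_map_isometry (P.g ∘ₗ N) (P.I_skew s) (P.I_sq s)
    simp only [LinearMap.comp_apply] at this
    rw [htr, ← this, ← Finset.sum_neg_distrib]
    exact Finset.sum_congr rfl fun a _ => P.I_skew s _ _
  -- This is the square norm of N − Σ I_s N I_s − c·id. The first two terms are four times the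
  -- component of N commuting with all I_s; its norm and trace are computed in `h1`–`h4`.
  have h0 : ∀ c : ℝ, 0 ≤ 4 * (nn + ∑ s, L s) - 8 * c * tr + c ^ 2 * Fintype.card ι := fun c => by
    have key : ∑ a, P.g (N (P.e a) - P.I 0 (N (P.I 0 (P.e a))) - P.I 1 (N (P.I 1 (P.e a)))
          - P.I 2 (N (P.I 2 (P.e a))) - c • P.e a)
        (N (P.e a) - P.I 0 (N (P.I 0 (P.e a))) - P.I 1 (N (P.I 1 (P.e a)))
          - P.I 2 (N (P.I 2 (P.e a))) - c • P.e a) =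
        4 * (nn + ∑ s, L s) - 8 * c * tr + c ^ 2 * Fintype.card ι := by
      have e1 : ∀ s a, P.g (P.I s (N (P.I s (P.e a)))) (N (P.e a)) =
        P.g (N (P.e a)) (P.I s (N (P.I s (P.e a)))) := fun s a => P.onb.symm _ _
      have e2 : ∀ v a, P.g (P.e a) v = P.g v (P.e a) := fun v a => P.onb.symm _ _
      have e3 : ∀ s t a, P.g (P.I t (N (P.I t (P.e a)))) (P.I s (N (P.I s (P.e a)))) =
        P.g (P.I s (N (P.I s (P.e a)))) (P.I t (N (P.I t (P.e a)))) := fun s t a => P.onb.symm _ _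
      simp only [map_sub, map_smul, LinearMap.sub_apply, LinearMap.smul_apply, smul_eq_mul, e1,
        e2 (N _), e2 (P.I _ _), e3 0 1, e3 1 2, e3 2 0, Finset.sum_sub_distrib, ← Finset.mul_sum,
        P.onb.orth, if_true, Finset.sum_const, Finset.card_univ, nsmul_eq_mul, mul_one,
        h1, h2, h4, ← htr, ← hnn, h3 0 1 2 cyc_zero, h3 1 2 0 cyc_zero.rot,
        h3 2 0 1 cyc_zero.rot.rot, Fin.sum_univ_three]
      ring
    rw [← key]
    exact Finset.sum_nonneg fun a _ => P.onb.self_nonneg _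
  rcases Nat.eq_zero_or_pos (Fintype.card ι) with hc | hc
  · have : IsEmpty ι := Fintype.card_eq_zero_iff.1 hc
    simp [htr]
  · have hc' : (0 : ℝ) < Fintype.card ι := by exact_mod_cast hc
    -- The optimal c, for which c·id is the trace part of N − Σ I_s N I_s.
    have := mul_nonneg hc'.le (h0 (4 * tr / Fintype.card ι))
    field_simp at this
    nlinarith [this]

end TorsionCurvature

namespace FrameAlgebra

variable {A 𝔛 ι : Type*} [CommRing A] [Algebra ℝ A] [AddCommGroup 𝔛] [Module A 𝔛]
    [Fintype ι] [DecidableEq ι] (P : FrameAlgebra A 𝔛 ι) (ev : A →ₐ[ℝ] ℝ)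

/-- the components of the value of a field at a point -/
def comp (X : 𝔛) : ι → ℝ := fun a => ev (P.g X (P.e a))

/-- the field with given constant components -/
def lift (u : ι → ℝ) : 𝔛 := ∑ a, algebraMap ℝ A (u a) • P.e a

@[simp] theorem comp_add (X Y) : P.comp ev (X + Y) = P.comp ev X + P.comp ev Y := by
  ext a; simp [comp]
@[simp] theorem comp_smul (c : A) (X) : P.comp ev (c • X) = ev c • P.comp ev X := by
  ext a; simp [comp]
@[simp] theorem comp_neg (X) : P.comp ev (-X) = -P.comp ev X := by
  ext a; simp [comp]
@[simp] theorem comp_sum {κ : Type*} (S : Finset κ) (F : κ → 𝔛) :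
    P.comp ev (∑ i ∈ S, F i) = ∑ i ∈ S, P.comp ev (F i) := by
  ext a; simp [comp]
@[simp] theorem lift_add (u v) : P.lift (u + v) = P.lift u + P.lift v := by
  simp [lift, add_smul, Finset.sum_add_distrib]
@[simp] theorem lift_smul (c : ℝ) (u) : P.lift (c • u) = algebraMap ℝ A c • P.lift u := by
  simp [lift, Finset.smul_sum, smul_smul]
theorem isHor_lift (u) : P.IsHor (P.lift u) := .sum fun a _ => (P.isHor_e a).smul _
theorem lift_single (a) : P.lift (Pi.single a 1) = P.e a := by
  rw [lift, Finset.sum_eq_single a] <;> simp +contextual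

theorem ev_algebraMap (r : ℝ) : ev (algebraMap ℝ A r) = r := ev.commutes r

theorem comp_lift (u) : P.comp ev (P.lift u) = u := by
  ext a; simp [comp, lift, P.g_e]

variable {P} in
-- Linear forms over the functions are tensorial: at the point, a horizontal field may be replaced
-- by the one with the same components held constant.
theorem IsHor.ev_map {X : 𝔛} (h : P.IsHor X) (φ : 𝔛 →ₗ[A] A) :
    ev (φ (P.lift (P.comp ev X))) = ev (φ X) := by
  rw [h.map_eq_sum φ]
  simp [lift, comp]

variable {P} in
theorem IsHor.comp_map {X : 𝔛} (h : P.IsHor X) (F : 𝔛 →ₗ[A] 𝔛) :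
    P.comp ev (F (P.lift (P.comp ev X))) = P.comp ev (F X) := by
  ext a
  exact h.ev_map ev (P.g.flip (P.e a) ∘ₗ F)

/-- the value at a point of the metric -/
def evG : (ι → ℝ) →ₗ[ℝ] (ι → ℝ) →ₗ[ℝ] ℝ :=
  LinearMap.mk₂ ℝ (fun u v => ev (P.g (P.lift u) (P.lift v))) (by simp) (by simp) (by simp) (by simp)

/-- the value at a point of an endomorphism -/
def evEnd (F : 𝔛 →ₗ[A] 𝔛) : (ι → ℝ) →ₗ[ℝ] (ι → ℝ) where
  toFun u := P.comp ev (F (P.lift u))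
  map_add' := by simp
  map_smul' := by simp

theorem evG_apply (u v) : P.evG ev u v = ev (P.g (P.lift u) (P.lift v)) := rfl
theorem evEnd_apply (F u) : P.evEnd ev F u = P.comp ev (F (P.lift u)) := rfl

theorem evG_comp_left {X : 𝔛} (h : P.IsHor X) (v) :
    P.evG ev (P.comp ev X) v = ev (P.g X (P.lift v)) := h.ev_map ev (P.g.flip (P.lift v))
theorem evG_comp_right {X : 𝔛} (h : P.IsHor X) (v) :
    P.evG ev v (P.comp ev X) = ev (P.g (P.lift v) X) := h.ev_map ev (P.g (P.lift v))
theorem evG_comp {X Y : 𝔛} (h : P.IsHor X) (h' : P.IsHor Y) :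
    P.evG ev (P.comp ev X) (P.comp ev Y) = ev (P.g X Y) := by
  rw [evG_comp_left _ _ h]; exact h'.ev_map ev (P.g X)

/-- the value at a point of the vertical curvature -/
def evκ (s t : Fin 3) : (ι → ℝ) →ₗ[ℝ] (ι → ℝ) →ₗ[ℝ] ℝ :=
  LinearMap.mk₂ ℝ (fun u v => ev (P.η t (P.RL (P.lift u) (P.lift v) (P.ξ s))))
    (by simp [-FieldAlgebra.RL_apply]) (by simp [-FieldAlgebra.RL_apply])
    (by simp [-FieldAlgebra.RL_apply]) (by simp [-FieldAlgebra.RL_apply])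

theorem evκ_apply (s t u v) : P.evκ ev s t u v = ev (P.κ s t (P.lift u) (P.lift v)) := rfl

/-- Orthogonality of the torsion endomorphisms at a point to `sp(n) ⊕ sp(1)`. -/
structure TorsionPerp : Prop where
  perp_Q : ∀ s t, ∑ a, ev (P.g (P.T (P.ξ s) (P.e a)) (P.J t (P.e a))) = 0
  perp_sp : ∀ s (L : (ι → ℝ) →ₗ[ℝ] (ι → ℝ)), (∀ u v, P.evG ev (L u) v = -P.evG ev u (L v)) →
    (∀ t u, L (P.evEnd ev (P.J t) u) = P.evEnd ev (P.J t) (L u)) →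
    ∑ a, ev (P.g (P.T (P.ξ s) (P.e a)) (P.lift (L (Pi.single a 1)))) = 0

variable {P ev} in
/-- The torsion and the curvature at a point. -/
def torsionCurvature [Nonempty ι] (h : P.TorsionPerp ev) : TorsionCurvature ι (ι → ℝ) where
  g := P.evG ev
  e a := Pi.single a 1
  I s := P.evEnd ev (P.J s)
  T s := P.evEnd ev (P.T (P.ξ s))
  R := LinearMap.mk₂ ℝ (fun u v => P.evEnd ev (P.R (P.lift u) (P.lift v)))
    (fun _ _ _ => by ext; simp [evEnd_apply, P.R_add_left])
    (fun _ _ _ => by ext; simp [evEnd_apply, P.R_smul_left])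
    (fun u v w => by
      ext; simp only [← P.RL_apply, lift_add, map_add]; simp [evEnd_apply])
    (fun c u v => by
      ext; simp only [← P.RL_apply, lift_smul, map_smul]; simp [evEnd_apply])
  κ := P.evκ ev
  τ r s t := ev (P.η t (P.T (P.ξ r) (P.ξ s)))
  onb := ⟨fun u v => by rw [evG_apply, evG_apply, P.g_symm],
    fun a b => by simp [evG_apply, lift_single, P.g_e, apply_ite ev],
    fun v => by
      ext b
      simp only [evG_apply, lift_single, Finset.sum_apply, Pi.smul_apply, Pi.single_apply,
        smul_eq_mul, mul_ite, mul_one, mul_zero, Finset.sum_ite_eq, Finset.mem_univ, if_true]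
      exact (congrFun (P.comp_lift ev v) b).symm⟩
  I_sq s X := by
    rw [evEnd_apply, evEnd_apply, (P.isHor_J _ _).comp_map, (P.isHor_lift _).J_sq, comp_neg,
      comp_lift]
  I_mul i j k hc X := by
    rw [evEnd_apply, evEnd_apply, evEnd_apply, (P.isHor_J _ _).comp_map, P.J_mul i j k hc]
  I_mul' i j k hc X := by
    rw [evEnd_apply, evEnd_apply, evEnd_apply, (P.isHor_J _ _).comp_map, P.J_mul' i j k hc,
      comp_neg]
  I_skew s X Y := by
    rw [evEnd_apply, evEnd_apply, evG_comp_left _ _ (P.isHor_J _ _),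
      evG_comp_right _ _ (P.isHor_J _ _), P.J_skew, map_neg]
  τ_antisymm r s t := by rw [P.T_antisymm, map_neg, map_neg]
  perp_Q s t := by
    simp only [evEnd_apply, lift_single]
    rw [← h.perp_Q s t]
    exact Finset.sum_congr rfl fun a _ =>
      evG_comp _ _ (P.isHor_torsion (P.isHor_e a) s) (P.isHor_J _ _)
  perp_sp s L h1 h2 := by
    rw [← h.perp_sp s L h1 fun t u => h2 t u]
    refine Finset.sum_congr rfl fun a _ => ?_
    rw [evEnd_apply, lift_single, evG_comp_left _ _ (P.isHor_torsion (P.isHor_e a) s)]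
  R_antisymm X Y Z := by
    simp only [LinearMap.mk₂_apply, evEnd_apply]; rw [P.R_antisymm, comp_neg]
  R_skew X Y Z Z' := by
    simp only [LinearMap.mk₂_apply, evEnd_apply]
    rw [evG_comp_left _ _ (P.isHor_R (P.isHor_lift _) _ _),
      evG_comp_right _ _ (P.isHor_R (P.isHor_lift _) _ _),
      P.R_skew (P.isHor_lift _) (P.isHor_lift _), map_neg]
  R_I X Y s Z := by
    simp only [LinearMap.mk₂_apply, evEnd_apply]
    rw [(P.isHor_J _ _).comp_map, P.R_J (P.isHor_lift _),
      (P.isHor_R (P.isHor_lift _) _ _).comp_map]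
    simp [evκ_apply]
  κ_eq X Y s t := by
    simp only [evκ_apply, evEnd_apply]
    rw [P.κ_eq_torsion (P.isHor_lift _) (P.isHor_lift _),
      evG_comp _ _ (P.isHor_torsion (P.isHor_lift _) s) (P.isHor_J _ _),
      evG_comp _ _ (P.isHor_torsion (P.isHor_lift _) s) (P.isHor_J _ _)]
    simp only [map_add, map_mul, map_sum, map_sub, map_ofNat]
    congr 2
    refine Finset.sum_congr rfl fun r _ => ?_
    rw [evG_comp_left _ _ (P.isHor_J _ _)]
  bianchi X Y Z := by
    have := congrArg (P.comp ev) (P.bianchi_hor (P.isHor_lift X) (P.isHor_lift Y) (P.isHor_lift Z))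
    simp only [LinearMap.mk₂_apply, evEnd_apply, comp_add, comp_sum, comp_smul] at this ⊢
    rw [this]
    simp only [evG_comp_left _ _ (P.isHor_J _ _), ← Finset.sum_add_distrib, map_mul, map_ofNat,
      smul_add, smul_smul]

/-- twice the torsion component `T⁰` -/
def T0₂ (X : 𝔛) : A := ∑ s, (P.g (P.T (P.ξ s) (P.J s X)) X + P.g (P.T (P.ξ s) X) (P.J s X))

/-- six times the torsion component `U` -/
def U₆ (X : 𝔛) : A := ∑ s, (P.g (P.T (P.ξ s) X) (P.J s X) - P.g (P.T (P.ξ s) (P.J s X)) X)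

variable {P ev} [Nonempty ι] (h : P.TorsionPerp ev) {G : 𝔛} (hG : P.IsHor G)

include hG in
theorem torsionCurvature_T0 :
    (torsionCurvature h).T0 (P.comp ev G) (P.comp ev G) = ev (P.T0₂ G) / 2 := by
  simp only [TorsionCurvature.T0, TorsionCurvature.sym_apply, T0₂, map_sum, Finset.sum_div, map_add]
  refine Finset.sum_congr rfl fun s _ => ?_
  simp only [torsionCurvature, evEnd_apply]
  rw [hG.comp_map, hG.comp_map, (P.isHor_J _ _).comp_map,
    evG_comp _ _ (P.isHor_torsion (P.isHor_J _ _) s) hG,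
    evG_comp _ _ (P.isHor_torsion hG s) (P.isHor_J _ _)]

include hG in
theorem torsionCurvature_U :
    (torsionCurvature h).U (P.comp ev G) (P.comp ev G) = ev (P.U₆ G) / 6 := by
  simp only [TorsionCurvature.U, TorsionCurvature.skw_apply, U₆, map_sum, Finset.sum_div, map_sub]
  refine Finset.sum_congr rfl fun s _ => ?_
  simp only [torsionCurvature, evEnd_apply]
  rw [hG.comp_map, hG.comp_map, (P.isHor_J _ _).comp_map,
    evG_comp _ _ (P.isHor_torsion (P.isHor_J _ _) s) hG,
    evG_comp _ _ (P.isHor_torsion hG s) (P.isHor_J _ _)]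
  ring

include hG in
theorem torsionCurvature_Ric :
    (torsionCurvature h).Ric (P.comp ev G) (P.comp ev G) = ev (P.Ric G G) := by
  simp only [TorsionCurvature.Ric, Ric, map_sum]
  refine Finset.sum_congr rfl fun a _ => ?_
  simp only [torsionCurvature, LinearMap.mk₂_apply, evEnd_apply, lift_single]
  rw [evG_comp_left _ _ (P.isHor_R (P.isHor_lift _) _ _), lift_single, ← P.RL_apply]
  have h1 := hG.ev_map ev (P.g.flip (P.e a) ∘ₗ P.RL (P.e a) (P.lift (P.comp ev G)))
  have h2 := hG.ev_map ev (P.g.flip (P.e a) ∘ₗ (P.RL (P.e a)).flip G)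
  simp only [LinearMap.comp_apply, LinearMap.flip_apply, P.RL_apply] at h1 h2 ⊢
  rw [h1, h2]

theorem torsionCurvature_trace_Ric : ∑ a, (torsionCurvature h).Ric ((torsionCurvature h).e a)
      ((torsionCurvature h).e a) = ∑ a, ev (P.Ric (P.e a) (P.e a)) := by
  refine Finset.sum_congr rfl fun a _ => ?_
  rw [← torsionCurvature_Ric h (P.isHor_e a)]
  have : P.comp ev (P.e a) = Pi.single a 1 := by rw [← P.lift_single, comp_lift]
  rw [this]; rfl

include hG in
theorem torsionCurvature_ricForm :
    (torsionCurvature h).ricForm (P.comp ev G) = ev (P.ricForm₂ G) / 2 := by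
  simp only [TorsionCurvature.ricForm, ricForm₂, map_sum]
  congr 1
  refine Finset.sum_congr rfl fun s _ => Finset.sum_congr rfl fun a _ => ?_
  simp only [torsionCurvature, LinearMap.mk₂_apply, evEnd_apply, lift_single]
  rw [hG.comp_map, (P.isHor_J _ _).comp_map, evG_comp _ _ (P.isHor_R (P.isHor_J _ _) _ _) hG,
    ← P.RL_apply]
  exact (P.isHor_J s (P.e a)).ev_map ev
    (P.g.flip G ∘ₗ (P.RL (P.e a)).flip (P.J s G))

include hG h in
theorem ev_trace_sq_le : 4 * ev (P.tr G) ^ 2 ≤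
    Fintype.card ι * (ev (P.normSq G) + ev (P.rotSq G)) := by
  have := (torsionCurvature h).trace_sq_le (P.evEnd ev (P.nabL G))
  have hn : ∀ X, P.IsHor (P.nab X G) := P.isHor_nab hG
  convert this using 3
  · rw [tr, map_sum]
    refine Finset.sum_congr rfl fun a _ => ?_
    simp only [torsionCurvature, evEnd_apply, lift_single, FieldAlgebra.nabL_apply]
    rw [evG_comp_left _ _ (hn _), lift_single]
  · rw [normSq, map_sum]
    refine Finset.sum_congr rfl fun a _ => ?_
    simp only [torsionCurvature, evEnd_apply, lift_single, FieldAlgebra.nabL_apply]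
    rw [evG_comp _ _ (hn _) (hn _)]
  · simp only [rotSq, map_sum]
    refine Finset.sum_congr rfl fun s _ => Finset.sum_congr rfl fun a _ => ?_
    simp only [torsionCurvature, evEnd_apply, lift_single]
    rw [(P.isHor_J _ _).comp_map, FieldAlgebra.nabL_apply, FieldAlgebra.nabL_apply,
      (hn _).comp_map, evG_comp _ _ (hn _) (P.isHor_J _ _)]

/-- The Ricci tensor in terms of the torsion and of the scalar curvature. -/
theorem ev_Ric_eq {n : ℕ} (hn : Fintype.card ι = 4 * n) (h : P.TorsionPerp ev) {G : 𝔛}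
    (hG : P.IsHor G) : ev (P.Ric G G) = (2 * n + 2) * (ev (P.T0₂ G) / 2)
      + (4 * n + 10) * (ev (P.U₆ G) / 6) + 2 * (n + 2) *
        ((∑ a, ev (P.Ric (P.e a) (P.e a))) / (8 * n * (n + 2)) * ev (P.g G G)) := by
  have hn0 : (n : ℝ) ≠ 0 := by
    rintro h0
    have : n = 0 := by exact_mod_cast h0
    exact Fintype.card_ne_zero (α := ι) (by rw [hn, this])
  have h1 := (torsionCurvature h).Ric_eq_τ (P.comp ev G)
  have h2 := (torsionCurvature h).trace_Ric
  rw [torsionCurvature_trace_Ric, hn] at h2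
  rw [torsionCurvature_T0 h hG, torsionCurvature_U h hG, torsionCurvature_Ric h hG, hn] at h1
  rw [h2, h1, show (torsionCurvature h).g (P.comp ev G) (P.comp ev G) = ev (P.g G G) from
    evG_comp _ _ hG hG]
  push_cast
  have : (n : ℝ) + 2 ≠ 0 := by positivity
  field_simp
  ring

/-- The divergence of `bochnerField` in terms of the Hessian, the torsion and the curvature. -/
theorem ev_div_bochnerField {n : ℕ} (hn : Fintype.card ι = 4 * n) (h : P.TorsionPerp ev) {G : 𝔛}
    (hG : P.IsHor G) {f : A} (hf : ∀ X, P.IsHor X → P.g G X = P.D X f) :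
    ev (P.div (P.bochnerField n G)) = n * ev (P.normSq G) + ev (P.rotSq G) - n * ev (P.tr G) ^ 2
      + n * ev (P.Ric G G) - 4 * (ev (P.T0₂ G) / 2) - 6 * n * (ev (P.U₆ G) / 6)
      - 6 * n * ((∑ a, ev (P.Ric (P.e a) (P.e a))) / (8 * n * (n + 2)) * ev (P.g G G)) := by
  have hn0 : (n : ℝ) ≠ 0 := by
    rintro h0
    have : n = 0 := by exact_mod_cast h0
    exact Fintype.card_ne_zero (α := ι) (by rw [hn, this])
  have h1 := (torsionCurvature h).ricForm_eq_τ (P.comp ev G)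
  have h2 := (torsionCurvature h).trace_Ric
  have h3 := congrArg ev (two_mul_div_bochnerField hG hf hn)
  -- With the symmetric and skew parts separated, Σ g(T(ξ_s, J_s G), G) = T⁰(G,G) − 3U(G,G).
  have h4 : 2 * ev (P.tors G) = ev (P.T0₂ G) - ev (P.U₆ G) := by
    simp only [T0₂, U₆, tors, ← map_sub, ← Finset.sum_sub_distrib]
    rw [← map_ofNat ev 2, ← map_mul, Finset.mul_sum]
    congr 1
    exact Finset.sum_congr rfl fun s _ => by ring
  rw [torsionCurvature_trace_Ric, hn] at h2
  rw [torsionCurvature_T0 h hG, torsionCurvature_ricForm h hG, hn,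
    show (torsionCurvature h).g (P.comp ev G) (P.comp ev G) = ev (P.g G G) from
    evG_comp _ _ hG hG] at h1
  simp only [map_mul, map_add, map_sub, map_pow, map_natCast, map_ofNat] at h3
  -- The normalized scalar curvature is minus the common vertical torsion component.
  have h5 : (∑ a, ev (P.Ric (P.e a) (P.e a))) / (8 * n * (n + 2)) =
      -(torsionCurvature h).τ 2 0 1 := by
    rw [h2]; push_cast
    have : (n : ℝ) + 2 ≠ 0 := by positivity
    field_simp; ring
  rw [h5]
  push_cast at h1
  linear_combination h3 / 2 - h1 / 2 * 2 + n * h4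

end FrameAlgebra
end QC
end

/-! ### Smooth functions and vector fields on an open set -/

noncomputable section

namespace QC

variable {n : ℕ} {M : Type*} [TopologicalSpace M]
  [ChartedSpace (EuclideanSpace ℝ (Fin (4 * n + 3))) M] [IsManifold (𝓡 (4 * n + 3)) ∞ M]

instance isManifold_minSmoothness_two : IsManifold (𝓡 (4 * n + 3)) (minSmoothness ℝ 2) M := by
  rw [minSmoothness_of_isRCLikeNormedField]; infer_instance

instance isManifold_minSmoothness_three : IsManifold (𝓡 (4 * n + 3)) (minSmoothness ℝ 3) M := by
  rw [minSmoothness_of_isRCLikeNormedField]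
  exact IsManifold.of_le (n := ∞) (WithTop.coe_le_coe.2 le_top)

/-- Smoothness of a function on `U`. -/
def SmoothFun (n : ℕ) {M : Type*} [TopologicalSpace M]
    [ChartedSpace (EuclideanSpace ℝ (Fin (4 * n + 3))) M] (U : Set M) (f : M → ℝ) : Prop :=
  ContMDiffOn (𝓡 (4 * n + 3)) 𝓘(ℝ, ℝ) ∞ f U

section
variable {U V : Set M} {f g : M → ℝ} {X Y : ∀ x : M, Tan n x}

omit [IsManifold (𝓡 (4 * n + 3)) ∞ M] in
theorem SmoothFun.mono (h : SmoothFun n U f) (hV : V ⊆ U) : SmoothFun n V f :=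
  ContMDiffOn.mono h hV

theorem SmoothField.mono (h : SmoothField U X) (hV : V ⊆ U) : SmoothField V X :=
  ContMDiffOn.mono h hV

omit [IsManifold (𝓡 (4 * n + 3)) ∞ M] in
theorem SmoothFun.congr (h : SmoothFun n U f) (hg : ∀ y ∈ U, g y = f y) : SmoothFun n U g :=
  ContMDiffOn.congr h hg

theorem SmoothField.congr (h : SmoothField U X) (hY : ∀ y ∈ U, Y y = X y) : SmoothField U Y :=
  ContMDiffOn.congr h fun y hy => by rw [hY y hy]

omit [IsManifold (𝓡 (4 * n + 3)) ∞ M] in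
theorem SmoothFun.mdifferentiableAt (h : SmoothFun n U f) (hU : IsOpen U) {x} (hx : x ∈ U) :
    MDifferentiableAt (𝓡 (4 * n + 3)) 𝓘(ℝ, ℝ) f x :=
  (ContMDiffOn.contMDiffAt h (hU.mem_nhds hx)).mdifferentiableAt (by simp)

theorem SmoothField.mdifferentiableAt (h : SmoothField U X) (hU : IsOpen U) {x} (hx : x ∈ U) :
    MDifferentiableAt (𝓡 (4 * n + 3)) (𝓡 (4 * n + 3)).tangent
      (fun x => (⟨x, X x⟩ : TangentBundle (𝓡 (4 * n + 3)) M)) x :=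
  (ContMDiffOn.contMDiffAt h (hU.mem_nhds hx)).mdifferentiableAt (by simp)

theorem SmoothField.add (hX : SmoothField U X) (hY : SmoothField U Y) :
    SmoothField U fun y => X y + Y y := ContMDiffOn.add_section hX hY

theorem SmoothField.smul (hf : SmoothFun n U f) (hX : SmoothField U X) :
    SmoothField U fun y => f y • X y := ContMDiffOn.smul_section hf hX

theorem SmoothField.sum {ι : Type*} {s : Finset ι} {X : ι → ∀ x : M, Tan n x}
    (hX : ∀ i ∈ s, SmoothField U (X i)) : SmoothField U fun y => ∑ i ∈ s, X i y :=
  ContMDiffOn.sum_section hX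

theorem SmoothForm.apply {η : ∀ x : M, Tan n x →L[ℝ] ℝ} (hη : SmoothForm U η)
    (hX : SmoothField U X) : SmoothFun n U fun y => η y (X y) := by
  have h := ContMDiffOn.clm_bundle_apply (n := ∞) (E₂ := Bundle.Trivial M ℝ) hη hX
  intro x hx
  have := h x hx
  rw [Bundle.contMDiffWithinAt_totalSpace] at this
  exact this.2

theorem SmoothFun.d_apply (hU : IsOpen U) (hf : SmoothFun n U f) (hX : SmoothField U X) :
    SmoothFun n U fun y => d n f y (X y) := by
  have h1 := ContMDiffOn.contMDiffOn_tangentMapWithin (m := ∞) hf (by simp) hU.uniqueMDiffOn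
  have h2 : ContMDiffOn (𝓡 (4 * n + 3)) 𝓘(ℝ, ℝ) ∞ (fun y => (tangentMapWithin (𝓡 (4 * n + 3))
      𝓘(ℝ, ℝ) f U ⟨y, X y⟩).2) U :=
    (contMDiff_snd_tangentBundle_modelSpace ℝ 𝓘(ℝ, ℝ)).comp_contMDiffOn
      (h1.comp hX fun y hy => hy)
  refine ContMDiffOn.congr h2 fun y hy => ?_
  simp only [tangentMapWithin, mfderivWithin_of_isOpen hU hy]
  rfl

theorem SmoothField.bracket (hU : IsOpen U) (hX : SmoothField U X) (hY : SmoothField U Y) :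
    SmoothField U (bracket X Y) := fun x hx => by
  have : IsManifold (𝓡 (4 * n + 3)) (((⊤ : ℕ∞) : WithTop ℕ∞) + 1) M :=
    inferInstanceAs (IsManifold (𝓡 (4 * n + 3)) ∞ M)
  refine ContMDiffAt.contMDiffWithinAt ?_
  exact ContMDiffAt.mlieBracket_vectorField (n := ⊤) (m := ⊤)
    (ContMDiffOn.contMDiffAt hX (hU.mem_nhds hx)) (ContMDiffOn.contMDiffAt hY (hU.mem_nhds hx))
    (by simp)

/-- A bump function equal to 1 near the point makes the local field globally smooth, so that
smoothness of the connection applies; locality of ∇ removes the bump. -/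
theorem SmoothField.conn [T2Space M] {conn : CovariantDerivative (𝓡 (4 * n + 3))
    (EuclideanSpace ℝ (Fin (4 * n + 3))) (TangentSpace (𝓡 (4 * n + 3)) : M → Type _)}
    (hc : CovariantDerivative.ContMDiffCovariantDerivative conn ∞)
    (hU : IsOpen U) (hX : SmoothField U X) (hY : SmoothField U Y) :
    SmoothField U fun y => conn Y y (X y) := fun x hx => by
  obtain ⟨ψ, -, hψ⟩ := (SmoothBumpFunction.nhds_basis_tsupport (I := 𝓡 (4 * n + 3)) x).mem_iff.1
    (hU.mem_nhds hx)
  have h1 : ContMDiff (𝓡 (4 * n + 3)) (𝓡 (4 * n + 3)).tangent ∞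
      (fun x => (⟨x, ((ψ : M → ℝ) • Y) x⟩ : TangentBundle (𝓡 (4 * n + 3)) M)) :=
    ContMDiffOn.smul_section_of_tsupport ψ.contMDiff.contMDiffOn hU hψ hY
  have h2 := hc.contMDiff.contMDiff (σ := (ψ : M → ℝ) • Y) (h1.of_le (by simp)).contMDiffOn
  have h3 : ContMDiffWithinAt (𝓡 (4 * n + 3)) (𝓡 (4 * n + 3)).tangent ∞
      (fun y => (⟨y, conn ((ψ : M → ℝ) • Y) y (X y)⟩ : TangentBundle (𝓡 (4 * n + 3)) M)) U x :=
    ContMDiffWithinAt.clm_bundle_apply (h2.mono (Set.subset_univ U) x hx) (hX x hx)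
  refine (h3.congr_of_eventuallyEq ?_ ?_)
  · have := ψ.eventuallyEq_one.eventually_nhds
    filter_upwards [mem_nhdsWithin_of_mem_nhds this, self_mem_nhdsWithin] with y hy hyU
    have e : conn Y y = conn ((ψ : M → ℝ) • Y) y :=
      conn.isCovariantDerivativeOnUniv.congr_of_eventuallyEq (hY.mdifferentiableAt hU hyU)
        (h1.mdifferentiable (by simp) y) Filter.univ_mem
        (hy.mono fun z hz => by simp [hz])
    rw [e]
  · have e : conn Y x = conn ((ψ : M → ℝ) • Y) x :=
      conn.isCovariantDerivativeOnUniv.congr_of_eventuallyEq (hY.mdifferentiableAt hU hx)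
        (h1.mdifferentiable (by simp) x) Filter.univ_mem
        (ψ.eventuallyEq_one.mono fun z hz => by simp [hz])
    simp only [e]

end
end QC
end

/-! ### The Lie bracket as a commutator of derivations -/

noncomputable section

namespace QC

variable {n : ℕ} {M : Type*} [TopologicalSpace M]
  [ChartedSpace (EuclideanSpace ℝ (Fin (4 * n + 3))) M] [IsManifold (𝓡 (4 * n + 3)) ∞ M]

section
variable {U V : Set M} {f g : M → ℝ} {X Y : ∀ x : M, Tan n x}

/-- The Lie bracket is the commutator of derivations. -/
theorem d_bracket (hU : IsOpen U) (hf : SmoothFun n U f) (hX : SmoothField U X)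
    (hY : SmoothField U Y) {x : M} (hx : x ∈ U) :
    d n f x (bracket X Y x) =
      d n (fun y => d n f y (Y y)) x (X x) - d n (fun y => d n f y (X y)) x (Y x) := by
  set φ := extChartAt (𝓡 (4 * n + 3)) x with hφ
  set F : EuclideanSpace ℝ (Fin (4 * n + 3)) → ℝ := f ∘ φ.symm with hF
  have hxs : x ∈ φ.source := mem_extChartAt_source x
  have hFs : ∀ y ∈ φ.source ∩ U, ContDiffAt ℝ ∞ F (φ y) := fun y hy => by
    have h1 : ContMDiffAt (𝓡 (4 * n + 3)) 𝓘(ℝ, ℝ) ∞ f (φ.symm (φ y)) := by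
      rw [φ.left_inv hy.1]; exact ContMDiffOn.contMDiffAt hf (hU.mem_nhds hy.2)
    have h2 : ContMDiffAt 𝓘(ℝ, EuclideanSpace ℝ (Fin (4 * n + 3))) (𝓡 (4 * n + 3)) ∞ φ.symm (φ y) :=
      (contMDiffOn_extChartAt_symm x).contMDiffAt
        ((isOpen_extChartAt_target x).mem_nhds (φ.map_source hy.1))
    exact (h1.comp (φ y) h2).contDiffAt
  have hc : ∀ (y : M), y ∈ φ.source → ∀ (q : M → ℝ) (k : EuclideanSpace ℝ (Fin (4 * n + 3)) → ℝ),
      q =ᶠ[nhds y] k ∘ φ → DifferentiableAt ℝ k (φ y) → ∀ v : Tan n y, d n q y v =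
      fderiv ℝ k (φ y) (mfderiv (𝓡 (4 * n + 3)) 𝓘(ℝ, EuclideanSpace ℝ (Fin (4 * n + 3))) φ y v) := by
    intro y hy q k h1 hk v
    have h2 : d n q y = d n (k ∘ φ) y := by
      unfold d mvfderiv
      rw [h1.mfderiv_eq, h1.eq_of_nhds]
    rw [h2]
    have h3 := mvfderiv_comp_apply (I := 𝓡 (4 * n + 3))
      (I' := 𝓘(ℝ, EuclideanSpace ℝ (Fin (4 * n + 3)))) (g := k) (f := φ) y
      hk.mdifferentiableAt (mdifferentiableAt_extChartAt (by simpa [hφ] using hy)) v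
    refine h3.trans ?_
    simp [mvfderiv]
    rfl
  have hA : ∀ y ∈ φ.source ∩ U, ∀ v : Tan n y, d n f y v =
      fderiv ℝ F (φ y) (mfderiv (𝓡 (4 * n + 3)) 𝓘(ℝ, EuclideanSpace ℝ (Fin (4 * n + 3))) φ y v) := by
    intro y hy v
    refine hc y hy.1 f F ?_ ((hFs y hy).differentiableAt (by simp)) v
    filter_upwards [(isOpen_extChartAt_source x).mem_nhds hy.1] with z hz
    simp only [hF, Function.comp_apply]
    rw [φ.left_inv hz]
  set P : (∀ x : M, Tan n x) → EuclideanSpace ℝ (Fin (4 * n + 3)) →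
    EuclideanSpace ℝ (Fin (4 * n + 3)) := fun X =>
    VectorField.mpullbackWithin 𝓘(ℝ, EuclideanSpace ℝ (Fin (4 * n + 3))) (𝓡 (4 * n + 3)) φ.symm X
      (Set.range (𝓡 (4 * n + 3))) with hP
  have hPd : ∀ X, SmoothField U X → DifferentiableAt ℝ (P X) (φ x) := fun X hX => by
    have := (hX.mdifferentiableAt hU hx).mdifferentiableWithinAt
      (s := Set.univ) |>.differentiableWithinAt_mpullbackWithin_vectorField
    rw [show (extChartAt (𝓡 (4 * n + 3)) x).symm ⁻¹' Set.univ ∩ Set.range (𝓡 (4 * n + 3)) =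
      Set.univ by simp] at this
    exact differentiableWithinAt_univ.1 this
  have hPX : ∀ (X : ∀ x : M, Tan n x), ∀ y ∈ φ.source,
      mfderiv (𝓡 (4 * n + 3)) 𝓘(ℝ, EuclideanSpace ℝ (Fin (4 * n + 3))) φ y (X y) = P X (φ y) := by
    intro X y hy
    -- Stated for y' = y because the values of X at y and at φ⁻¹(φ y) lie in different types until
    -- the base points are identified.
    have key : ∀ y' : M, y' = y → (mfderiv (𝓡 (4 * n + 3))
        𝓘(ℝ, EuclideanSpace ℝ (Fin (4 * n + 3))) φ y (X y) : EuclideanSpace ℝ (Fin (4 * n + 3))) =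
        ((mfderivWithin 𝓘(ℝ, EuclideanSpace ℝ (Fin (4 * n + 3))) (𝓡 (4 * n + 3)) φ.symm
          (Set.range (𝓡 (4 * n + 3))) (φ y)).inverse (X y') : EuclideanSpace ℝ (Fin (4 * n + 3))) := by
      rintro y' rfl
      have h1 := mfderivWithin_extChartAt_symm_comp_mfderiv_extChartAt' (I := 𝓡 (4 * n + 3)) hy
      obtain ⟨A, hA'⟩ := isInvertible_mfderivWithin_extChartAt_symm (I := 𝓡 (4 * n + 3))
        (φ.map_source hy)
      rw [← hA'] at h1 ⊢
      rw [ContinuousLinearMap.inverse_equiv]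
      refine (A.eq_symm_apply).2 ?_
      exact congrArg (fun L => L (X y')) h1
    exact key _ (φ.left_inv hy)
  have hq : ∀ X, SmoothField U X → ∀ v : Tan n x, d n (fun y => d n f y (X y)) x v =
      fderiv ℝ (fderiv ℝ F) (φ x) (mfderiv (𝓡 (4 * n + 3)) 𝓘(ℝ, EuclideanSpace ℝ (Fin (4 * n + 3)))
        φ x v) (P X (φ x)) + fderiv ℝ F (φ x) (fderiv ℝ (P X) (φ x) (mfderiv (𝓡 (4 * n + 3))
        𝓘(ℝ, EuclideanSpace ℝ (Fin (4 * n + 3))) φ x v)) := fun X hX v => by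
    have hF1 : DifferentiableAt ℝ (fderiv ℝ F) (φ x) :=
      ((hFs x ⟨hxs, hx⟩).fderiv_right (m := 1) (by norm_cast)).differentiableAt (by simp)
    rw [hc x hxs _ (fun z => fderiv ℝ F z (P X z)) ?_ (hF1.clm_apply (hPd X hX)),
      fderiv_clm_apply hF1 (hPd X hX)]
    · exact add_comm _ _
    · filter_upwards [(isOpen_extChartAt_source x).mem_nhds hxs, hU.mem_nhds hx] with y hy hyU
      rw [hA y ⟨hy, hyU⟩, hPX X y hy]
      rfl
  rw [hq Y hY, hq X hX, hPX X x hxs, hPX Y x hxs, hA x ⟨hxs, hx⟩]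
  -- In the chart the two second derivative terms of F cancel by symmetry; what remains is dF of the
  -- coordinate bracket.
  have hsym : IsSymmSndFDerivAt ℝ F (φ x) := (hFs x ⟨hxs, hx⟩).isSymmSndFDerivAt
    (by simpa using (WithTop.coe_le_coe.2 le_top : ((2 : ℕ∞) : WithTop ℕ∞) ≤ ∞))
  rw [hsym.eq]
  have hb : mfderiv (𝓡 (4 * n + 3)) 𝓘(ℝ, EuclideanSpace ℝ (Fin (4 * n + 3))) φ x (bracket X Y x) =
      VectorField.lieBracket ℝ (P X) (P Y) (φ x) := by
    obtain ⟨A, hA'⟩ := isInvertible_mfderiv_extChartAt (I := 𝓡 (4 * n + 3)) hxs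
    have h1 : bracket X Y x = (mfderiv (𝓡 (4 * n + 3))
        𝓘(ℝ, EuclideanSpace ℝ (Fin (4 * n + 3))) φ x).inverse
        (VectorField.lieBracketWithin ℝ (P X) (P Y) Set.univ (φ x)) := by
      have := VectorField.mlieBracketWithin_apply (I := 𝓡 (4 * n + 3)) (V := X) (W := Y)
        (s := Set.univ) (x₀ := x)
      rw [show (extChartAt (𝓡 (4 * n + 3)) x).symm ⁻¹' Set.univ ∩ Set.range (𝓡 (4 * n + 3)) =
        Set.univ by simp] at this
      exact this
    rw [h1, ← hA', ContinuousLinearMap.inverse_equiv]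
    refine (A.apply_symm_apply _).trans ?_
    have e : VectorField.lieBracketWithin ℝ (P X) (P Y) Set.univ =
      VectorField.lieBracket ℝ (P X) (P Y) := VectorField.lieBracketWithin_univ
    exact congrFun e (φ x)
  rw [hb, VectorField.lieBracket, map_sub]
  abel
end
end QC
end

/-! ### The field algebra of an open set -/

noncomputable section

namespace QC

variable {n : ℕ} {M : Type*} [TopologicalSpace M]
  [ChartedSpace (EuclideanSpace ℝ (Fin (4 * n + 3))) M] [IsManifold (𝓡 (4 * n + 3)) ∞ M]
  {U : Set M}

omit [IsManifold (𝓡 (4 * n + 3)) ∞ M] in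
theorem d_congr (hU : IsOpen U) {x : M} (hx : x ∈ U) {f g : M → ℝ} (h : ∀ y ∈ U, f y = g y) :
    d n f x = d n g x := by
  have h1 : f =ᶠ[nhds x] g := Filter.eventually_of_mem (hU.mem_nhds hx) h
  unfold d mvfderiv
  rw [h1.mfderiv_eq, h1.eq_of_nhds]

omit [IsManifold (𝓡 (4 * n + 3)) ∞ M] in
theorem bracket_congr (hU : IsOpen U) {x : M} (hx : x ∈ U) {X X' Y Y' : ∀ x : M, Tan n x}
    (h : ∀ y ∈ U, X y = X' y) (h' : ∀ y ∈ U, Y y = Y' y) : bracket X Y x = bracket X' Y' x :=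
  Filter.EventuallyEq.mlieBracket_vectorField_eq
    (Filter.eventually_of_mem (hU.mem_nhds hx) h) (Filter.eventually_of_mem (hU.mem_nhds hx) h')

theorem conn_congr (conn : CovariantDerivative (𝓡 (4 * n + 3))
    (EuclideanSpace ℝ (Fin (4 * n + 3))) (TangentSpace (𝓡 (4 * n + 3)) : M → Type _))
    (hU : IsOpen U) {x : M} (hx : x ∈ U) {X Y : ∀ x : M, Tan n x} (hX : SmoothField U X)
    (h : ∀ y ∈ U, X y = Y y) : conn X x = conn Y x :=
  conn.isCovariantDerivativeOnUniv.congr_of_eventuallyEq (hX.mdifferentiableAt hU hx)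
    ((hX.congr fun y hy => (h y hy).symm).mdifferentiableAt hU hx) Filter.univ_mem
    (Filter.eventually_of_mem (hU.mem_nhds hx) h)

omit [IsManifold (𝓡 (4 * n + 3)) ∞ M] in
theorem smoothFun_const (c : ℝ) : SmoothFun n U fun _ => c := contMDiffOn_const

omit [IsManifold (𝓡 (4 * n + 3)) ∞ M] in
theorem SmoothFun.add {f g : M → ℝ} (hf : SmoothFun n U f) (hg : SmoothFun n U g) :
    SmoothFun n U fun y => f y + g y := ContMDiffOn.add hf hg

omit [IsManifold (𝓡 (4 * n + 3)) ∞ M] in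
theorem SmoothFun.mul {f g : M → ℝ} (hf : SmoothFun n U f) (hg : SmoothFun n U g) :
    SmoothFun n U fun y => f y * g y :=
  (contDiff_mul.contMDiff (n := ∞)).comp_contMDiffOn (ContMDiffOn.prodMk_space hf hg)

theorem smoothField_zero : SmoothField U (fun _ => 0 : ∀ x : M, Tan n x) :=
  ((Bundle.contMDiff_zeroSection ℝ (fun x : M => Tan n x)).contMDiffOn)

/-- The algebra of smooth functions on `U`. -/
def smoothSubalgebra (n : ℕ) {M : Type*} [TopologicalSpace M]
    [ChartedSpace (EuclideanSpace ℝ (Fin (4 * n + 3))) M] [IsManifold (𝓡 (4 * n + 3)) ∞ M]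
    (U : Set M) : Subalgebra ℝ (U → ℝ) where
  carrier := {a | ∃ f : M → ℝ, SmoothFun n U f ∧ ∀ y : U, f y = a y}
  mul_mem' := by
    rintro a b ⟨f, hf, hfa⟩ ⟨g, hg, hgb⟩
    exact ⟨_, hf.mul hg, fun y => by simp [hfa, hgb]⟩
  add_mem' := by
    rintro a b ⟨f, hf, hfa⟩ ⟨g, hg, hgb⟩
    exact ⟨_, hf.add hg, fun y => by simp [hfa, hgb]⟩
  algebraMap_mem' r := ⟨fun _ => r, smoothFun_const r, fun _ => rfl⟩

/-- The module of smooth vector fields on `U`. -/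
def smoothSubmodule (n : ℕ) {M : Type*} [TopologicalSpace M]
    [ChartedSpace (EuclideanSpace ℝ (Fin (4 * n + 3))) M] [IsManifold (𝓡 (4 * n + 3)) ∞ M]
    (U : Set M) : Submodule (smoothSubalgebra n U) (∀ y : U, Tan n (y : M)) where
  carrier := {X | ∃ F : ∀ x : M, Tan n x, SmoothField U F ∧ ∀ y : U, F y = X y}
  add_mem' := by
    rintro a b ⟨f, hf, hfa⟩ ⟨g, hg, hgb⟩
    exact ⟨_, hf.add hg, fun y => by simp [hfa, hgb]⟩
  zero_mem' := ⟨_, smoothField_zero, fun y => rfl⟩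
  smul_mem' := by
    rintro ⟨c, f, hf, hfc⟩ X ⟨F, hF, hFX⟩
    exact ⟨_, SmoothField.smul hf hF, fun y => by simp only [hfc, hFX]; rfl⟩

/-- The algebra of smooth functions on `U`. -/
def FunOn (n : ℕ) {M : Type*} [TopologicalSpace M]
    [ChartedSpace (EuclideanSpace ℝ (Fin (4 * n + 3))) M] [IsManifold (𝓡 (4 * n + 3)) ∞ M]
    (U : Set M) : Type _ := smoothSubalgebra n U

/-- The module of smooth vector fields on `U`. -/
def FieldOn (n : ℕ) {M : Type*} [TopologicalSpace M]
    [ChartedSpace (EuclideanSpace ℝ (Fin (4 * n + 3))) M] [IsManifold (𝓡 (4 * n + 3)) ∞ M]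
    (U : Set M) : Type _ := smoothSubmodule n U

instance : CommRing (FunOn n U) := inferInstanceAs (CommRing (smoothSubalgebra n U))
instance : Algebra ℝ (FunOn n U) := inferInstanceAs (Algebra ℝ (smoothSubalgebra n U))
instance : AddCommGroup (FieldOn n U) := inferInstanceAs (AddCommGroup (smoothSubmodule n U))
instance : Module (FunOn n U) (FieldOn n U) :=
  inferInstanceAs (Module (smoothSubalgebra n U) (smoothSubmodule n U))

/-- a smooth function as an element of `FunOn` -/
def SmoothFun.mk {f : M → ℝ} (hf : SmoothFun n U f) : FunOn n U := ⟨fun y => f y, f, hf, fun _ => rfl⟩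

/-- a smooth field as an element of `FieldOn` -/
def SmoothField.mk {X : ∀ x : M, Tan n x} (hX : SmoothField U X) : FieldOn n U :=
  ⟨fun y => X y, X, hX, fun _ => rfl⟩

/-- a smooth function representing an element of `FunOn` -/
def fn (a : FunOn n U) : M → ℝ := a.2.choose

/-- a smooth field representing an element of `FieldOn` -/
def fld (X : FieldOn n U) : ∀ x : M, Tan n x := X.2.choose

theorem smooth_fn (a : FunOn n U) : SmoothFun n U (fn a) := a.2.choose_spec.1
theorem smooth_fld (X : FieldOn n U) : SmoothField U (fld X) := X.2.choose_spec.1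
theorem fn_apply (a : FunOn n U) {y} (hy : y ∈ U) : fn a y = a.1 ⟨y, hy⟩ := a.2.choose_spec.2 ⟨y, hy⟩
theorem fld_apply (X : FieldOn n U) {y} (hy : y ∈ U) : fld X y = X.1 ⟨y, hy⟩ :=
  X.2.choose_spec.2 ⟨y, hy⟩

theorem fn_mk {f : M → ℝ} (hf : SmoothFun n U f) {y} (hy : y ∈ U) : fn hf.mk y = f y := fn_apply _ hy
theorem fld_mk {X : ∀ x : M, Tan n x} (hX : SmoothField U X) {y} (hy : y ∈ U) :
    fld hX.mk y = X y := fld_apply _ hy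

/-- Elements live on the subtype U; the values of chosen representatives outside U carry no
information. -/
theorem fun_ext {a b : FunOn n U} (h : ∀ y ∈ U, fn a y = fn b y) : a = b :=
  Subtype.ext <| funext fun y => by rw [← fn_apply a y.2, ← fn_apply b y.2, h y y.2]
theorem fld_ext {a b : FieldOn n U} (h : ∀ y ∈ U, fld a y = fld b y) : a = b :=
  Subtype.ext <| funext fun y => by rw [← fld_apply a y.2, ← fld_apply b y.2, h y y.2]

section
variable {y : M} (hy : y ∈ U) (a b : FunOn n U) (X Y : FieldOn n U)
include hy
theorem fn_add : fn (a + b) y = fn a y + fn b y := by simp only [fn_apply _ hy]; rfl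
theorem fn_sub : fn (a - b) y = fn a y - fn b y := by simp only [fn_apply _ hy]; rfl
theorem fn_mul : fn (a * b) y = fn a y * fn b y := by simp only [fn_apply _ hy]; rfl
theorem fld_add : fld (X + Y) y = fld X y + fld Y y := by simp only [fld_apply _ hy]; rfl
theorem fld_sub : fld (X - Y) y = fld X y - fld Y y := by simp only [fld_apply _ hy]; rfl
theorem fld_neg : fld (-X) y = -fld X y := by simp only [fld_apply _ hy]; rfl
theorem fld_smul : fld (a • X) y = fn a y • fld X y := by
  simp only [fld_apply _ hy, fn_apply _ hy]; rfl
end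

theorem fn_sum {ι : Type*} (s : Finset ι) (a : ι → FunOn n U) {y : M} (hy : y ∈ U) :
    fn (∑ i ∈ s, a i) y = ∑ i ∈ s, fn (a i) y := by
  classical
  induction s using Finset.induction_on with
  | empty => simp only [Finset.sum_empty, fn_apply _ hy]; rfl
  | insert i s hi ih => rw [Finset.sum_insert hi, Finset.sum_insert hi, fn_add hy, ih]

theorem fld_sum {ι : Type*} (s : Finset ι) (X : ι → FieldOn n U) {y : M} (hy : y ∈ U) :
    fld (∑ i ∈ s, X i) y = ∑ i ∈ s, fld (X i) y := by
  classical
  induction s using Finset.induction_on with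
  | empty => simp only [Finset.sum_empty, fld_apply _ hy]; rfl
  | insert i s hi ih => rw [Finset.sum_insert hi, Finset.sum_insert hi, fld_add hy, ih]

/-- evaluation at a point -/
def evalAt {y : M} (hy : y ∈ U) : FunOn n U →ₐ[ℝ] ℝ :=
  (Pi.evalAlgHom ℝ (fun _ : U => ℝ) ⟨y, hy⟩).comp (smoothSubalgebra n U).val

theorem evalAt_apply {y : M} (hy : y ∈ U) (a : FunOn n U) : evalAt hy a = fn a y :=
  (fn_apply a hy).symm

variable [T2Space M] (conn : CovariantDerivative (𝓡 (4 * n + 3))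
    (EuclideanSpace ℝ (Fin (4 * n + 3))) (TangentSpace (𝓡 (4 * n + 3)) : M → Type _))
    (hc : CovariantDerivative.ContMDiffCovariantDerivative conn ∞) (hU : IsOpen U)

/-- The algebra of vector fields on an open set of a manifold with a connection. -/
def fieldAlgebra : FieldAlgebra (FunOn n U) (FieldOn n U) where
  D X a := ((smooth_fn a).d_apply hU (smooth_fld X)).mk
  br X Y := ((smooth_fld X).bracket hU (smooth_fld Y)).mk
  nab X Y := (SmoothField.conn hc hU (smooth_fld X) (smooth_fld Y)).mk
  D_add X a b := fun_ext fun y hy => by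
    rw [fn_add hy, fn_mk _ hy, fn_mk _ hy, fn_mk _ hy,
      d_congr hU hy (g := fn a + fn b) fun z hz => fn_add hz a b]
    exact congrArg (fun L => L (fld X y)) (mvfderiv_add ((smooth_fn a).mdifferentiableAt hU hy)
      ((smooth_fn b).mdifferentiableAt hU hy))
  D_mul X a b := fun_ext fun y hy => by
    rw [fn_add hy, fn_mul hy, fn_mul hy, fn_mk _ hy, fn_mk _ hy, fn_mk _ hy,
      d_congr hU hy (g := fn a * fn b) fun z hz => fn_mul hz a b]
    exact congrArg (fun L => L (fld X y)) (mvfderiv_mul ((smooth_fn a).mdifferentiableAt hU hy)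
      ((smooth_fn b).mdifferentiableAt hU hy))
  D_add_left X Y a := fun_ext fun y hy => by
    rw [fn_add hy, fn_mk _ hy, fn_mk _ hy, fn_mk _ hy, fld_add hy, map_add]
  D_smul_left c X a := fun_ext fun y hy => by
    rw [fn_mul hy, fn_mk _ hy, fn_mk _ hy, fld_smul hy, map_smul, smul_eq_mul]
  br_antisymm X Y := fld_ext fun y hy => by
    rw [fld_neg hy, fld_mk _ hy, fld_mk _ hy]
    exact VectorField.mlieBracket_swap_apply
  br_add X Y Z := fld_ext fun y hy => by
    rw [fld_add hy, fld_mk _ hy, fld_mk _ hy, fld_mk _ hy,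
      bracket_congr hU hy (Y' := fld Y + fld Z) (fun _ _ => rfl) fun z hz => fld_add hz Y Z]
    exact VectorField.mlieBracket_add_right ((smooth_fld Y).mdifferentiableAt hU hy)
      ((smooth_fld Z).mdifferentiableAt hU hy)
  br_smul X c Y := fld_ext fun y hy => by
    rw [fld_add hy, fld_smul hy, fld_smul hy, fn_mk _ hy, fld_mk _ hy, fld_mk _ hy,
      bracket_congr hU hy (Y' := fn c • fld Y) (fun _ _ => rfl) fun z hz => fld_smul hz c Y]
    exact VectorField.mlieBracket_smul_right ((smooth_fn c).mdifferentiableAt hU hy)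
      ((smooth_fld Y).mdifferentiableAt hU hy)
  jacobi X Y Z := fld_ext fun y hy => by
    have e : ∀ X Y : FieldOn n U, ∀ z ∈ U, fld ((smooth_fld X).bracket hU (smooth_fld Y)).mk z =
      bracket (fld X) (fld Y) z := fun X Y z hz => fld_mk _ hz
    rw [fld_add hy, e _ _ y hy, e _ _ y hy, e _ _ y hy,
      bracket_congr hU hy (fun _ _ => rfl) (e Y Z), bracket_congr hU hy (e X Y) (fun _ _ => rfl),
      bracket_congr hU hy (fun _ _ => rfl) (e X Z)]
    have h2 : ∀ X : FieldOn n U, ContMDiffAt (𝓡 (4 * n + 3)) (𝓡 (4 * n + 3)).tangent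
        (minSmoothness ℝ 2) (fun x => (⟨x, fld X x⟩ : TangentBundle (𝓡 (4 * n + 3)) M)) y :=
      fun X => by
        rw [minSmoothness_of_isRCLikeNormedField]
        exact (ContMDiffOn.contMDiffAt (smooth_fld X) (hU.mem_nhds hy)).of_le
          (WithTop.coe_le_coe.2 le_top)
    exact VectorField.leibniz_identity_mlieBracket_apply (h2 X) (h2 Y) (h2 Z)
  D_br X Y a := fun_ext fun y hy => by
    have e : ∀ X : FieldOn n U, ∀ z ∈ U, fn ((smooth_fn a).d_apply hU (smooth_fld X)).mk z =
      d n (fn a) z (fld X z) := fun X z hz => fn_mk _ hz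
    rw [fn_sub hy, fn_mk _ hy, fn_mk _ hy, fn_mk _ hy, fld_mk _ hy, d_congr hU hy (e X),
      d_congr hU hy (e Y)]
    exact d_bracket hU (smooth_fn a) (smooth_fld X) (smooth_fld Y) hy
  nab_add_left X Y Z := fld_ext fun y hy => by
    rw [fld_add hy, fld_mk _ hy, fld_mk _ hy, fld_mk _ hy, fld_add hy, map_add]
  nab_smul_left c X Z := fld_ext fun y hy => by
    rw [fld_smul hy, fld_mk _ hy, fld_mk _ hy, fld_smul hy, map_smul]
  nab_add X Y Z := fld_ext fun y hy => by
    rw [fld_add hy, fld_mk _ hy, fld_mk _ hy, fld_mk _ hy,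
      conn_congr conn hU hy (Y := fld Y + fld Z) (smooth_fld _) fun z hz => fld_add hz Y Z]
    exact congrArg (fun L => L (fld X y)) (conn.isCovariantDerivativeOnUniv.add
      ((smooth_fld Y).mdifferentiableAt hU hy) ((smooth_fld Z).mdifferentiableAt hU hy))
  nab_smul X c Y := fld_ext fun y hy => by
    rw [fld_add hy, fld_smul hy, fld_smul hy, fld_mk _ hy, fld_mk _ hy, fn_mk _ hy,
      conn_congr conn hU hy (Y := fn c • fld Y) (smooth_fld _) fun z hz => fld_smul hz c Y]
    have := conn.isCovariantDerivativeOnUniv.leibniz ((smooth_fld Y).mdifferentiableAt hU hy)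
      ((smooth_fn c).mdifferentiableAt hU hy)
    have h2 := congrArg (fun L => L (fld X y)) this
    exact h2.trans (add_comm _ _)

end QC
end

/-! ### Tensoriality: invariants computed from arbitrary smooth extensions -/

noncomputable section

namespace QC

namespace FieldAlgebra
variable {A 𝔛 : Type*} [CommRing A] [AddCommGroup 𝔛] [Module A 𝔛] (P : FieldAlgebra A 𝔛)

/-- the covariant Hessian -/
def hess (a : A) : 𝔛 →ₗ[A] 𝔛 →ₗ[A] A :=
  LinearMap.mk₂ A (fun X Y => P.D X (P.D Y a) - P.D (P.nab X Y) a)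
    (fun X X' Y => by simp only [P.nab_add_left, P.D_add_left]; ring)
    (fun c X Y => by simp only [P.nab_smul_left, P.D_smul_left, smul_eq_mul]; ring)
    (fun X Y Y' => by simp only [P.nab_add, P.D_add_left, P.D_add]; ring)
    (fun c X Y => by
      simp only [P.nab_smul, P.D_add_left, P.D_smul_left, P.D_mul, smul_eq_mul]; ring)

/-- the exterior derivative of a 1-form -/
def extDer (θ : 𝔛 →ₗ[A] A) : 𝔛 →ₗ[A] 𝔛 →ₗ[A] A :=
  LinearMap.mk₂ A (fun X Y => P.D X (θ Y) - P.D Y (θ X) - θ (P.br X Y))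
    (fun X X' Y => by simp only [P.br_add_left, P.D_add_left, P.D_add, map_add]; ring)
    (fun c X Y => by
      simp only [P.br_smul_left, P.D_smul_left, P.D_mul, map_sub, map_smul, smul_eq_mul]; ring)
    (fun X Y Y' => by simp only [P.br_add, P.D_add_left, P.D_add, map_add]; ring)
    (fun c X Y => by
      simp only [P.br_smul, P.D_smul_left, P.D_mul, map_add, map_smul, smul_eq_mul]; ring)

theorem hess_apply (a X Y) : P.hess a X Y = P.D X (P.D Y a) - P.D (P.nab X Y) a := rfl
theorem extDer_apply (θ X Y) : P.extDer θ X Y = P.D X (θ Y) - P.D Y (θ X) - θ (P.br X Y) := rfl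
end FieldAlgebra

variable {n : ℕ} {M : Type*} [TopologicalSpace M]
  [ChartedSpace (EuclideanSpace ℝ (Fin (4 * n + 3))) M] [IsManifold (𝓡 (4 * n + 3)) ∞ M]
  {U : Set M}

/-- the coordinate functions of the chart at `c` -/
def coord (n : ℕ) {M : Type*} [TopologicalSpace M]
    [ChartedSpace (EuclideanSpace ℝ (Fin (4 * n + 3))) M] (c : M) (i : Fin (4 * n + 3)) (y : M) : ℝ :=
  chartAt (EuclideanSpace ℝ (Fin (4 * n + 3))) c y i

/-- the field with constant components in the chart at `c` -/
def constField (c : M) (w : EuclideanSpace ℝ (Fin (4 * n + 3))) (y : M) : Tan n y :=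
  (trivializationAt (EuclideanSpace ℝ (Fin (4 * n + 3)))
    (TangentSpace (𝓡 (4 * n + 3)) : M → Type _) c).symmL ℝ y w

theorem smooth_constField (c : M) (w : EuclideanSpace ℝ (Fin (4 * n + 3))) :
    SmoothField (chartAt (EuclideanSpace ℝ (Fin (4 * n + 3))) c).source
      (constField c w : ∀ y : M, Tan n y) := by
  set e := trivializationAt (EuclideanSpace ℝ (Fin (4 * n + 3)))
    (TangentSpace (𝓡 (4 * n + 3)) : M → Type _) c with he
  have : ContMDiffOn (𝓡 (4 * n + 3)) (𝓡 (4 * n + 3)).tangent ∞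
    (fun x => (⟨x, constField c w x⟩ : TangentBundle (𝓡 (4 * n + 3)) M)) e.baseSet := by
    refine (Bundle.Trivialization.contMDiffOn_iff (e := e) fun x hx => ?_).2 ⟨?_, ?_⟩
    · exact (e.mem_source).2 hx
    · exact contMDiffOn_id
    · refine (contMDiffOn_const (c := w)).congr fun x hx => ?_
      have h1 : constField c w x = e.symm x w := e.symmL_apply hx w
      rw [h1]
      exact congrArg Prod.snd (e.apply_mk_symm hx w)
  exact this

theorem smooth_coord (c : M) (i : Fin (4 * n + 3)) :
    SmoothFun n (chartAt (EuclideanSpace ℝ (Fin (4 * n + 3))) c).source (coord n c i) :=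
  ((EuclideanSpace.proj i : EuclideanSpace ℝ (Fin (4 * n + 3)) →L[ℝ] ℝ).contDiff.contMDiff (n := ∞)).comp_contMDiffOn
    (contMDiffOn_chart (I := 𝓡 (4 * n + 3)) (x := c))

theorem d_coord (c : M) (i : Fin (4 * n + 3)) {y : M}
    (hy : y ∈ (chartAt (EuclideanSpace ℝ (Fin (4 * n + 3))) c).source) (v : Tan n y) :
    d n (coord n c i) y v = (show EuclideanSpace ℝ (Fin (4 * n + 3)) from
      (trivializationAt (EuclideanSpace ℝ (Fin (4 * n + 3)))
      (TangentSpace (𝓡 (4 * n + 3)) : M → Type _) c).continuousLinearMapAt ℝ y v) i := by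
  rw [TangentBundle.continuousLinearMapAt_trivializationAt hy]
  have h3 := mvfderiv_comp_apply (I := 𝓡 (4 * n + 3))
      (I' := 𝓘(ℝ, EuclideanSpace ℝ (Fin (4 * n + 3))))
      (g := (EuclideanSpace.proj i : EuclideanSpace ℝ (Fin (4 * n + 3)) →L[ℝ] ℝ)) (f := extChartAt (𝓡 (4 * n + 3)) c) y
      (EuclideanSpace.proj i : EuclideanSpace ℝ (Fin (4 * n + 3)) →L[ℝ] ℝ).differentiableAt.mdifferentiableAt
      (mdifferentiableAt_extChartAt hy) v
  refine h3.trans ?_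
  rw [mvfderiv, mfderiv_eq_fderiv, ContinuousLinearMap.fderiv]
  rfl

theorem d_coord_constField (c : M) (i j : Fin (4 * n + 3)) {y : M}
    (hy : y ∈ (chartAt (EuclideanSpace ℝ (Fin (4 * n + 3))) c).source) :
    d n (coord n c i) y (constField c (EuclideanSpace.single j 1) y) = if i = j then 1 else 0 := by
  rw [d_coord c i hy, constField, Bundle.Trivialization.continuousLinearMapAt_symmL _ hy]
  simp

theorem eq_sum_constField (c : M) {y : M}
    (hy : y ∈ (chartAt (EuclideanSpace ℝ (Fin (4 * n + 3))) c).source) (v : Tan n y) :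
    v = ∑ i, d n (coord n c i) y v • constField c (EuclideanSpace.single i 1) y := by
  set e := trivializationAt (EuclideanSpace ℝ (Fin (4 * n + 3)))
    (TangentSpace (𝓡 (4 * n + 3)) : M → Type _) c with he
  have h1 : (e.continuousLinearMapAt ℝ y v : EuclideanSpace ℝ (Fin (4 * n + 3))) =
      ∑ i, d n (coord n c i) y v • EuclideanSpace.single i 1 := by
    ext j
    simp only [d_coord c _ hy, ← he]
    simp [Finset.sum_apply, Pi.single_apply]
  have h2 := e.symmL_continuousLinearMapAt (R := ℝ) hy v
  have h3 := (congrArg (e.symmL ℝ y) h1).symm.trans h2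
  rw [map_sum] at h3
  simp only [map_smul] at h3
  exact h3.symm

theorem smooth_ext {x : M} (v : Tan n x) :
    SmoothField (chartAt (EuclideanSpace ℝ (Fin (4 * n + 3))) x).source (ext v) :=
  (smooth_constField x _).congr fun _ hy => (Bundle.Trivialization.symmL_apply _ hy _).symm

theorem ext_self {x : M} (v : Tan n x) : ext v x = v := FiberBundle.extend_apply_self _ v

omit [IsManifold (𝓡 (4 * n + 3)) ∞ M] in
theorem exists_subset_source (hU : IsOpen U) {y : M} (hy : y ∈ U) : ∃ W : Set M, IsOpen W ∧ y ∈ W ∧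
    W ⊆ (chartAt (EuclideanSpace ℝ (Fin (4 * n + 3))) y).source ∧ W ⊆ U :=
  ⟨U ∩ (chartAt (EuclideanSpace ℝ (Fin (4 * n + 3))) y).source,
    hU.inter (chartAt _ y).open_source, ⟨hy, mem_chart_source _ y⟩, Set.inter_subset_right,
    Set.inter_subset_left⟩

/-- A field which vanishes at a point is a combination of fields whose coefficients vanish. -/
theorem exists_eq_sum (hU : IsOpen U) {c : M}
    (hc : U ⊆ (chartAt (EuclideanSpace ℝ (Fin (4 * n + 3))) c).source) (X : FieldOn n U) :
    ∃ (a : Fin (4 * n + 3) → FunOn n U) (Δ : Fin (4 * n + 3) → FieldOn n U), X = ∑ i, a i • Δ i ∧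
      ∀ y ∈ U, fld X y = 0 → ∀ i, fn (a i) y = 0 := by
  refine ⟨fun i => (((smooth_coord c i).mono hc).d_apply hU (smooth_fld X)).mk,
    fun i => ((smooth_constField c (EuclideanSpace.single i 1)).mono hc).mk, ?_, ?_⟩
  · refine fld_ext fun y hy => ?_
    rw [fld_sum _ _ hy]
    simp only [fld_smul hy, fn_mk _ hy, fld_mk _ hy]
    exact eq_sum_constField c (hc hy) _
  · intro y hy h0 i
    rw [fn_mk _ hy, h0, map_zero]

/-- In a chart, the difference of two fields agreeing at y is a combination of coordinate fields
with coefficients vanishing at y; linearity over functions finishes. -/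
theorem fn_map_congr (hU : IsOpen U) {c : M}
    (hc : U ⊆ (chartAt (EuclideanSpace ℝ (Fin (4 * n + 3))) c).source)
    (θ : FieldOn n U →ₗ[FunOn n U] FunOn n U) {X Y : FieldOn n U} {y : M} (hy : y ∈ U)
    (h : fld X y = fld Y y) : fn (θ X) y = fn (θ Y) y := by
  obtain ⟨a, Δ, h1, h2⟩ := exists_eq_sum hU hc (X - Y)
  have h3 := h2 y hy (by rw [fld_sub hy, h, sub_self])
  rw [← sub_eq_zero, ← fn_sub hy, ← map_sub, h1, map_sum, fn_sum _ _ hy]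
  exact Finset.sum_eq_zero fun i _ => by rw [map_smul, smul_eq_mul, fn_mul hy, h3, zero_mul]

theorem fld_map_congr (hU : IsOpen U) {c : M}
    (hc : U ⊆ (chartAt (EuclideanSpace ℝ (Fin (4 * n + 3))) c).source)
    (θ : FieldOn n U →ₗ[FunOn n U] FieldOn n U) {X Y : FieldOn n U} {y : M} (hy : y ∈ U)
    (h : fld X y = fld Y y) : fld (θ X) y = fld (θ Y) y := by
  obtain ⟨a, Δ, h1, h2⟩ := exists_eq_sum hU hc (X - Y)
  have h3 := h2 y hy (by rw [fld_sub hy, h, sub_self])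
  rw [← sub_eq_zero, ← fld_sub hy, ← map_sub, h1, map_sum, fld_sum _ _ hy]
  exact Finset.sum_eq_zero fun i _ => by rw [map_smul, fld_smul hy, h3, zero_smul]

/-- a smooth 1-form as a linear form -/
def SmoothForm.lin {η : ∀ x : M, Tan n x →L[ℝ] ℝ} (hη : SmoothForm U η) :
    FieldOn n U →ₗ[FunOn n U] FunOn n U where
  toFun X := (hη.apply (smooth_fld X)).mk
  map_add' X Y := fun_ext fun y hy => by
    rw [fn_add hy, fn_mk _ hy, fn_mk _ hy, fn_mk _ hy, fld_add hy, map_add]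
  map_smul' c X := fun_ext fun y hy => by
    rw [RingHom.id_apply, smul_eq_mul, fn_mul hy, fn_mk _ hy, fn_mk _ hy, fld_smul hy, map_smul,
      smul_eq_mul]

theorem fn_lin {η : ∀ x : M, Tan n x →L[ℝ] ℝ} (hη : SmoothForm U η) (X) {y} (hy : y ∈ U) :
    fn (hη.lin X) y = η y (fld X y) := fn_mk (hη.apply (smooth_fld X)) hy

section

variable [T2Space M] {conn : CovariantDerivative (𝓡 (4 * n + 3))
    (EuclideanSpace ℝ (Fin (4 * n + 3))) (TangentSpace (𝓡 (4 * n + 3)) : M → Type _)}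
    (hc : CovariantDerivative.ContMDiffCovariantDerivative conn ∞) (hU : IsOpen U)

theorem fn_D (X : FieldOn n U) (a : FunOn n U) {y} (hy : y ∈ U) :
    fn ((fieldAlgebra conn hc hU).D X a) y = d n (fn a) y (fld X y) :=
  fn_mk ((smooth_fn a).d_apply hU (smooth_fld X)) hy
theorem fld_br (X Y : FieldOn n U) {y} (hy : y ∈ U) :
    fld ((fieldAlgebra conn hc hU).br X Y) y = bracket (fld X) (fld Y) y :=
  fld_mk ((smooth_fld X).bracket hU (smooth_fld Y)) hy
theorem fld_nab (X Y : FieldOn n U) {y} (hy : y ∈ U) :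
    fld ((fieldAlgebra conn hc hU).nab X Y) y = conn (fld Y) y (fld X y) :=
  fld_mk (SmoothField.conn hc hU (smooth_fld X) (smooth_fld Y)) hy

variable {y : M} (hy : y ∈ U) {X Y Z : ∀ x : M, Tan n x} (hX : SmoothField U X)
  (hY : SmoothField U Y) (hZ : SmoothField U Z)

include hc hU hy hX hY

theorem fld_nab_mk : fld ((fieldAlgebra conn hc hU).nab hX.mk hY.mk) y = conn Y y (X y) := by
  rw [fld_nab hc hU _ _ hy, fld_mk _ hy, conn_congr conn hU hy (smooth_fld _)
    (fun z hz => fld_mk hY hz)]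

theorem fld_br_mk : fld ((fieldAlgebra conn hc hU).br hX.mk hY.mk) y = bracket X Y y := by
  rw [fld_br hc hU _ _ hy]
  exact bracket_congr hU hy (fun z hz => fld_mk hX hz) (fun z hz => fld_mk hY hz)

omit hY in
theorem fn_D_mk {f : M → ℝ} (hf : SmoothFun n U f) :
    fn ((fieldAlgebra conn hc hU).D hX.mk hf.mk) y = d n f y (X y) := by
  rw [fn_D hc hU _ _ hy, fld_mk _ hy, d_congr hU hy (f := fn hf.mk) (fun z hz => fn_mk hf hz)]

theorem fn_extDer_mk {η : ∀ x : M, Tan n x →L[ℝ] ℝ} (hη : SmoothForm U η) :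
    fn ((fieldAlgebra conn hc hU).extDer hη.lin hX.mk hY.mk) y = d n (fun z => η z (Y z)) y (X y)
        - d n (fun z => η z (X z)) y (Y y) - η y (bracket X Y y) := by
  have e : ∀ (X : ∀ x : M, Tan n x) (hX : SmoothField U X), ∀ z ∈ U,
      fn (hη.lin hX.mk) z = η z (X z) := fun X hX z hz => by
    rw [fn_lin hη _ hz, fld_mk _ hz]
  rw [FieldAlgebra.extDer_apply, fn_sub hy, fn_sub hy, fn_D hc hU _ _ hy, fn_D hc hU _ _ hy,
    fn_lin hη _ hy, fld_br_mk hc hU hy hX hY, fld_mk _ hy, fld_mk _ hy, d_congr hU hy (e X hX),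
    d_congr hU hy (e Y hY)]

theorem fn_hess_mk {f : M → ℝ} (hf : SmoothFun n U f) :
    fn ((fieldAlgebra conn hc hU).hess hf.mk hX.mk hY.mk) y =
      d n (fun z => d n f z (Y z)) y (X y) - d n f y (conn Y y (X y)) := by
  rw [FieldAlgebra.hess_apply, fn_sub hy, fn_D hc hU _ _ hy, fn_D hc hU _ _ hy,
    fld_nab_mk hc hU hy hX hY, fld_mk _ hy,
    d_congr hU hy (f := fn hf.mk) (fun z hz => fn_mk hf hz),
    d_congr hU hy fun z hz => fn_D_mk hc hU hz hY hf]

include hZ in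
theorem fld_R_mk : fld ((fieldAlgebra conn hc hU).R hX.mk hY.mk hZ.mk) y =
      conn (fun z => conn Z z (Y z)) y (X y)
      - conn (fun z => conn Z z (X z)) y (Y y) - conn Z y (bracket X Y y) := by
  rw [FieldAlgebra.R_apply, fld_sub hy, fld_sub hy, fld_nab hc hU _ _ hy, fld_nab hc hU _ _ hy,
    fld_nab hc hU _ _ hy, fld_br_mk hc hU hy hX hY, fld_mk _ hy, fld_mk _ hy,
    conn_congr conn hU hy (smooth_fld _) (fun z hz => fld_nab_mk hc hU hz hY hZ),
    conn_congr conn hU hy (smooth_fld _) (fun z hz => fld_nab_mk hc hU hz hX hZ),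
    conn_congr conn hU hy (smooth_fld _) (fun z hz => fld_mk hZ hz)]

/-- `dForm` is defined with the extensions `ext`, which are smooth only on a chart domain. After
shrinking to it, both sides are values of one tensor on fields agreeing at y. The Hessian and the
curvature are treated likewise. -/
theorem dForm_apply {η : ∀ x : M, Tan n x →L[ℝ] ℝ} (hη : SmoothForm U η) :
    dForm η y (X y) (Y y) = d n (fun z => η z (Y z)) y (X y) - d n (fun z => η z (X z)) y (Y y)
      - η y (bracket X Y y) := by
  obtain ⟨W, hWo, hyW, hWc, hWU⟩ := exists_subset_source (n := n) hU hy
  have e : ∀ v : Tan n y, SmoothField W (ext v) := fun v => (smooth_ext v).mono hWc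
  have e' : ∀ (X : ∀ x : M, Tan n x) (hX : SmoothField W X), fld (e (X y)).mk y = fld hX.mk y :=
    fun X hX => by rw [fld_mk _ hyW, fld_mk _ hyW, ext_self]
  have hη' : SmoothForm W η := ContMDiffOn.mono hη hWU
  rw [← fn_extDer_mk hc hWo hyW (hX.mono hWU) (hY.mono hWU) hη']
  have h1 := fn_extDer_mk hc hWo hyW (e (X y)) (e (Y y)) hη'
  rw [ext_self, ext_self] at h1
  rw [dForm, ← h1]
  have h2 := fn_map_congr hWo hWc ((fieldAlgebra conn hc hWo).extDer hη'.lin (e (X y)).mk) hyW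
    (e' Y (hY.mono hWU))
  have h3 := fn_map_congr hWo hWc (((fieldAlgebra conn hc hWo).extDer hη'.lin).flip
    (hY.mono hWU).mk) hyW (e' X (hX.mono hWU))
  rw [LinearMap.flip_apply, LinearMap.flip_apply] at h3
  rw [h2, h3]

theorem hess_apply {D : QCStructure n M} (B : BiquardConnection D) (hB : B.conn = conn) {f : M → ℝ}
    (hf : SmoothFun n U f) : B.hess f y (X y) (Y y) =
      d n (fun z => d n f z (Y z)) y (X y) - d n f y (conn Y y (X y)) := by
  obtain ⟨W, hWo, hyW, hWc, hWU⟩ := exists_subset_source (n := n) hU hy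
  have e : ∀ v : Tan n y, SmoothField W (ext v) := fun v => (smooth_ext v).mono hWc
  have e' : ∀ (X : ∀ x : M, Tan n x) (hX : SmoothField W X), fld (e (X y)).mk y = fld hX.mk y :=
    fun X hX => by rw [fld_mk _ hyW, fld_mk _ hyW, ext_self]
  have hf' : SmoothFun n W f := hf.mono hWU
  rw [← fn_hess_mk hc hWo hyW (hX.mono hWU) (hY.mono hWU) hf']
  have h1 := fn_hess_mk hc hWo hyW (e (X y)) (e (Y y)) hf'
  rw [ext_self] at h1
  rw [BiquardConnection.hess, hB, ← h1]
  have h2 := fn_map_congr hWo hWc ((fieldAlgebra conn hc hWo).hess hf'.mk (e (X y)).mk) hyW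
    (e' Y (hY.mono hWU))
  have h3 := fn_map_congr hWo hWc (((fieldAlgebra conn hc hWo).hess hf'.mk).flip
    (hY.mono hWU).mk) hyW (e' X (hX.mono hWU))
  rw [LinearMap.flip_apply, LinearMap.flip_apply] at h3
  rw [h2, h3]

include hZ in
theorem curv_apply {D : QCStructure n M} (B : BiquardConnection D) (hB : B.conn = conn) :
    B.curv y (X y) (Y y) (Z y) = conn (fun z => conn Z z (Y z)) y (X y)
      - conn (fun z => conn Z z (X z)) y (Y y) - conn Z y (bracket X Y y) := by
  obtain ⟨W, hWo, hyW, hWc, hWU⟩ := exists_subset_source (n := n) hU hy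
  have e : ∀ v : Tan n y, SmoothField W (ext v) := fun v => (smooth_ext v).mono hWc
  have e' : ∀ (X : ∀ x : M, Tan n x) (hX : SmoothField W X), fld (e (X y)).mk y = fld hX.mk y :=
    fun X hX => by rw [fld_mk _ hyW, fld_mk _ hyW, ext_self]
  rw [← fld_R_mk hc hWo hyW (hX.mono hWU) (hY.mono hWU) (hZ.mono hWU)]
  have h1 := fld_R_mk hc hWo hyW (e (X y)) (e (Y y)) (e (Z y))
  rw [ext_self, ext_self] at h1
  rw [BiquardConnection.curv, hB, ← h1]
  have h2 := fld_map_congr hWo hWc ((fieldAlgebra conn hc hWo).R (e (X y)).mk (e (Y y)).mk) hyW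
    (e' Z (hZ.mono hWU))
  have h3 := fld_map_congr hWo hWc (((fieldAlgebra conn hc hWo).RL (e (X y)).mk).flip
    (hZ.mono hWU).mk) hyW (e' Y (hY.mono hWU))
  have h4 := fld_map_congr hWo hWc (((fieldAlgebra conn hc hWo).RL.flip (hY.mono hWU).mk).flip
    (hZ.mono hWU).mk) hyW (e' X (hX.mono hWU))
  simp only [LinearMap.flip_apply, FieldAlgebra.RL_apply] at h3 h4
  rw [h2, h3, h4]

end

end QC
end

noncomputable section

namespace QC

variable {n : ℕ} {M : Type*} [TopologicalSpace M]
  [ChartedSpace (EuclideanSpace ℝ (Fin (4 * n + 3))) M] [IsManifold (𝓡 (4 * n + 3)) ∞ M]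
  {U : Set M}

/-! ### Pointwise properties of local frames -/

namespace QCStructure

variable {D : QCStructure n M} {η : Fin 3 → ∀ x : M, Tan n x →L[ℝ] ℝ}
  {J : Fin 3 → ∀ x : M, Module.End ℝ (D.H x)}

theorem LocalFrame.mono (h : D.LocalFrame U η J) {W : Set M} (hW : IsOpen W) (hWU : W ⊆ U) :
    D.LocalFrame W η J :=
  ⟨hW, fun s => ContMDiffOn.mono (h.smooth s) hWU, fun x hx => h.mem_iff x (hWU hx),
    fun x hx => h.sq x (hWU hx), fun x hx => h.mul x (hWU hx), fun x hx => h.mul' x (hWU hx),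
    fun x hx => h.hermitian x (hWU hx), fun x hx => h.span_eq x (hWU hx),
    fun x hx => h.compat x (hWU hx)⟩

section
variable {y : M} (hy : y ∈ U) (h : D.LocalFrame U η J)
include hy h

theorem LocalFrame.J_J (s) (u : D.H y) : J s y (J s y u) = -u :=
  congrArg (fun A => A u) (h.sq y hy s)

theorem LocalFrame.J_skew (s) (u v : D.H y) : D.g y (J s y u) v = -D.g y u (J s y v) := by
  rw [← h.hermitian y hy s u, h.J_J hy, map_neg, neg_neg]

theorem LocalFrame.J_self (s) (u : D.H y) : D.g y (J s y u) u = 0 := by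
  have := h.J_skew hy s u u
  rw [D.g_symm y u] at this
  linarith

theorem LocalFrame.J_cyc {i j k : Fin 3} (hc : Cyc i j k) (u : D.H y) :
    J i y (J j y u) = J k y u ∧ J j y (J i y u) = -J k y u := by
  have h1 : ∀ u, J 0 y (J 1 y u) = J 2 y u := fun u => congrArg (fun A => A u) (h.mul y hy)
  have h2 : ∀ u, J 1 y (J 0 y u) = -J 2 y u := fun u => congrArg (fun A => A u) (h.mul' y hy)
  have h3 : ∀ u, J 1 y (J 2 y u) = J 0 y u := fun u => by
    have := h2 (J 1 y u)
    rw [h1] at this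
    have e := congrArg (J 1 y) (h1 u)
    have e2 := h2 (J 1 y u)
    rw [← e, e2, ← h1, h.J_J hy, map_neg, neg_neg]
  have h4 : ∀ u, J 2 y (J 1 y u) = -J 0 y u := fun u => by
    rw [← h1, h.J_J hy, map_neg]
  have h5 : ∀ u, J 2 y (J 0 y u) = J 1 y u := fun u => by
    have := h2 (J 0 y u)
    rw [h.J_J hy, map_neg] at this
    exact (neg_injective this).symm
  have h6 : ∀ u, J 0 y (J 2 y u) = -J 1 y u := fun u => by
    rw [← h1, h.J_J hy]
  obtain ⟨rfl, rfl⟩ := hc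
  fin_cases i
  · exact ⟨h1 u, h2 u⟩
  · exact ⟨h3 u, h4 u⟩
  · exact ⟨h5 u, h6 u⟩

theorem LocalFrame.g_J_J (s t : Fin 3) (u : D.H y) :
    D.g y (J s y u) (J t y u) = if s = t then D.g y u u else 0 := by
  split_ifs with hst
  · subst hst; exact h.hermitian y hy s u u
  · obtain ⟨j, k, hc⟩ : ∃ j k, Cyc s j k := ⟨s + 1, s + 2, rfl, rfl⟩
    rw [D.g_symm, h.J_skew hy]
    rcases hc.eq_or_eq (Ne.symm hst) with rfl | rfl
    · rw [(h.J_cyc hy hc u).2, map_neg, neg_neg, D.g_symm, h.J_self hy]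
    · rw [(h.J_cyc hy hc.rot.rot u).1, D.g_symm, h.J_self hy, neg_zero]

end

omit [IsManifold (𝓡 (4 * n + 3)) ∞ M] in
theorem finrank_tan (x : M) : Module.finrank ℝ (Tan n x) = 4 * n + 3 :=
  finrank_euclideanSpace_fin (𝕜 := ℝ) (n := 4 * n + 3)

instance (x : M) : FiniteDimensional ℝ (Tan n x) :=
  inferInstanceAs (FiniteDimensional ℝ (EuclideanSpace ℝ (Fin (4 * n + 3))))

theorem eq_zero_of_g {y : M} {u : D.H y} (h : ∀ v, D.g y u v = 0) : u = 0 := by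
  by_contra hu
  exact (D.g_pos y u hu).ne' (h u)

theorem Orthonormal.linearIndependent {y : M} {k : ℕ} {e : Fin k → D.H y}
    (h : ∀ a b, D.g y (e a) (e b) = if a = b then 1 else 0) : LinearIndependent ℝ e := by
  rw [Fintype.linearIndependent_iff]
  intro c hc a
  have := congrArg (fun v => D.g y v (e a)) hc
  simpa [h] using this

theorem Orthonormal.isONB {y : M} {e : Fin (4 * n) → D.H y} (h : D.Orthonormal y e) :
    IsONB (D.g y) e := by
  refine ⟨D.g_symm y, h, fun v => ?_⟩
  have hli := Orthonormal.linearIndependent (D := D) h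
  have hsp : ⊤ ≤ Submodule.span ℝ (Set.range e) := by
    rw [hli.span_eq_top_of_card_eq_finrank' (by simp [D.finrank_H y])]
  obtain ⟨c, rfl⟩ := (Submodule.mem_span_range_iff_exists_fun ℝ).1 (hsp (Submodule.mem_top (x := v)))
  simp [h _ _]

end QCStructure

namespace BiquardConnection

variable {D : QCStructure n M} (B : BiquardConnection D) {η : Fin 3 → ∀ x : M, Tan n x →L[ℝ] ℝ}
  {J : Fin 3 → ∀ x : M, Module.End ℝ (D.H x)}

/-- The Reeb vectors of a local frame. -/
theorem exists_reeb_of_frame (h : D.LocalFrame U η J) {y : M} (hy : y ∈ U) (s : Fin 3) :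
    ∃ ξ : B.V y, ∀ t, η t y ξ = if s = t then 1 else 0 := by
  let L : B.V y →ₗ[ℝ] (Fin 3 → ℝ) :=
    LinearMap.pi fun t => (η t y : Tan n y →ₗ[ℝ] ℝ) ∘ₗ (B.V y).subtype
  have hinj : Function.Injective L := by
    rw [injective_iff_map_eq_zero]
    intro ξ hξ
    have h1 : (ξ : Tan n y) ∈ D.H y := (h.mem_iff y hy _).2 fun t => congrFun hξ t
    exact Subtype.ext ((Submodule.disjoint_def.1 (B.isCompl y).disjoint) _ h1 ξ.2)
  have hdim : Module.finrank ℝ (B.V y) = Module.finrank ℝ (Fin 3 → ℝ) := by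
    have h1 := Submodule.finrank_add_eq_of_isCompl (B.isCompl y)
    have h2 := QCStructure.finrank_tan (n := n) y
    have h3 := D.finrank_H y
    simp only [Module.finrank_fin_fun]
    omega
  obtain ⟨ξ, hξ⟩ := (LinearMap.injective_iff_surjective_of_finrank_eq_finrank hdim).1 hinj
    fun t => if s = t then 1 else 0
  exact ⟨ξ, fun t => congrFun hξ t⟩

open Classical in
/-- The Reeb fields of a local frame. -/
def reeb (η : Fin 3 → ∀ x : M, Tan n x →L[ℝ] ℝ) (s : Fin 3) (y : M) : B.V y :=
  if h : ∃ ξ : B.V y, ∀ t, η t y ξ = if s = t then 1 else 0 then h.choose else 0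

section
variable (h : D.LocalFrame U η J) {y : M} (hy : y ∈ U)
include h hy

theorem η_reeb (s t : Fin 3) : η t y (B.reeb η s y) = if s = t then 1 else 0 := by
  have := B.exists_reeb_of_frame h hy s
  rw [reeb, dif_pos this]
  exact this.choose_spec t

theorem hor_eq (v : Tan n y) :
    (B.hor y v : Tan n y) = v - ∑ s, η s y v • (B.reeb η s y : Tan n y) := by
  have h1 : v - ∑ s, η s y v • (B.reeb η s y : Tan n y) ∈ D.H y := by
    rw [h.mem_iff y hy]
    intro t
    simp [map_sub, map_sum, B.η_reeb h hy]
  have h2 : ∑ s, η s y v • (B.reeb η s y : Tan n y) ∈ B.V y :=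
    Submodule.sum_mem _ fun s _ => Submodule.smul_mem _ _ (B.reeb η s y).2
  have h3 : v = (v - ∑ s, η s y v • (B.reeb η s y : Tan n y))
    + ∑ s, η s y v • (B.reeb η s y : Tan n y) := by abel
  conv_lhs => rw [h3]
  rw [hor, map_add, (Submodule.projectionOnto_apply_eq_zero_iff _).2 h2, add_zero]
  exact congrArg Subtype.val (Submodule.projectionOnto_apply_left (B.isCompl y) ⟨_, h1⟩)

theorem mem_V_eq (v : Tan n y) (hv : v ∈ B.V y) :
    v = ∑ s, η s y v • (B.reeb η s y : Tan n y) := by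
  have h1 := B.hor_eq h hy v
  rw [hor, (Submodule.projectionOnto_apply_eq_zero_iff _).2 hv] at h1
  exact sub_eq_zero.1 h1.symm

theorem projection_V_eq (v : Tan n y) : (B.V y).projection (D.H y) (B.isCompl y).symm v =
    ∑ s, η s y v • (B.reeb η s y : Tan n y) := by
  have h1 := Submodule.projection_add_projection_eq_self (B.isCompl y) v
  have h2 := B.hor_eq h hy v
  have h3 : ((D.H y).projection (B.V y) (B.isCompl y)) v = B.hor y v := rfl
  rw [h3, h2] at h1
  have h4 := eq_sub_of_add_eq' h1
  rw [h4]; abel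

end

end BiquardConnection

end QC
end

noncomputable section

namespace QC

variable {n : ℕ} {M : Type*} [TopologicalSpace M]
  [ChartedSpace (EuclideanSpace ℝ (Fin (4 * n + 3))) M] [IsManifold (𝓡 (4 * n + 3)) ∞ M]
  {U : Set M}

/-! ### Smooth matrices -/

omit [IsManifold (𝓡 (4 * n + 3)) ∞ M] in
theorem SmoothFun.comp {f : M → ℝ} (hf : SmoothFun n U f) {φ : ℝ → ℝ}
    (hφ : ∀ y ∈ U, ContDiffAt ℝ ∞ φ (f y)) : SmoothFun n U fun y => φ (f y) := fun y hy =>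
  (hφ y hy).contMDiffAt.comp_contMDiffWithinAt y (hf y hy)

omit [IsManifold (𝓡 (4 * n + 3)) ∞ M] in
theorem SmoothFun.sum {ι : Type*} {s : Finset ι} {f : ι → M → ℝ}
    (hf : ∀ i ∈ s, SmoothFun n U (f i)) : SmoothFun n U fun y => ∑ i ∈ s, f i y := by
  classical
  induction s using Finset.induction_on with
  | empty => exact smoothFun_const 0
  | insert i s hi ih =>
    simp only [Finset.sum_insert hi]
    exact (hf i (Finset.mem_insert_self i s)).add
      (ih fun j hj => hf j (Finset.mem_insert_of_mem hj))

omit [IsManifold (𝓡 (4 * n + 3)) ∞ M] in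
theorem SmoothFun.continuousOn {f : M → ℝ} (hf : SmoothFun n U f) : ContinuousOn f U :=
  ContMDiffOn.continuousOn hf

omit [IsManifold (𝓡 (4 * n + 3)) ∞ M] in
theorem SmoothFun.neg {f : M → ℝ} (hf : SmoothFun n U f) : SmoothFun n U fun y => -f y :=
  hf.comp fun _ _ => contDiffAt_id.neg

omit [IsManifold (𝓡 (4 * n + 3)) ∞ M] in
theorem SmoothFun.const_mul {f : M → ℝ} (c : ℝ) (hf : SmoothFun n U f) :
    SmoothFun n U fun y => c * f y := hf.comp fun _ _ => contDiffAt_const.mul contDiffAt_id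

omit [IsManifold (𝓡 (4 * n + 3)) ∞ M] in
theorem SmoothFun.sub {f g : M → ℝ} (hf : SmoothFun n U f) (hg : SmoothFun n U g) :
    SmoothFun n U fun y => f y - g y := by
  simpa only [sub_eq_add_neg] using hf.add hg.neg

section
variable {m : Type*} [Fintype m] [DecidableEq m] {A : M → Matrix m m ℝ}
  (hA : ∀ i j, SmoothFun n U fun y => A y i j)

include hA

theorem mapMatrix_evalAt {y : M} (hy : y ∈ U) :
    (evalAt (n := n) hy).mapMatrix (Matrix.of fun i j => (hA i j).mk) = A y := by
  ext i j
  simp only [AlgHom.mapMatrix_apply, Matrix.map_apply, Matrix.of_apply, evalAt_apply]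
  exact fn_mk (hA i j) hy

theorem smoothFun_det : SmoothFun n U fun y => (A y).det :=
  (smooth_fn (Matrix.of fun i j => (hA i j).mk).det).congr fun y hy => by
    rw [← evalAt_apply hy, AlgHom.map_det, mapMatrix_evalAt hA hy]

theorem smoothFun_inv (hdet : ∀ y ∈ U, (A y).det ≠ 0) (i j : m) :
    SmoothFun n U fun y => (A y)⁻¹ i j := by
  have h1 : SmoothFun n U fun y => (A y).adjugate i j :=
    (smooth_fn ((Matrix.of fun i j => (hA i j).mk).adjugate i j)).congr fun y hy => by
      rw [← evalAt_apply hy, ← mapMatrix_evalAt hA hy, ← AlgHom.map_adjugate]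
      rfl
  refine (((smoothFun_det hA).comp (φ := fun t => t⁻¹)
    fun y hy => contDiffAt_inv ℝ (hdet y hy)).mul h1).congr fun y hy => ?_
  simp [Matrix.inv_def]

end

omit [IsManifold (𝓡 (4 * n + 3)) ∞ M] in
theorem isOpen_ne_zero (hU : IsOpen U) {f : M → ℝ} (hf : SmoothFun n U f) :
    IsOpen {y | y ∈ U ∧ f y ≠ 0} :=
  hf.continuousOn.isOpen_inter_preimage hU isOpen_ne

/-! ### Smooth horizontal sections of a local frame -/

namespace QCStructure

variable {D : QCStructure n M} {η : Fin 3 → ∀ x : M, Tan n x →L[ℝ] ℝ}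
  {J : Fin 3 → ∀ x : M, Module.End ℝ (D.H x)}

open Classical in
/-- the horizontal section given by a horizontal field -/
def toH (D : QCStructure n M) (F : ∀ x : M, Tan n x) (y : M) : D.H y :=
  if h : F y ∈ D.H y then ⟨F y, h⟩ else 0

theorem coe_toH {F : ∀ x : M, Tan n x} {y : M} (h : F y ∈ D.H y) : (D.toH F y : Tan n y) = F y := by
  rw [toH, dif_pos h]

theorem smoothSec_toH {F : ∀ x : M, Tan n x} (hF : SmoothField U F) (h : ∀ y ∈ U, F y ∈ D.H y) :
    SmoothSec D.H U (D.toH F) := SmoothField.congr hF fun y hy => coe_toH (h y hy)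

section
variable {W : ∀ x : M, Submodule ℝ (Tan n x)} {X Y : ∀ y : M, W y}

theorem SmoothSec.mono (hX : SmoothSec W U X) {V : Set M} (hV : V ⊆ U) : SmoothSec W V X :=
  SmoothField.mono hX hV
theorem SmoothSec.congr (hX : SmoothSec W U X) (h : ∀ y ∈ U, Y y = X y) : SmoothSec W U Y :=
  SmoothField.congr hX fun y hy => by rw [h y hy]
theorem SmoothSec.add (hX : SmoothSec W U X) (hY : SmoothSec W U Y) :
    SmoothSec W U fun y => X y + Y y := SmoothField.add hX hY
theorem SmoothSec.smul {f : M → ℝ} (hf : SmoothFun n U f) (hX : SmoothSec W U X) :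
    SmoothSec W U fun y => f y • X y := SmoothField.smul hf hX
theorem SmoothSec.sum {ι : Type*} [Fintype ι] {X : ι → ∀ y : M, W y} (hX : ∀ i, SmoothSec W U (X i)) :
    SmoothSec W U fun y => ∑ i, X i y :=
  SmoothField.congr (SmoothField.sum (s := Finset.univ) fun i _ => hX i) fun y _ => by simp
end

/-- Horizontal vectors extend to smooth horizontal fields. -/
theorem exists_extension (h : D.LocalFrame U η J) (B : BiquardConnection D) {p : M} (hp : p ∈ U) :
    ∃ W : Set M, IsOpen W ∧ p ∈ W ∧ W ⊆ U ∧
      W ⊆ (chartAt (EuclideanSpace ℝ (Fin (4 * n + 3))) p).source ∧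
      ∀ v : D.H p, ∃ X : ∀ y, D.H y, SmoothSec D.H W X ∧ X p = v := by
  set V := U ∩ (chartAt (EuclideanSpace ℝ (Fin (4 * n + 3))) p).source with hV
  have hVo : IsOpen V := h.isOpen.inter (chartAt _ p).open_source
  have hps := mem_chart_source (EuclideanSpace ℝ (Fin (4 * n + 3))) p
  have hc : ∀ v : Tan n p, SmoothField V (ext v) := fun v =>
    (smooth_ext v).mono Set.inter_subset_right
  set Z : Fin 3 → ∀ y : M, Tan n y := fun s => ext (B.reeb η s p : Tan n p) with hZ
  have hη : ∀ t, SmoothForm V (η t) := fun t => ContMDiffOn.mono (h.smooth t) Set.inter_subset_left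
  -- The matrix η_t(Z_s) for extensions Z_s of the Reeb vectors is the identity at p, hence
  -- invertible nearby; its inverse corrects any extension of a horizontal vector to lie in the
  -- kernel of η.
  set A : M → Matrix (Fin 3) (Fin 3) ℝ := fun y => Matrix.of fun s t => η t y (Z s y) with hA
  have hAs : ∀ s t, SmoothFun n V fun y => A y s t := fun s t => (hη t).apply (hc _)
  have hAp : A p = 1 := by
    ext s t
    simp only [hA, hZ, ext_self, Matrix.of_apply, B.η_reeb h hp, Matrix.one_apply]
  refine ⟨{y | y ∈ V ∧ (A y).det ≠ 0}, isOpen_ne_zero hVo (smoothFun_det hAs),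
    ⟨⟨hp, hps⟩, by simp [hAp]⟩, fun y hy => hy.1.1, fun y hy => hy.1.2, fun v => ?_⟩
  have hWV : {y | y ∈ V ∧ (A y).det ≠ 0} ⊆ V := fun y hy => hy.1
  set F : ∀ y : M, Tan n y := fun y =>
    ext (v : Tan n p) y - ∑ s, (∑ t, η t y (ext (v : Tan n p) y) * (A y)⁻¹ t s) • Z s y with hF
  have hFs : SmoothField {y | y ∈ V ∧ (A y).det ≠ 0} F := by
    have h1 : ∀ s, SmoothField {y | y ∈ V ∧ (A y).det ≠ 0} fun y =>
        (-∑ t, η t y (ext (v : Tan n p) y) * (A y)⁻¹ t s) • Z s y := fun s =>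
      SmoothField.smul (SmoothFun.neg <| SmoothFun.sum fun t _ =>
        ((SmoothForm.apply (hη t) (hc _)).mono hWV).mul
        (smoothFun_inv (fun i j => (hAs i j).mono hWV) (fun y hy => hy.2) t s)) ((hc _).mono hWV)
    refine (((hc (v : Tan n p)).mono hWV).add (SmoothField.sum (s := Finset.univ)
      fun s _ => h1 s)).congr fun y _ => ?_
    simp [hF, sub_eq_add_neg]
  have hFH : ∀ y ∈ {y | y ∈ V ∧ (A y).det ≠ 0}, F y ∈ D.H y := fun y hy => by
    rw [h.mem_iff y hy.1.1]
    intro r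
    have h1 : (A y)⁻¹ * A y = 1 := Matrix.nonsing_inv_mul _ (isUnit_iff_ne_zero.2 hy.2)
    have h2 : ∀ t, ∑ s, (A y)⁻¹ t s * η r y (Z s y) = if t = r then 1 else 0 := fun t => by
      have := congrArg (fun B => B t r) h1
      simpa [Matrix.mul_apply, hA, Matrix.one_apply] using this
    simp only [hF, map_sub, map_sum, map_smul, smul_eq_mul, Finset.sum_mul, mul_assoc]
    rw [Finset.sum_comm]
    simp only [← Finset.mul_sum, h2]
    simp
  refine ⟨D.toH F, smoothSec_toH hFs hFH, Subtype.ext ?_⟩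
  rw [coe_toH (hFH p ⟨⟨hp, hps⟩, by simp [hAp]⟩)]
  have : ∀ t, η t p (v : Tan n p) = 0 := (h.mem_iff p hp _).1 v.2
  simp [hF, ext_self, this]

variable [T2Space M] (B : BiquardConnection D)

theorem smoothFun_dForm (h : D.LocalFrame U η J) (B : BiquardConnection D) {X Y : ∀ y, D.H y}
    (hX : SmoothSec D.H U X)
    (hY : SmoothSec D.H U Y) (s) : SmoothFun n U fun y => dForm (η s) y (X y) (Y y) := by
  have h1 : SmoothFun n U fun y => d n (fun z => η s z (Y z)) y (X y) - d n (fun z => η s z (X z)) y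
      (Y y) - η s y (bracket (fun y => (X y : Tan n y)) (fun y => (Y y : Tan n y)) y) :=
    ((((h.smooth s).apply hY).d_apply h.isOpen hX).sub
      (((h.smooth s).apply hX).d_apply h.isOpen hY)).sub
      ((h.smooth s).apply (SmoothField.bracket h.isOpen hX hY))
  exact h1.congr fun y hy => dForm_apply B.smooth h.isOpen hy hX hY (h.smooth s)

/-- A horizontal section is smooth if its contractions with a symplectic form are. -/
theorem smoothSec_of_dForm (h : D.LocalFrame U η J) (B : BiquardConnection D)
    {X : Fin (4 * n) → ∀ y, D.H y}
    (hX : ∀ a, SmoothSec D.H U (X a)) (j : Fin 3)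
    (hdet : ∀ y ∈ U, (Matrix.of fun a b => dForm (η j) y (X a y) (X b y)).det ≠ 0)
    {F : ∀ y, D.H y} (hF : ∀ b, SmoothFun n U fun y => dForm (η j) y (F y) (X b y)) :
    SmoothSec D.H U F := by
  set Ω : M → Matrix (Fin (4 * n)) (Fin (4 * n)) ℝ := fun y =>
    Matrix.of fun a b => dForm (η j) y (X a y) (X b y) with hΩ
  have hs : ∀ a b, SmoothFun n U fun y => Ω y a b := fun a b => smoothFun_dForm h B (hX a) (hX b) j
  have h1 : SmoothSec D.H U fun y =>
      ∑ a, (∑ b, dForm (η j) y (F y) (X b y) * (Ω y)⁻¹ b a) • X a y :=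
    SmoothSec.sum fun a => (hX a).smul (SmoothFun.sum fun b _ => (hF b).mul
      (smoothFun_inv hs hdet b a))
  refine h1.congr fun y hy => ?_
  have hco : ∀ u v : D.H y, dForm (η j) y u v = 2 * D.g y (J j y u) v := fun u v =>
    (h.compat y hy j u v).symm
  have hunit : IsUnit (Ω y).det := isUnit_iff_ne_zero.2 (hdet y hy)
  have hli : LinearIndependent ℝ fun a => X a y := by
    rw [Fintype.linearIndependent_iff]
    intro c hc
    have h2 : (Ω y).mulVec c = 0 := by
      ext a
      have := congrArg (fun v => 2 * D.g y (J j y (X a y)) v) hc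
      simp only [map_sum, map_smul, smul_eq_mul, map_zero, mul_zero, Finset.mul_sum] at this
      simp only [Matrix.mulVec, dotProduct, hΩ, Matrix.of_apply, hco, Pi.zero_apply]
      rw [← this]
      exact Finset.sum_congr rfl fun b _ => by ring
    have h3 := congrArg ((Ω y)⁻¹).mulVec h2
    rw [Matrix.mulVec_mulVec, Matrix.nonsing_inv_mul _ hunit, Matrix.one_mulVec,
      Matrix.mulVec_zero] at h3
    exact fun i => congrFun h3 i
  have hsp : ⊤ ≤ Submodule.span ℝ (Set.range fun a => X a y) := by
    rw [hli.span_eq_top_of_card_eq_finrank' (by simp [D.finrank_H y])]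
  -- The section reconstructed from the contractions by inverting Ω. F − G has zero contraction with
  -- every X_c, and these span H.
  set G := ∑ a, (∑ b, dForm (η j) y (F y) (X b y) * (Ω y)⁻¹ b a) • X a y with hG
  have hinv : ∀ b c, ∑ a, (Ω y)⁻¹ b a * Ω y a c = if b = c then 1 else 0 := fun b c => by
    have := congrArg (fun B => B b c) (Matrix.nonsing_inv_mul _ hunit)
    simpa [Matrix.mul_apply, Matrix.one_apply] using this
  have h2 : ∀ c, D.g y (J j y (F y - G)) (X c y) = 0 := fun c => by
    have e1 : 2 * D.g y (J j y G) (X c y) = dForm (η j) y (F y) (X c y) := by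
      have e2 : ∀ a, 2 * D.g y (J j y (X a y)) (X c y) = Ω y a c := fun a => (hco _ _).symm
      rw [hG]
      simp only [map_sum, map_smul, LinearMap.coe_sum, Finset.sum_apply, LinearMap.smul_apply,
        smul_eq_mul, Finset.mul_sum, Finset.sum_mul]
      rw [Finset.sum_comm]
      have e3 : ∀ b, ∑ a, 2 * (dForm (η j) y (F y) (X b y) * (Ω y)⁻¹ b a *
          D.g y (J j y (X a y)) (X c y)) = dForm (η j) y (F y) (X b y) *
          ∑ a, (Ω y)⁻¹ b a * Ω y a c := fun b => by
        rw [Finset.mul_sum]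
        exact Finset.sum_congr rfl fun a _ => by rw [← e2]; ring
      simp only [e3, hinv]
      simp
    rw [map_sub, map_sub, LinearMap.sub_apply]
    have e4 := hco (F y) (X c y)
    linarith
  have h3 : J j y (F y - G) = 0 := by
    refine eq_zero_of_g (D := D) fun v => ?_
    obtain ⟨c, rfl⟩ := (Submodule.mem_span_range_iff_exists_fun ℝ).1
      (hsp (Submodule.mem_top (x := v)))
    rw [map_sum]
    exact Finset.sum_eq_zero fun c _ => by rw [map_smul, h2, smul_zero]
  have h4 := h.J_J hy j (F y - G)
  rw [h3, map_zero] at h4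
  exact sub_eq_zero.1 (neg_eq_zero.1 h4.symm)

end QCStructure

end QC
end

/-! ### Existence of smooth adapted frames -/

noncomputable section

namespace QC

variable {n : ℕ} {M : Type*} [TopologicalSpace M]
  [ChartedSpace (EuclideanSpace ℝ (Fin (4 * n + 3))) M] [IsManifold (𝓡 (4 * n + 3)) ∞ M]
  {U : Set M} [T2Space M]

namespace QCStructure

variable {D : QCStructure n M} {η : Fin 3 → ∀ x : M, Tan n x →L[ℝ] ℝ}
  {J : Fin 3 → ∀ x : M, Module.End ℝ (D.H x)}

/-- Near each point the complex structures of a local frame are smooth. -/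
theorem exists_smooth_J (h : D.LocalFrame U η J) (B : BiquardConnection D) {p : M} (hp : p ∈ U) :
    ∃ W : Set M, IsOpen W ∧ p ∈ W ∧ W ⊆ U ∧
      W ⊆ (chartAt (EuclideanSpace ℝ (Fin (4 * n + 3))) p).source ∧
      (∀ v : D.H p, ∃ X : ∀ y, D.H y, SmoothSec D.H W X ∧ X p = v) ∧
      ∀ V ⊆ W, IsOpen V → ∀ s, ∀ X : ∀ y, D.H y, SmoothSec D.H V X →
        SmoothSec D.H V fun y => J s y (X y) := by
  obtain ⟨W, hWo, hpW, hWU, hWc, hext⟩ := exists_extension h B hp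
  have hW := LocalFrame.mono h hWo hWU
  choose X hX hXp using fun a => hext (D.e p a)
  have he : D.Orthonormal p (D.e p) := (D.exists_orthonormal p).choose_spec
  set Ω : Fin 3 → M → Matrix (Fin (4 * n)) (Fin (4 * n)) ℝ := fun s y =>
    Matrix.of fun a b => dForm (η s) y (X a y) (X b y) with hΩ
  have hs : ∀ s a b, SmoothFun n W fun y => Ω s y a b := fun s a b =>
    smoothFun_dForm hW B (hX a) (hX b) s
  have hdp : ∀ s, (Ω s p).det ≠ 0 := fun s hd => by
    obtain ⟨c, hc0, hc⟩ := Matrix.exists_mulVec_eq_zero_iff.2 hd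
    set v := ∑ a, c a • D.e p a with hv
    have h1 : ∀ a, D.g p (J s p (D.e p a)) v = 0 := fun a => by
      have := congrFun hc a
      simp only [Matrix.mulVec, dotProduct, hΩ, Matrix.of_apply, Pi.zero_apply,
        ← h.compat p hp, hXp] at this
      have e : 2 * D.g p (J s p (D.e p a)) v = 0 := by
        rw [← this, hv, map_sum, Finset.mul_sum]
        exact Finset.sum_congr rfl fun b _ => by rw [map_smul, smul_eq_mul]; ring
      linarith
    have h2 : J s p v = 0 := eq_zero_of_g (D := D) fun w => by
      rw [(Orthonormal.isONB he).expand w, map_sum]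
      refine Finset.sum_eq_zero fun a _ => ?_
      rw [map_smul, h.J_skew hp, D.g_symm p v, h1, neg_zero, smul_zero]
    have h3 := h.J_J hp s v
    rw [h2, map_zero] at h3
    have h4 := (Fintype.linearIndependent_iff.1 (Orthonormal.linearIndependent (D := D) he)) c
      (by rw [← hv]; exact neg_eq_zero.1 h3.symm)
    exact hc0 (funext h4)
  set W' : Set M := {y | y ∈ {y | y ∈ {y | y ∈ W ∧ (Ω 0 y).det ≠ 0} ∧ (Ω 1 y).det ≠ 0} ∧
    (Ω 2 y).det ≠ 0} with hW'
  have hW'W : W' ⊆ W := fun y hy => hy.1.1.1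
  have hW'o : IsOpen W' := by
    have o1 := isOpen_ne_zero hWo (smoothFun_det (hs 0))
    have o2 := isOpen_ne_zero o1 ((smoothFun_det (hs 1)).mono fun y hy => hy.1)
    exact isOpen_ne_zero o2 ((smoothFun_det (hs 2)).mono fun y hy => hy.1.1)
  have hdet : ∀ s, ∀ y ∈ W', (Ω s y).det ≠ 0 := fun s y hy => by
    fin_cases s
    exacts [hy.1.1.2, hy.1.2, hy.2]
  refine ⟨W', hW'o, ⟨⟨⟨hpW, hdp 0⟩, hdp 1⟩, hdp 2⟩, hW'W.trans hWU, hW'W.trans hWc,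
    fun v => ?_, fun V hV hVo i Y hY => ?_⟩
  · obtain ⟨Y, hY, hYp⟩ := hext v
    exact ⟨Y, hY.mono hW'W, hYp⟩
  · obtain ⟨j, k, hc⟩ : ∃ j k, Cyc i j k := ⟨i + 1, i + 2, rfl, rfl⟩
    have hVW : V ⊆ W := hV.trans hW'W
    have hVf := LocalFrame.mono h hVo (hVW.trans hWU)
    refine smoothSec_of_dForm hVf B (fun a => (hX a).mono hVW) j (fun y hy => hdet j y (hV hy))
      fun b => ?_
    -- From J_j J_i = −J_k one has dη_j(J_i Y, ·) = −dη_k(Y, ·), whose smoothness does not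
    -- presuppose that of J_i.
    refine (smoothFun_dForm hVf B hY ((hX b).mono hVW) k).neg.congr fun y hy => ?_
    rw [← hVf.compat y hy, ← hVf.compat y hy, (hVf.J_cyc hy hc _).2, map_neg, LinearMap.neg_apply]
    ring

/-- g(X,Y) = −½ dη_0(J_0 X, Y): the metric is as smooth as the contact forms and the complex
structures. -/
theorem smoothFun_g (h : D.LocalFrame U η J) (B : BiquardConnection D)
    (hJ : ∀ s, ∀ X : ∀ y, D.H y, SmoothSec D.H U X → SmoothSec D.H U fun y => J s y (X y))
    {X Y : ∀ y, D.H y} (hX : SmoothSec D.H U X) (hY : SmoothSec D.H U Y) :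
    SmoothFun n U fun y => D.g y (X y) (Y y) := by
  refine ((smoothFun_dForm h B (hJ 0 X hX) hY 0).const_mul (-1 / 2)).congr fun y hy => ?_
  rw [← h.compat y hy, h.J_J hy, map_neg, LinearMap.neg_apply]
  ring

/-- Gram–Schmidt orthonormalization. -/
theorem exists_smooth_orthonormal (h : D.LocalFrame U η J) (B : BiquardConnection D)
    (hJ : ∀ V ⊆ U, IsOpen V → ∀ s, ∀ X : ∀ y, D.H y, SmoothSec D.H V X →
        SmoothSec D.H V fun y => J s y (X y)) {p : M} (hp : p ∈ U)
    (hext : ∀ v : D.H p, ∃ X : ∀ y, D.H y, SmoothSec D.H U X ∧ X p = v) (k : ℕ) (hk : k ≤ 4 * n) :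
    ∃ W ⊆ U, IsOpen W ∧ p ∈ W ∧ ∃ E : Fin k → ∀ y, D.H y, (∀ a, SmoothSec D.H W (E a)) ∧
      ∀ y ∈ W, ∀ a b, D.g y (E a y) (E b y) = if a = b then 1 else 0 := by
  induction k with
  | zero => exact ⟨U, subset_rfl, h.isOpen, hp, fun a => a.elim0, fun a => a.elim0,
      fun y _ a => a.elim0⟩
  | succ k ih =>
    obtain ⟨W, hWU, hWo, hpW, E, hE, hEo⟩ := ih (by omega)
    obtain ⟨v, hv⟩ : ∃ v : D.H p, v ∉ Submodule.span ℝ (Set.range fun a => E a p) := by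
      by_contra! hcon
      have h1 : Submodule.span ℝ (Set.range fun a => E a p) = ⊤ :=
        Submodule.eq_top_iff'.2 hcon
      have h2 := finrank_range_le_card (R := ℝ) (fun a => E a p)
      rw [Set.finrank, h1, finrank_top, D.finrank_H, Fintype.card_fin] at h2
      omega
    obtain ⟨X, hX, hXp⟩ := hext v
    have hWf := LocalFrame.mono h hWo hWU
    have hg : ∀ {X Y : ∀ y, D.H y}, SmoothSec D.H W X → SmoothSec D.H W Y →
        SmoothFun n W fun y => D.g y (X y) (Y y) := fun hX hY => smoothFun_g hWf B (hJ W hWU hWo) hX hY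
    set F : ∀ y, D.H y := fun y => X y + ∑ a, (-D.g y (X y) (E a y)) • E a y with hF
    have hXW := hX.mono hWU
    have hFs : SmoothSec D.H W F := hXW.add (SmoothSec.sum fun a => (hE a).smul (hg hXW (hE a)).neg)
    have hFE : ∀ y ∈ W, ∀ b, D.g y (F y) (E b y) = 0 := fun y hy b => by
      simp only [hF, map_add, map_sum, map_smul, LinearMap.add_apply, LinearMap.coe_sum,
        Finset.sum_apply, LinearMap.smul_apply, smul_eq_mul, hEo y hy]
      simp
    have hFp : F p ≠ 0 := fun h0 => hv <| by
      have e : v = ∑ a, (D.g p (X p) (E a p)) • E a p := by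
        have := h0
        simp only [hF, hXp, neg_smul, Finset.sum_neg_distrib, ← sub_eq_add_neg] at this
        rw [hXp]
        exact sub_eq_zero.1 this
      rw [e]
      exact Submodule.sum_mem _ fun a _ => Submodule.smul_mem _ _ (Submodule.subset_span ⟨a, rfl⟩)
    set V : Set M := {y | y ∈ W ∧ D.g y (F y) (F y) ≠ 0} with hV
    have hVW : V ⊆ W := fun y hy => hy.1
    have hVo : IsOpen V := isOpen_ne_zero hWo (hg hFs hFs)
    have hpos : ∀ y ∈ V, 0 < D.g y (F y) (F y) := fun y hy => D.g_pos y _ fun h0 => hy.2 (by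
      rw [h0]; simp)
    set E' : ∀ y, D.H y := fun y => (√(D.g y (F y) (F y)))⁻¹ • F y with hE'
    have hE's : SmoothSec D.H V E' := SmoothSec.smul
      (((hg hFs hFs).mono hVW).comp (φ := fun t => (√t)⁻¹) fun y hy =>
        ((Real.contDiffAt_sqrt (hpos y hy).ne').inv
          (Real.sqrt_pos.2 (hpos y hy)).ne')) (hFs.mono hVW)
    have hE'E : ∀ y ∈ V, ∀ b, D.g y (E' y) (E b y) = 0 := fun y hy b => by
      simp only [hE', map_smul, LinearMap.smul_apply, hFE y hy.1, smul_zero]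
    have hE'E' : ∀ y ∈ V, D.g y (E' y) (E' y) = 1 := fun y hy => by
      simp only [hE', map_smul, LinearMap.smul_apply, smul_eq_mul]
      have h1 := Real.mul_self_sqrt (hpos y hy).le
      have h2 := (Real.sqrt_pos.2 (hpos y hy)).ne'
      field_simp
      nlinarith [h1]
    refine ⟨V, hVW.trans hWU, hVo, ⟨hpW, (D.g_pos p _ hFp).ne'⟩,
      Fin.cases E' E, fun a => ?_, fun y hy a b => ?_⟩
    · refine Fin.cases ?_ (fun a => ?_) a
      exacts [hE's, (hE a).mono hVW]
    · refine Fin.cases (Fin.cases ?_ (fun b => ?_) b) (fun a => Fin.cases ?_ (fun b => ?_) b) a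
      · simpa using hE'E' y hy
      · simpa [Fin.succ_ne_zero, (Fin.succ_ne_zero _).symm] using hE'E y hy b
      · simpa [Fin.succ_ne_zero, (Fin.succ_ne_zero _).symm, D.g_symm y (E a y)] using hE'E y hy a
      · simpa [Fin.succ_inj] using hEo y hy.1 a b

end QCStructure

/-- A smooth frame of `TM` adapted to a qc structure with its Biquard connection. -/
structure AdaptedFrame {D : QCStructure n M} (B : BiquardConnection D) (U : Set M) where
  /-- contact forms -/
  η : Fin 3 → ∀ x : M, Tan n x →L[ℝ] ℝ
  /-- complex structures -/
  J : Fin 3 → ∀ x : M, Module.End ℝ (D.H x)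
  /-- orthonormal horizontal frame -/
  e : Fin (4 * n) → ∀ x, D.H x
  frame : D.LocalFrame U η J
  smooth_e : ∀ a, QCStructure.SmoothSec D.H U (e a)
  orth : ∀ y ∈ U, D.Orthonormal y fun a => e a y
  smooth_J : ∀ s, ∀ X : ∀ y, D.H y, QCStructure.SmoothSec D.H U X →
    QCStructure.SmoothSec D.H U fun y => J s y (X y)

/-- Adapted frames exist near each point. -/
theorem exists_adaptedFrame {D : QCStructure n M} (B : BiquardConnection D) (p : M) :
    ∃ U : Set M, p ∈ U ∧ U ⊆ (chartAt (EuclideanSpace ℝ (Fin (4 * n + 3))) p).source ∧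
      Nonempty (AdaptedFrame B U) := by
  obtain ⟨U, η, J, hp, h⟩ := D.exists_frame p
  obtain ⟨W, hWo, hpW, hWU, hWc, hext, hJ⟩ := QCStructure.exists_smooth_J h B hp
  have hW := QCStructure.LocalFrame.mono h hWo hWU
  obtain ⟨V, hVW, hVo, hpV, E, hE, hEo⟩ := QCStructure.exists_smooth_orthonormal hW B hJ hpW hext
    (4 * n) le_rfl
  exact ⟨V, hpV, hVW.trans hWc, ⟨⟨η, J, E, QCStructure.LocalFrame.mono hW hVo hVW, hE, hEo,
    hJ V hVW hVo⟩⟩⟩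

end QC
end

/-! ### The frame algebra of an adapted frame -/

noncomputable section

namespace QC

variable {n : ℕ} {M : Type*} [TopologicalSpace M]
  [ChartedSpace (EuclideanSpace ℝ (Fin (4 * n + 3))) M] [IsManifold (𝓡 (4 * n + 3)) ∞ M]
  {U : Set M} [T2Space M]

theorem fld_T {conn : CovariantDerivative (𝓡 (4 * n + 3))
    (EuclideanSpace ℝ (Fin (4 * n + 3))) (TangentSpace (𝓡 (4 * n + 3)) : M → Type _)}
    (hc : CovariantDerivative.ContMDiffCovariantDerivative conn ∞) (hU : IsOpen U)
    (X Y : FieldOn n U) {y} (hy : y ∈ U) :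
    fld ((fieldAlgebra conn hc hU).T X Y) y = conn.torsion y (fld X y) (fld Y y) := by
  rw [FieldAlgebra.T_apply, fld_sub hy, fld_sub hy, fld_nab hc hU _ _ hy, fld_nab hc hU _ _ hy,
    fld_br hc hU _ _ hy]
  exact (conn.torsion_apply ((smooth_fld X).mdifferentiableAt hU hy)
    ((smooth_fld Y).mdifferentiableAt hU hy)).symm

/-- a smooth section of a distribution as an element of `FieldOn` -/
def QCStructure.SmoothSec.mk {W : ∀ x : M, Submodule ℝ (Tan n x)} {X : ∀ x : M, W x}
    (h : QCStructure.SmoothSec W U X) : FieldOn n U :=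
  SmoothField.mk (X := fun y => (X y : Tan n y)) h

theorem fld_secMk {W : ∀ x : M, Submodule ℝ (Tan n x)} {X : ∀ x : M, W x}
    (h : QCStructure.SmoothSec W U X) {y : M} (hy : y ∈ U) : fld h.mk y = X y :=
  fld_mk (X := fun y => (X y : Tan n y)) h hy

namespace BiquardConnection
variable {D : QCStructure n M} (B : BiquardConnection D)

theorem hor_coe {y : M} (u : D.H y) : B.hor y (u : Tan n y) = u :=
  Submodule.projectionOnto_apply_left (B.isCompl y) u

theorem hor_of_mem_V {y : M} {v : Tan n y} (hv : v ∈ B.V y) : B.hor y v = 0 :=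
  (Submodule.projectionOnto_apply_eq_zero_iff _).2 hv

theorem coe_hor {y : M} {v : Tan n y} (hv : v ∈ D.H y) : (B.hor y v : Tan n y) = v :=
  congrArg Subtype.val (B.hor_coe ⟨v, hv⟩)

end BiquardConnection

namespace AdaptedFrame

variable {D : QCStructure n M} {B : BiquardConnection D} (F : AdaptedFrame B U)

include F in
theorem isOpen : IsOpen U := F.frame.isOpen

include F in
theorem smoothFun_g {X Y : ∀ y, D.H y} (hX : QCStructure.SmoothSec D.H U X)
    (hY : QCStructure.SmoothSec D.H U Y) : SmoothFun n U fun y => D.g y (X y) (Y y) :=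
  QCStructure.smoothFun_g F.frame B F.smooth_J hX hY

/-- the Reeb fields -/
def ξ (s : Fin 3) (y : M) : B.V y := B.reeb F.η s y

include F in
theorem η_ξ {y : M} (hy : y ∈ U) (s t : Fin 3) : F.η t y (F.ξ s y) = if s = t then 1 else 0 :=
  B.η_reeb F.frame hy s t

include F in
theorem η_hor {y : M} (hy : y ∈ U) (s) (u : D.H y) : F.η s y u = 0 :=
  (F.frame.mem_iff y hy _).1 u.2 s

include F in
/-- The torsion of horizontal fields. -/
theorem torsion_hor {X Y : ∀ y, D.H y} (hX : QCStructure.SmoothSec D.H U X)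
    (hY : QCStructure.SmoothSec D.H U Y) {y : M} (hy : y ∈ U) :
    B.conn.torsion y (X y) (Y y) =
      ∑ s, (2 * D.g y (F.J s y (X y)) (Y y)) • (F.ξ s y : Tan n y) := by
  rw [B.torsion_H U F.isOpen X Y hX hY y hy, B.projection_V_eq F.frame hy,
    ← Finset.sum_neg_distrib]
  refine Finset.sum_congr rfl fun s _ => ?_
  -- η_s vanishes on horizontal fields, so dη_s(X,Y) = −η_s([X,Y]); compatibility then evaluates
  -- −[X,Y]_V as 2 Σ g(J_s X,Y) ξ_s.
  have h0 : ∀ X : ∀ y, D.H y, d n (fun z => F.η s z (X z)) y = 0 := fun X => by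
    rw [d_congr F.isOpen hy (g := fun _ => 0) fun z hz => F.η_hor hz s (X z)]
    exact mvfderiv_const (0 : ℝ)
  have h1 := dForm_apply B.smooth F.isOpen hy hX hY (F.frame.smooth s)
  rw [h0, h0] at h1
  rw [F.frame.compat y hy, h1, ← neg_smul]
  simp [ξ]

include F in
-- For a unit horizontal field E, T(E, J_s E) = 2ξ_s, and the torsion of a smooth connection is
-- smooth. In this way the smoothness of V follows from that of ∇.
theorem smooth_ξ (hn : 0 < n) (s) : QCStructure.SmoothSec B.V U (F.ξ s) := by
  set E := F.e ⟨0, by omega⟩ with hE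
  have hEs := F.smooth_e ⟨0, by omega⟩
  have hJE := F.smooth_J s _ hEs
  have h1 : SmoothField U fun y => B.conn.torsion y (E y : Tan n y) (F.J s y (E y) : Tan n y) := by
    refine (smooth_fld ((fieldAlgebra B.conn B.smooth F.isOpen).T hEs.mk hJE.mk)).congr fun y hy => ?_
    rw [fld_T B.smooth F.isOpen _ _ hy, fld_secMk _ hy, fld_secMk _ hy]
  refine (SmoothField.smul (smoothFun_const (1 / 2)) h1).congr fun y hy => ?_
  have h2 : D.g y (E y) (E y) = 1 := by have := F.orth y hy ⟨0, by omega⟩ ⟨0, by omega⟩; simpa using this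
  rw [F.torsion_hor hEs hJE hy]
  have h3 : ∀ t, D.g y (F.J t y (E y)) (F.J s y (E y)) = if t = s then 1 else 0 := fun t => by
    rw [F.frame.g_J_J hy, h2]
  simp only [← hE, h3]
  simp [smul_smul]

include F in
theorem smooth_hor (hn : 0 < n) {X : ∀ y : M, Tan n y} (hX : SmoothField U X) :
    QCStructure.SmoothSec D.H U fun y => B.hor y (X y) := by
  refine (hX.add (SmoothField.sum (s := Finset.univ) fun s _ => SmoothField.smul
    ((F.frame.smooth s).apply hX).neg (F.smooth_ξ hn s))).congr fun y hy => ?_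
  rw [B.hor_eq F.frame hy]
  simp [sub_eq_add_neg, ξ]

/-- the horizontal metric as a bilinear form on fields -/
def gL (hn : 0 < n) : FieldOn n U →ₗ[FunOn n U] FieldOn n U →ₗ[FunOn n U] FunOn n U :=
  LinearMap.mk₂ (FunOn n U) (fun X Y =>
    (F.smoothFun_g (F.smooth_hor hn (smooth_fld X)) (F.smooth_hor hn (smooth_fld Y))).mk)
    (fun X X' Y => fun_ext fun y hy => by
      rw [fn_add hy, fn_mk _ hy, fn_mk _ hy, fn_mk _ hy, fld_add hy, map_add, map_add,
        LinearMap.add_apply])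
    (fun c X Y => fun_ext fun y hy => by
      rw [smul_eq_mul, fn_mul hy, fn_mk _ hy, fn_mk _ hy, fld_smul hy, map_smul, map_smul,
        LinearMap.smul_apply, smul_eq_mul])
    (fun X Y Y' => fun_ext fun y hy => by
      rw [fn_add hy, fn_mk _ hy, fn_mk _ hy, fn_mk _ hy, fld_add hy, map_add, map_add])
    (fun c X Y => fun_ext fun y hy => by
      rw [smul_eq_mul, fn_mul hy, fn_mk _ hy, fn_mk _ hy, fld_smul hy, map_smul, map_smul,
        smul_eq_mul])

theorem fn_gL (hn : 0 < n) (X Y : FieldOn n U) {y : M} (hy : y ∈ U) :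
    fn (F.gL hn X Y) y = D.g y (B.hor y (fld X y)) (B.hor y (fld Y y)) :=
  fn_mk (F.smoothFun_g (F.smooth_hor hn (smooth_fld X)) (F.smooth_hor hn (smooth_fld Y))) hy

/-- the complex structures as endomorphisms of the module of fields -/
def JL (hn : 0 < n) (s : Fin 3) : FieldOn n U →ₗ[FunOn n U] FieldOn n U where
  toFun X := (F.smooth_J s _ (F.smooth_hor hn (smooth_fld X))).mk
  map_add' X Y := fld_ext fun y hy => by
    rw [fld_add hy, fld_secMk _ hy, fld_secMk _ hy, fld_secMk _ hy, fld_add hy, map_add, map_add]; rfl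
  map_smul' c X := fld_ext fun y hy => by
    rw [RingHom.id_apply, fld_smul hy, fld_secMk _ hy, fld_secMk _ hy, fld_smul hy, map_smul, map_smul]
    rfl

theorem fld_JL (hn : 0 < n) (s) (X : FieldOn n U) {y : M} (hy : y ∈ U) :
    fld (F.JL hn s X) y = F.J s y (B.hor y (fld X y)) :=
  fld_secMk (F.smooth_J s _ (F.smooth_hor hn (smooth_fld X))) hy

/-- the horizontal frame as elements of the module of fields -/
def eL (a : Fin (4 * n)) : FieldOn n U := (F.smooth_e a).mk

/-- the Reeb fields as elements of the module of fields -/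
def ξL (hn : 0 < n) (s : Fin 3) : FieldOn n U := (F.smooth_ξ hn s).mk

theorem fld_eL (a) {y : M} (hy : y ∈ U) : fld (F.eL a) y = F.e a y := fld_secMk (F.smooth_e a) hy
theorem fld_ξL (hn : 0 < n) (s) {y : M} (hy : y ∈ U) : fld (F.ξL hn s) y = F.ξ s y :=
  fld_secMk (F.smooth_ξ hn s) hy

theorem hor_eL (a) {y : M} (hy : y ∈ U) : B.hor y (fld (F.eL a) y) = F.e a y := by
  rw [F.fld_eL a hy, B.hor_coe]
theorem hor_ξL (hn : 0 < n) (s) {y : M} (hy : y ∈ U) : B.hor y (fld (F.ξL hn s) y) = 0 := by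
  rw [F.fld_ξL hn s hy, B.hor_of_mem_V (F.ξ s y).2]
theorem hor_JL (hn : 0 < n) (s) (X : FieldOn n U) {y : M} (hy : y ∈ U) :
    B.hor y (fld (F.JL hn s X) y) = F.J s y (B.hor y (fld X y)) := by
  rw [F.fld_JL hn s X hy, B.hor_coe]

theorem fld_nab_eL (X : FieldOn n U) (a) {y : M} (hy : y ∈ U) :
    fld ((fieldAlgebra B.conn B.smooth F.isOpen).nab X (F.eL a)) y =
      B.conn (fun y => (F.e a y : Tan n y)) y (fld X y) := by
  rw [fld_nab B.smooth F.isOpen _ _ hy, conn_congr B.conn F.isOpen hy (smooth_fld _)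
    fun z hz => F.fld_eL a hz]

theorem fld_nab_ξL (hn : 0 < n) (X : FieldOn n U) (s) {y : M} (hy : y ∈ U) :
    fld ((fieldAlgebra B.conn B.smooth F.isOpen).nab X (F.ξL hn s)) y =
      B.conn (fun y => (F.ξ s y : Tan n y)) y (fld X y) := by
  rw [fld_nab B.smooth F.isOpen _ _ hy, conn_congr B.conn F.isOpen hy (smooth_fld _)
    fun z hz => F.fld_ξL hn s hz]

theorem φ_ξ {y : M} (hy : y ∈ U) (s) : QCStructure.φ F.η F.J y (F.ξ s y : Tan n y) = F.J s y := by
  simp only [QCStructure.φ, F.η_ξ hy]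
  simp

/-- The frame algebra of an adapted frame. -/
def frameAlgebra (hn : 0 < n) : FrameAlgebra (FunOn n U) (FieldOn n U) (Fin (4 * n)) where
  toFieldAlgebra := fieldAlgebra B.conn B.smooth F.isOpen
  g := F.gL hn
  η s := (F.frame.smooth s).lin
  J := F.JL hn
  e := F.eL
  ξ := F.ξL hn
  g_symm X Y := fun_ext fun y hy => by rw [F.fn_gL hn _ _ hy, F.fn_gL hn _ _ hy, D.g_symm]
  g_e a b := fun_ext fun y hy => by
    rw [F.fn_gL hn _ _ hy, F.hor_eL a hy, F.hor_eL b hy, F.orth y hy, ← evalAt_apply hy]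
    split_ifs <;> simp
  g_ξ s X := fun_ext fun y hy => by
    rw [F.fn_gL hn _ _ hy, F.hor_ξL hn s hy, ← evalAt_apply hy]; simp
  η_e s a := fun_ext fun y hy => by
    rw [fn_lin _ _ hy, F.fld_eL a hy, F.η_hor hy, ← evalAt_apply hy]; simp
  η_ξ s t := fun_ext fun y hy => by
    rw [fn_lin _ _ hy, F.fld_ξL hn t hy, F.η_ξ hy, ← evalAt_apply hy]
    split_ifs <;> simp_all
  expand X := fld_ext fun y hy => by
    rw [fld_add hy, fld_sum _ _ hy, fld_sum _ _ hy]
    simp only [fld_smul hy, F.fn_gL hn _ _ hy, F.fld_eL _ hy, B.hor_coe, fn_lin _ _ hy,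
      F.fld_ξL hn _ hy]
    have h1 := congrArg Subtype.val
      ((QCStructure.Orthonormal.isONB (F.orth y hy)).expand (B.hor y (fld X y)))
    rw [B.hor_eq F.frame hy] at h1
    rw [sub_eq_iff_eq_add] at h1
    conv_lhs => rw [h1]
    simp [ξ]
  η_J s t X := fun_ext fun y hy => by
    rw [fn_lin _ _ hy, F.fld_JL hn t X hy, F.η_hor hy, ← evalAt_apply hy]; simp
  J_skew s X Y := fun_ext fun y hy => by
    rw [F.fn_gL hn _ _ hy, F.hor_JL hn s _ hy, F.frame.J_skew hy, ← evalAt_apply hy, map_neg,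
      evalAt_apply hy, F.fn_gL hn _ _ hy, F.hor_JL hn s _ hy]
  J_sq s a := fld_ext fun y hy => by
    rw [F.fld_JL hn s _ hy, F.hor_JL hn s _ hy, F.frame.J_J hy, fld_neg hy, F.hor_eL a hy,
      F.fld_eL a hy]; rfl
  J_mul i j k hc X := fld_ext fun y hy => by
    rw [F.fld_JL hn i _ hy, F.hor_JL hn j _ hy, (F.frame.J_cyc hy hc _).1, F.fld_JL hn k _ hy]
  J_mul' i j k hc X := fld_ext fun y hy => by
    rw [F.fld_JL hn j _ hy, F.hor_JL hn i _ hy, (F.frame.J_cyc hy hc _).2, fld_neg hy,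
      F.fld_JL hn k _ hy]; rfl
  η_nab_e s X a := fun_ext fun y hy => by
    rw [fn_lin _ _ hy, F.fld_nab_eL X a hy, (F.frame.mem_iff y hy _).1
      (B.preserves_H U F.isOpen _ (F.smooth_e a) y hy _) s, ← evalAt_apply hy, map_zero]
  g_nab_ξ s X Y := fun_ext fun y hy => by
    rw [F.fn_gL hn _ _ hy, F.fld_nab_ξL hn X s hy, B.hor_of_mem_V
      (B.preserves_V U F.isOpen _ (F.smooth_ξ hn s) y hy _), ← evalAt_apply hy]
    simp
  nab_g X a b := fun_ext fun y hy => by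
    rw [fn_add hy, F.fn_gL hn _ _ hy, F.fn_gL hn _ _ hy, F.hor_eL a hy, F.hor_eL b hy,
      F.fld_nab_eL X a hy, F.fld_nab_eL X b hy]
    have h1 := B.metric U F.isOpen _ _ (F.smooth_e a) (F.smooth_e b) y hy (fld X y)
    rw [d_congr F.isOpen hy (g := fun _ => if a = b then 1 else 0)
      fun z hz => F.orth z hz a b] at h1
    have h2 : d n (fun _ : M => if a = b then (1 : ℝ) else 0) y = 0 := mvfderiv_const _
    rw [h2] at h1
    refine h1.symm.trans ?_
    rw [← evalAt_apply hy, map_zero]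
    rfl
  nab_J s X a := fld_ext fun y hy => by
    -- The identification of V with Q sends ξ_s to J_s, so its parallelism applied to ξ_s says
    -- exactly that J_s and ξ_s have the same connection forms.
    have h1 := B.parallel U F.η F.J F.frame _ (F.smooth_ξ hn s) _ (F.smooth_e a) y hy (fld X y)
    rw [F.φ_ξ hy] at h1
    rw [fld_nab B.smooth F.isOpen _ _ hy, fld_add hy, fld_sum _ _ hy, F.fld_JL hn s _ hy,
      F.fld_nab_eL X a hy]
    simp only [fld_smul hy, fn_lin _ _ hy, F.fld_nab_ξL hn X s hy, F.fld_JL hn _ _ hy,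
      F.hor_eL a hy]
    rw [conn_congr B.conn F.isOpen hy (smooth_fld _) (Y := fun y =>
      (QCStructure.φ F.η F.J y (F.ξ s y) (F.e a y) : Tan n y)) fun z hz => by
        rw [F.fld_JL hn s _ hz, F.hor_eL a hz, F.φ_ξ hz], ← sub_eq_iff_eq_add']
    refine h1.symm.trans ?_
    simp [QCStructure.φ]
  torsion_e a b := fld_ext fun y hy => by
    rw [fld_T B.smooth F.isOpen _ _ hy, F.fld_eL a hy, F.fld_eL b hy,
      F.torsion_hor (F.smooth_e a) (F.smooth_e b) hy, fld_sum _ _ hy]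
    refine Finset.sum_congr rfl fun s _ => ?_
    rw [fld_smul hy, F.fld_ξL hn s hy, fn_mul hy, F.fn_gL hn _ _ hy, F.hor_JL hn s _ hy,
      F.hor_eL a hy, F.hor_eL b hy, ← evalAt_apply hy 2, map_ofNat]
  η_torsion r s a := fun_ext fun y hy => by
    rw [fn_lin _ _ hy, fld_T B.smooth F.isOpen _ _ hy, F.fld_ξL hn s hy, F.fld_eL a hy,
      (F.frame.mem_iff y hy _).1 (B.torsion_V y _ (F.ξ s y).2 _ (F.e a y).2) r,
      ← evalAt_apply hy, map_zero]

end AdaptedFrame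

end QC
end

/-! ### Change of quaternionic frame, and orthogonality of the torsion -/

noncomputable section

namespace QC

variable {n : ℕ} {M : Type*} [TopologicalSpace M]
  [ChartedSpace (EuclideanSpace ℝ (Fin (4 * n + 3))) M] [IsManifold (𝓡 (4 * n + 3)) ∞ M]
  {U : Set M} [T2Space M]

/-- Sums over s of expressions bilinear in two objects rotating with the frame are therefore
independent of the frame; T⁰, U and the Gram matrix are of this kind. -/
theorem sum_orthogonal {O : Matrix (Fin 3) (Fin 3) ℝ} (hO : O.transpose * O = 1)
    (f : Fin 3 → Fin 3 → ℝ) : ∑ s, ∑ a, ∑ b, O s a * O s b * f a b = ∑ a, f a a := by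
  have h1 : ∀ a b, ∑ s, O s a * O s b = if a = b then 1 else 0 := fun a b => by
    have := congrFun (congrFun hO a) b
    simpa [Matrix.mul_apply, Matrix.one_apply] using this
  rw [Finset.sum_comm]
  refine Finset.sum_congr rfl fun a _ => ?_
  rw [Finset.sum_comm]
  simp [← Finset.sum_mul, h1]

theorem exists_localFrame (D : QCStructure n M) (y : M) :
    ∃ (U : Set M) (η : Fin 3 → ∀ x : M, Tan n x →L[ℝ] ℝ)
    (J : Fin 3 → ∀ x : M, Module.End ℝ (D.H x)), y ∈ U ∧ D.LocalFrame U η J ∧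
      (∀ s, η s y = D.η y s) ∧ ∀ s, J s y = D.J y s :=
  ⟨_, _, _, (D.exists_frame y).choose_spec.choose_spec.choose_spec.1,
    (D.exists_frame y).choose_spec.choose_spec.choose_spec.2, fun _ => rfl, fun _ => rfl⟩

namespace AdaptedFrame

variable {D : QCStructure n M} {B : BiquardConnection D} (F : AdaptedFrame B U) (hn : 0 < n)

include hn in
/-- Two frames of the qc structure differ by an orthogonal matrix. -/
theorem exists_gauge {y : M} (hy : y ∈ U) : ∃ O : Matrix (Fin 3) (Fin 3) ℝ,
    O.transpose * O = 1 ∧ (∀ s, D.J y s = ∑ t, O s t • F.J t y) ∧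
    (∀ s v, D.η y s v = ∑ t, O s t * F.η t y v) ∧
    ∀ s, (B.ξ y s : Tan n y) = ∑ t, O s t • (F.ξ t y : Tan n y) := by
  obtain ⟨U', η', J', hy', h', hη, hJ⟩ := exists_localFrame D y
  have hspan : ∀ s, ∃ c : Fin 3 → ℝ, ∑ t, c t • F.J t y = J' s y := fun s => by
    rw [← Submodule.mem_span_range_iff_exists_fun, ← F.frame.span_eq y hy, h'.span_eq y hy']
    exact Submodule.subset_span ⟨s, rfl⟩
  choose O hO using hspan
  set u := F.e ⟨0, by omega⟩ y with hu
  have huu : D.g y u u = 1 := by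
    have := F.orth y hy ⟨0, by omega⟩ ⟨0, by omega⟩; simpa using this
  have hgJ : ∀ s t, D.g y (F.J s y u) (F.J t y u) = if s = t then 1 else 0 := fun s t => by
    rw [F.frame.g_J_J hy, huu]
  have hgJ' : ∀ s r, D.g y (J' s y u) (F.J r y u) = O s r := fun s r => by
    rw [← hO]; simp [LinearMap.sum_apply, hgJ]
  have hOO : Matrix.of O * (Matrix.of O).transpose = 1 := by
    ext s t
    have h1 := h'.g_J_J hy' s t u
    rw [huu, ← hO t] at h1
    simp only [LinearMap.sum_apply, LinearMap.smul_apply, map_sum, map_smul, hgJ'] at h1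
    simp only [Matrix.mul_apply, Matrix.of_apply, Matrix.transpose_apply, Matrix.one_apply]
    rw [← h1]
    exact Finset.sum_congr rfl fun a _ => by rw [smul_eq_mul, mul_comm]
  have hA : ∀ s v, η' s y v = ∑ t, η' s y (F.ξ t y) * F.η t y v := fun s v => by
    have h1 := B.hor_eq F.frame hy v
    have h2 : η' s y (B.hor y v) = 0 := (h'.mem_iff y hy' _).1 (B.hor y v).2 s
    rw [h1, map_sub, map_sum, sub_eq_zero] at h2
    rw [h2]
    exact Finset.sum_congr rfl fun t _ => by rw [map_smul, smul_eq_mul, mul_comm]; rfl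
  -- The contact forms and the complex structures rotate by the same matrix: dη'_s(u, J_r u) is both
  -- 2g(J'_s u, J_r u) and minus η'_s of a bracket. Applying the same identity to the η_t evaluates
  -- that bracket.
  have hAO : ∀ s r, η' s y (F.ξ r y) = O s r := fun s r => by
    have key : ∀ {V : Set M} (hV : IsOpen V) (hyV : y ∈ V) (hVU : V ⊆ U)
        {θ : ∀ x : M, Tan n x →L[ℝ] ℝ} (hθ : SmoothForm V θ)
        (h0 : ∀ z ∈ V, ∀ w : D.H z, θ z w = 0), dForm θ y u (F.J r y u) =
          -θ y (bracket (fun z => (F.e ⟨0, by omega⟩ z : Tan n z))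
            (fun z => (F.J r z (F.e ⟨0, by omega⟩ z) : Tan n z)) y) := by
      intro V hV hyV hVU θ hθ h0
      have hX : SmoothField V fun z => (F.e ⟨0, by omega⟩ z : Tan n z) := (F.smooth_e _).mono hVU
      have hY : SmoothField V fun z => (F.J r z (F.e ⟨0, by omega⟩ z) : Tan n z) :=
        (F.smooth_J r _ (F.smooth_e _)).mono hVU
      have h1 := dForm_apply B.smooth hV hyV hX hY hθ
      have h2 : ∀ X : ∀ y, D.H y, d n (fun z => θ z (X z)) y = 0 := fun X => by
        rw [d_congr hV hyV (g := fun _ => 0) fun z hz => h0 z hz (X z)]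
        exact mvfderiv_const (0 : ℝ)
      rw [h2, h2] at h1
      refine h1.trans ?_
      simp
    have hVo := F.isOpen.inter h'.isOpen
    have k1 := key hVo ⟨hy, hy'⟩ Set.inter_subset_left
      (ContMDiffOn.mono (h'.smooth s) Set.inter_subset_right)
      fun z hz w => (h'.mem_iff z hz.2 _).1 w.2 s
    have k2 := fun t => key F.isOpen hy subset_rfl (F.frame.smooth t)
      fun z hz w => (F.frame.mem_iff z hz _).1 w.2 t
    rw [hA] at k1
    rw [← h'.compat y hy', hgJ'] at k1
    have k3 : ∀ t, (F.η t y) (bracket (fun z => (F.e ⟨0, by omega⟩ z : Tan n z))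
            (fun z => (F.J r z (F.e ⟨0, by omega⟩ z) : Tan n z)) y) =
            if t = r then -2 else 0 := fun t => by
      have := k2 t
      rw [← F.frame.compat y hy, hgJ] at this
      split_ifs at this ⊢ <;> linarith
    simp only [k3] at k1
    simp at k1
    linarith
  have hOt : (Matrix.of O).transpose * Matrix.of O = 1 := mul_eq_one_comm.1 hOO
  refine ⟨Matrix.of O, hOt, fun s => by rw [← hJ, ← hO]; rfl,
    fun s v => by rw [← hη, hA]; simp [hAO], fun s => ?_⟩
  have hη2 : ∀ t v, F.η t y v = ∑ r, O r t * η' r y v := fun t v => by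
    simp only [hA _ v, hAO, Finset.mul_sum]
    rw [Finset.sum_comm]
    have : ∀ a, ∑ r, O r t * O r a = if t = a then 1 else 0 := fun a => by
      have := congrFun (congrFun hOt t) a
      simpa [Matrix.mul_apply, Matrix.one_apply] using this
    simp [← mul_assoc, ← Finset.sum_mul, this]
  rw [B.mem_V_eq F.frame hy _ (B.ξ y s).2]
  refine Finset.sum_congr rfl fun t _ => ?_
  have h1 : ∀ r, η' r y (B.ξ y s) = if s = r then 1 else 0 := fun r => by
    rw [hη]; exact (B.exists_reeb y s).choose_spec r
  rw [hη2]
  simp [h1, ξ]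

section
variable {y : M} (hy : y ∈ U)
include hy

theorem evalAt_g (X Y) : evalAt hy ((F.frameAlgebra hn).g X Y) =
    D.g y (B.hor y (fld X y)) (B.hor y (fld Y y)) := by
  rw [evalAt_apply]; exact F.fn_gL hn X Y hy

theorem fld_J' (s X) : fld ((F.frameAlgebra hn).J s X) y = F.J s y (B.hor y (fld X y)) :=
  F.fld_JL hn s X hy

theorem fld_torsion (s X) : fld ((F.frameAlgebra hn).T ((F.frameAlgebra hn).ξ s) X) y =
    B.conn.torsion y (F.ξ s y) (fld X y) := by
  refine (fld_T B.smooth F.isOpen _ _ hy).trans ?_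
  rw [show fld ((F.frameAlgebra hn).ξ s) y = F.ξ s y from F.fld_ξL hn s hy]

theorem fld_e (a) : fld ((F.frameAlgebra hn).e a) y = F.e a y := F.fld_eL a hy

theorem coe_hor_of_isHor {X} (hX : (F.frameAlgebra hn).IsHor X) :
    (B.hor y (fld X y) : Tan n y) = fld X y :=
  B.coe_hor <| (F.frame.mem_iff y hy _).2 fun s => by
    rw [← fn_lin (F.frame.smooth s) X hy, ← evalAt_apply hy]
    exact (congrArg (evalAt hy) (hX s)).trans (map_zero _)

theorem fld_lift (u : Fin (4 * n) → ℝ) :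
    fld ((F.frameAlgebra hn).lift u) y = ((∑ a, u a • F.e a y : D.H y) : Tan n y) := by
  rw [FrameAlgebra.lift, fld_sum _ _ hy]
  simp only [Submodule.coe_sum, Submodule.coe_smul]
  refine Finset.sum_congr rfl fun a _ => ?_
  rw [fld_smul hy, F.fld_e hn hy, ← evalAt_apply hy, FrameAlgebra.ev_algebraMap]

theorem comp_apply (X a) : (F.frameAlgebra hn).comp (evalAt hy) X a =
    D.g y (B.hor y (fld X y)) (F.e a y) := by
  rw [FrameAlgebra.comp, F.evalAt_g hn hy, F.fld_e hn hy, B.hor_coe]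

/-- A matrix acting on components is transported to an endomorphism of H_y by the orthonormal frame.
Skewness and commutation carry over, and commuting with the three J_t means commuting with Q, their
span. -/
theorem torsionPerp : (F.frameAlgebra hn).TorsionPerp (evalAt hy) where
  perp_Q s t := by
    have := B.torsion_perp y (F.ξ s y) (F.J t y) (Or.inr (by
      rw [F.frame.span_eq y hy]; exact Submodule.subset_span ⟨t, rfl⟩)) _ (F.orth y hy)
    rw [← this]
    refine Finset.sum_congr rfl fun a _ => ?_
    rw [F.evalAt_g hn hy, F.fld_torsion hn hy, F.fld_J' hn hy, F.fld_e hn hy, B.hor_coe, B.hor_coe]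
    congr 2
    exact Subtype.ext (B.coe_hor (B.torsion_V y _ (F.ξ s y).2 _ (F.e a y).2))
  perp_sp s L h1 h2 := by
    have onb := QCStructure.Orthonormal.isONB (F.orth y hy)
    set c : D.H y →ₗ[ℝ] (Fin (4 * n) → ℝ) := LinearMap.pi fun a => (D.g y).flip (F.e a y) with hc
    have hca : ∀ u a, c u a = D.g y u (F.e a y) := fun u a => rfl
    set A : Module.End ℝ (D.H y) :=
      (Fintype.linearCombination ℝ (fun a => F.e a y)) ∘ₗ L ∘ₗ c with hA
    have hAu : ∀ u, A u = ∑ a, L (c u) a • F.e a y := fun u => by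
      simp [hA, Fintype.linearCombination_apply]
    have hexp : ∀ u, u = ∑ a, c u a • F.e a y := fun u => onb.expand u
    have hlift : ∀ w w', (F.frameAlgebra hn).evG (evalAt hy) w w' = ∑ a, w a * w' a :=
      fun w w' => by
        rw [FrameAlgebra.evG_apply, F.evalAt_g hn hy, F.fld_lift hn hy, F.fld_lift hn hy, B.hor_coe, B.hor_coe]
        simp [map_sum, LinearMap.sum_apply, F.orth y hy _ _]
        exact Finset.sum_congr rfl fun a _ => mul_comm _ _
    have hJL : ∀ t u, (F.frameAlgebra hn).evEnd (evalAt hy) ((F.frameAlgebra hn).J t) (c u) =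
        c (F.J t y u) := fun t u => by
      ext a
      rw [FrameAlgebra.evEnd_apply, F.comp_apply hn hy, F.fld_J' hn hy, F.fld_lift hn hy, ← hexp,
        B.hor_coe, B.hor_coe, hca]
    have hcA : ∀ u, c (A u) = L (c u) := fun u => by
      ext b
      rw [hca, hAu]
      simp [F.orth y hy _ _]
    have hsp : D.IsSp y A := by
      refine ⟨fun u v => ?_, fun σ hσ => ?_⟩
      · have := h1 (c u) (c v)
        rw [← hcA, ← hcA] at this
        rw [hlift, hlift] at this
        rw [onb.inner_eq_sum (A u) v, onb.inner_eq_sum u (A v)]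
        exact this
      · have hJ : ∀ t, A * F.J t y = F.J t y * A := fun t => LinearMap.ext fun u => by
          change A (F.J t y u) = F.J t y (A u)
          rw [hexp (A (F.J t y u)), hexp (F.J t y (A u)), hcA, ← hJL, h2, ← hJL, hcA]
        rw [F.frame.span_eq y hy] at hσ
        induction hσ using Submodule.span_induction with
        | mem x hx => obtain ⟨t, rfl⟩ := hx; exact hJ t
        | zero => simp
        | add x y _ _ hx hy => rw [mul_add, add_mul, hx, hy]
        | smul a x _ hx => rw [mul_smul_comm, smul_mul_assoc, hx]
    rw [← B.torsion_perp y (F.ξ s y) A (Or.inl hsp) _ (F.orth y hy)]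
    refine Finset.sum_congr rfl fun a _ => ?_
    rw [F.evalAt_g hn hy, F.fld_torsion hn hy, F.fld_lift hn hy, F.fld_e hn hy, B.hor_coe]
    have h3 : c (F.e a y) = Pi.single a 1 := by
      ext b; rw [hca, F.orth y hy a b, Pi.single_apply]; simp [eq_comm]
    have h4 : B.hor y (B.conn.torsion y (F.ξ s y) (F.e a y)) = ⟨_, B.torsion_V y _ (F.ξ s y).2 _ (F.e a y).2⟩ :=
      Subtype.ext (B.coe_hor (B.torsion_V y _ (F.ξ s y).2 _ (F.e a y).2))
    rw [h4, hAu, h3]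

end
end AdaptedFrame

end QC
end

/-! ### Hessian, Ricci tensor and scalar curvature in an adapted frame -/

noncomputable section

namespace QC

variable {n : ℕ} {M : Type*} [TopologicalSpace M]
  [ChartedSpace (EuclideanSpace ℝ (Fin (4 * n + 3))) M] [IsManifold (𝓡 (4 * n + 3)) ∞ M]
  {U : Set M} [T2Space M]

theorem mk_fld (X : FieldOn n U) : (smooth_fld X).mk = X := fld_ext fun y hy => fld_mk _ hy

namespace BiquardConnection

variable {D : QCStructure n M} (B : BiquardConnection D)

/-- The horizontal field
`n ∑ h(e_b, ∇f) e_b + ∑ ∑ h(J_s e_b, J_s ∇f) e_b + n (△f) ∇f`, where `h` is the Hessian of `f`. -/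
def bochnerSec (f : M → ℝ) (y : M) : D.H y :=
  (n : ℝ) • ∑ b, B.hess f y (D.e y b) (D.grad f y) • D.e y b
    + ∑ b, (∑ s, B.hess f y (D.J y s (D.e y b)) (D.J y s (D.grad f y))) • D.e y b
    + (n * B.subLaplacian f y) • D.grad f y

/-- The horizontal divergence of `bochnerSec`. -/
def bochnerDiv (f : M → ℝ) (y : M) : ℝ :=
  ∑ a, D.g y (B.hor y (B.conn (fun z => (B.bochnerSec f z : Tan n z)) y (D.e y a))) (D.e y a)

end BiquardConnection

namespace AdaptedFrame

variable {D : QCStructure n M} {B : BiquardConnection D} (F : AdaptedFrame B U) (hn : 0 < n)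

/-- an extension of a horizontal vector -/
def sec {y : M} (u : D.H y) : FieldOn n U := (F.frameAlgebra hn).lift fun a => D.g y u (F.e a y)

theorem isHor_sec {y : M} (u : D.H y) : (F.frameAlgebra hn).IsHor (F.sec hn u) :=
  FrameAlgebra.isHor_lift _ _

theorem sec_add {y : M} (u v : D.H y) : F.sec hn (u + v) = F.sec hn u + F.sec hn v := by
  rw [sec, sec, sec, ← FrameAlgebra.lift_add]
  congr 1; ext a; simp

theorem sec_smul {y : M} (c : ℝ) (u : D.H y) :
    F.sec hn (c • u) = algebraMap ℝ (FunOn n U) c • F.sec hn u := by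
  rw [sec, sec, ← FrameAlgebra.lift_smul]
  congr 1; ext a; simp

/-- The gradient of a function as an element of the module of fields. -/
def gradL {f : M → ℝ} (hf : SmoothFun n U f) : FieldOn n U :=
  ∑ a, (F.frameAlgebra hn).D ((F.frameAlgebra hn).e a) hf.mk • (F.frameAlgebra hn).e a

theorem isHor_gradL {f : M → ℝ} (hf : SmoothFun n U f) :
    (F.frameAlgebra hn).IsHor (F.gradL hn hf) :=
  .sum fun a _ => (FrameAlgebra.isHor_e _ a).smul _

theorem g_gradL {f : M → ℝ} (hf : SmoothFun n U f) (X) (hX : (F.frameAlgebra hn).IsHor X) :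
    (F.frameAlgebra hn).g (F.gradL hn hf) X = (F.frameAlgebra hn).D X hf.mk := by
  have := hX.sum_g ((F.frameAlgebra hn).dL hf.mk)
  simp only [FieldAlgebra.dL_apply, smul_eq_mul] at this
  rw [← this, gradL]
  simp [mul_comm]

section
variable {y : M} (hy : y ∈ U)
include hy

theorem fld_sec (u : D.H y) : fld (F.sec hn u) y = u := by
  rw [sec, F.fld_lift hn hy, ← (QCStructure.Orthonormal.isONB (F.orth y hy)).expand u]

theorem hor_sec (u : D.H y) : B.hor y (fld (F.sec hn u) y) = u := by
  rw [F.fld_sec hn hy, B.hor_coe]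

/-- the value at a point of a bilinear map on fields -/
def ptForm (Φ : FieldOn n U →ₗ[FunOn n U] FieldOn n U →ₗ[FunOn n U] FunOn n U) :
    D.H y →ₗ[ℝ] D.H y →ₗ[ℝ] ℝ :=
  LinearMap.mk₂ ℝ (fun u v => evalAt hy (Φ (F.sec hn u) (F.sec hn v)))
    (fun u u' v => by simp [sec_add]) (fun c u v => by simp [sec_smul])
    (fun u u' v => by simp [sec_add]) (fun c u v => by simp [sec_smul])

theorem ptForm_apply (Φ) (u v) :
    F.ptForm hn hy Φ u v = evalAt hy (Φ (F.sec hn u) (F.sec hn v)) := rfl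

theorem sec_hor {X} (hX : (F.frameAlgebra hn).IsHor X)
    (Φ : FieldOn n U →ₗ[FunOn n U] FunOn n U) :
    evalAt hy (Φ (F.sec hn (B.hor y (fld X y)))) = evalAt hy (Φ X) := by
  rw [← hX.ev_map (evalAt hy) Φ, sec]
  congr 3
  ext a
  rw [F.comp_apply hn hy]

theorem ptForm_hor {X Y} (hX : (F.frameAlgebra hn).IsHor X) (hY : (F.frameAlgebra hn).IsHor Y) (Φ) :
    F.ptForm hn hy Φ (B.hor y (fld X y)) (B.hor y (fld Y y)) = evalAt hy (Φ X Y) := by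
  rw [ptForm_apply, F.sec_hor hn hy hY]
  exact F.sec_hor hn hy hX (Φ.flip Y)

theorem ptForm_e (Φ) (a b) : F.ptForm hn hy Φ (F.e a y) (F.e b y) =
    evalAt hy (Φ ((F.frameAlgebra hn).e a) ((F.frameAlgebra hn).e b)) := by
  rw [← F.ptForm_hor hn hy (FrameAlgebra.isHor_e _ a) (FrameAlgebra.isHor_e _ b),
    F.fld_e hn hy, F.fld_e hn hy, B.hor_coe, B.hor_coe]

omit hy in
theorem isONB_e (y : M) : IsONB (D.g y) (D.e y) :=
  QCStructure.Orthonormal.isONB (D.exists_orthonormal y).choose_spec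

/-- Trades the basis `D.e`, chosen pointwise without any regularity, for the smooth frame. -/
theorem sum_ptForm (Φ) : ∑ a, F.ptForm hn hy Φ (D.e y a) (D.e y a) =
    ∑ a, evalAt hy (Φ ((F.frameAlgebra hn).e a) ((F.frameAlgebra hn).e a)) := by
  rw [(isONB_e y).trace_eq (QCStructure.Orthonormal.isONB (F.orth y hy)) (F.ptForm hn hy Φ)]
  exact Finset.sum_congr rfl fun a _ => F.ptForm_e hn hy Φ a a

theorem fld_R (X Y Z) : fld ((F.frameAlgebra hn).R X Y Z) y =
    B.curv y (fld X y) (fld Y y) (fld Z y) := by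
  rw [curv_apply B.smooth F.isOpen hy (smooth_fld X) (smooth_fld Y) (smooth_fld Z) B rfl]
  have := fld_R_mk B.smooth F.isOpen hy (smooth_fld X) (smooth_fld Y) (smooth_fld Z)
  rw [mk_fld, mk_fld, mk_fld] at this
  exact this

theorem Ric_eq (X Y) : B.Ric y (fld X y) (fld Y y) = evalAt hy ((F.frameAlgebra hn).Ric X Y) := by
  have h1 := F.sum_ptForm hn hy
    ((F.frameAlgebra hn).g ∘ₗ (((F.frameAlgebra hn).RL.flip X).flip Y))
  simp only [LinearMap.comp_apply, LinearMap.flip_apply, FieldAlgebra.RL_apply] at h1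
  rw [FrameAlgebra.Ric, map_sum, ← h1, BiquardConnection.Ric]
  refine Finset.sum_congr rfl fun b _ => ?_
  rw [ptForm_apply]
  simp only [LinearMap.comp_apply, LinearMap.flip_apply, FieldAlgebra.RL_apply]
  rw [F.evalAt_g hn hy, F.fld_R hn hy, F.hor_sec hn hy, F.fld_sec hn hy]

theorem S_eq : B.S y = (∑ a, evalAt hy ((F.frameAlgebra hn).Ric ((F.frameAlgebra hn).e a)
    ((F.frameAlgebra hn).e a))) / (8 * n * (n + 2)) := by
  have h1 := F.sum_ptForm hn hy
    (∑ b, ((F.frameAlgebra hn).RL ((F.frameAlgebra hn).e b)).compr₂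
      ((F.frameAlgebra hn).g.flip ((F.frameAlgebra hn).e b)))
  simp only [LinearMap.sum_apply, LinearMap.compr₂_apply, LinearMap.flip_apply,
    FieldAlgebra.RL_apply] at h1
  rw [BiquardConnection.S]
  congr 1
  refine Eq.trans (Finset.sum_congr rfl fun a _ => ?_) h1
  rw [ptForm_apply]
  simp only [LinearMap.sum_apply, LinearMap.compr₂_apply, LinearMap.flip_apply,
    FieldAlgebra.RL_apply]
  rw [show (D.e y a : Tan n y) = fld (F.sec hn (D.e y a)) y from (F.fld_sec hn hy _).symm,
    F.Ric_eq hn hy]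
  rfl

variable {f : M → ℝ} (hf : SmoothFun n U f)

/-- Metricity: X(g(∇f,Y)) = g(∇_X∇f, Y) + g(∇f, ∇_X Y), with both inner products against ∇f being
derivatives of f. -/
theorem hess_eq {X Y} (hY : (F.frameAlgebra hn).IsHor Y) :
    B.hess f y (fld X y) (fld Y y) =
      evalAt hy ((F.frameAlgebra hn).g ((F.frameAlgebra hn).nab X (F.gradL hn hf)) Y) := by
  rw [hess_apply B.smooth F.isOpen hy (smooth_fld X) (smooth_fld Y) B rfl hf,
    ← fn_hess_mk B.smooth F.isOpen hy (smooth_fld X) (smooth_fld Y) hf, mk_fld, mk_fld,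
    ← evalAt_apply hy]
  congr 1
  have h1 := (F.frameAlgebra hn).D_g (F.isHor_gradL hn hf) hY X
  rw [F.g_gradL hn hf _ hY, F.g_gradL hn hf _ ((F.frameAlgebra hn).isHor_nab hY X)] at h1
  rw [FieldAlgebra.hess_apply]
  exact sub_eq_of_eq_add h1

theorem fld_gradL : fld (F.gradL hn hf) y = D.grad f y := by
  rw [gradL, fld_sum _ _ hy]
  have h1 := (isONB_e y).trace_eq (QCStructure.Orthonormal.isONB (F.orth y hy))
    (LinearMap.lsmul ℝ (D.H y) ∘ₗ ((d n f y : Tan n y →ₗ[ℝ] ℝ) ∘ₗ (D.H y).subtype))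
  have h2 : D.grad f y = ∑ a, d n f y (F.e a y) • F.e a y := by
    rw [QCStructure.grad]
    simpa using h1
  rw [h2, Submodule.coe_sum]
  refine Finset.sum_congr rfl fun a _ => ?_
  rw [fld_smul hy, F.fld_e hn hy, Submodule.coe_smul]
  congr 1
  refine (fn_D B.smooth F.isOpen _ _ hy).trans ?_
  rw [show fld ((F.frameAlgebra hn).e a) y = _ from F.fld_e hn hy a,
    d_congr F.isOpen hy (fun z hz => fn_mk hf hz)]

/-- the Hessian at a point as a bilinear form -/
theorem hess_eq_ptForm (u v : D.H y) : B.hess f y u v =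
    F.ptForm hn hy ((F.frameAlgebra hn).g ∘ₗ (F.frameAlgebra hn).nabL (F.gradL hn hf)) u v := by
  have := F.hess_eq hn hy hf (X := F.sec hn u) (F.isHor_sec hn v)
  rw [F.fld_sec hn hy, F.fld_sec hn hy] at this
  exact this

theorem subLaplacian_eq : B.subLaplacian f y =
    -evalAt hy ((F.frameAlgebra hn).tr (F.gradL hn hf)) := by
  rw [BiquardConnection.subLaplacian, FrameAlgebra.tr, map_sum]
  simp only [F.hess_eq_ptForm hn hy hf]
  rw [F.sum_ptForm hn hy]
  rfl

theorem hessNormSq_eq : B.hessNormSq f y =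
    evalAt hy ((F.frameAlgebra hn).normSq (F.gradL hn hf)) := by
  set N := (F.frameAlgebra hn).nabL (F.gradL hn hf) with hN
  have h1 := F.sum_ptForm hn hy ((F.frameAlgebra hn).g.compl₁₂ N N)
  rw [BiquardConnection.hessNormSq, FrameAlgebra.normSq, map_sum]
  refine Eq.trans (Finset.sum_congr rfl fun a _ => ?_) h1
  rw [ptForm_apply, LinearMap.compl₁₂_apply, F.evalAt_g hn hy, (isONB_e y).inner_eq_sum]
  refine Finset.sum_congr rfl fun b _ => ?_
  rw [F.hess_eq_ptForm hn hy hf, ptForm_apply, sq, LinearMap.comp_apply, F.evalAt_g hn hy,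
    F.hor_sec hn hy]

end
end AdaptedFrame

end QC
end

/-! ### Torsion and the Bochner field in an adapted frame; the pointwise inequality -/

noncomputable section

namespace QC

variable {n : ℕ} {M : Type*} [TopologicalSpace M]
  [ChartedSpace (EuclideanSpace ℝ (Fin (4 * n + 3))) M] [IsManifold (𝓡 (4 * n + 3)) ∞ M]
  {U : Set M} [T2Space M]

namespace AdaptedFrame

variable {D : QCStructure n M} {B : BiquardConnection D} (F : AdaptedFrame B U) (hn : 0 < n)

section
variable {y : M} (hy : y ∈ U)
include hy

/-- the torsion at a point -/
def tor (s : Fin 3) : D.H y →ₗ[ℝ] D.H y →ₗ[ℝ] ℝ :=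
  D.g y ∘ₗ B.hor y ∘ₗ (B.conn.torsion y (F.ξ s y) : Tan n y →ₗ[ℝ] Tan n y) ∘ₗ (D.H y).subtype

omit hy in
theorem tor_apply (s) (u v : D.H y) :
    F.tor s u v = D.g y (B.hor y (B.conn.torsion y (F.ξ s y) u)) v := rfl

include hn in
theorem exists_gauge_tor : ∃ O : Matrix (Fin 3) (Fin 3) ℝ, O.transpose * O = 1 ∧
    (∀ s u, D.J y s u = ∑ t, O s t • F.J t y u) ∧
    ∀ s u v, B.tor y s u v = ∑ t, O s t * F.tor t u v := by
  obtain ⟨O, hO, hJ, -, hξ⟩ := F.exists_gauge hn hy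
  refine ⟨O, hO, fun s u => by rw [hJ]; simp [LinearMap.sum_apply], fun s u v => ?_⟩
  rw [BiquardConnection.tor, hξ]
  simp [tor_apply, map_sum, LinearMap.sum_apply]

theorem evalAt_tor_J {X Y} (s t) :
    evalAt hy ((F.frameAlgebra hn).g ((F.frameAlgebra hn).T ((F.frameAlgebra hn).ξ s)
      ((F.frameAlgebra hn).J t X)) Y) = F.tor s (F.J t y (B.hor y (fld X y))) (B.hor y (fld Y y)) := by
  rw [F.evalAt_g hn hy, F.fld_torsion hn hy, F.fld_J' hn hy]
  rfl

theorem evalAt_J_tor {X Y} (hX : (F.frameAlgebra hn).IsHor X) (s t) :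
    evalAt hy ((F.frameAlgebra hn).g ((F.frameAlgebra hn).T ((F.frameAlgebra hn).ξ s) X)
      ((F.frameAlgebra hn).J t Y)) = F.tor s (B.hor y (fld X y)) (F.J t y (B.hor y (fld Y y))) := by
  rw [F.evalAt_g hn hy, F.fld_torsion hn hy, F.fld_J' hn hy, B.hor_coe, tor_apply,
    F.coe_hor_of_isHor hn hy hX]

theorem T0_eq {X} (hX : (F.frameAlgebra hn).IsHor X) :
    B.T0 y (B.hor y (fld X y)) (B.hor y (fld X y)) = evalAt hy ((F.frameAlgebra hn).T0₂ X) / 2 := by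
  obtain ⟨O, hO, hJ, ht⟩ := F.exists_gauge_tor hn hy
  set u := B.hor y (fld X y) with hu
  rw [FrameAlgebra.T0₂, map_sum]
  simp only [map_add, F.evalAt_tor_J hn hy, F.evalAt_J_tor hn hy hX, ← hu]
  rw [← sum_orthogonal hO fun s t => F.tor s (F.J t y u) u + F.tor s u (F.J t y u),
    BiquardConnection.T0, Finset.sum_div]
  refine Finset.sum_congr rfl fun s _ => ?_
  rw [BiquardConnection.torSymm]
  congr 1
  simp only [ht, hJ, map_sum, map_smul, LinearMap.sum_apply, LinearMap.smul_apply, smul_eq_mul,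
    Finset.mul_sum, ← Finset.sum_add_distrib]
  exact Finset.sum_congr rfl fun a _ => Finset.sum_congr rfl fun b _ => by ring

theorem U_eq {X} (hX : (F.frameAlgebra hn).IsHor X) :
    B.U y (B.hor y (fld X y)) (B.hor y (fld X y)) = evalAt hy ((F.frameAlgebra hn).U₆ X) / 6 := by
  obtain ⟨O, hO, hJ, ht⟩ := F.exists_gauge_tor hn hy
  set u := B.hor y (fld X y) with hu
  rw [FrameAlgebra.U₆, map_sum]
  simp only [map_sub, F.evalAt_tor_J hn hy, F.evalAt_J_tor hn hy hX, ← hu]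
  rw [← sum_orthogonal hO fun s t => F.tor s u (F.J t y u) - F.tor s (F.J t y u) u,
    BiquardConnection.U, Finset.sum_div, Finset.sum_div]
  refine Finset.sum_congr rfl fun s _ => ?_
  rw [BiquardConnection.torSkew, div_div]
  norm_num
  congr 1
  simp only [ht, hJ, map_sum, map_smul, LinearMap.sum_apply, LinearMap.smul_apply, smul_eq_mul,
    Finset.mul_sum, ← Finset.sum_sub_distrib]
  exact Finset.sum_congr rfl fun a _ => Finset.sum_congr rfl fun b _ => by ring

variable {f : M → ℝ} (hf : SmoothFun n U f)

theorem hor_gradL : B.hor y (fld (F.gradL hn hf) y) = D.grad f y := by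
  rw [F.fld_gradL hn hy hf, B.hor_coe]

theorem hess_J_eq (u v : D.H y) : ∑ s, B.hess f y (D.J y s u) (D.J y s v) =
    ∑ s, F.ptForm hn hy ((F.frameAlgebra hn).g ∘ₗ (F.frameAlgebra hn).nabL (F.gradL hn hf))
      (F.J s y u) (F.J s y v) := by
  obtain ⟨O, hO, hJ, ht⟩ := F.exists_gauge_tor hn hy
  simp only [F.hess_eq_ptForm hn hy hf]
  set h := F.ptForm hn hy ((F.frameAlgebra hn).g ∘ₗ (F.frameAlgebra hn).nabL (F.gradL hn hf))
  rw [← sum_orthogonal hO fun s t => h (F.J s y u) (F.J t y v)]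
  refine Finset.sum_congr rfl fun s _ => ?_
  simp only [hJ, map_sum, map_smul, LinearMap.sum_apply, LinearMap.smul_apply, smul_eq_mul,
    Finset.mul_sum]
  rw [Finset.sum_comm]
  exact Finset.sum_congr rfl fun a _ => Finset.sum_congr rfl fun b _ => by ring

/-- The globally defined field uses arbitrary pointwise frames, but its formula is invariant;
agreement with the frame expression is what makes it smooth. -/
theorem bochnerSec_eq : (B.bochnerSec f y : Tan n y) =
    fld ((F.frameAlgebra hn).bochnerField n (F.gradL hn hf)) y := by
  set G := F.gradL hn hf with hG
  set h := F.ptForm hn hy ((F.frameAlgebra hn).g ∘ₗ (F.frameAlgebra hn).nabL G) with hh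
  have hor : ∀ a, B.hor y (fld ((F.frameAlgebra hn).e a) y) = F.e a y := fun a => by
    rw [F.fld_e hn hy, B.hor_coe]
  have e1 : ∑ b, B.hess f y (D.e y b) (D.grad f y) • D.e y b =
      ∑ b, evalAt hy ((F.frameAlgebra hn).g ((F.frameAlgebra hn).nab ((F.frameAlgebra hn).e b) G) G) •
        F.e b y := by
    have := (isONB_e y).trace_eq (QCStructure.Orthonormal.isONB (F.orth y hy))
      (LinearMap.lsmul ℝ (D.H y) ∘ₗ h.flip (D.grad f y))
    simp only [LinearMap.comp_apply, LinearMap.flip_apply, LinearMap.lsmul_apply] at this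
    simp only [F.hess_eq_ptForm hn hy hf]
    refine this.trans (Finset.sum_congr rfl fun b _ => ?_)
    have h2 := F.ptForm_hor hn hy (FrameAlgebra.isHor_e _ b) (F.isHor_gradL hn hf)
      ((F.frameAlgebra hn).g ∘ₗ (F.frameAlgebra hn).nabL G)
    rw [hor, F.hor_gradL hn hy hf, ← hh] at h2
    rw [h2]; rfl
  have e2 : ∑ b, (∑ s, B.hess f y (D.J y s (D.e y b)) (D.J y s (D.grad f y))) • D.e y b =
      ∑ b, (∑ s, evalAt hy ((F.frameAlgebra hn).g ((F.frameAlgebra hn).nab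
        ((F.frameAlgebra hn).J s ((F.frameAlgebra hn).e b)) G) ((F.frameAlgebra hn).J s G))) •
        F.e b y := by
    have := (isONB_e y).trace_eq (QCStructure.Orthonormal.isONB (F.orth y hy))
      (LinearMap.lsmul ℝ (D.H y) ∘ₗ (∑ s, h.flip (F.J s y (D.grad f y)) ∘ₗ F.J s y))
    simp only [LinearMap.comp_apply, LinearMap.sum_apply, LinearMap.flip_apply,
      LinearMap.lsmul_apply] at this
    simp only [F.hess_J_eq hn hy hf]
    refine this.trans (Finset.sum_congr rfl fun b _ => ?_)
    congr 1
    refine Finset.sum_congr rfl fun s _ => ?_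
    have h2 := F.ptForm_hor hn hy (FrameAlgebra.isHor_J _ s ((F.frameAlgebra hn).e b))
      (FrameAlgebra.isHor_J _ s G) ((F.frameAlgebra hn).g ∘ₗ (F.frameAlgebra hn).nabL G)
    rw [F.fld_J' hn hy, F.fld_J' hn hy, B.hor_coe, B.hor_coe, hor, hG, F.hor_gradL hn hy hf, ← hG,
      ← hh] at h2
    rw [h2]; rfl
  rw [BiquardConnection.bochnerSec, e1, e2, F.subLaplacian_eq hn hy hf, FrameAlgebra.bochnerField,
    fld_sub hy, fld_add hy, fld_smul hy, fld_smul hy, fld_sum _ _ hy, fld_sum _ _ hy]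
  simp only [fld_smul hy, F.fld_e hn hy, ← evalAt_apply hy, map_natCast, map_mul, map_sum]
  rw [F.fld_gradL hn hy hf, ← hG]
  push_cast
  simp only [mul_neg, neg_smul, sub_eq_add_neg]

theorem bochnerDiv_eq : B.bochnerDiv f y = evalAt hy ((F.frameAlgebra hn).div
    ((F.frameAlgebra hn).bochnerField n (F.gradL hn hf))) := by
  set σ := (F.frameAlgebra hn).bochnerField n (F.gradL hn hf) with hσ
  have h1 := F.sum_ptForm hn hy ((F.frameAlgebra hn).g ∘ₗ (F.frameAlgebra hn).nabL σ)
  rw [FrameAlgebra.div, map_sum]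
  refine Eq.trans (Finset.sum_congr rfl fun a _ => ?_) h1
  rw [ptForm_apply, LinearMap.comp_apply, F.evalAt_g hn hy, F.hor_sec hn hy]
  congr 3
  rw [conn_congr B.conn F.isOpen hy (X := fun z => (B.bochnerSec f z : Tan n z)) (Y := fld σ)
    ((smooth_fld σ).congr fun z hz => F.bochnerSec_eq hn hz hf)
    fun z hz => F.bochnerSec_eq hn hz hf]
  refine Eq.trans ?_ (fld_nab B.smooth F.isOpen (F.sec hn (D.e y a)) σ hy).symm
  rw [F.fld_sec hn hy]

theorem g_grad_eq : D.g y (D.grad f y) (D.grad f y) =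
    evalAt hy ((F.frameAlgebra hn).g (F.gradL hn hf) (F.gradL hn hf)) := by
  rw [F.evalAt_g hn hy, F.hor_gradL hn hy hf]

theorem Ric_grad_eq : B.Ric y (D.grad f y) (D.grad f y) =
    evalAt hy ((F.frameAlgebra hn).Ric (F.gradL hn hf) (F.gradL hn hf)) := by
  rw [← F.Ric_eq hn hy, F.fld_gradL hn hy hf]

theorem T0_grad_eq : B.T0 y (D.grad f y) (D.grad f y) =
    evalAt hy ((F.frameAlgebra hn).T0₂ (F.gradL hn hf)) / 2 := by
  rw [← F.T0_eq hn hy (F.isHor_gradL hn hf), F.hor_gradL hn hy hf]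

theorem U_grad_eq : B.U y (D.grad f y) (D.grad f y) =
    evalAt hy ((F.frameAlgebra hn).U₆ (F.gradL hn hf)) / 6 := by
  rw [← F.U_eq hn hy (F.isHor_gradL hn hf), F.hor_gradL hn hy hf]

end
end AdaptedFrame

namespace BiquardConnection
variable {D : QCStructure n M} (B : BiquardConnection D) (hn : 0 < n) {f : M → ℝ}
  (hf : SmoothFun n Set.univ f)
include hn hf

/-- The Ricci tensor in terms of the torsion and the scalar curvature. -/
theorem Ric_grad (y : M) : B.Ric y (D.grad f y) (D.grad f y) =
    (2 * n + 2) * B.T0 y (D.grad f y) (D.grad f y) + (4 * n + 10) * B.U y (D.grad f y) (D.grad f y)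
      + 2 * (n + 2) * (B.S y * D.g y (D.grad f y) (D.grad f y)) := by
  obtain ⟨U, hy, -, ⟨F⟩⟩ := exists_adaptedFrame B y
  have hfU : SmoothFun n U f := hf.mono (Set.subset_univ _)
  have : Nonempty (Fin (4 * n)) := ⟨⟨0, by omega⟩⟩
  rw [F.Ric_grad_eq hn hy hfU, F.T0_grad_eq hn hy hfU, F.U_grad_eq hn hy hfU, F.S_eq hn hy,
    F.g_grad_eq hn hy hfU]
  exact FrameAlgebra.ev_Ric_eq (by simp) (F.torsionPerp hn hy) (F.isHor_gradL hn hfU)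

/-- The rotated square in `ev_div_bochnerField` is at least (△f)²/n − |∇²f|²; this changes the
coefficients n and −n into n − 1 and −(n − 1/n). -/
theorem le_bochnerDiv (y : M) :
    (n - 1) * B.hessNormSq f y - (n - 1 / n) * B.subLaplacian f y ^ 2
      + n * B.Ric y (D.grad f y) (D.grad f y) - 4 * B.T0 y (D.grad f y) (D.grad f y)
      - 6 * n * B.U y (D.grad f y) (D.grad f y)
      - 6 * n * (B.S y * D.g y (D.grad f y) (D.grad f y)) ≤ B.bochnerDiv f y := by
  obtain ⟨U, hy, -, ⟨F⟩⟩ := exists_adaptedFrame B y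
  have hfU : SmoothFun n U f := hf.mono (Set.subset_univ _)
  have : Nonempty (Fin (4 * n)) := ⟨⟨0, by omega⟩⟩
  rw [F.Ric_grad_eq hn hy hfU, F.T0_grad_eq hn hy hfU, F.U_grad_eq hn hy hfU, F.S_eq hn hy,
    F.g_grad_eq hn hy hfU, F.hessNormSq_eq hn hy hfU, F.subLaplacian_eq hn hy hfU,
    F.bochnerDiv_eq hn hy hfU]
  rw [FrameAlgebra.ev_div_bochnerField (by simp) (F.torsionPerp hn hy) (F.isHor_gradL hn hfU)
    (F.g_gradL hn hfU)]
  have h1 := FrameAlgebra.ev_trace_sq_le (F.torsionPerp hn hy) (F.isHor_gradL hn hfU)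
  rw [Fintype.card_fin] at h1
  push_cast at h1
  have hn' : (0 : ℝ) < n := by exact_mod_cast hn
  have h2 : 1 / (n : ℝ) * evalAt hy ((F.frameAlgebra hn).tr (F.gradL hn hfU)) ^ 2 ≤
      evalAt hy ((F.frameAlgebra hn).normSq (F.gradL hn hfU)) +
      evalAt hy ((F.frameAlgebra hn).rotSq (F.gradL hn hfU)) := by
    rw [one_div_mul_eq_div, div_le_iff₀ hn']
    linarith
  rw [neg_sq]
  linarith

/-- The functions in the integral formula are continuous. -/
theorem continuous_bochner : Continuous (B.bochnerDiv f) ∧ Continuous (B.hessNormSq f) ∧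
    Continuous (B.subLaplacian f) ∧ (Continuous fun y => B.Ric y (D.grad f y) (D.grad f y)) ∧
    (Continuous fun y => B.T0 y (D.grad f y) (D.grad f y)) ∧
    (Continuous fun y => B.U y (D.grad f y) (D.grad f y)) ∧
    Continuous fun y => B.S y * D.g y (D.grad f y) (D.grad f y) := by
  -- Continuity is local, and near each point every quantity is the value of an element of the
  -- algebra of smooth functions of an adapted frame.
  have key : ∀ Φ : M → ℝ, (∀ (U : Set M) (F : AdaptedFrame B U), ∃ a : FunOn n U, ∀ y (hy : y ∈ U),
      Φ y = evalAt hy a) → Continuous Φ := fun Φ h => by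
    rw [continuous_iff_continuousAt]
    intro y
    obtain ⟨U, hy, -, ⟨F⟩⟩ := exists_adaptedFrame B y
    obtain ⟨a, ha⟩ := h U F
    refine ContinuousAt.congr ((smooth_fn a).continuousOn.continuousAt (F.isOpen.mem_nhds hy)) ?_
    exact Filter.eventually_of_mem (F.isOpen.mem_nhds hy) fun z hz => by
      rw [ha z hz, evalAt_apply]
  have hfU : ∀ U, SmoothFun n U f := fun U => hf.mono (Set.subset_univ _)
  have half : ∀ (r : ℝ) {U : Set M} (a : FunOn n U) {y} (hy : y ∈ U),
      evalAt hy (algebraMap ℝ (FunOn n U) r * a) = evalAt hy a * r := fun r U a y hy => by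
    rw [map_mul, AlgHom.commutes, mul_comm]; rfl
  refine ⟨key _ fun U F => ⟨_, fun y hy => F.bochnerDiv_eq hn hy (hfU U)⟩,
    key _ fun U F => ⟨_, fun y hy => F.hessNormSq_eq hn hy (hfU U)⟩,
    key _ fun U F => ⟨-_, fun y hy => (F.subLaplacian_eq hn hy (hfU U)).trans (map_neg _ _).symm⟩,
    key _ fun U F => ⟨_, fun y hy => F.Ric_grad_eq hn hy (hfU U)⟩,
    key _ fun U F => ⟨algebraMap ℝ _ 2⁻¹ * (F.frameAlgebra hn).T0₂ (F.gradL hn (hfU U)),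
      fun y hy => by rw [F.T0_grad_eq hn hy (hfU U), div_eq_mul_inv, half]⟩,
    key _ fun U F => ⟨algebraMap ℝ _ 6⁻¹ * (F.frameAlgebra hn).U₆ (F.gradL hn (hfU U)),
      fun y hy => by rw [F.U_grad_eq hn hy (hfU U), div_eq_mul_inv, half]⟩,
    key _ fun U F => ⟨algebraMap ℝ _ (8 * n * (n + 2) : ℝ)⁻¹ *
      ((∑ a, (F.frameAlgebra hn).Ric ((F.frameAlgebra hn).e a) ((F.frameAlgebra hn).e a)) *
        (F.frameAlgebra hn).g (F.gradL hn (hfU U)) (F.gradL hn (hfU U))),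
      fun y hy => by
        rw [F.S_eq hn hy, F.g_grad_eq hn hy (hfU U), half, map_mul, map_sum, div_eq_mul_inv]
        ring⟩⟩

end BiquardConnection

end QC
end

/-! ### The volume form and Gram determinants -/

noncomputable section

namespace QC

section Multilinear

variable {n : ℕ} {W : Type*} [AddCommGroup W] [Module ℝ W]

/-- The multilinear map whose alternatization is `η_1 ∧ η_2 ∧ η_3 ∧ ω^{2n}`. -/
def volProd (n : ℕ) (η : Fin 3 → W →ₗ[ℝ] ℝ) (Ω : W →ₗ[ℝ] W →ₗ[ℝ] ℝ) (v : Fin (4 * n + 3) → W) : ℝ :=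
  η 0 (v ⟨0, by omega⟩) * η 1 (v ⟨1, by omega⟩) * η 2 (v ⟨2, by omega⟩) *
      ∏ k : Fin (2 * n), Ω (v ⟨2 * k + 3, by omega⟩) (v ⟨2 * k + 4, by omega⟩)

/-- Each slot occurs in exactly one factor: slots 0, 1, 2 in a contact form, slot j ≥ 3 in the pair
k = (j − 3)/2. Hence the product is linear in that slot. -/
theorem exists_volProd_update (η : Fin 3 → W →ₗ[ℝ] ℝ) (Ω : W →ₗ[ℝ] W →ₗ[ℝ] ℝ)
    [DecidableEq (Fin (4 * n + 3))] (v : Fin (4 * n + 3) → W) (i : Fin (4 * n + 3)) :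
    ∃ L : W →ₗ[ℝ] ℝ, ∀ x, volProd n η Ω (Function.update v i x) = L x := by
  have hu : ∀ (j : ℕ) (hj : j < 4 * n + 3) (x : W), Function.update v i x ⟨j, hj⟩ =
      if j = i then x else v ⟨j, hj⟩ := fun j hj x => by
    by_cases h : j = i
    · have : (⟨j, hj⟩ : Fin (4 * n + 3)) = i := Fin.ext h
      rw [if_pos h, this, Function.update_self]
    · rw [if_neg h, Function.update_of_ne fun h' => h (congrArg Fin.val h')]
  obtain ⟨j, hj⟩ := i
  simp only [volProd, hu]
  by_cases h3 : j < 3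
  · have hp : ∀ k : ℕ, 2 * k + 3 ≠ j ∧ 2 * k + 4 ≠ j := fun k => by omega
    simp only [(hp _).1, (hp _).2, if_false]
    set P := ∏ k : Fin (2 * n), Ω (v ⟨2 * k + 3, by omega⟩) (v ⟨2 * k + 4, by omega⟩)
    interval_cases j
    · exact ⟨(η 1 (v ⟨1, by omega⟩) * η 2 (v ⟨2, by omega⟩) * P) • η 0, fun x => by simp; ring⟩
    · exact ⟨(η 0 (v ⟨0, by omega⟩) * η 2 (v ⟨2, by omega⟩) * P) • η 1, fun x => by simp; ring⟩
    · exact ⟨(η 0 (v ⟨0, by omega⟩) * η 1 (v ⟨1, by omega⟩) * P) • η 2, fun x => by simp; ring⟩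
  · have h0 : 0 ≠ j ∧ 1 ≠ j ∧ 2 ≠ j := by omega
    simp only [h0.1, h0.2.1, h0.2.2, if_false]
    set a := η 0 (v ⟨0, by omega⟩) * η 1 (v ⟨1, by omega⟩) * η 2 (v ⟨2, by omega⟩)
    obtain ⟨k, hk⟩ : ∃ k : Fin (2 * n), j = 2 * k + 3 ∨ j = 2 * k + 4 :=
      ⟨⟨(j - 3) / 2, by omega⟩, by simp only; omega⟩
    simp only [← Finset.mul_prod_erase Finset.univ _ (Finset.mem_univ k)]
    have hne : ∀ x, ∏ l ∈ Finset.univ.erase k,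
        Ω (if 2 * (l : ℕ) + 3 = j then x else v ⟨2 * l + 3, by omega⟩)
          (if 2 * (l : ℕ) + 4 = j then x else v ⟨2 * l + 4, by omega⟩) =
        ∏ l ∈ Finset.univ.erase k, Ω (v ⟨2 * l + 3, by omega⟩) (v ⟨2 * l + 4, by omega⟩) :=
      fun x => Finset.prod_congr rfl fun l hl => by
        have h1 : (l : ℕ) ≠ k := fun h => (Finset.ne_of_mem_erase hl) (Fin.ext h)
        rw [if_neg (by omega), if_neg (by omega)]
    simp only [hne]
    set P := ∏ l ∈ Finset.univ.erase k, Ω (v ⟨2 * l + 3, by omega⟩) (v ⟨2 * l + 4, by omega⟩)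
    rcases hk with hk | hk
    · refine ⟨(a * P) • Ω.flip (v ⟨2 * k + 4, by omega⟩), fun x => ?_⟩
      rw [if_pos hk.symm, if_neg (by omega)]
      simp; ring
    · refine ⟨(a * P) • Ω (v ⟨2 * k + 3, by omega⟩), fun x => ?_⟩
      rw [if_pos hk.symm, if_neg (by omega)]
      simp; ring

/-- `volProd` as a multilinear map -/
def volMultilinear (n : ℕ) (η : Fin 3 → W →ₗ[ℝ] ℝ) (Ω : W →ₗ[ℝ] W →ₗ[ℝ] ℝ) :
    MultilinearMap ℝ (fun _ : Fin (4 * n + 3) => W) ℝ where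
  toFun := volProd n η Ω
  map_update_add' v i x y := by
    obtain ⟨L, hL⟩ := exists_volProd_update η Ω v i
    rw [hL, hL, hL, map_add]
  map_update_smul' v i c x := by
    obtain ⟨L, hL⟩ := exists_volProd_update η Ω v i
    rw [hL, hL, map_smul]

end Multilinear

variable {n : ℕ} {M : Type*} [TopologicalSpace M]
  [ChartedSpace (EuclideanSpace ℝ (Fin (4 * n + 3))) M] [IsManifold (𝓡 (4 * n + 3)) ∞ M]
  {U : Set M} [T2Space M]

/-- the index set of a basis adapted to one complex structure -/
def frameEquiv (n : ℕ) : Fin (4 * n + 3) ≃ (Fin (2 * n) ⊕ Fin (2 * n)) ⊕ Fin 3 :=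
  Fintype.equivOfCardEq (by simp; ring)

/-- the values of the contact forms on an adapted basis -/
def stdη (n : ℕ) (s : Fin 3) : (Fin (2 * n) ⊕ Fin (2 * n)) ⊕ Fin 3 → ℝ :=
  Sum.elim 0 fun t => if t = s then 1 else 0

/-- the values of the fundamental form on an adapted basis -/
def stdω (n : ℕ) (i j : (Fin (2 * n) ⊕ Fin (2 * n)) ⊕ Fin 3) : ℝ :=
  Sum.elim (Sum.elim
    (fun a => Sum.elim (Sum.elim 0 fun b => if a = b then 1 else 0) 0 j)
    (fun a => Sum.elim (Sum.elim (fun b => if a = b then -1 else 0) 0) 0 j)) 0 i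

/-- The value of the volume form in terms of the values of the contact forms and of the
fundamental form. -/
def volValue (n : ℕ) (h : Fin 3 → Fin (4 * n + 3) → ℝ)
    (Ω : Fin (4 * n + 3) → Fin (4 * n + 3) → ℝ) : ℝ :=
  (∑ σ : Equiv.Perm (Fin (4 * n + 3)), ((Equiv.Perm.sign σ : ℤ) : ℝ) *
    (h 0 (σ ⟨0, by omega⟩) * h 1 (σ ⟨1, by omega⟩) * h 2 (σ ⟨2, by omega⟩) *
      ∏ k : Fin (2 * n), Ω (σ ⟨2 * k + 3, by omega⟩) (σ ⟨2 * k + 4, by omega⟩))) / 2 ^ (2 * n)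

/-- The absolute value of the volume form on an orthonormal basis. -/
def volConst (n : ℕ) : ℝ := |volValue n (fun s i => stdη n s (frameEquiv n i))
  fun i j => stdω n (frameEquiv n i) (frameEquiv n j)|

namespace BiquardConnection

variable {D : QCStructure n M} (B : BiquardConnection D)

theorem vol_eq_volValue (y : M) (v : Fin (4 * n + 3) → Tan n y) :
    B.vol y v = volValue n (fun s i => D.η y s (v i)) fun i j => B.fundForm y 0 (v i) (v j) := rfl

/-- The Gram matrix for the metric which extends the horizontal one by declaring the Reeb vectors
to be orthonormal. -/
def gram (y : M) {κ : Type*} (v : κ → Tan n y) : Matrix κ κ ℝ :=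
  Matrix.of fun i j => ∑ s, D.η y s (v i) * D.η y s (v j) + D.g y (B.hor y (v i)) (B.hor y (v j))

/-- An orthonormal basis of half of `H` together with its image under a complex structure. -/
theorem exists_unitary_basis (y : M) (k : ℕ) (hk : k ≤ 2 * n) : ∃ u : Fin k → D.H y,
    ∀ a b, D.g y (u a) (u b) = (if a = b then 1 else 0) ∧ D.g y (u a) (D.J y 0 (u b)) = 0 := by
  obtain ⟨U', η', J', hy', h', hη, hJ⟩ := exists_localFrame D y
  induction k with
  | zero => exact ⟨fun a => a.elim0, fun a => a.elim0⟩
  | succ k ih =>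
    obtain ⟨u, hu⟩ := ih (by omega)
    let L : D.H y →ₗ[ℝ] (Fin k → ℝ) × (Fin k → ℝ) :=
      (LinearMap.pi fun a => D.g y (u a)).prod (LinearMap.pi fun a => D.g y (D.J y 0 (u a)))
    -- Orthogonality to the u_a and J u_a is 2k conditions, fewer than dim H = 4n while k < 2n.
    have hL : LinearMap.ker L ≠ ⊥ := LinearMap.ker_ne_bot_of_finrank_lt (by
      rw [D.finrank_H]; simp; omega)
    obtain ⟨v, hv, hv0⟩ := Submodule.exists_mem_ne_zero_of_ne_bot hL
    have h1 : ∀ a, D.g y (u a) v = 0 := fun a => congrFun (congrArg Prod.fst hv) a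
    have h2 : ∀ a, D.g y (D.J y 0 (u a)) v = 0 := fun a => congrFun (congrArg Prod.snd hv) a
    have hpos := D.g_pos y v hv0
    have hself : ∀ w, D.g y w (D.J y 0 w) = 0 := fun w => by
      rw [D.g_symm, ← hJ]; exact h'.J_self hy' 0 w
    have hskew : ∀ w w', D.g y (D.J y 0 w) w' = -D.g y w (D.J y 0 w') := fun w w' => by
      rw [← hJ]; exact h'.J_skew hy' 0 w w'
    set r := (√(D.g y v v))⁻¹ with hr
    have hrr : r * (r * D.g y v v) = 1 := by
      have h3 := Real.mul_self_sqrt hpos.le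
      have h4 := (Real.sqrt_pos.2 hpos).ne'
      rw [hr]; field_simp; nlinarith
    refine ⟨Fin.cases (r • v) u, fun a b => ?_⟩
    refine Fin.cases (Fin.cases ?_ (fun b => ?_) b) (fun a => Fin.cases ?_ (fun b => ?_) b) a
    · simp [hself, hrr]
    · have h3 : D.g y v (D.J y 0 (u b)) = 0 := by rw [D.g_symm, h2]
      simp [D.g_symm y v (u b), h1, h3, (Fin.succ_ne_zero _).symm]
    · have h3 : D.g y (u a) (D.J y 0 v) = 0 := by
        have := hskew (u a) v
        rw [h2] at this; linarith
      simp [h1, h3, Fin.succ_ne_zero]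
    · simpa [Fin.succ_inj] using hu a b

/-- The volume form in terms of Gram matrices. -/
theorem abs_vol (y : M) (v : Fin (4 * n + 3) → Tan n y) :
    |B.vol y v| = volConst n * √(B.gram y v).det := by
  obtain ⟨U', η', J', hy', h', hη, hJ⟩ := exists_localFrame D y
  have hskew : ∀ w w', D.g y (D.J y 0 w) w' = -D.g y w (D.J y 0 w') := fun w w' => by
    rw [← hJ]; exact h'.J_skew hy' 0 w w'
  have hJJ : ∀ w, D.J y 0 (D.J y 0 w) = -w := fun w => by
    rw [← hJ]; exact h'.J_J hy' 0 w
  obtain ⟨u, hu⟩ := exists_unitary_basis (D := D) y (2 * n) le_rfl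
  set e : Fin (2 * n) ⊕ Fin (2 * n) → D.H y := Sum.elim u fun a => D.J y 0 (u a) with he
  have hee : ∀ a b, D.g y (e a) (e b) = if a = b then 1 else 0 := by
    rintro (a | a) (b | b)
    · simpa [he] using (hu a b).1
    · simpa [he] using (hu a b).2
    · simpa [he, hskew] using (hu a b).2
    · have := (hu a b).1
      simp only [he, Sum.elim_inr, hskew, hJJ, map_neg, neg_neg, Sum.inr.injEq]
      exact this
  have hexp : ∀ w : D.H y, w = ∑ a, D.g y w (e a) • e a := by
    let E : Fin (4 * n) ≃ Fin (2 * n) ⊕ Fin (2 * n) := Fintype.equivOfCardEq (by simp; ring)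
    have h1 : D.Orthonormal y fun a => e (E a) := fun a b => by simp [hee]
    intro w
    refine ((QCStructure.Orthonormal.isONB h1).expand w).trans ?_
    exact E.sum_comp fun a => D.g y w (e a) • e a
  set w : (Fin (2 * n) ⊕ Fin (2 * n)) ⊕ Fin 3 → Tan n y :=
    Sum.elim (fun a => (e a : Tan n y)) fun s => B.ξ y s with hw
  set θ : (Fin (2 * n) ⊕ Fin (2 * n)) ⊕ Fin 3 → Tan n y →ₗ[ℝ] ℝ :=
    Sum.elim (fun a => D.g y (e a) ∘ₗ B.hor y) fun s => D.η y s with hθ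
  have hξ : ∀ s t, D.η y t (B.ξ y s) = if s = t then 1 else 0 := fun s =>
    (B.exists_reeb y s).choose_spec
  have hηH : ∀ s (u : D.H y), D.η y s u = 0 := fun s u => (D.mem_H_iff y _).1 u.2 s
  have hreeb : ∀ s, B.reeb η' s y = B.ξ y s := fun s => by
    refine Subtype.ext ?_
    rw [B.mem_V_eq h' hy' _ (B.ξ y s).2]
    simp [hη, hξ]
  have hor := fun v => B.hor_eq h' hy' v
  simp only [hη, hreeb] at hor
  have hθw : ∀ i j, θ i (w j) = if i = j then 1 else 0 := by
    rintro (i | i) (j | j)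
    · simp [hθ, hw, B.hor_coe, hee]
    · simp [hθ, hw, B.hor_of_mem_V (B.ξ y j).2]
    · simp [hθ, hw, hηH]
    · simp [hθ, hw, hξ, eq_comm]
  have hexpw : ∀ v, v = ∑ i, θ i v • w i := fun v => by
    have h1 := congrArg (fun w : D.H y => (w : Tan n y)) (hexp (B.hor y v))
    simp only [hor] at h1
    rw [sub_eq_iff_eq_add] at h1
    conv_lhs => rw [h1]
    simp [Fintype.sum_sum_type, hθ, hw, D.g_symm y (B.hor y v)]
  set E := frameEquiv n with hE
  let φ : Tan n y ≃ₗ[ℝ] (Fin (4 * n + 3) → ℝ) :=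
    { toFun := fun v i => θ (E i) v
      map_add' := fun v v' => by ext i; simp
      map_smul' := fun c v => by ext i; simp
      invFun := fun c => ∑ i, c i • w (E i)
      left_inv := fun v => by
        refine Eq.trans ?_ (hexpw v).symm
        exact E.sum_comp fun i => θ i v • w i
      right_inv := fun c => by
        ext i
        simp [map_sum, hθw] }
  let b := Module.Basis.ofEquivFun φ
  have hb : ∀ i, b i = w (E i) := fun i => by
    rw [Module.Basis.coe_ofEquivFun]
    change ∑ j, (Pi.single i (1 : ℝ) : Fin (4 * n + 3) → ℝ) j • w (E j) = _
    rw [Finset.sum_eq_single i] <;> simp +contextual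
  let ω₀ : Tan n y →ₗ[ℝ] Tan n y →ₗ[ℝ] ℝ := (D.g y).compl₁₂ (D.J y 0 ∘ₗ B.hor y) (B.hor y)
  let m := volMultilinear n (fun s => (D.η y s : Tan n y →ₗ[ℝ] ℝ)) ω₀
  have hvol : ∀ v, B.vol y v = m.alternatization v / 2 ^ (2 * n) := fun v => by
    rw [vol, MultilinearMap.alternatization_apply]
    congr 1
    refine Finset.sum_congr rfl fun σ _ => ?_
    rw [Units.smul_def, zsmul_eq_mul]
    rfl
  -- An alternating form of top degree is a multiple of the determinant.
  have h1 : B.vol y v = B.vol y b * b.det v := by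
    rw [hvol, hvol]
    conv_lhs => rw [AlternatingMap.eq_smul_basis_det b m.alternatization]
    simp only [AlternatingMap.smul_apply, smul_eq_mul]
    ring
  -- On a basis (u_a, J u_a, ξ_s) the contact forms and the fundamental form take standard values,
  -- so the constant depends on n alone. Its value is never needed.
  have h2 : |B.vol y b| = volConst n := by
    rw [vol_eq_volValue, volConst]
    congr 2
    · ext s i
      rw [hb, stdη]
      rcases E i with i | i
      · simp [hw, hηH]
      · simp [hw, hξ]
    · ext i j
      rw [hb, hb, stdω, fundForm]
      rcases E i with (i | i) | i <;> rcases E j with (j | j) | j <;>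
        simp [hw, he, B.hor_coe, B.hor_of_mem_V (Subtype.mem _), hskew, hJJ, hu]
      split_ifs <;> simp
  -- The same basis is orthonormal for the metric extended by the Reeb vectors, so the Gram matrix
  -- is PᵀP with P the matrix of components.
  have h3 : (B.gram y v).det = b.det v ^ 2 := by
    have : B.gram y v = (b.toMatrix v).transpose * b.toMatrix v := by
      ext i j
      rw [Matrix.mul_apply]
      change _ = ∑ k, θ (E k) (v i) * θ (E k) (v j)
      rw [E.sum_comp fun k => θ k (v i) * θ k (v j), Fintype.sum_sum_type, gram, Matrix.of_apply,
        add_comm]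
      congr 1
      conv_lhs => rw [hexp (B.hor y (v j))]
      simp only [map_sum, map_smul, smul_eq_mul]
      exact Finset.sum_congr rfl fun a _ => by
        simp only [hθ, Sum.elim_inl, LinearMap.comp_apply]
        rw [D.g_symm y (B.hor y (v j)), D.g_symm y (B.hor y (v i)), mul_comm]
    rw [this, Matrix.det_mul, Matrix.det_transpose, Module.Basis.det_apply, sq]
  rw [h1, abs_mul, h2, h3, Real.sqrt_sq_eq_abs]
end BiquardConnection

end QC
end

/-! ### The volume density in charts -/

noncomputable section

namespace QC

/-- the model space -/
abbrev Model (n : ℕ) : Type := EuclideanSpace ℝ (Fin (4 * n + 3))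

variable {n : ℕ} {M : Type*} [TopologicalSpace M]
  [ChartedSpace (EuclideanSpace ℝ (Fin (4 * n + 3))) M] [IsManifold (𝓡 (4 * n + 3)) ∞ M]
  {U : Set M}

theorem mfderiv_chart_symm {c z : M} (hz : z ∈ (chartAt (Model n) c).source) (w : Model n) :
    mfderiv (𝓡 (4 * n + 3)) (𝓡 (4 * n + 3)) (chartAt (Model n) c).symm (chartAt (Model n) c z) w =
      (constField c w z : Tan n ((chartAt (Model n) c).symm (chartAt (Model n) c z))) := by
  rw [constField, TangentBundle.symmL_trivializationAt hz]
  simp only [modelWithCornersSelf_coe, Set.range_id, mfderivWithin_univ]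
  rfl

/-- Derivatives of functions in a chart. -/
theorem hasFDerivAt_comp_symm (hU : IsOpen U) {w : M → ℝ} (hw : SmoothFun n U w) {c z : M}
    (hz : z ∈ U) (hzc : z ∈ (chartAt (Model n) c).source) :
    DifferentiableAt ℝ (fun y => w ((chartAt (Model n) c).symm y)) (chartAt (Model n) c z) ∧
    ∀ v, fderiv ℝ (fun y => w ((chartAt (Model n) c).symm y)) (chartAt (Model n) c z) v =
      d n w z (constField c v z) := by
  have hinv := (chartAt (Model n) c).left_inv hzc
  have h1 : MDifferentiableAt (𝓡 (4 * n + 3)) 𝓘(ℝ, ℝ) w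
      ((chartAt (Model n) c).symm (chartAt (Model n) c z)) := by
    rw [hinv]
    exact (hw.contMDiffAt (hU.mem_nhds hz)).mdifferentiableAt (by simp)
  have h2 : MDifferentiableAt (𝓡 (4 * n + 3)) (𝓡 (4 * n + 3)) (chartAt (Model n) c).symm
      (chartAt (Model n) c z) :=
    mdifferentiableAt_atlas_symm (chart_mem_atlas _ _) ((chartAt (Model n) c).map_source hzc)
  refine ⟨mdifferentiableAt_iff_differentiableAt.1 (h1.comp _ h2), fun v => ?_⟩
  have h3 := mvfderiv_comp_apply (I := 𝓡 (4 * n + 3)) (I' := 𝓡 (4 * n + 3)) _ h1 h2 v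
  rw [mfderiv_chart_symm hzc, hinv] at h3
  refine Eq.trans ?_ h3
  rw [mvfderiv, mfderiv_eq_fderiv]
  rfl

namespace BiquardConnection

variable [T2Space M] {D : QCStructure n M} (B : BiquardConnection D)

theorem gram_sum {y : M} {κ : Type*} [Fintype κ] (v : κ → Tan n y) (P : Matrix κ κ ℝ) :
    B.gram y (fun j => ∑ i, P i j • v i) = P.transpose * B.gram y v * P := by
  obtain ⟨Γ, hΓ⟩ : ∃ Γ : Tan n y →ₗ[ℝ] Tan n y →ₗ[ℝ] ℝ, ∀ u w, Γ u w =
      ∑ s, D.η y s u * D.η y s w + D.g y (B.hor y u) (B.hor y w) := by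
    refine ⟨∑ s, (LinearMap.mul ℝ ℝ).compl₁₂ (D.η y s : Tan n y →ₗ[ℝ] ℝ) (D.η y s) +
      (D.g y).compl₁₂ (B.hor y) (B.hor y), fun u w => ?_⟩
    rw [LinearMap.add_apply, LinearMap.add_apply, LinearMap.sum_apply, LinearMap.sum_apply]
    rfl
  have h1 : ∀ v : κ → Tan n y, B.gram y v = Matrix.of fun i j => Γ (v i) (v j) := fun v => by
    ext i j
    rw [Matrix.of_apply, hΓ]
    rfl
  ext a b
  rw [h1, h1]
  simp only [Matrix.of_apply, map_sum, map_smul, LinearMap.sum_apply, LinearMap.smul_apply,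
    smul_eq_mul, Matrix.mul_apply, Matrix.transpose_apply, Finset.sum_mul]
  refine Finset.sum_congr rfl fun j _ => ?_
  rw [Finset.mul_sum]
  exact Finset.sum_congr rfl fun i _ => by ring

/-- The density of the volume form with respect to the coordinates of the chart at `c`. -/
def density (c z : M) : ℝ :=
  volConst n * √(B.gram z fun i => constField c (EuclideanSpace.single i 1) z).det

theorem chartDensity_eq {c z : M} (hz : z ∈ (chartAt (Model n) c).source) :
    B.chartDensity c (chartAt (Model n) c z) = B.density c z := by
  rw [chartDensity, density, B.abs_vol]
  simp only [mfderiv_chart_symm hz]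
  rw [(chartAt (Model n) c).left_inv hz]

/-- The change of the density under a change of charts. -/
theorem exists_density_eq {c p z : M} (hz : z ∈ (chartAt (Model n) c).source)
    (hzp : z ∈ (chartAt (Model n) p).source) : ∃ L : Model n →L[ℝ] Model n,
      HasFDerivAt (fun y => chartAt (Model n) c ((chartAt (Model n) p).symm y)) L
        (chartAt (Model n) p z) ∧ B.density p z = |L.det| * B.density c z := by
  set P : Matrix (Fin (4 * n + 3)) (Fin (4 * n + 3)) ℝ := Matrix.of fun i j =>
    d n (coord n c i) z (constField p (EuclideanSpace.single j 1) z) with hP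
  have hd := fun i => hasFDerivAt_comp_symm (chartAt (Model n) c).open_source (smooth_coord c i) hz hzp
  have hdiff : DifferentiableAt ℝ (fun y => chartAt (Model n) c ((chartAt (Model n) p).symm y))
      (chartAt (Model n) p z) := differentiableAt_euclidean.2 fun i => (hd i).1
  refine ⟨_, hdiff.hasFDerivAt, ?_⟩
  set L := fderiv ℝ (fun y => chartAt (Model n) c ((chartAt (Model n) p).symm y))
      (chartAt (Model n) p z) with hL
  have hLP : ∀ i j, (L (EuclideanSpace.single j 1)) i = P i j := fun i j => by
    have h1 := ((EuclideanSpace.proj i : Model n →L[ℝ] ℝ).hasFDerivAt.comp _ hdiff.hasFDerivAt).fderiv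
    have h2 := (hd i).2 (EuclideanSpace.single j 1)
    rw [hP, Matrix.of_apply, ← h2]
    exact (congrArg (fun A => A (EuclideanSpace.single j 1)) h1).symm
  have hdet : L.det = P.det := by
    rw [ContinuousLinearMap.det, ← LinearMap.det_toMatrix
      (EuclideanSpace.basisFun (Fin (4 * n + 3)) ℝ).toBasis]
    congr 1
    ext i j
    rw [LinearMap.toMatrix_apply]
    simp [hLP]
  have hg : (B.gram z fun j => constField p (EuclideanSpace.single j 1) z) =
      P.transpose * (B.gram z fun i => constField c (EuclideanSpace.single i 1) z) * P := by
    rw [← B.gram_sum]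
    congr 1
    ext1 j
    exact eq_sum_constField c hz _
  rw [density, density, hg, Matrix.det_mul, Matrix.det_mul, Matrix.det_transpose, hdet,
    mul_right_comm, ← sq, Real.sqrt_mul (sq_nonneg _), Real.sqrt_sq_eq_abs]
  ring

end BiquardConnection

theorem measurableSet_inter_preimage {X Y : Type*} [TopologicalSpace X] [MeasurableSpace X]
    [BorelSpace X] [TopologicalSpace Y] [MeasurableSpace Y] [BorelSpace Y] {f : X → Y} {s : Set X}
    (hs : MeasurableSet s) (hf : ContinuousOn f s) {t : Set Y} (ht : MeasurableSet t) :
    MeasurableSet (s ∩ f ⁻¹' t) := by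
  have h1 : Measurable (s.domRestrict f) := (continuousOn_iff_continuous_domRestrict.1 hf).measurable
  have h2 := hs.subtype_image (h1 ht)
  convert h2 using 1
  ext x
  exact ⟨fun h => ⟨⟨x, h.1⟩, h.2, rfl⟩, fun ⟨a, h, e⟩ => e ▸ ⟨a.2, h⟩⟩

end QC
end

/-! ### The divergence of the Bochner field in a chart -/

noncomputable section

namespace QC

variable {n : ℕ} {M : Type*} [TopologicalSpace M]
  [ChartedSpace (EuclideanSpace ℝ (Fin (4 * n + 3))) M] [IsManifold (𝓡 (4 * n + 3)) ∞ M]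
  {U : Set M} [T2Space M]

namespace AdaptedFrame

variable {D : QCStructure n M} {B : BiquardConnection D} (F : AdaptedFrame B U) (hn : 0 < n)
  {p : M} (hp : U ⊆ (chartAt (Model n) p).source)

/-- coordinate fields of a chart -/
def coordField (i : Fin (4 * n) ⊕ Fin 3) : FieldOn n U :=
  ((smooth_constField p (EuclideanSpace.single (finSumFinEquiv i) 1)).mono hp).mk

/-- coordinates of a chart -/
def coordFun (i : Fin (4 * n) ⊕ Fin 3) : FunOn n U :=
  ((smooth_coord p (finSumFinEquiv i)).mono hp).mk

omit [T2Space M] in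
theorem fld_coordField (i) {y : M} (hy : y ∈ U) : fld (coordField hp i) y =
    constField p (EuclideanSpace.single (finSumFinEquiv i) 1) y := fld_mk _ hy

theorem evalAt_D_coordFun (X : FieldOn n U) (i) {y : M} (hy : y ∈ U) :
    evalAt hy ((F.frameAlgebra hn).D X (coordFun hp i)) =
      d n (coord n p (finSumFinEquiv i)) y (fld X y) := by
  rw [evalAt_apply]
  refine (fn_D B.smooth F.isOpen _ _ hy).trans ?_
  rw [d_congr F.isOpen hy (f := fn (coordFun hp i)) fun z hz =>
    fn_mk ((smooth_coord p (finSumFinEquiv i)).mono hp) hz]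

theorem D_coordField (i j) : (F.frameAlgebra hn).D (coordField hp i) (coordFun hp j) =
    if i = j then 1 else 0 := fun_ext fun y hy => by
  rw [← evalAt_apply hy, ← evalAt_apply hy, F.evalAt_D_coordFun hn hp _ _ hy, fld_coordField hp _ hy,
    d_coord_constField p _ _ (hp hy)]
  simp only [EmbeddingLike.apply_eq_iff_eq, eq_comm (a := j)]
  split_ifs <;> simp

theorem eq_sum_coordField (X : FieldOn n U) :
    X = ∑ i, (F.frameAlgebra hn).D X (coordFun hp i) • coordField hp i := fld_ext fun y hy => by
  rw [fld_sum _ _ hy]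
  simp only [fld_smul hy, ← evalAt_apply hy, F.evalAt_D_coordFun hn hp _ _ hy, fld_coordField hp _ hy]
  rw [finSumFinEquiv.sum_comp fun i => d n (coord n p i) y (fld X y) •
    constField p (EuclideanSpace.single i 1) y]
  exact eq_sum_constField p (hp hy) _

/-- the determinant of the adapted coframe in the coordinates of a chart -/
def coordDet : FunOn n U :=
  (Matrix.of fun j k => (F.frameAlgebra hn).coframe j (coordField hp k)).det

/-- The components of the coframe on coordinate fields and the coordinate components of the frame
are inverse matrices. -/
theorem isUnit_coordDet : IsUnit (F.coordDet hn hp) := by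
  set P := F.frameAlgebra hn with hP
  have h1 : (Matrix.of fun j k => P.coframe j (coordField hp k)) *
      (Matrix.of fun k j => P.D (P.frame j) (coordFun hp k)) = 1 := by
    ext1 i j
    have h2 := congrArg (P.coframe i) (F.eq_sum_coordField hn hp (P.frame j))
    rw [map_sum] at h2
    simp only [map_smul, smul_eq_mul] at h2
    rw [Matrix.mul_apply, Matrix.one_apply, ← P.coframe_frame, h2]
    exact Finset.sum_congr rfl fun k _ => mul_comm _ _
  have h3 := congrArg Matrix.det h1
  rw [Matrix.det_mul, Matrix.det_one] at h3
  exact IsUnit.of_mul_eq_one _ h3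

/-- The Gram matrix of the coordinate fields is ΘᵀΘ for the adapted coframe Θ; the orthogonal change
from the chosen η to the frame's η does not affect it. -/
theorem density_eq {y : M} (hy : y ∈ U) :
    B.density p y = volConst n * |evalAt hy (F.coordDet hn hp)| := by
  rw [BiquardConnection.density, ← Real.sqrt_sq_eq_abs]
  congr 2
  set Θ : Matrix (Fin (4 * n) ⊕ Fin 3) (Fin (4 * n) ⊕ Fin 3) ℝ := Matrix.of fun j k =>
    evalAt hy ((F.frameAlgebra hn).coframe j (coordField hp k)) with hΘ
  have h1 : evalAt hy (F.coordDet hn hp) = Θ.det := by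
    rw [coordDet, AlgHom.map_det]; rfl
  have h0 : Θ.det ^ 2 = (Θ.transpose * Θ).det := by
    rw [Matrix.det_mul, Matrix.det_transpose, sq]
  rw [h1, h0, ← Matrix.det_submatrix_equiv_self finSumFinEquiv]
  congr 1
  ext i j
  rw [Matrix.mul_apply, Matrix.submatrix_apply, BiquardConnection.gram, Matrix.of_apply,
    Fintype.sum_sum_type, add_comm]
  congr 1
  · rw [(QCStructure.Orthonormal.isONB (F.orth y hy)).inner_eq_sum]
    refine Finset.sum_congr rfl fun a _ => ?_
    have h2 : ∀ k, Θ (Sum.inl a) k = D.g y (B.hor y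
        (constField p (EuclideanSpace.single (finSumFinEquiv k) 1) y)) (F.e a y) := fun k => by
      rw [hΘ, Matrix.of_apply, ← fld_coordField hp k hy, D.g_symm]
      refine (F.evalAt_g hn hy _ _).trans ?_
      rw [F.fld_e hn hy, B.hor_coe]
    rw [Matrix.transpose_apply, h2, h2]
  · obtain ⟨O, hO, -, hη, -⟩ := F.exists_gauge hn hy
    have h2 : ∀ s k, Θ (Sum.inr s) k = F.η s y
        (constField p (EuclideanSpace.single (finSumFinEquiv k) 1) y) := fun s k => by
      rw [hΘ, Matrix.of_apply, ← fld_coordField hp k hy, evalAt_apply]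
      exact fn_lin (F.frame.smooth s) _ hy
    simp only [Matrix.transpose_apply, h2, hη]
    rw [← sum_orthogonal hO fun s t =>
      F.η s y (constField p (EuclideanSpace.single (finSumFinEquiv i) 1) y) *
        F.η t y (constField p (EuclideanSpace.single (finSumFinEquiv j) 1) y)]
    refine Finset.sum_congr rfl fun s _ => ?_
    rw [Finset.sum_mul_sum]
    exact Finset.sum_congr rfl fun a _ => Finset.sum_congr rfl fun b _ => by ring

theorem fn_D_bochnerField {f u : M → ℝ} (hf : SmoothFun n U f) (hu : SmoothFun n U u) {z : M}
    (hz : z ∈ U) : fn ((F.frameAlgebra hn).D ((F.frameAlgebra hn).bochnerField n (F.gradL hn hf))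
      hu.mk) z = d n u z (B.bochnerSec f z) := by
  refine (fn_D B.smooth F.isOpen _ _ hz).trans ?_
  rw [F.bochnerSec_eq hn hz hf, d_congr F.isOpen hz (f := fn hu.mk) fun z hz => fn_mk hu hz]

include F hn hp in
/-- The divergence of a multiple of the field `bochnerSec`, in coordinates. -/
theorem exists_divergence {f : M → ℝ} (hf : SmoothFun n U f) : ∃ δ : M → ℝ, SmoothFun n U δ ∧
    (∀ z ∈ U, δ z ≠ 0) ∧ (∀ z ∈ U, B.density p z = volConst n * |δ z|) ∧
    ∀ u : M → ℝ, SmoothFun n U u → ∃ a : Fin (4 * n + 3) → M → ℝ, (∀ i, SmoothFun n U (a i)) ∧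
      (∀ z ∈ U, ∀ i, a i z = δ z * (u z * d n (coord n p i) z (B.bochnerSec f z))) ∧
      ∀ z ∈ U, ∑ i, d n (a i) z (constField p (EuclideanSpace.single i 1) z) =
        δ z * (u z * B.bochnerDiv f z + d n u z (B.bochnerSec f z)) := by
  set P := F.frameAlgebra hn with hP
  set σ := P.bochnerField n (F.gradL hn hf) with hσ
  have : Nonempty (Fin (4 * n)) := ⟨⟨0, by omega⟩⟩
  have hσh : P.IsHor σ := FrameAlgebra.isHor_bochnerField P n (F.isHor_gradL hn hf)
  refine ⟨fn (F.coordDet hn hp), smooth_fn _, fun z hz => by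
    rw [← evalAt_apply hz]
    exact ((F.isUnit_coordDet hn hp).map (evalAt hz)).ne_zero, fun z hz => by
    rw [F.density_eq hn hp hz, evalAt_apply], fun u hu => ?_⟩
  have h1 := P.sum_D_det_mul (hσh.smul hu.mk) (coordFun hp) (coordField hp) (F.D_coordField hn hp)
    (F.eq_sum_coordField hn hp)
  rw [P.div_smul _ hσh] at h1
  change ∑ i, P.D (coordField hp i) (F.coordDet hn hp * P.D (hu.mk • σ) (coordFun hp i)) =
    F.coordDet hn hp * _ at h1
  refine ⟨fun i => fn (F.coordDet hn hp * P.D (hu.mk • σ) (coordFun hp (finSumFinEquiv.symm i))),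
    fun i => smooth_fn _, fun z hz i => ?_, fun z hz => ?_⟩
  · change fn (F.coordDet hn hp * P.D (hu.mk • σ) (coordFun hp (finSumFinEquiv.symm i))) z = _
    rw [fn_mul hz, ← evalAt_apply hz (P.D _ _), F.evalAt_D_coordFun hn hp _ _ hz, fld_smul hz,
      fn_mk hu hz, ← F.bochnerSec_eq hn hz hf]
    simp
  · have h2 := congrArg (evalAt hz) h1
    rw [map_sum, map_mul, map_add, map_mul, ← F.bochnerDiv_eq hn hz hf, evalAt_apply, evalAt_apply,
      evalAt_apply, fn_mk hu hz] at h2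
    rw [F.fn_D_bochnerField hn hf hu hz] at h2
    rw [add_comm (u z * _), ← h2, ← finSumFinEquiv.sum_comp]
    refine Finset.sum_congr rfl fun i _ => ?_
    rw [evalAt_apply]
    refine Eq.trans ?_ (fn_D B.smooth F.isOpen _ _ hz).symm
    rw [fld_coordField hp _ hz]
    beta_reduce
    rw [Equiv.symm_apply_apply]

end AdaptedFrame

end QC
end

/-! ### The volume measure in a chart -/

noncomputable section

namespace QC

variable {n : ℕ} {M : Type*} [TopologicalSpace M]
  [ChartedSpace (EuclideanSpace ℝ (Fin (4 * n + 3))) M] [IsManifold (𝓡 (4 * n + 3)) ∞ M]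
  {U : Set M} [T2Space M]

/-- the part of a set in a chart, in coordinates -/
def chartSet (n : ℕ) {M : Type*} [TopologicalSpace M]
    [ChartedSpace (EuclideanSpace ℝ (Fin (4 * n + 3))) M] (p : M) (A : Set M) : Set (Model n) :=
  (chartAt (Model n) p).target ∩ (chartAt (Model n) p).symm ⁻¹' A

omit [IsManifold (𝓡 (4 * n + 3)) ∞ M] [T2Space M] in
theorem measurableSet_chartSet [MeasurableSpace M] [BorelSpace M] (p : M) {A : Set M}
    (hA : MeasurableSet A) : MeasurableSet (chartSet n p A) :=
  measurableSet_inter_preimage (chartAt (Model n) p).open_target.measurableSet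
    (chartAt (Model n) p).continuousOn_symm hA

namespace BiquardConnection

variable {D : QCStructure n M} (B : BiquardConnection D)

theorem density_nonneg (c z : M) : 0 ≤ B.density c z := by
  unfold density
  have : 0 ≤ volConst n := by unfold volConst; positivity
  positivity

variable [SigmaCompactSpace M]

theorem partition_eq_zero {c z : M} (hz : z ∉ (chartAt (Model n) c).source) :
    partition n M c z = 0 := by
  by_contra h
  exact hz ((SmoothPartitionOfUnity.exists_isSubordinate_chartAt_source
    (𝓡 (4 * n + 3)) M).choose_spec c (subset_tsupport _ h))

variable [MeasurableSpace M] [BorelSpace M]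

/-- A term of the volume measure, in another chart. -/
theorem map_symm_apply (c p : M) {A : Set M} (hA : MeasurableSet A)
    (hAp : A ⊆ (chartAt (Model n) p).source) :
    Measure.map (chartAt (Model n) c).symm
      ((volume.restrict (chartAt (Model n) c).target).withDensity
        fun y => ENNReal.ofReal
          (partition n M c ((chartAt (Model n) c).symm y) * B.chartDensity c y)) A =
    ∫⁻ y in chartSet n p A, ENNReal.ofReal (partition n M c ((chartAt (Model n) p).symm y) *
      B.density p ((chartAt (Model n) p).symm y)) := by
  have htc := (chartAt (Model n) c).open_target.measurableSet
  have hae : AEMeasurable (chartAt (Model n) c).symm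
      (volume.restrict (chartAt (Model n) c).target) :=
    (chartAt (Model n) c).continuousOn_symm.aemeasurable htc
  rw [Measure.map_apply_of_aemeasurable (hae.mono_ac (withDensity_absolutelyContinuous _ _)) hA,
    withDensity_apply', Measure.restrict_restrict' htc]
  set S : Set (Model n) := chartSet n p A ∩ (chartAt (Model n) p).symm ⁻¹'
    (chartAt (Model n) c).source with hS
  set ψ : Model n → Model n := fun y => chartAt (Model n) c ((chartAt (Model n) p).symm y) with hψ
  have hSm : MeasurableSet S := measurableSet_inter_preimage (measurableSet_chartSet p hA)
    ((chartAt (Model n) p).continuousOn_symm.mono Set.inter_subset_left)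
    (chartAt (Model n) c).open_source.measurableSet
  -- The transition map ψ carries the overlap S to the region of integration in chart c, so the
  -- change of variables formula applies.
  have himg : (chartAt (Model n) c).symm ⁻¹' A ∩ (chartAt (Model n) c).target = ψ '' S := by
    ext y
    constructor
    · rintro ⟨h1, h2⟩
      have h3 : (chartAt (Model n) p).symm (chartAt (Model n) p ((chartAt (Model n) c).symm y)) =
          (chartAt (Model n) c).symm y := (chartAt (Model n) p).left_inv (hAp h1)
      refine ⟨chartAt (Model n) p ((chartAt (Model n) c).symm y),
        ⟨⟨(chartAt (Model n) p).map_source (hAp h1), ?_⟩, ?_⟩, ?_⟩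
      · rw [Set.mem_preimage, h3]; exact h1
      · rw [Set.mem_preimage, h3]; exact (chartAt (Model n) c).map_target h2
      · rw [hψ]; beta_reduce; rw [h3, (chartAt (Model n) c).right_inv h2]
    · rintro ⟨x, ⟨⟨h1, h2⟩, h3⟩, rfl⟩
      refine ⟨?_, (chartAt (Model n) c).map_source h3⟩
      rw [Set.mem_preimage, (chartAt (Model n) c).left_inv h3]
      exact h2
  have hder : ∀ y, ∃ L : Model n →L[ℝ] Model n, y ∈ S → HasFDerivAt ψ L y ∧
      B.density p ((chartAt (Model n) p).symm y) =
        |L.det| * B.density c ((chartAt (Model n) p).symm y) := fun y => by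
    by_cases hy : y ∈ S
    · obtain ⟨L, h1, h2⟩ := B.exists_density_eq hy.2 ((chartAt (Model n) p).map_target hy.1.1)
      rw [(chartAt (Model n) p).right_inv hy.1.1] at h1
      exact ⟨L, fun _ => ⟨h1, h2⟩⟩
    · exact ⟨0, fun h => absurd h hy⟩
  choose L hL using hder
  have hinj : Set.InjOn ψ S := by
    intro x hx y hy hxy
    have h1 := (chartAt (Model n) c).injOn hx.2 hy.2 hxy
    exact (chartAt (Model n) p).symm.injOn hx.1.1 hy.1.1 h1
  rw [himg, lintegral_image_eq_lintegral_abs_det_fderiv_mul volume hSm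
    (fun y hy => (hL y hy).1.hasFDerivWithinAt) hinj,
    ← lintegral_inter_add_sdiff _ (chartSet n p A) hSm, Set.inter_eq_self_of_subset_right
      (Set.inter_subset_left : S ⊆ chartSet n p A)]
  -- On S the Jacobian is absorbed by the change of density; outside S the partition function of c
  -- vanishes.
  refine (add_zero _).symm.trans (congrArg₂ _ ?_ ?_)
  · refine setLIntegral_congr_fun hSm fun y hy => ?_
    rw [hψ]
    beta_reduce
    rw [← ENNReal.ofReal_mul (abs_nonneg _), B.chartDensity_eq hy.2,
      (chartAt (Model n) c).left_inv hy.2, (hL y hy).2]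
    congr 1
    ring
  · symm
    refine setLIntegral_eq_zero ((measurableSet_chartSet p hA).diff hSm) fun y hy => ?_
    have : (chartAt (Model n) p).symm y ∉ (chartAt (Model n) c).source := fun h => hy.2 ⟨hy.1, h⟩
    simp [partition_eq_zero this]

/-- Charts in which the volume measure has a continuous density. -/
structure IsDensityChart (p : M) (V : Set M) (δ : M → ℝ) : Prop where
  isOpen : IsOpen V
  subset : V ⊆ (chartAt (Model n) p).source
  continuousOn : ContinuousOn δ V
  density_eq : ∀ z ∈ V, B.density p z = volConst n * |δ z|
  finite : {c | ∃ z ∈ V, partition n M c z ≠ 0}.Finite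

namespace IsDensityChart

variable {B} {p : M} {V : Set M} {δ : M → ℝ} (h : B.IsDensityChart p V δ)
include h

theorem aemeasurable {A : Set M} (hA : MeasurableSet A) (hAV : A ⊆ V) :
    AEMeasurable (fun y => B.density p ((chartAt (Model n) p).symm y))
      (volume.restrict (chartSet n p A)) := by
  refine ContinuousOn.aemeasurable ?_ (measurableSet_chartSet p hA)
  have h1 : ContinuousOn (fun y => δ ((chartAt (Model n) p).symm y)) (chartSet n p A) :=
    h.continuousOn.comp ((chartAt (Model n) p).continuousOn_symm.mono Set.inter_subset_left)
      fun y hy => hAV hy.2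
  exact (continuousOn_const.mul h1.abs).congr fun y hy => h.density_eq _ (hAV hy.2)

/-- In one chart the terms of the measure differ only by their partition functions, which sum to 1;
only finitely many are nonzero on V, so the sum passes under the integral. -/
theorem volMeasure_apply {A : Set M} (hA : MeasurableSet A) (hAV : A ⊆ V) :
    B.volMeasure A =
      ∫⁻ y in chartSet n p A, ENNReal.ofReal (B.density p ((chartAt (Model n) p).symm y)) := by
  rw [volMeasure, Measure.sum_apply _ hA]
  have h1 := fun c => B.map_symm_apply c p hA (hAV.trans h.subset)
  refine (tsum_congr h1).trans ?_
  have hm := measurableSet_chartSet (n := n) p hA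
  have h2 : ∀ c ∉ h.finite.toFinset, ∀ z ∈ V, partition n M c z = 0 := fun c hc z hz => by
    by_contra h3
    exact hc ((Set.Finite.mem_toFinset _).2 ⟨z, hz, h3⟩)
  rw [tsum_eq_sum (s := h.finite.toFinset) fun c hc => setLIntegral_eq_zero hm fun y hy => by
    simp [h2 c hc _ (hAV hy.2)], ← lintegral_finsetSum']
  · refine setLIntegral_congr_fun hm fun y hy => ?_
    beta_reduce
    rw [← ENNReal.ofReal_sum_of_nonneg fun c _ => mul_nonneg ((partition n M).nonneg c _)
      (B.density_nonneg _ _), ← Finset.sum_mul]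
    have h3 := (partition n M).sum_eq_one (Set.mem_univ ((chartAt (Model n) p).symm y))
    rw [finsum_eq_sum_of_support_subset _ (s := h.finite.toFinset) fun c hc => by
      by_contra h4
      exact hc (h2 c h4 _ (hAV hy.2))] at h3
    rw [h3, one_mul]
  · intro c _
    refine AEMeasurable.ennreal_ofReal (AEMeasurable.mul ?_ (h.aemeasurable hA hAV))
    exact ((partition n M c).contMDiff.continuous.comp_continuousOn ((chartAt (Model n) p).continuousOn_symm.mono
      Set.inter_subset_left)).aemeasurable hm

theorem restrict_volMeasure : B.volMeasure.restrict V =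
    Measure.map (chartAt (Model n) p).symm ((volume.restrict (chartSet n p V)).withDensity
      fun y => ENNReal.ofReal (B.density p ((chartAt (Model n) p).symm y))) := by
  have hV := h.isOpen.measurableSet
  have hm := measurableSet_chartSet (n := n) p hV
  ext A hA
  rw [Measure.restrict_apply hA, h.volMeasure_apply (hA.inter hV) Set.inter_subset_right,
    Measure.map_apply_of_aemeasurable ?_ hA, withDensity_apply', Measure.restrict_restrict' hm]
  · congr 2
    ext y
    simp only [chartSet, Set.mem_inter_iff, Set.mem_preimage]
    tauto
  · exact ((((chartAt (Model n) p).continuousOn_symm.mono Set.inter_subset_left).aemeasurable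
      hm)).mono_ac (withDensity_absolutelyContinuous _ _)

theorem setIntegral_eq {w : M → ℝ} (hw : ContinuousOn w V) : ∫ z in V, w z ∂B.volMeasure =
    ∫ y in chartSet n p V, B.density p ((chartAt (Model n) p).symm y) *
      w ((chartAt (Model n) p).symm y) := by
  have hV := h.isOpen.measurableSet
  have hm := measurableSet_chartSet (n := n) p hV
  have hae : AEMeasurable (chartAt (Model n) p).symm ((volume.restrict (chartSet n p V)).withDensity
      fun y => ENNReal.ofReal (B.density p ((chartAt (Model n) p).symm y))) :=
    ((((chartAt (Model n) p).continuousOn_symm.mono Set.inter_subset_left).aemeasurable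
      hm)).mono_ac (withDensity_absolutelyContinuous _ _)
  have hs : AEStronglyMeasurable w (B.volMeasure.restrict V) := hw.aestronglyMeasurable hV
  rw [h.restrict_volMeasure] at hs ⊢
  rw [integral_map hae hs, integral_withDensity_eq_integral_toReal_smul₀
    ((h.aemeasurable hV subset_rfl).ennreal_ofReal) (.of_forall fun _ => ENNReal.ofReal_lt_top)]
  refine setIntegral_congr_fun hm fun y _ => ?_
  simp only [ENNReal.toReal_ofReal (B.density_nonneg _ _), smul_eq_mul]

end IsDensityChart

end BiquardConnection

end QC
end

/-! ### Supports, and good neighbourhoods for the measure -/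

noncomputable section

namespace QC

variable {n : ℕ} {M : Type*} [TopologicalSpace M]
  [ChartedSpace (EuclideanSpace ℝ (Fin (4 * n + 3))) M] [IsManifold (𝓡 (4 * n + 3)) ∞ M]
  {U : Set M} [T2Space M]

omit [IsManifold (𝓡 (4 * n + 3)) ∞ M] [T2Space M] in
theorem d_eq_zero {f : M → ℝ} {y : M} (hy : y ∉ tsupport f) : d n f y = 0 := by
  rw [d_congr (isClosed_tsupport f).isOpen_compl hy (g := fun _ => 0) fun z hz =>
    image_eq_zero_of_notMem_tsupport hz]
  exact mvfderiv_const ..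

/-- Integration by parts against the constant function 1. -/
theorem integral_fderiv_eq_zero {E : Type*} [NormedAddCommGroup E] [NormedSpace ℝ E]
    [MeasurableSpace E] [BorelSpace E] [FiniteDimensional ℝ E] (μ : Measure E) [μ.IsAddHaarMeasure]
    {w : E → ℝ} (hw : ContDiff ℝ 1 w) (hc : HasCompactSupport w) (v : E) :
    Integrable (fun y => fderiv ℝ w y v) μ ∧ ∫ y, fderiv ℝ w y v ∂μ = 0 := by
  have h1 : Integrable (fun y => fderiv ℝ w y v) μ :=
    ((hw.continuous_fderiv one_ne_zero).clm_apply continuous_const).integrable_of_hasCompactSupport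
      (hc.fderiv_apply (𝕜 := ℝ) v)
  have h2 := integral_mul_fderiv_eq_neg_fderiv_mul_of_integrable (μ := μ) (𝕜 := ℝ)
    (f := fun _ : E => (1 : ℝ)) (g := w) (v := v) (by simp) (by simpa using h1)
    (by simpa using hw.continuous.integrable_of_hasCompactSupport hc)
    (fun _ _ => differentiableAt_const _)
    fun y _ => hw.differentiable one_ne_zero y
  exact ⟨h1, by simpa using h2⟩

namespace BiquardConnection

variable {D : QCStructure n M} (B : BiquardConnection D)

section
variable {f : M → ℝ} {y : M} (hy : y ∉ tsupport f)
include hy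

theorem grad_eq_zero : D.grad f y = 0 := by
  rw [QCStructure.grad, d_eq_zero hy]
  simp

theorem hess_eq_zero (u v : Tan n y) : B.hess f y u v = 0 := by
  rw [hess, d_congr (isClosed_tsupport f).isOpen_compl hy (g := fun _ => 0) fun z hz => by
    rw [d_eq_zero hz]; rfl, d_eq_zero hy, show d n (fun _ : M => (0 : ℝ)) y = 0 from
      mvfderiv_const ..]
  simp

theorem subLaplacian_eq_zero : B.subLaplacian f y = 0 := by
  simp [subLaplacian, B.hess_eq_zero hy]

theorem hessNormSq_eq_zero : B.hessNormSq f y = 0 := by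
  simp [hessNormSq, B.hess_eq_zero hy]

theorem bochnerSec_eq_zero : B.bochnerSec f y = 0 := by
  simp [bochnerSec, B.hess_eq_zero hy, grad_eq_zero hy]

theorem bochnerDiv_eq_zero : B.bochnerDiv f y = 0 := by
  have h0 : SmoothField (tsupport f)ᶜ (0 : ∀ x : M, Tan n x) := by
    exact (Bundle.contMDiff_zeroSection ℝ _).contMDiffOn
  rw [bochnerDiv, conn_congr B.conn (isClosed_tsupport f).isOpen_compl hy (Y := 0)
    (h0.congr fun z hz => by rw [B.bochnerSec_eq_zero hz]; rfl) fun z hz => by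
      rw [B.bochnerSec_eq_zero hz]; rfl, CovariantDerivative.zero]
  simp

end

variable (hn : 0 < n) {f : M → ℝ} (hf : SmoothFun n Set.univ f)
include hn hf

theorem continuous_d_bochnerSec {u : M → ℝ} (hu : SmoothFun n Set.univ u) :
    Continuous fun z => d n u z (B.bochnerSec f z) := by
  rw [continuous_iff_continuousAt]
  intro y
  obtain ⟨U, hy, -, ⟨F⟩⟩ := exists_adaptedFrame B y
  refine ContinuousAt.congr ((smooth_fn _).continuousOn.continuousAt (F.isOpen.mem_nhds hy))
    (Filter.eventually_of_mem (F.isOpen.mem_nhds hy) fun z hz => F.fn_D_bochnerField hn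
      (hf.mono (Set.subset_univ _)) (hu.mono (Set.subset_univ _)) hz)

variable [SigmaCompactSpace M] [MeasurableSpace M] [BorelSpace M]

/-- V is shrunk until the density function δ keeps its sign and is bounded, the chart image lies in
a ball, and only finitely many partition functions are active. -/
theorem exists_isDensityChart (p : M) : ∃ (V : Set M) (δ : M → ℝ) (ε : ℝ), p ∈ V ∧
    B.IsDensityChart p V δ ∧ (∀ z ∈ V, |δ z| = ε * δ z) ∧ B.volMeasure V < ⊤ ∧
    ∀ u : M → ℝ, SmoothFun n Set.univ u → ∃ a : Fin (4 * n + 3) → M → ℝ,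
      (∀ i, SmoothFun n V (a i)) ∧
      (∀ z ∈ V, ∀ i, a i z = δ z * (u z * d n (coord n p i) z (B.bochnerSec f z))) ∧
      ∀ z ∈ V, ∑ i, d n (a i) z (constField p (EuclideanSpace.single i 1) z) =
        δ z * (u z * B.bochnerDiv f z + d n u z (B.bochnerSec f z)) := by
  obtain ⟨U, hpU, hUp, ⟨F⟩⟩ := exists_adaptedFrame B p
  obtain ⟨δ, hδ, hδ0, hdens, hdiv⟩ := F.exists_divergence hn hUp (hf.mono (Set.subset_univ _))
  obtain ⟨t, ht, htf⟩ := (partition n M).locallyFinite p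
  have hUn := F.isOpen.mem_nhds hpU
  have hδc := hδ.continuousOn.continuousAt hUn
  have e1 : ∀ᶠ z in nhds p, 0 < δ z * δ p :=
    (hδc.mul continuousAt_const).eventually_const_lt (mul_self_pos.2 (hδ0 p hpU))
  have e2 : ∀ᶠ z in nhds p, |δ z| < |δ p| + 1 :=
    hδc.abs.eventually_lt_const (lt_add_one _)
  have e3 : ∀ᶠ z in nhds p, chartAt (Model n) p z ∈ Metric.ball (chartAt (Model n) p p) 1 :=
    ((chartAt (Model n) p).continuousAt (mem_chart_source _ p)).eventually
      (Metric.ball_mem_nhds _ one_pos)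
  obtain ⟨V, hV, hVo, hpV⟩ := eventually_nhds_iff.1
    (e1.and (e2.and (e3.and (Filter.Eventually.and (Filter.eventually_of_mem hUn fun _ h => h)
      (Filter.eventually_of_mem ht fun _ h => h)))))
  have hVU : V ⊆ U := fun z hz => (hV z hz).2.2.2.1
  have hch : B.IsDensityChart p V δ := ⟨hVo, hVU.trans hUp, hδ.continuousOn.mono hVU,
    fun z hz => hdens z (hVU hz), htf.subset fun c ⟨z, hz, hc⟩ => ⟨z, hc, (hV z hz).2.2.2.2⟩⟩
  -- ε is the sign of δ at p, which turns the absolute value in the density into a constant factor.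
  refine ⟨V, δ, δ p / |δ p|, hpV, hch, fun z hz => ?_, ?_, fun u hu => ?_⟩
  · have h1 : |δ p| ≠ 0 := abs_ne_zero.2 (hδ0 p hpU)
    rw [div_mul_eq_mul_div, eq_div_iff h1, ← abs_mul, abs_of_pos (hV z hz).1, mul_comm]
  · rw [hch.volMeasure_apply hVo.measurableSet subset_rfl]
    have hm := measurableSet_chartSet (n := n) p hVo.measurableSet
    have hb : chartSet n p V ⊆ Metric.ball (chartAt (Model n) p p) 1 := fun y hy => by
      have := (hV _ hy.2).2.2.1
      rwa [(chartAt (Model n) p).right_inv hy.1] at this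
    calc _ ≤ ∫⁻ _ in chartSet n p V, ENNReal.ofReal (volConst n * (|δ p| + 1)) := by
          refine setLIntegral_mono' hm fun y hy => ENNReal.ofReal_le_ofReal ?_
          rw [hch.density_eq _ hy.2]
          have : 0 ≤ volConst n := by unfold volConst; positivity
          exact mul_le_mul_of_nonneg_left (hV _ hy.2).2.1.le this
      _ = ENNReal.ofReal (volConst n * (|δ p| + 1)) * volume (chartSet n p V) :=
        setLIntegral_const _ _
      _ < ⊤ := ENNReal.mul_lt_top ENNReal.ofReal_lt_top
        ((measure_mono hb).trans_lt measure_ball_lt_top)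
  · obtain ⟨a, h1, h2, h3⟩ := hdiv u (hu.mono (Set.subset_univ _))
    exact ⟨a, fun i => (h1 i).mono hVU, fun z hz => h2 z (hVU hz), fun z hz => h3 z (hVU hz)⟩

omit hf in
theorem isLocallyFiniteMeasure_volMeasure : IsLocallyFiniteMeasure B.volMeasure := by
  refine ⟨fun p => ?_⟩
  -- Any smooth function would do; only the neighbourhood of finite measure is used.
  obtain ⟨V, δ, ε, hp, hV, -, hlt, -⟩ := B.exists_isDensityChart hn (f := fun _ => 0)
    contMDiffOn_const p
  exact ⟨V, hV.isOpen.mem_nhds hp, hlt⟩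

end BiquardConnection

end QC
end

/-! ### The divergence theorem -/

noncomputable section

namespace QC

variable {n : ℕ} {M : Type*} [TopologicalSpace M]
  [ChartedSpace (EuclideanSpace ℝ (Fin (4 * n + 3))) M] [IsManifold (𝓡 (4 * n + 3)) ∞ M]
  {U : Set M} [T2Space M]

theorem isOpen_chartSet {V : Set M} (hV : IsOpen V) (p : M) : IsOpen (chartSet n p V) :=
  (chartAt (Model n) p).continuousOn_symm.isOpen_inter_preimage (chartAt (Model n) p).open_target hV

theorem contDiffAt_comp_symm {V : Set M} (hV : IsOpen V) {w : M → ℝ} (hw : SmoothFun n V w) (p : M)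
    {y : Model n} (hy : y ∈ chartSet n p V) :
    ContDiffAt ℝ 1 (fun y => w ((chartAt (Model n) p).symm y)) y := by
  have h1 : ContMDiffAt (𝓡 (4 * n + 3)) (𝓡 (4 * n + 3)) ∞ (chartAt (Model n) p).symm y :=
    (contMDiffOn_chart_symm (I := 𝓡 (4 * n + 3))).contMDiffAt
      ((chartAt (Model n) p).open_target.mem_nhds hy.1)
  exact (((hw.contMDiffAt (hV.mem_nhds hy.2)).comp y h1).contDiffAt).of_le (by norm_cast)

theorem d_sum {ι : Type*} (s : Finset ι) (u : ι → M → ℝ) (hu : ∀ i, SmoothFun n Set.univ (u i))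
    (z : M) : ∑ i ∈ s, d n (u i) z = d n (fun y => ∑ i ∈ s, u i y) z := by
  classical
  induction s using Finset.induction_on with
  | empty =>
    rw [Finset.sum_empty]
    exact (mvfderiv_const (I := 𝓡 (4 * n + 3)) (0 : ℝ) (x := z)).symm
  | insert i s hi ih =>
    rw [Finset.sum_insert hi, ih]
    simp only [Finset.sum_insert hi]
    exact (mvfderiv_add ((hu i).mdifferentiableAt isOpen_univ (Set.mem_univ z))
      ((SmoothFun.sum fun i _ => hu i).mdifferentiableAt isOpen_univ (Set.mem_univ z))).symm

namespace BiquardConnection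

variable {D : QCStructure n M} (B : BiquardConnection D)
variable (hn : 0 < n) {f : M → ℝ} (hf : SmoothFun n Set.univ f)
variable [SigmaCompactSpace M] [MeasurableSpace M] [BorelSpace M]

/-- In the chart the integrand is a constant times Σ ∂_i a_i, where the a_i extend by zero to
compactly supported C¹ functions on Euclidean space. -/
theorem integral_divergence_eq_zero {p : M} {V : Set M} {δ : M → ℝ} {ε : ℝ}
    (hV : B.IsDensityChart p V δ) (hε : ∀ z ∈ V, |δ z| = ε * δ z) (hc : HasCompactSupport f)
    {u : M → ℝ} (hu : tsupport u ⊆ V) {a : Fin (4 * n + 3) → M → ℝ}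
    (ha : ∀ i, SmoothFun n V (a i))
    (ha' : ∀ z ∈ V, ∀ i, a i z = δ z * (u z * d n (coord n p i) z (B.bochnerSec f z)))
    (hdiv : ∀ z ∈ V, ∑ i, d n (a i) z (constField p (EuclideanSpace.single i 1) z) =
        δ z * (u z * B.bochnerDiv f z + d n u z (B.bochnerSec f z)))
    (hw : Continuous fun z => u z * B.bochnerDiv f z + d n u z (B.bochnerSec f z)) :
    ∫ z, (u z * B.bochnerDiv f z + d n u z (B.bochnerSec f z)) ∂B.volMeasure = 0 := by
  have h0 : ∀ z ∉ V, u z * B.bochnerDiv f z + d n u z (B.bochnerSec f z) = 0 := fun z hz => by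
    rw [image_eq_zero_of_notMem_tsupport fun h => hz (hu h), d_eq_zero fun h => hz (hu h)]
    simp
  rw [← setIntegral_eq_integral_of_forall_compl_eq_zero h0, hV.setIntegral_eq hw.continuousOn]
  set φ := chartAt (Model n) p with hφ
  have hSo : IsOpen (chartSet n p V) := isOpen_chartSet hV.isOpen p
  -- Both supports are needed: that of f is compact but may leave the chart, that of u stays in V
  -- but need not be compact.
  obtain ⟨K, hK⟩ : ∃ K, K = φ '' (tsupport f ∩ tsupport u) := ⟨_, rfl⟩
  have hKV : tsupport f ∩ tsupport u ⊆ V := fun z hz => hu hz.2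
  have hKc : IsCompact K := by
    rw [hK]
    exact (hc.inter_right (isClosed_tsupport u)).image_of_continuousOn
      (φ.continuousOn.mono (hKV.trans hV.subset))
  have hKS : K ⊆ chartSet n p V := by
    rw [hK]
    rintro _ ⟨z, hz, rfl⟩
    refine ⟨φ.map_source (hV.subset (hKV hz)), ?_⟩
    rw [Set.mem_preimage, φ.left_inv (hV.subset (hKV hz))]
    exact hKV hz
  obtain ⟨W, hW⟩ : ∃ W : Fin (4 * n + 3) → Model n → ℝ, ∀ i, W i =
    (chartSet n p V).indicator fun y => a i (φ.symm y) := ⟨_, fun _ => rfl⟩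
  have hWK : ∀ i, ∀ y ∉ K, W i y = 0 := fun i y hy => by
    rw [hW]
    refine Set.indicator_apply_eq_zero.2 fun hyS => ?_
    rw [ha' _ hyS.2]
    by_cases h1 : φ.symm y ∈ tsupport f
    · by_cases h2 : φ.symm y ∈ tsupport u
      · exact absurd (hK ▸ ⟨_, ⟨h1, h2⟩, φ.right_inv hyS.1⟩) hy
      · rw [image_eq_zero_of_notMem_tsupport h2]; simp
    · rw [B.bochnerSec_eq_zero h1]; simp
  have hWS : ∀ i, ∀ y ∈ chartSet n p V, W i =ᶠ[nhds y] fun y => a i (φ.symm y) := fun i y hy =>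
    Filter.eventually_of_mem (hSo.mem_nhds hy) fun x hx => by rw [hW, Set.indicator_of_mem hx]
  have hW0 : ∀ i, ∀ y ∉ K, W i =ᶠ[nhds y] fun _ => 0 := fun i y hy =>
    Filter.eventually_of_mem (hKc.isClosed.isOpen_compl.mem_nhds hy) fun x hx => hWK i x hx
  have hWd : ∀ i, ContDiff ℝ 1 (W i) := fun i => contDiff_iff_contDiffAt.2 fun y => by
    by_cases hy : y ∈ K
    · exact (contDiffAt_comp_symm hV.isOpen (ha i) p (hKS hy)).congr_of_eventuallyEq
        (hWS i y (hKS hy))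
    · exact contDiffAt_const.congr_of_eventuallyEq (hW0 i y hy)
  have hWc : ∀ i, HasCompactSupport (W i) := fun i => HasCompactSupport.intro hKc (hWK i)
  have hI := fun i => integral_fderiv_eq_zero volume (hWd i) (hWc i) (EuclideanSpace.single i 1)
  have h1 : ∀ y ∈ chartSet n p V, B.density p (φ.symm y) *
      (u (φ.symm y) * B.bochnerDiv f (φ.symm y) + d n u (φ.symm y) (B.bochnerSec f (φ.symm y))) =
      volConst n * ε * ∑ i, fderiv ℝ (W i) y (EuclideanSpace.single i 1) := fun y hy => by
    rw [hV.density_eq _ hy.2, hε _ hy.2, mul_assoc, mul_assoc, ← hdiv _ hy.2, ← mul_assoc]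
    congr 1
    refine Finset.sum_congr rfl fun i _ => ?_
    have h2 := (hasFDerivAt_comp_symm hV.isOpen (ha i) hy.2 (hV.subset hy.2)).2
      (EuclideanSpace.single i 1)
    rw [φ.right_inv hy.1] at h2
    rw [(hWS i y hy).fderiv_eq, ← h2]
  rw [setIntegral_congr_fun hSo.measurableSet h1, integral_const_mul,
    setIntegral_eq_integral_of_forall_compl_eq_zero fun y hy => Finset.sum_eq_zero fun i _ => by
      rw [(hW0 i y fun h => hy (hKS h)).fderiv_eq]; simp,
    integral_finsetSum _ fun i _ => (hI i).1, Finset.sum_eq_zero fun i _ => (hI i).2, mul_zero]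

include hn hf

/-- The divergence theorem for the horizontal field `bochnerSec`. -/
theorem integral_bochnerDiv (hc : HasCompactSupport f) :
    ∫ z, B.bochnerDiv f z ∂B.volMeasure = 0 := by
  have hlf := B.isLocallyFiniteMeasure_volMeasure hn
  have hlc : LocallyCompactSpace M := ChartedSpace.locallyCompactSpace (Model n) M
  choose V δ ε hpV hV hε hlt hdiv using B.exists_isDensityChart hn hf
  obtain ⟨τ, hτ⟩ := SmoothPartitionOfUnity.exists_isSubordinate (𝓡 (4 * n + 3))
    isClosed_univ V (fun p => (hV p).isOpen) fun p _ => Set.mem_iUnion.2 ⟨p, hpV p⟩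
  -- A compact neighbourhood of the support rather than the support itself: the finite sum of the
  -- τ_p must be 1 on an open set for the differentials to add up to zero.
  obtain ⟨K, hKc, hK⟩ := exists_compact_superset hc
  have hfin := τ.locallyFinite.finite_nonempty_inter_compact hKc
  have hτs : ∀ p, SmoothFun n Set.univ (τ p) := fun p => (τ p).contMDiff.contMDiffOn
  have hcont : ∀ p, Continuous fun z => τ p z * B.bochnerDiv f z + d n (τ p) z (B.bochnerSec f z) :=
    fun p => ((τ p).contMDiff.continuous.mul (B.continuous_bochner hn hf).1).add
      (B.continuous_d_bochnerSec hn hf (hτs p))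
  have hzero : ∀ p, ∫ z, (τ p z * B.bochnerDiv f z + d n (τ p) z (B.bochnerSec f z))
      ∂B.volMeasure = 0 := fun p => by
    obtain ⟨a, h1, h2, h3⟩ := hdiv p (τ p) (hτs p)
    exact B.integral_divergence_eq_zero (hV p) (hε p) hc (hτ p) h1 h2 h3 (hcont p)
  have hsum : ∀ z ∈ K, ∑ p ∈ hfin.toFinset, τ p z = 1 := fun z hz => by
    rw [← τ.sum_eq_one (Set.mem_univ z), finsum_eq_sum_of_support_subset]
    intro p hp
    exact (Set.Finite.mem_toFinset _).2 ⟨z, hp, hz⟩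
  -- div σ = Σ_p div(τ_p σ), since the terms dτ_p(σ) sum to zero where σ may be nonzero.
  have hpt : ∀ z, B.bochnerDiv f z =
      ∑ p ∈ hfin.toFinset, (τ p z * B.bochnerDiv f z + d n (τ p) z (B.bochnerSec f z)) := fun z => by
    by_cases hz : z ∈ tsupport f
    · have h1 := congrArg (fun L => L (B.bochnerSec f z : Tan n z))
        (d_sum hfin.toFinset (fun p => τ p) hτs z)
      rw [d_congr isOpen_interior (hK hz) (g := fun _ => 1) fun y hy => hsum y (interior_subset hy),
        show d n (fun _ : M => (1 : ℝ)) z = 0 from mvfderiv_const ..] at h1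
      rw [Finset.sum_add_distrib, ← Finset.sum_mul, hsum z (interior_subset (hK hz)), one_mul]
      simpa using h1
    · simp [B.bochnerSec_eq_zero hz, B.bochnerDiv_eq_zero hz]
  rw [integral_congr_ae (.of_forall hpt), integral_finsetSum]
  · exact Finset.sum_eq_zero fun p _ => hzero p
  · refine fun p _ => (hcont p).integrable_of_hasCompactSupport (HasCompactSupport.intro hc ?_)
    intro z hz
    simp [B.bochnerSec_eq_zero hz, B.bochnerDiv_eq_zero hz]

end BiquardConnection

end QC
end

/-! ### Integrability -/

noncomputable section

namespace QC

variable {n : ℕ} {M : Type*} [TopologicalSpace M]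
  [ChartedSpace (EuclideanSpace ℝ (Fin (4 * n + 3))) M] [IsManifold (𝓡 (4 * n + 3)) ∞ M]
  [T2Space M]

namespace BiquardConnection

variable {D : QCStructure n M} (B : BiquardConnection D) (hn : 0 < n) {f : M → ℝ}
  (hf : SmoothFun n Set.univ f) [SigmaCompactSpace M] [MeasurableSpace M] [BorelSpace M]
include hn hf

/-- The functions in the integral formula are integrable. -/
theorem integrable_bochner (hc : HasCompactSupport f) :
    Integrable (B.bochnerDiv f) B.volMeasure ∧
    Integrable (fun x => |B.subLaplacian f x| ^ 2) B.volMeasure ∧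
    Integrable (fun x => B.hessNormSq f x) B.volMeasure ∧
    Integrable (fun x => B.Ric x (D.grad f x) (D.grad f x)) B.volMeasure ∧
    Integrable (fun x => B.T0 x (D.grad f x) (D.grad f x)) B.volMeasure ∧
    Integrable (fun x => B.U x (D.grad f x) (D.grad f x)) B.volMeasure ∧
    Integrable (fun x => B.S x * D.g x (D.grad f x) (D.grad f x)) B.volMeasure := by
  have hlf := B.isLocallyFiniteMeasure_volMeasure hn
  have key : ∀ Φ : M → ℝ, Continuous Φ → (∀ z ∉ tsupport f, Φ z = 0) → Integrable Φ B.volMeasure :=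
    fun Φ h1 h2 => h1.integrable_of_hasCompactSupport (HasCompactSupport.intro hc h2)
  obtain ⟨h1, h2, h3, h4, h5, h6, h7⟩ := B.continuous_bochner hn hf
  have hT : ∀ z ∉ tsupport f, B.T0 z (D.grad f z) (D.grad f z) = 0 := fun z hz => by
    simp [T0, torSymm, tor, grad_eq_zero hz]
  have hU : ∀ z ∉ tsupport f, B.U z (D.grad f z) (D.grad f z) = 0 := fun z hz => by
    simp [BiquardConnection.U, torSkew, tor, grad_eq_zero hz]
  have hS : ∀ z ∉ tsupport f, B.S z * D.g z (D.grad f z) (D.grad f z) = 0 := fun z hz => by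
    simp [grad_eq_zero hz]
  exact ⟨key _ h1 fun z hz => B.bochnerDiv_eq_zero hz,
    key _ (h3.abs.pow 2) fun z hz => by simp [B.subLaplacian_eq_zero hz],
    key _ h2 fun z hz => B.hessNormSq_eq_zero hz,
    key _ h4 fun z hz => by rw [B.Ric_grad hn hf, hT z hz, hU z hz, hS z hz]; simp,
    key _ h5 hT, key _ h6 hU, key _ h7 hS⟩

end BiquardConnection

end QC
end

/-! ### The integral inequality -/

theorem theorem1p3 (n : ℕ) (hn : 1 < n) (M : Type*) [TopologicalSpace M]
    [ChartedSpace (EuclideanSpace ℝ (Fin (4 * n + 3))) M] [IsManifold (𝓡 (4 * n + 3)) ∞ M]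
    [T2Space M] [SigmaCompactSpace M] [MeasurableSpace M] [BorelSpace M]
    (D : QC.QCStructure n M) (B : QC.BiquardConnection D)
    (f : M → ℝ) (hf : ContMDiff (𝓡 (4 * n + 3)) 𝓘(ℝ, ℝ) ∞ f) (hc : HasCompactSupport f) :
    (Integrable (fun x => |B.subLaplacian f x| ^ 2) B.volMeasure ∧
      Integrable (fun x => B.hessNormSq f x) B.volMeasure ∧
      Integrable (fun x => B.Ric x (D.grad f x) (D.grad f x)) B.volMeasure ∧
      Integrable (fun x => B.T0 x (D.grad f x) (D.grad f x)) B.volMeasure ∧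
      Integrable (fun x => B.U x (D.grad f x) (D.grad f x)) B.volMeasure ∧
      Integrable (fun x => B.S x * D.g x (D.grad f x) (D.grad f x)) B.volMeasure) ∧
    (n : ℝ) / (n + 1) * ∫ x, B.hessNormSq f x ∂B.volMeasure
        + (n : ℝ) ^ 2 / ((n : ℝ) ^ 2 - 1) *
          ∫ x, B.Ric x (D.grad f x) (D.grad f x) ∂B.volMeasure
        + (n : ℝ) ^ 2 / ((n : ℝ) ^ 2 - 1) *
          ∫ x, (-(4 / (n : ℝ)) * B.T0 x (D.grad f x) (D.grad f x)
            - 6 * B.U x (D.grad f x) (D.grad f x)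
            - 6 * (B.S x * D.g x (D.grad f x) (D.grad f x))) ∂B.volMeasure
      ≤ ∫ x, |B.subLaplacian f x| ^ 2 ∂B.volMeasure ∧
    (n : ℝ) / (n + 1) * ∫ x, B.hessNormSq f x ∂B.volMeasure
        + (n : ℝ) ^ 2 / ((n : ℝ) ^ 2 - 1) *
          ∫ x, B.Ric x (D.grad f x) (D.grad f x) ∂B.volMeasure
        + (n : ℝ) ^ 2 / ((n : ℝ) ^ 2 - 1) *
          ∫ x, (-(4 / (n : ℝ)) * B.T0 x (D.grad f x) (D.grad f x)
            - 6 * B.U x (D.grad f x) (D.grad f x)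
            - 6 * (B.S x * D.g x (D.grad f x) (D.grad f x))) ∂B.volMeasure
      = (n : ℝ) / (n + 1) * ∫ x, B.hessNormSq f x ∂B.volMeasure
        + ∫ x, (2 * (n : ℝ) * (n + 2) / (n + 1) * B.T0 x (D.grad f x) (D.grad f x)
            + 4 * (n : ℝ) ^ 2 / (n - 1) * B.U x (D.grad f x) (D.grad f x)
            + 2 * (n : ℝ) ^ 2 / (n + 1) *
              (B.S x * D.g x (D.grad f x) (D.grad f x))) ∂B.volMeasure := by
  have hn0 : 0 < n := by omega
  have hn1 : (1 : ℝ) < n := by exact_mod_cast hn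
  have hn2 : (0 : ℝ) < (n : ℝ) ^ 2 - 1 := by nlinarith
  have hf' : QC.SmoothFun n Set.univ f := hf.contMDiffOn
  obtain ⟨h1, h2, h3, h4, h5, h6, h7⟩ := B.integrable_bochner hn0 hf' hc
  have hlin : ∀ a b c : ℝ, ∫ x, (a * B.T0 x (D.grad f x) (D.grad f x)
      + b * B.U x (D.grad f x) (D.grad f x)
      + c * (B.S x * D.g x (D.grad f x) (D.grad f x))) ∂B.volMeasure =
      a * ∫ x, B.T0 x (D.grad f x) (D.grad f x) ∂B.volMeasure
      + b * ∫ x, B.U x (D.grad f x) (D.grad f x) ∂B.volMeasure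
      + c * ∫ x, B.S x * D.g x (D.grad f x) (D.grad f x) ∂B.volMeasure := fun a b c => by
    refine (integral_add ((h5.const_mul a).add (h6.const_mul b)) (h7.const_mul c)).trans ?_
    refine (congrArg (· + _) (integral_add (h5.const_mul a) (h6.const_mul b))).trans ?_
    simp only [integral_const_mul]
  rw [show (fun x => -(4 / (n : ℝ)) * B.T0 x (D.grad f x) (D.grad f x)
      - 6 * B.U x (D.grad f x) (D.grad f x) - 6 * (B.S x * D.g x (D.grad f x) (D.grad f x))) =
    fun x => -(4 / (n : ℝ)) * B.T0 x (D.grad f x) (D.grad f x)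
      + (-6) * B.U x (D.grad f x) (D.grad f x)
      + (-6) * (B.S x * D.g x (D.grad f x) (D.grad f x)) from funext fun x => by ring, hlin]
  refine ⟨⟨h2, h3, h4, h5, h6, h7⟩, ?_, ?_⟩
  · have hle := integral_mono (μ := B.volMeasure) (((((h3.const_mul ((n : ℝ) - 1)).sub
      (h2.const_mul ((n : ℝ) - 1 / n))).add (h4.const_mul (n : ℝ))).sub (h5.const_mul 4)).sub
      (h6.const_mul (6 * (n : ℝ))) |>.sub (h7.const_mul (6 * (n : ℝ)))) h1 fun x => by
        simpa using B.le_bochnerDiv hn0 hf' x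
    rw [B.integral_bochnerDiv hn0 hf' hc,
      integral_sub' (((((h3.const_mul _).sub (h2.const_mul _)).add (h4.const_mul _)).sub
        (h5.const_mul _)).sub (h6.const_mul _)) (h7.const_mul _),
      integral_sub' ((((h3.const_mul _).sub (h2.const_mul _)).add (h4.const_mul _)).sub
        (h5.const_mul _)) (h6.const_mul _),
      integral_sub' (((h3.const_mul _).sub (h2.const_mul _)).add (h4.const_mul _)) (h5.const_mul _),
      integral_add' ((h3.const_mul _).sub (h2.const_mul _)) (h4.const_mul _),
      integral_sub' (h3.const_mul _) (h2.const_mul _)] at hle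
    simp only [integral_const_mul] at hle
    generalize ∫ x, B.hessNormSq f x ∂B.volMeasure = a at *
    generalize ∫ x, |B.subLaplacian f x| ^ 2 ∂B.volMeasure = b at *
    generalize ∫ x, B.Ric x (D.grad f x) (D.grad f x) ∂B.volMeasure = r at *
    generalize ∫ x, B.T0 x (D.grad f x) (D.grad f x) ∂B.volMeasure = t at *
    generalize ∫ x, B.U x (D.grad f x) (D.grad f x) ∂B.volMeasure = v at *
    generalize ∫ x, B.S x * D.g x (D.grad f x) (D.grad f x) ∂B.volMeasure = s at *
    -- This factor normalizes the coefficient of (△f)², as (n − 1/n)·n/(n² − 1) = 1; its positivity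
    -- is where n > 1 is used.
    have hpos : (0 : ℝ) < n / ((n : ℝ) ^ 2 - 1) := by positivity
    have hmul := mul_le_mul_of_nonneg_left hle hpos.le
    have hid : (n : ℝ) / ((n : ℝ) ^ 2 - 1) * (((n : ℝ) - 1) * a - ((n : ℝ) - 1 / n) * b + n * r
        - 4 * t - 6 * n * v - 6 * n * s) = n / (n + 1) * a + (n : ℝ) ^ 2 / ((n : ℝ) ^ 2 - 1) * r
        + (n : ℝ) ^ 2 / ((n : ℝ) ^ 2 - 1) * (-(4 / (n : ℝ)) * t + (-6) * v + (-6) * s) - b := by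
      have h8 : (n : ℝ) + 1 ≠ 0 := by positivity
      have h9 : (n : ℝ) ≠ 0 := by positivity
      rw [show (n : ℝ) ^ 2 - 1 = (n + 1) * (n - 1) by ring] at hn2 ⊢
      have h10 : (n : ℝ) - 1 ≠ 0 := by linarith
      field_simp
      ring
    rw [hid, mul_zero] at hmul
    linarith
  -- The equality is pointwise: after inserting Ric = (2n+2)T⁰ + (4n+10)U + 2(n+2)S g on ∇f, only
  -- the coefficients of the three integrals have to be compared.
  · rw [integral_congr_ae (.of_forall (B.Ric_grad hn0 hf')), hlin, hlin]
    have h8 : (n : ℝ) + 1 ≠ 0 := by positivity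
    have h9 : (n : ℝ) ≠ 0 := by positivity
    have h10 : (n : ℝ) - 1 ≠ 0 := by linarith
    rw [show (n : ℝ) ^ 2 - 1 = (n + 1) * (n - 1) by ring]
    field_simp
    ring
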